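/- Let $n\ge 1$, $G=\mathrm{GL}(2n,\mathbb R)$, and let $H=\mathrm{GL}(2n-1,\mathbb R)$ be embedded in the upper left corner of $G$. Write $|x|^\mu_\varepsilon=\operatorname{sgn}(x)^\varepsilon|x|^\mu$, and let $[\varepsilon]\in\{0,1\}$ be the representative of $\varepsilon\in\mathbb Z/2\mathbb Z$. For $\xi\in(\mathbb Z/2\mathbb Z)^2$, $\lambda\in\mathbb C^2$ let $\pi_{\xi,\lambda}$ be the left regular representation of $G$ on the functions $f\in C^\infty(G)$ with $$f\Big(g\begin{pmatrix}p_1&*\\0&p_2\end{pmatrix}\Big)=|\det p_1|_{\xi_1}^{-\lambda_1-\frac n2}\,|\det p_2|_{\xi_2}^{-\lambda_2+\frac n2}f(g)\qquad(p_1,p_2\in \mathrm{GL}(n,\mathbb R)),$$ and for $\eta\in(\mathbb Z/2\mathbb Z)^3$, $\nu\in\mathbb C^3$ let $\tau_{\eta,\nu}$ be the left regular representation of $H$ on the functions $f\in C^\infty(H)$ with $f(hp)=|\det p_1|_{\eta_1}^{-\nu_1-\frac n2}|p_2|_{\eta_2}^{-\nu_2}|\det p_3|_{\eta_3}^{-\nu_3+\frac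 n2}f(h)$ for all block upper triangular $p$ with diagonal blocks $p_1,p_2,p_3$ of sizes $n-1,1,n-1$. Let $w_G$ swap the two entries of $\xi$ and of $\lambda$, and let $w_H$ reverse triples. Put $$\tilde w_G=\begin{pmatrix}0&-I_n\\I_n&0\end{pmatrix},\qquad \tilde w_H=\begin{pmatrix}0&0&-I_{n-1}\\0&1&0\\I_{n-1}&0&0\end{pmatrix},\qquad \bar n(X)=\begin{pmatrix}I_n&0\\X&I_n\end{pmatrix},\qquad \bar n_H(X,u,v)=\begin{pmatrix}I_{n-1}&0&0\\v^\top&1&0\\X&u&I_{n-1}\end{pmatrix},$$ let $E_{2n,n}$ be the $2n\times 2n$ matrix unit, and let $\det_{n-1}(X)$ be the upper left $(n-1)\times(n-1)$ minor of $X\in\mathbb R^{n\times n}$. Consider the integrals (with respect to Lebesgue measure) $$T_{\xi,\lambda}f(g)=\int_{\mathbb R^{n\times n}}f(g\,\tilde w_G\,\bar n(X))\,dX,\qquad S_{\eta,\nu}f(h)=\int f(h\,\tilde w_H\,\bar n_H(X,u,v))\,d(X,u,v),$$ $$A^{\eta,\nu}_{\xi,\lambda}f(h)=\int_{\mathbb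 R^{n\times n}}|\det X|^{\lambda_1-\nu-\frac n2}_{\xi_1+\eta}\,|\det{}_{n-1}(X)|^{\nu-\lambda_2-\frac n2}_{\eta+\xi_2}\,f(h\,\bar n(X))\,dX,\qquad B^{\eta,\nu}_{\xi,\lambda}f(h)=\int_{\mathbb R}|t|^{\lambda_1-\nu+\frac n2}_{\xi_1+\eta}f(h(I_{2n}+tE_{2n,n}))\frac{dt}{|t|},$$ where $\eta\in\mathbb Z/2\mathbb Z$, $\nu\in\mathbb C$ in the last two, and the factors $$n_{\mathbf T}(\xi,\lambda)=\prod_{i=1}^n\Gamma\big(\tfrac{\lambda_1-\lambda_2-n+i+[\xi_1+\xi_2]}2\big),$$ $$n_{\mathbf S}(\eta,\nu)=\Gamma\big(\tfrac{\nu_1-\nu_2+1-\frac n2+[\eta_1+\eta_2]}2\big)\Gamma\big(\tfrac{\nu_2-\nu_3+1-\frac n2+[\eta_2+\eta_3]}2\big)\prod_{i=2}^n\Gamma\big(\tfrac{\nu_1-\nu_3+i-n+[\eta_1+\eta_3]}2\big),$$ $$n_{\mathbf A}(\xi,\lambda,\eta,\nu)=\Gamma\big(\tfrac{\lambda_1-\nu+1-\frac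 n2+[\xi_1+\eta]}2\big)\Gamma\big(\tfrac{\nu-\lambda_2+1-\frac n2+[\xi_2+\eta]}2\big)\prod_{i=2}^n\Gamma\big(\tfrac{\lambda_1-\lambda_2+i-n+[\xi_1+\xi_2]}2\big),$$ $$n_{\mathbf B}(\xi,\lambda,\eta,\nu)=\Gamma\big(\tfrac{\lambda_1-\nu+\frac n2+[\xi_1+\eta]}2\big)\Gamma\big(\tfrac{\nu-\lambda_2+\frac n2+[\xi_2+\eta]}2\big).$$ The integrals converge absolutely for $\Re(\lambda_1-\lambda_2)>n-1$; for $\Re(\nu_1-\nu_2),\Re(\nu_2-\nu_3)>\frac n2-1$; for $\Re(\lambda_1-\nu),\Re(\nu-\lambda_2)>\frac n2-1$; and for $\Re(\lambda_1-\nu),\Re(\nu-\lambda_2)>-\frac n2$, respectively. The quotients $\mathbf T=T/n_{\mathbf T}$, $\mathbf S=S/n_{\mathbf S}$, $\mathbf A=A/n_{\mathbf A}$, $\mathbf B=B/n_{\mathbf B}$ extend uniquely to families of intertwining operators $$\mathbf T_{\xi,\lambda}:\pi_{\xi,\lambda}\to\pi_{w_G(\xi,\lambda)},\quad \mathbf S_{\eta,\nu}:\tau_{\eta,\nu}\to\tau_{w_H(\eta,\nu)},\quad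 \mathbf A^{\eta,\nu}_{\xi,\lambda}:\pi_{\xi,\lambda}|_H\to\tau_{(\xi_2,\eta,\xi_1),(\lambda_2,\nu,\lambda_1)},\quad \mathbf B^{\eta,\nu}_{\xi,\lambda}:\pi_{\xi,\lambda}|_H\to\tau_{(\xi_1,\eta,\xi_2),(\lambda_1,\nu,\lambda_2)}$$ that depend holomorphically on all their complex parameters (that is, if $f_\lambda\in\pi_{\xi,\lambda}$, resp. $f_\nu\in\tau_{\eta,\nu}$, has a restriction to the orthogonal group that does not depend on the parameter, then the value of the image of $f_\lambda$, resp. $f_\nu$, at each group element is an entire function of the parameters). For all $\xi\in(\mathbb Z/2\mathbb Z)^2$, $\lambda\in\mathbb C^2$, $\eta\in\mathbb Z/2\mathbb Z$, $\nu\in\mathbb C$ these satisfy $$\mathbf S_{(\xi_1,\eta,\xi_2),(\lambda_1,\nu,\lambda_2)}\circ\mathbf B^{\eta,\nu}_{\xi,\lambda}=\frac1{n_{\mathbf B}(\xi,\lambda,\eta,\nu)}\,\mathbf A^{\eta,\nu}_{\xi,\lambda}$$ and $$\mathbf B^{\eta,\nu}_{w_G(\xi,\lambda)}\circ\mathbf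 T_{\xi,\lambda}=\frac{\sqrt\pi\,(-1)^{(\eta+\xi_2)(\xi_1+\xi_2)}}{\Gamma\big(\frac{\lambda_2-\lambda_1+n+[\xi_1+\xi_2]}2\big)}\,\mathbf A^{\eta,\nu}_{\xi,\lambda},$$ where $1/\Gamma$ denotes the entire function, equal to $0$ at the poles of $\Gamma$. -/

import Mathlib

open scoped ContDiff
open MeasureTheory

noncomputable section

namespace GLBranching

/-! Throughout `n = m + 1` with `m : ℕ`, so that `n ≥ 1`.  The index set of size `n` is
`Fin m ⊕ Unit` (the element of `Unit` is the last, `n`-th, index), the index set of size `2n` is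
`Blk m ⊕ Blk m`, and the one of size `2n - 1` is `Blk m ⊕ Fin m`. -/

/-- An index set with `n = m + 1` elements, the last one being `Sum.inr ()`. -/
abbrev Blk (m : ℕ) : Type := Fin m ⊕ Unit

/-- The `2n` indices of `GL(2n, ℝ)`, in two blocks of size `n`. -/
abbrev IdxG (m : ℕ) : Type := Blk m ⊕ Blk m

/-- The `2n - 1` indices of `GL(2n - 1, ℝ)`, in blocks of size `n - 1, 1, n - 1`. -/
abbrev IdxH (m : ℕ) : Type := (Fin m ⊕ Unit) ⊕ Fin m

/-- `G = GL(2n, ℝ)`. -/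
abbrev GG (m : ℕ) : Type := GL (IdxG m) ℝ

/-- `H = GL(2n - 1, ℝ)`. -/
abbrev HH (m : ℕ) : Type := GL (IdxH m) ℝ

/-- The last index `2n` of `G`, the one that is missing in `H`. -/
abbrev lastIdx (m : ℕ) : IdxG m := Sum.inr (Sum.inr ())

/-- The `n`-th index of `G`. -/
abbrev nthIdx (m : ℕ) : IdxG m := Sum.inl (Sum.inr ())

/-- The bijection between the indices of `H` together with one more index, and those of `G`:
the indices of `H` are the first `2n - 1` indices of `G`. -/
def idxEquiv (m : ℕ) : IdxH m ⊕ Unit ≃ IdxG m := Equiv.sumAssoc (Blk m) (Fin m) Unit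

/-- The embedding of `H` into `G` in the upper left corner, `h ↦ diag(h, 1)`. -/
def embH (m : ℕ) (h : HH m) : GG m :=
  Matrix.GeneralLinearGroup.mkOfDetNeZero
    (Matrix.reindex (idxEquiv m) (idxEquiv m)
      (Matrix.fromBlocks (h : Matrix (IdxH m) (IdxH m) ℝ) 0 0 (1 : Matrix Unit Unit ℝ)))
    (by
      rw [Matrix.det_reindex_self, Matrix.det_fromBlocks_zero₂₁, Matrix.det_one, mul_one]
      exact h.det_ne_zero)

/-- `|x|^μ_ε = sgn(x)^ε |x|^μ`. -/
def sgnPow (ε : ZMod 2) (μ : ℂ) (x : ℝ) : ℂ :=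
  ((Real.sign x : ℝ) : ℂ) ^ ε.val * ((|x| : ℝ) : ℂ) ^ μ

/-- The representative `[ε] ∈ {0, 1}` of `ε ∈ ℤ/2ℤ`, as a complex number. -/
def rep (ε : ZMod 2) : ℂ := ((ε.val : ℕ) : ℂ)

/-- A function on `GL(ι, ℝ)` extended by zero to all `ι × ι` matrices. -/
def extendGL {ι : Type} [Fintype ι] [DecidableEq ι] (f : GL ι ℝ → ℂ) (X : ι → ι → ℝ) : ℂ :=
  open Classical in
  if hX : (Matrix.of X).det ≠ 0 then
    f (Matrix.GeneralLinearGroup.mkOfDetNeZero (Matrix.of X) hX)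
  else 0

/-- Smoothness of a function on `GL(ι, ℝ)`, an open subset of the vector space of matrices. -/
def SmoothGL {ι : Type} [Fintype ι] [DecidableEq ι] (f : GL ι ℝ → ℂ) : Prop :=
  ContDiffOn ℝ ∞ (extendGL f) {X | (Matrix.of X).det ≠ 0}

theorem extendGL_add {ι : Type} [Fintype ι] [DecidableEq ι] (f g : GL ι ℝ → ℂ) :
    extendGL (f + g) = extendGL f + extendGL g := by
  funext X
  by_cases hX : (Matrix.of X).det ≠ 0 <;> simp [extendGL, hX]

theorem extendGL_smul {ι : Type} [Fintype ι] [DecidableEq ι] (c : ℂ) (f : GL ι ℝ → ℂ) :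
    extendGL (c • f) = c • extendGL f := by
  funext X
  by_cases hX : (Matrix.of X).det ≠ 0 <;> simp [extendGL, hX]

theorem extendGL_zero {ι : Type} [Fintype ι] [DecidableEq ι] :
    extendGL (0 : GL ι ℝ → ℂ) = fun _ => 0 := by
  funext X
  by_cases hX : (Matrix.of X).det ≠ 0 <;> simp [extendGL, hX]

/-! ### The degenerate series -/

/-- The space of the degenerate series `π_{ξ,λ} = Ind_{P_G}^G(ξ ⊗ e^λ ⊗ 1)`: smooth functions on
`G` with `f(gp) = |det p₁|_{ξ₁}^{-(λ₁ + n/2)} |det p₂|_{ξ₂}^{-(λ₂ - n/2)} f(g)` for all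
`p = (p₁ Y; 0 p₂) ∈ P_G`. -/
def piRep (m : ℕ) (ξ : ZMod 2 × ZMod 2) (lam : ℂ × ℂ) : Submodule ℂ (GG m → ℂ) where
  carrier := {f | SmoothGL f ∧
    ∀ (g p : GG m) (p₁ p₂ Y : Matrix (Blk m) (Blk m) ℝ),
      (p : Matrix (IdxG m) (IdxG m) ℝ) = Matrix.fromBlocks p₁ Y 0 p₂ →
      f (g * p) = sgnPow ξ.1 (-(lam.1 + ((m : ℂ) + 1) / 2)) p₁.det
        * sgnPow ξ.2 (-(lam.2 - ((m : ℂ) + 1) / 2)) p₂.det * f g}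
  add_mem' := by
    rintro f f' ⟨h1, h2⟩ ⟨h1', h2'⟩
    refine ⟨?_, ?_⟩
    · unfold SmoothGL
      rw [extendGL_add]
      exact h1.add h1'
    · intro g p p₁ p₂ Y hp
      simp only [Pi.add_apply]
      rw [h2 g p p₁ p₂ Y hp, h2' g p p₁ p₂ Y hp, mul_add]
  zero_mem' := by
    refine ⟨?_, ?_⟩
    · unfold SmoothGL
      rw [extendGL_zero]
      exact contDiffOn_const
    · intro g p p₁ p₂ Y hp
      simp
  smul_mem' := by
    rintro c f ⟨h1, h2⟩
    refine ⟨?_, ?_⟩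
    · unfold SmoothGL
      rw [extendGL_smul]
      exact contDiffOn_const.smul h1
    · intro g p p₁ p₂ Y hp
      simp only [Pi.smul_apply, smul_eq_mul]
      rw [h2 g p p₁ p₂ Y hp]
      ring

/-- The space of the degenerate series `τ_{η,ν} = Ind_{P_H}^H(η ⊗ e^ν ⊗ 1)`: smooth functions on
`H` with `f(hp) = |det p₁|_{η₁}^{-(ν₁ + n/2)} |p₂|_{η₂}^{-ν₂} |det p₃|_{η₃}^{-(ν₃ - n/2)} f(h)`
for all block upper triangular `p ∈ P_H` with diagonal blocks `p₁, p₂, p₃` of size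
`n - 1, 1, n - 1`. -/
def tauRep (m : ℕ) (η : ZMod 2 × ZMod 2 × ZMod 2) (ν : ℂ × ℂ × ℂ) :
    Submodule ℂ (HH m → ℂ) where
  carrier := {f | SmoothGL f ∧
    ∀ (h p : HH m) (p₁ p₃ : Matrix (Fin m) (Fin m) ℝ) (p₂ : Matrix Unit Unit ℝ)
      (y : Matrix (Fin m) Unit ℝ) (Z : Matrix (Fin m ⊕ Unit) (Fin m) ℝ),
      (p : Matrix (IdxH m) (IdxH m) ℝ) =
        Matrix.fromBlocks (Matrix.fromBlocks p₁ y 0 p₂) Z 0 p₃ →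
      f (h * p) = sgnPow η.1 (-(ν.1 + ((m : ℂ) + 1) / 2)) p₁.det
        * sgnPow η.2.1 (-ν.2.1) p₂.det
        * sgnPow η.2.2 (-(ν.2.2 - ((m : ℂ) + 1) / 2)) p₃.det * f h}
  add_mem' := by
    rintro f f' ⟨h1, h2⟩ ⟨h1', h2'⟩
    refine ⟨?_, ?_⟩
    · unfold SmoothGL
      rw [extendGL_add]
      exact h1.add h1'
    · intro h p p₁ p₃ p₂ y Z hp
      simp only [Pi.add_apply]
      rw [h2 h p p₁ p₃ p₂ y Z hp, h2' h p p₁ p₃ p₂ y Z hp, mul_add]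
  zero_mem' := by
    refine ⟨?_, ?_⟩
    · unfold SmoothGL
      rw [extendGL_zero]
      exact contDiffOn_const
    · intro h p p₁ p₃ p₂ y Z hp
      simp
  smul_mem' := by
    rintro c f ⟨h1, h2⟩
    refine ⟨?_, ?_⟩
    · unfold SmoothGL
      rw [extendGL_smul]
      exact contDiffOn_const.smul h1
    · intro h p p₁ p₃ p₂ y Z hp
      simp only [Pi.smul_apply, smul_eq_mul]
      rw [h2 h p p₁ p₃ p₂ y Z hp]
      ring

/-- The action of `w_H` on the parameters of `τ`: reversal of triples.
(`w_G` acts on the parameters of `π` by `Prod.swap`.) -/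
abbrev wH {α : Type} (x : α × α × α) : α × α × α := (x.2.2, x.2.1, x.1)

/-- A family of vectors `F λ ∈ π_{ξ,λ}` whose restriction to the maximal compact subgroup
`O(2n)` does not depend on `λ`, that is, one fixed vector of the compact picture. -/
def IsStandardSectionG (m : ℕ) (ξ : ZMod 2 × ZMod 2) (F : ∀ lam : ℂ × ℂ, piRep m ξ lam) : Prop :=
  ∀ (k : GG m), (k : Matrix (IdxG m) (IdxG m) ℝ) ∈ Matrix.orthogonalGroup (IdxG m) ℝ →
    ∀ lam lam' : ℂ × ℂ, (F lam : GG m → ℂ) k = (F lam' : GG m → ℂ) k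

/-- A family of vectors `F ν ∈ τ_{η,ν}` whose restriction to the maximal compact subgroup
`O(2n - 1)` does not depend on `ν`. -/
def IsStandardSectionH (m : ℕ) (η : ZMod 2 × ZMod 2 × ZMod 2)
    (F : ∀ ν : ℂ × ℂ × ℂ, tauRep m η ν) : Prop :=
  ∀ (k : HH m), (k : Matrix (IdxH m) (IdxH m) ℝ) ∈ Matrix.orthogonalGroup (IdxH m) ℝ →
    ∀ ν ν' : ℂ × ℂ × ℂ, (F ν : HH m → ℂ) k = (F ν' : HH m → ℂ) k

/-! ### Group elements -/

/-- `(I 0; X I) ∈ N̄_G`. -/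
def nbarG (m : ℕ) (X : Blk m → Blk m → ℝ) : GG m :=
  Matrix.GeneralLinearGroup.mkOfDetNeZero (Matrix.fromBlocks 1 0 (Matrix.of X) 1)
    (by simp)

/-- `n̄_{2n,n}(t) = I + t E_{2n,n}`. -/
def nbarLast (m : ℕ) (t : ℝ) : GG m :=
  Matrix.GeneralLinearGroup.mkOfDetNeZero (Matrix.transvection (lastIdx m) (nthIdx m) t)
    (by rw [Matrix.det_transvection_of_ne _ _ (by simp)]; exact one_ne_zero)

/-- `w̃_G = (0 -I; I 0)`. -/
def wtildeG (m : ℕ) : GG m where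
  val := Matrix.fromBlocks 0 (-1) 1 0
  inv := Matrix.fromBlocks 0 1 (-1) 0
  val_inv := by simp [Matrix.fromBlocks_multiply]
  inv_val := by simp [Matrix.fromBlocks_multiply]

/-- The element `(I 0 0; vᵀ 1 0; X u I)` of `N̄_H`, from the triple `(X, u, v)`. -/
def nbarH (m : ℕ) (x : (Fin m → Fin m → ℝ) × (Fin m → ℝ) × (Fin m → ℝ)) : HH m :=
  Matrix.GeneralLinearGroup.mkOfDetNeZero
    (Matrix.fromBlocks
      (Matrix.fromBlocks 1 0 (Matrix.replicateRow Unit x.2.2) 1) 0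
      (Matrix.fromCols (Matrix.of x.1) (Matrix.replicateCol Unit x.2.1)) 1)
    (by simp)

/-- `w̃_H = (0 0 -I; 0 1 0; I 0 0)`. -/
def wtildeH (m : ℕ) : HH m where
  val := Matrix.fromBlocks (Matrix.fromBlocks 0 0 0 1) (Matrix.fromRows (-1) 0)
    (Matrix.fromCols 1 0) 0
  inv := Matrix.fromBlocks (Matrix.fromBlocks 0 0 0 1) (Matrix.fromRows 1 0)
    (Matrix.fromCols (-1) 0) 0
  val_inv := by
    ext ((i | i) | i) ((j | j) | j) <;>
      simp [Matrix.mul_apply, Fintype.sum_sum_type, Matrix.one_apply]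
  inv_val := by
    ext ((i | i) | i) ((j | j) | j) <;>
      simp [Matrix.mul_apply, Fintype.sum_sum_type, Matrix.one_apply]

/-! ### The normalizing factors -/

/-- `n_T(ξ, λ)`. -/
def nT (m : ℕ) (ξ : ZMod 2 × ZMod 2) (lam : ℂ × ℂ) : ℂ :=
  ∏ i ∈ Finset.Icc 1 (m + 1),
    Complex.Gamma ((lam.1 - lam.2 - ((m : ℂ) + 1) + (i : ℂ) + rep (ξ.1 + ξ.2)) / 2)

/-- `n_S(η, ν)`. -/
def nS (m : ℕ) (η : ZMod 2 × ZMod 2 × ZMod 2) (ν : ℂ × ℂ × ℂ) : ℂ :=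
  Complex.Gamma ((ν.1 - ν.2.1 + 1 - ((m : ℂ) + 1) / 2 + rep (η.1 + η.2.1)) / 2)
  * Complex.Gamma ((ν.2.1 - ν.2.2 + 1 - ((m : ℂ) + 1) / 2 + rep (η.2.1 + η.2.2)) / 2)
  * ∏ i ∈ Finset.Icc 2 (m + 1),
      Complex.Gamma ((ν.1 - ν.2.2 + (i : ℂ) - ((m : ℂ) + 1) + rep (η.1 + η.2.2)) / 2)

/-- `n_A(ξ, λ, η, ν)`. -/
def nA (m : ℕ) (ξ : ZMod 2 × ZMod 2) (lam : ℂ × ℂ) (η : ZMod 2) (ν : ℂ) : ℂ :=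
  Complex.Gamma ((lam.1 - ν + 1 - ((m : ℂ) + 1) / 2 + rep (ξ.1 + η)) / 2)
  * Complex.Gamma ((ν - lam.2 + 1 - ((m : ℂ) + 1) / 2 + rep (ξ.2 + η)) / 2)
  * ∏ i ∈ Finset.Icc 2 (m + 1),
      Complex.Gamma ((lam.1 - lam.2 + (i : ℂ) - ((m : ℂ) + 1) + rep (ξ.1 + ξ.2)) / 2)

/-- `n_B(ξ, λ, η, ν)`. -/
def nB (m : ℕ) (ξ : ZMod 2 × ZMod 2) (lam : ℂ × ℂ) (η : ZMod 2) (ν : ℂ) : ℂ :=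
  Complex.Gamma ((lam.1 - ν + ((m : ℂ) + 1) / 2 + rep (ξ.1 + η)) / 2)
  * Complex.Gamma ((ν - lam.2 + ((m : ℂ) + 1) / 2 + rep (ξ.2 + η)) / 2)

/-! ### Families of operators

Each predicate below says that a family of linear operators is the normalized family: it
intertwines, it is given by the absolutely convergent integral divided by the normalizing factor
in the range of convergence, and it depends holomorphically on all complex parameters in the
compact picture.  By the identity theorem there is at most one such family. -/

/-- Families of linear maps `π_{ξ,λ} → π_{w_G(ξ,λ)}`. -/
abbrev FamilyT (m : ℕ) : Type :=
  ∀ (ξ : ZMod 2 × ZMod 2) (lam : ℂ × ℂ), piRep m ξ lam →ₗ[ℂ] piRep m ξ.swap lam.swap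

/-- Families of linear maps `τ_{η,ν} → τ_{w_H(η,ν)}`. -/
abbrev FamilyS (m : ℕ) : Type :=
  ∀ (η : ZMod 2 × ZMod 2 × ZMod 2) (ν : ℂ × ℂ × ℂ), tauRep m η ν →ₗ[ℂ] tauRep m (wH η) (wH ν)

/-- Families of linear maps `π_{ξ,λ} → τ_{(ξ₂,η,ξ₁),(λ₂,ν,λ₁)}`. -/
abbrev FamilyA (m : ℕ) : Type :=
  ∀ (ξ : ZMod 2 × ZMod 2) (lam : ℂ × ℂ) (η : ZMod 2) (ν : ℂ),
    piRep m ξ lam →ₗ[ℂ] tauRep m (ξ.2, η, ξ.1) (lam.2, ν, lam.1)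

/-- Families of linear maps `π_{ξ,λ} → τ_{(ξ₁,η,ξ₂),(λ₁,ν,λ₂)}`. -/
abbrev FamilyB (m : ℕ) : Type :=
  ∀ (ξ : ZMod 2 × ZMod 2) (lam : ℂ × ℂ) (η : ZMod 2) (ν : ℂ),
    piRep m ξ lam →ₗ[ℂ] tauRep m (ξ.1, η, ξ.2) (lam.1, ν, lam.2)

/-- The integrand `X ↦ f(g w̃_G n̄)`, `n̄ = (I 0; X I)`, of the Knapp-Stein integral for `G`. -/
def integrandT (m : ℕ) (f : GG m → ℂ) (g : GG m) (X : Blk m → Blk m → ℝ) : ℂ :=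
  f (g * wtildeG m * nbarG m X)

/-- The integrand `n̄ ↦ f(h w̃_H n̄)` of the Knapp-Stein integral for `H`. -/
def integrandS (m : ℕ) (f : HH m → ℂ) (h : HH m)
    (x : (Fin m → Fin m → ℝ) × (Fin m → ℝ) × (Fin m → ℝ)) : ℂ :=
  f (h * wtildeH m * nbarH m x)

/-- The integrand
`|det X|^{λ₁-ν-n/2}_{ξ₁+η} |det_{n-1} X|^{ν-λ₂-n/2}_{η+ξ₂} f(h (I 0; X I))`. -/
def integrandA (m : ℕ) (ξ : ZMod 2 × ZMod 2) (lam : ℂ × ℂ) (η : ZMod 2) (ν : ℂ)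
    (f : GG m → ℂ) (h : HH m) (X : Blk m → Blk m → ℝ) : ℂ :=
  sgnPow (ξ.1 + η) (lam.1 - ν - ((m : ℂ) + 1) / 2) (Matrix.of X).det
  * sgnPow (η + ξ.2) (ν - lam.2 - ((m : ℂ) + 1) / 2) (Matrix.of X).toBlocks₁₁.det
  * f (embH m h * nbarG m X)

/-- The integrand `|t|^{λ₁-ν+n/2}_{ξ₁+η} f(h n̄_{2n,n}(t)) / |t|`. -/
def integrandB (m : ℕ) (ξ : ZMod 2 × ZMod 2) (lam : ℂ × ℂ) (η : ZMod 2) (ν : ℂ)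
    (f : GG m → ℂ) (h : HH m) (t : ℝ) : ℂ :=
  sgnPow (ξ.1 + η) (lam.1 - ν + ((m : ℂ) + 1) / 2) t * f (embH m h * nbarLast m t)
    / ((|t| : ℝ) : ℂ)

/-- `T` is the normalized holomorphic family of Knapp-Stein intertwining operators of `G`. -/
structure IsNormalizedT (m : ℕ) (T : FamilyT m) : Prop where
  intertwines : ∀ (ξ : ZMod 2 × ZMod 2) (lam : ℂ × ℂ) (x : GG m) (f f' : piRep m ξ lam),
    (∀ g, (f' : GG m → ℂ) g = (f : GG m → ℂ) (x⁻¹ * g)) →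
    ∀ g, (T ξ lam f' : GG m → ℂ) g = (T ξ lam f : GG m → ℂ) (x⁻¹ * g)
  integral : ∀ (ξ : ZMod 2 × ZMod 2) (lam : ℂ × ℂ), (m : ℝ) < (lam.1 - lam.2).re →
    ∀ (f : piRep m ξ lam) (g : GG m),
      Integrable (integrandT m f g) ∧
      (T ξ lam f : GG m → ℂ) g = (nT m ξ lam)⁻¹ * ∫ X, integrandT m f g X
  holomorphic : ∀ (ξ : ZMod 2 × ZMod 2) (F : ∀ lam : ℂ × ℂ, piRep m ξ lam),
    IsStandardSectionG m ξ F → ∀ g : GG m,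
      Differentiable ℂ (fun lam : ℂ × ℂ => (T ξ lam (F lam) : GG m → ℂ) g)

/-- `S` is the normalized holomorphic family of Knapp-Stein intertwining operators of `H`. -/
structure IsNormalizedS (m : ℕ) (S : FamilyS m) : Prop where
  intertwines : ∀ (η : ZMod 2 × ZMod 2 × ZMod 2) (ν : ℂ × ℂ × ℂ) (x : HH m)
    (f f' : tauRep m η ν),
    (∀ h, (f' : HH m → ℂ) h = (f : HH m → ℂ) (x⁻¹ * h)) →
    ∀ h, (S η ν f' : HH m → ℂ) h = (S η ν f : HH m → ℂ) (x⁻¹ * h)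
  integral : ∀ (η : ZMod 2 × ZMod 2 × ZMod 2) (ν : ℂ × ℂ × ℂ),
    ((m : ℝ) + 1) / 2 - 1 < (ν.1 - ν.2.1).re → ((m : ℝ) + 1) / 2 - 1 < (ν.2.1 - ν.2.2).re →
    ∀ (f : tauRep m η ν) (h : HH m),
      Integrable (integrandS m f h) ∧
      (S η ν f : HH m → ℂ) h = (nS m η ν)⁻¹ * ∫ x, integrandS m f h x
  holomorphic : ∀ (η : ZMod 2 × ZMod 2 × ZMod 2) (F : ∀ ν : ℂ × ℂ × ℂ, tauRep m η ν),
    IsStandardSectionH m η F → ∀ h : HH m,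
      Differentiable ℂ (fun ν : ℂ × ℂ × ℂ => (S η ν (F ν) : HH m → ℂ) h)

/-- `A` is the normalized holomorphic family of symmetry breaking operators of the first type. -/
structure IsNormalizedA (m : ℕ) (A : FamilyA m) : Prop where
  intertwines : ∀ (ξ : ZMod 2 × ZMod 2) (lam : ℂ × ℂ) (η : ZMod 2) (ν : ℂ) (x : HH m)
    (f f' : piRep m ξ lam),
    (∀ g, (f' : GG m → ℂ) g = (f : GG m → ℂ) ((embH m x)⁻¹ * g)) →
    ∀ h, (A ξ lam η ν f' : HH m → ℂ) h = (A ξ lam η ν f : HH m → ℂ) (x⁻¹ * h)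
  integral : ∀ (ξ : ZMod 2 × ZMod 2) (lam : ℂ × ℂ) (η : ZMod 2) (ν : ℂ),
    ((m : ℝ) + 1) / 2 - 1 < (lam.1 - ν).re → ((m : ℝ) + 1) / 2 - 1 < (ν - lam.2).re →
    ∀ (f : piRep m ξ lam) (h : HH m),
      Integrable (integrandA m ξ lam η ν f h) ∧
      (A ξ lam η ν f : HH m → ℂ) h =
        (nA m ξ lam η ν)⁻¹ * ∫ X, integrandA m ξ lam η ν f h X
  holomorphic : ∀ (ξ : ZMod 2 × ZMod 2) (η : ZMod 2) (F : ∀ lam : ℂ × ℂ, piRep m ξ lam),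
    IsStandardSectionG m ξ F → ∀ h : HH m,
      Differentiable ℂ (fun z : (ℂ × ℂ) × ℂ => (A ξ z.1 η z.2 (F z.1) : HH m → ℂ) h)

/-- `B` is the normalized holomorphic family of symmetry breaking operators of the second
type. -/
structure IsNormalizedB (m : ℕ) (B : FamilyB m) : Prop where
  intertwines : ∀ (ξ : ZMod 2 × ZMod 2) (lam : ℂ × ℂ) (η : ZMod 2) (ν : ℂ) (x : HH m)
    (f f' : piRep m ξ lam),
    (∀ g, (f' : GG m → ℂ) g = (f : GG m → ℂ) ((embH m x)⁻¹ * g)) →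
    ∀ h, (B ξ lam η ν f' : HH m → ℂ) h = (B ξ lam η ν f : HH m → ℂ) (x⁻¹ * h)
  integral : ∀ (ξ : ZMod 2 × ZMod 2) (lam : ℂ × ℂ) (η : ZMod 2) (ν : ℂ),
    -(((m : ℝ) + 1) / 2) < (lam.1 - ν).re → -(((m : ℝ) + 1) / 2) < (ν - lam.2).re →
    ∀ (f : piRep m ξ lam) (h : HH m),
      Integrable (integrandB m ξ lam η ν f h) ∧
      (B ξ lam η ν f : HH m → ℂ) h =
        (nB m ξ lam η ν)⁻¹ * ∫ t, integrandB m ξ lam η ν f h t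
  holomorphic : ∀ (ξ : ZMod 2 × ZMod 2) (η : ZMod 2) (F : ∀ lam : ℂ × ℂ, piRep m ξ lam),
    IsStandardSectionG m ξ F → ∀ h : HH m,
      Differentiable ℂ (fun z : (ℂ × ℂ) × ℂ => (B ξ z.1 η z.2 (F z.1) : HH m → ℂ) h)

end GLBranching

end

noncomputable section

namespace GLBranching

open Set Filter Topology

open Complex (Gamma)

set_option linter.unusedSectionVars false
set_option linter.overlappingInstances false

/-- Square matrices, as elements of a normed space of functions. -/
local notation:max "Sq" a:max => (a → a → ℝ)

section ParametricIntegrals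

variable {Q V F : Type} [NormedAddCommGroup Q] [NormedSpace ℝ Q]
  [NormedAddCommGroup V] [SecondCountableTopology V] [MeasurableSpace V] [BorelSpace V]
  {μ : Measure V} [IsFiniteMeasureOnCompacts μ]

omit [SecondCountableTopology V] in
theorem continuous_integrable_of_support {F : Type} [NormedAddCommGroup F]
    {k : Set V} (hk : IsCompact k) {f : V → F} (hf : Continuous f) (h0 : ∀ v ∉ k, f v = 0) :
    Integrable f μ :=
  hf.integrable_of_hasCompactSupport (HasCompactSupport.intro hk h0)

theorem hasFDerivAt_integral_of_compact_support [NormedAddCommGroup F] [NormedSpace ℝ F]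
    {U : Set Q} (hU : IsOpen U) {k : Set V} (hk : IsCompact k) {H : Q → V → F}
    {H' : Q → V → Q →L[ℝ] F}
    (hH : ContinuousOn (Function.uncurry H) (U ×ˢ univ))
    (hH' : ContinuousOn (Function.uncurry H') (U ×ˢ univ))
    (h0 : ∀ q ∈ U, ∀ v ∉ k, H q v = 0)
    (hd : ∀ q ∈ U, ∀ v, HasFDerivAt (fun q => H q v) (H' q v) q) {q : Q} (hq : q ∈ U) :
    HasFDerivAt (fun q => ∫ v, H q v ∂μ) (∫ v, H' q v ∂μ) q := by
  have h0' : ∀ q ∈ U, ∀ v ∉ k, H' q v = 0 := by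
    intro q hq v hv
    have h1 : HasFDerivAt (fun q => H q v) (0 : Q →L[ℝ] F) q := by
      refine (hasFDerivAt_const (0 : F) q).congr_of_eventuallyEq ?_
      filter_upwards [hU.mem_nhds hq] with q' hq' using h0 q' hq' v hv
    exact (hd q hq v).unique h1
  have cH : ∀ q ∈ U, Continuous (H q) := fun q hq =>
    hH.comp_continuous (f := fun v => (q, v)) (by fun_prop) (fun v => ⟨hq, mem_univ _⟩)
  have cH' : ∀ q ∈ U, Continuous (H' q) := fun q hq =>
    hH'.comp_continuous (f := fun v => (q, v)) (by fun_prop) (fun v => ⟨hq, mem_univ _⟩)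
  obtain ⟨C, hC⟩ := hk.exists_bound_of_continuousOn (cH' q hq).continuousOn
  have hev : ∀ᶠ q' in 𝓝 q, ∀ v ∈ k, ‖H' q' v‖ < C + 1 := by
    refine hk.eventually_forall_of_forall_eventually fun v hv => ?_
    have h1 : ContinuousAt (Function.uncurry H') (q, v) :=
      hH'.continuousAt ((hU.prod isOpen_univ).mem_nhds ⟨hq, mem_univ _⟩)
    have h2 : ∀ᶠ z in 𝓝 (q, v), ‖Function.uncurry H' z‖ < C + 1 :=
      h1.norm.eventually_lt continuousAt_const (lt_of_le_of_lt (hC v hv) (by simp))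
    exact h2
  have hs : {q' | q' ∈ U ∧ ∀ v ∈ k, ‖H' q' v‖ < C + 1} ∈ 𝓝 q :=
    (hU.eventually_mem hq).and hev
  refine hasFDerivAt_integral_of_dominated_of_fderiv_le (bound := k.indicator fun _ => C + 1)
    hs ?_ ?_ ?_ ?_ ?_ ?_
  · filter_upwards [hU.mem_nhds hq] with q' hq' using (cH q' hq').aestronglyMeasurable
  · exact continuous_integrable_of_support hk (cH q hq) (h0 q hq)
  · exact (cH' q hq).aestronglyMeasurable
  · refine Eventually.of_forall fun v q' hq' => ?_
    by_cases hv : v ∈ k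
    · simpa [hv] using (hq'.2 v hv).le
    · simp [hv, h0' q' hq'.1 v hv]
  · rw [integrable_indicator_iff hk.measurableSet]
    exact integrableOn_const hk.measure_ne_top
  · exact Eventually.of_forall fun v q' hq' => hd q' hq'.1 v

theorem contDiffOn_integral_weight {U : Set Q} (hU : IsOpen U) {k : Set V} (hk : IsCompact k)
    [NormedSpace ℝ V]
    {D : Q → Q →L[ℝ] ℂ} (hD : ContDiff ℝ ∞ D) {w : ℕ → Q → V → ℂ} {N : ℕ}
    (hw : ∀ j ≤ N, ContinuousOn (Function.uncurry (w j)) (U ×ˢ univ))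
    (hw' : ∀ j < N, ∀ q ∈ U, ∀ v, HasFDerivAt (fun q => w j q v) (w (j + 1) q v • D q) q) :
    ∀ (n j : ℕ), n + j ≤ N → ∀ (F : Type) [NormedAddCommGroup F] [NormedSpace ℝ F]
      [NormedSpace ℂ F] [IsScalarTower ℝ ℂ F] (Φ : Q → V → F),
      ContDiff ℝ ∞ (Function.uncurry Φ) → (∀ q, ∀ v ∉ k, Φ q v = 0) →
      ContDiffOn ℝ n (fun q => ∫ v, w j q v • Φ q v ∂μ) U := by
  intro n
  induction n with
  | zero =>
    intro j hj F _ _ _ _ Φ hΦ h0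
    simp only [Nat.cast_zero, contDiffOn_zero]
    refine continuousOn_integral_of_compact_support hk ?_ (fun p x _ hx => by simp [h0 p x hx])
    exact (hw j (by omega)).smul hΦ.continuous.continuousOn
  | succ n ih =>
    intro j hj F _ _ _ _ Φ hΦ h0
    have hΦd : ∀ q v, HasFDerivAt (fun q => Φ q v)
        ((fderiv ℝ (Function.uncurry Φ) (q, v)).comp (ContinuousLinearMap.inl ℝ Q V)) q := by
      intro q v
      have h1 : HasFDerivAt (Function.uncurry Φ) (fderiv ℝ (Function.uncurry Φ) (q, v)) (q, v) :=
        (hΦ.differentiable (by simp)).differentiableAt.hasFDerivAt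
      have h2 : HasFDerivAt (fun q : Q => (q, v)) (ContinuousLinearMap.inl ℝ Q V) q :=
        hasFDerivAt_prodMk_left q v
      exact h1.comp q h2
    let Φ₁ : Q → V → (Q →L[ℝ] F) := fun q v =>
      ((ContinuousLinearMap.lsmul ℝ ℂ : ℂ →L[ℝ] F →L[ℝ] F).flip (Φ q v)).comp (D q)
    let Φ₂ : Q → V → (Q →L[ℝ] F) := fun q v =>
      (fderiv ℝ (Function.uncurry Φ) (q, v)).comp (ContinuousLinearMap.inl ℝ Q V)
    have hΦ₁ : ContDiff ℝ ∞ (Function.uncurry Φ₁) := by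
      have h1 : ContDiff ℝ ∞ fun z : Q × V => D z.1 := hD.comp contDiff_fst
      exact (((ContinuousLinearMap.lsmul ℝ ℂ : ℂ →L[ℝ] F →L[ℝ] F).flip.contDiff).comp hΦ).clm_comp h1
    have hΦ₂ : ContDiff ℝ ∞ (Function.uncurry Φ₂) := by
      have h1 : ContDiff ℝ ∞ (fderiv ℝ (Function.uncurry Φ)) := hΦ.fderiv_right (by simp)
      exact h1.clm_comp contDiff_const
    have h01 : ∀ q, ∀ v ∉ k, Φ₁ q v = 0 := fun q v hv => by
      ext; simp [Φ₁, h0 q v hv]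
    have h02 : ∀ q, ∀ v ∉ k, Φ₂ q v = 0 := fun q v hv => by
      have h1 : HasFDerivAt (fun q => Φ q v) (0 : Q →L[ℝ] F) q :=
        (hasFDerivAt_const (0 : F) q).congr_of_eventuallyEq
          (Eventually.of_forall fun q' => h0 q' v hv)
      exact (hΦd q v).unique h1
    have c1 : ContinuousOn (Function.uncurry fun q v => w (j + 1) q v • Φ₁ q v) (U ×ˢ univ) :=
      (hw (j + 1) (by omega)).smul hΦ₁.continuous.continuousOn
    have c2 : ContinuousOn (Function.uncurry fun q v => w j q v • Φ₂ q v) (U ×ˢ univ) :=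
      (hw j (by omega)).smul hΦ₂.continuous.continuousOn
    have hderiv : ∀ q ∈ U, HasFDerivAt (fun q => ∫ v, w j q v • Φ q v ∂μ)
        ((∫ v, w (j + 1) q v • Φ₁ q v ∂μ) + ∫ v, w j q v • Φ₂ q v ∂μ) q := by
      intro q hq
      have hi1 : Integrable (fun v => w (j + 1) q v • Φ₁ q v) μ :=
        continuous_integrable_of_support hk
          (c1.comp_continuous (f := fun v => (q, v)) (by fun_prop) fun v => ⟨hq, mem_univ _⟩)
          (fun v hv => by simp [h01 q v hv])
      have hi2 : Integrable (fun v => w j q v • Φ₂ q v) μ :=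
        continuous_integrable_of_support hk
          (c2.comp_continuous (f := fun v => (q, v)) (by fun_prop) fun v => ⟨hq, mem_univ _⟩)
          (fun v hv => by simp [h02 q v hv])
      rw [← integral_add hi1 hi2]
      refine hasFDerivAt_integral_of_compact_support hU hk
        (H := fun q v => w j q v • Φ q v) (H' := fun q v => w (j + 1) q v • Φ₁ q v +
          w j q v • Φ₂ q v)
        ((hw j (by omega)).smul hΦ.continuous.continuousOn) (c1.add c2) ?_ ?_ hq
      · intro q _ v hv; simp [h0 q v hv]
      · intro q hq v
        have h3 := (hw' j (by omega) q hq v).smul (hΦd q v)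
        refine h3.congr_fderiv ?_
        ext x
        simp [Φ₁, Φ₂, mul_smul, add_comm]
    rw [Nat.cast_succ, contDiffOn_succ_iff_hasFDerivWithinAt_of_uniqueDiffOn hU.uniqueDiffOn]
    refine ⟨by simp, _, ?_, fun q hq => (hderiv q hq).hasFDerivWithinAt⟩
    exact (ih (j + 1) (by omega) _ Φ₁ hΦ₁ h01).add (ih j (by omega) _ Φ₂ hΦ₂ h02)

end ParametricIntegrals


section HolSmooth

variable {Q Q' E E' V : Type} [NormedAddCommGroup Q] [NormedSpace ℂ Q]
  [NormedAddCommGroup Q'] [NormedSpace ℂ Q']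
  [NormedAddCommGroup E] [NormedSpace ℝ E] [NormedAddCommGroup E'] [NormedSpace ℝ E']
  [NormedAddCommGroup V] [NormedSpace ℝ V]

/-- Functions that are smooth, and holomorphic in the first variable. -/
def HolSmooth (Φ : Q × E → ℂ) : Prop :=
  ContDiff ℝ ∞ Φ ∧ ∀ x, Differentiable ℂ fun q => Φ (q, x)

theorem differentiableAt_complex_of_real {f : Q → ℂ} {q : Q} (h : DifferentiableAt ℝ f q)
    (hI : ∀ v, fderiv ℝ f q (Complex.I • v) = Complex.I * fderiv ℝ f q v) :
    DifferentiableAt ℂ f q := by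
  rw [differentiableAt_iff_restrictScalars ℝ h]
  refine ⟨{ toFun := fderiv ℝ f q, map_add' := by simp, map_smul' := ?_, cont := by fun_prop }, ?_⟩
  · intro c v
    have h1 : c • v = (c.re : ℝ) • v + (c.im : ℝ) • (Complex.I • v) := by
      conv_lhs => rw [← Complex.re_add_im c]
      rw [add_smul, mul_smul]
      simp
    rw [h1, map_add, map_smul, map_smul, hI]
    simp only [Complex.real_smul, RingHom.id_apply, smul_eq_mul]
    conv_rhs => rw [← Complex.re_add_im c]
    ring
  · ext; rfl

theorem fderiv_real_I_smul {f : Q → ℂ} {q : Q} (h : DifferentiableAt ℂ f q) (v : Q) :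
    fderiv ℝ f q (Complex.I • v) = Complex.I * fderiv ℝ f q v := by
  rw [h.fderiv_restrictScalars ℝ]
  simp

theorem HolSmooth.fderiv_fst {Φ : Q × E → ℂ} (h : HolSmooth Φ) (q : Q) (x : E) (v : Q) :
    fderiv ℝ Φ (q, x) (Complex.I • v, 0) = Complex.I * fderiv ℝ Φ (q, x) (v, 0) := by
  have h1 : HasFDerivAt (fun q => Φ (q, x))
      ((fderiv ℝ Φ (q, x)).comp (ContinuousLinearMap.inl ℝ Q E)) q :=
    ((h.1.differentiable (by simp)).differentiableAt.hasFDerivAt).comp q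
      (hasFDerivAt_prodMk_left q x)
  have h2 := fderiv_real_I_smul (h.2 x q) v
  rw [h1.fderiv] at h2
  simpa using h2

theorem HolSmooth.of_fderiv {Φ : Q × E → ℂ} (h : ContDiff ℝ ∞ Φ)
    (hI : ∀ q x v, fderiv ℝ Φ (q, x) (Complex.I • v, 0) = Complex.I * fderiv ℝ Φ (q, x) (v, 0)) :
    HolSmooth Φ := by
  refine ⟨h, fun x q => ?_⟩
  have h1 : HasFDerivAt (fun q => Φ (q, x))
      ((fderiv ℝ Φ (q, x)).comp (ContinuousLinearMap.inl ℝ Q E)) q :=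
    ((h.differentiable (by simp)).differentiableAt.hasFDerivAt).comp q
      (hasFDerivAt_prodMk_left q x)
  refine differentiableAt_complex_of_real h1.differentiableAt fun v => ?_
  rw [h1.fderiv]
  simpa using hI q x v

theorem HolSmooth.comp {Φ : Q × E → ℂ} (h : HolSmooth Φ) {a : Q' → Q} (ha : ContDiff ℂ ∞ a)
    {θ : E' → E} (hθ : ContDiff ℝ ∞ θ) : HolSmooth fun z : Q' × E' => Φ (a z.1, θ z.2) := by
  refine ⟨h.1.comp (((ha.restrict_scalars ℝ).comp contDiff_fst).prodMk (hθ.comp contDiff_snd)),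
    fun x => (h.2 (θ x)).comp (ha.differentiable (by simp))⟩

theorem HolSmooth.comp_right {Φ : Q × E → ℂ} (h : HolSmooth Φ) {θ : E' → E}
    (hθ : ContDiff ℝ ∞ θ) : HolSmooth fun z : Q × E' => Φ (z.1, θ z.2) :=
  h.comp (a := fun q => q) contDiff_id hθ

theorem HolSmooth.mul {Φ Ψ : Q × E → ℂ} (h : HolSmooth Φ) (h' : HolSmooth Ψ) :
    HolSmooth fun z => Φ z * Ψ z := by
  refine ⟨h.1.mul h'.1, fun x => (h.2 x).mul (h'.2 x)⟩

theorem HolSmooth.of_right {f : E → ℂ} (hf : ContDiff ℝ ∞ f) :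
    HolSmooth fun z : Q × E => f z.2 :=
  ⟨hf.comp contDiff_snd, fun x => differentiable_const (f x)⟩

theorem HolSmooth.of_left {f : Q → ℂ} (hf : ContDiff ℂ ∞ f) :
    HolSmooth fun z : Q × E => f z.1 :=
  ⟨(hf.restrict_scalars ℝ).comp contDiff_fst, fun _ => hf.differentiable (by simp)⟩

theorem HolSmooth.const (c : ℂ) : HolSmooth fun _ : Q × E => c :=
  ⟨contDiff_const, fun _ => differentiable_const _⟩

theorem HolSmooth.const_mul {Φ : Q × E → ℂ} (h : HolSmooth Φ) (c : ℂ) :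
    HolSmooth fun z => c * Φ z :=
  (HolSmooth.const c).mul h

theorem HolSmooth.sum {ι : Type} (s : Finset ι) {Φ : ι → Q × E → ℂ}
    (h : ∀ i ∈ s, HolSmooth (Φ i)) : HolSmooth fun z => ∑ i ∈ s, Φ i z :=
  ⟨ContDiff.sum fun i hi => (h i hi).1, fun x => Differentiable.fun_sum fun i hi => (h i hi).2 x⟩

theorem HolSmooth.cexp {Φ : Q × E → ℂ} (h : HolSmooth Φ) :
    HolSmooth fun z => Complex.exp (Φ z) :=
  ⟨h.1.cexp, fun x => (h.2 x).cexp⟩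

/-- The derivative in a direction of the second variable. -/
theorem HolSmooth.deriv_snd {Φ : Q × E → ℂ} (h : HolSmooth Φ) (u : E) :
    HolSmooth fun z : Q × E => fderiv ℝ Φ z (0, u) := by
  have h1 : ContDiff ℝ ∞ (fderiv ℝ Φ) := h.1.fderiv_right (by simp)
  have hd : ∀ z, DifferentiableAt ℝ (fderiv ℝ Φ) z := fun z =>
    (h1.differentiable (by simp)).differentiableAt
  have hv : ∀ (z w v : Q × E),
      fderiv ℝ (fun z => fderiv ℝ Φ z w) z v = fderiv ℝ (fderiv ℝ Φ) z v w := by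
    intro z w v
    have h2 := (hd z).hasFDerivAt.clm_apply (hasFDerivAt_const w z)
    rw [h2.fderiv]
    simp
  have hsymm : ∀ z v w, fderiv ℝ (fderiv ℝ Φ) z v w = fderiv ℝ (fderiv ℝ Φ) z w v := by
    intro z v w
    have h2 : IsSymmSndFDerivAt ℝ Φ z :=
      h.1.contDiffAt.isSymmSndFDerivAt (by
        rw [minSmoothness_of_isRCLikeNormedField]
        exact WithTop.coe_le_coe.2 le_top)
    exact h2 v w
  refine HolSmooth.of_fderiv (h1.clm_apply contDiff_const) fun q x v => ?_
  rw [hv, hv, hsymm, hsymm _ (v, 0), ← hv, ← hv]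
  have h3 : (fun z : Q × E => fderiv ℝ Φ z (Complex.I • v, 0)) =
      fun z => Complex.I * fderiv ℝ Φ z (v, 0) := by
    funext z
    exact h.fderiv_fst z.1 z.2 v
  rw [h3, fderiv_const_mul ((hd _).clm_apply (differentiableAt_const _))]
  simp

variable [SecondCountableTopology V] [MeasurableSpace V] [BorelSpace V]
  {μ : Measure V} [IsFiniteMeasureOnCompacts μ]

theorem HolSmooth.integral {Φ : Q × E × V → ℂ} (h : HolSmooth Φ) {k : Set V} (hk : IsCompact k)
    (h0 : ∀ q x, ∀ v ∉ k, Φ (q, x, v) = 0) :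
    HolSmooth fun z : Q × E => ∫ v, Φ (z.1, z.2, v) ∂μ := by
  let H : Q × E → V → ℂ := fun z v => Φ (z.1, z.2, v)
  have hH : ContDiff ℝ ∞ (Function.uncurry H) :=
    h.1.comp (f := fun z : (Q × E) × V => (z.1.1, z.1.2, z.2)) (by fun_prop)
  let w : ℕ → Q × E → V → ℂ := fun j _ _ => if j = 0 then 1 else 0
  have hs : ContDiff ℝ ∞ fun z : Q × E => ∫ v, H z v ∂μ := by
    rw [contDiff_infty]
    intro n
    have h1 := contDiffOn_integral_weight (μ := μ) isOpen_univ hk (D := fun _ : Q × E => 0)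
      contDiff_const (w := w) (N := n)
      (fun j _ => continuousOn_const)
      (fun j _ q _ v => by
        exact (hasFDerivAt_const (𝕜 := ℝ) (if j = 0 then (1 : ℂ) else 0) q).congr_fderiv
          (by ext <;> simp))
      n 0 (by simp) ℂ H hH (fun q v hv => h0 _ _ v hv)
    rw [contDiffOn_univ] at h1
    simpa [w] using h1
  refine HolSmooth.of_fderiv hs fun q x v => ?_
  have hd : ∀ z v, HasFDerivAt (fun z => H z v)
      ((fderiv ℝ (Function.uncurry H) (z, v)).comp (ContinuousLinearMap.inl ℝ (Q × E) V)) z :=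
    fun z v => ((hH.differentiable (by simp)).differentiableAt.hasFDerivAt).comp z
      (hasFDerivAt_prodMk_left z v)
  have hc : Continuous (Function.uncurry fun z v =>
      (fderiv ℝ (Function.uncurry H) (z, v)).comp (ContinuousLinearMap.inl ℝ (Q × E) V)) := by
    have : Continuous (fderiv ℝ (Function.uncurry H)) := hH.continuous_fderiv (by simp)
    exact (this.clm_comp continuous_const)
  have h1 := hasFDerivAt_integral_of_compact_support (μ := μ) isOpen_univ hk
    hH.continuous.continuousOn hc.continuousOn (fun z _ v hv => h0 _ _ v hv)
    (fun z _ v => hd z v) (mem_univ (q, x))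
  have h0' : ∀ v ∉ k, (fderiv ℝ (Function.uncurry H) ((q, x), v)).comp
      (ContinuousLinearMap.inl ℝ (Q × E) V) = 0 := by
    intro v hv
    exact (hd (q, x) v).unique ((hasFDerivAt_const (0 : ℂ) (q, x)).congr_of_eventuallyEq
      (Eventually.of_forall fun z => h0 _ _ v hv))
  have hint : Integrable (fun v => (fderiv ℝ (Function.uncurry H) ((q, x), v)).comp
      (ContinuousLinearMap.inl ℝ (Q × E) V)) μ :=
    continuous_integrable_of_support hk
      (hc.comp (by fun_prop : Continuous fun v : V => ((q, x), v))) h0'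
  rw [h1.fderiv, ContinuousLinearMap.integral_apply hint, ContinuousLinearMap.integral_apply hint,
    ← integral_const_mul]
  congr 1
  funext y
  rw [← (hd (q, x) y).fderiv]
  have h2 : HolSmooth fun z : Q × E => H z y :=
    h.comp_right (θ := fun x => (x, y)) (by fun_prop)
  exact h2.fderiv_fst q x v

end HolSmooth

section SgnPow

theorem sgnPow_zero_left (μ : ℂ) (x : ℝ) : sgnPow 0 μ x = ((|x| : ℝ) : ℂ) ^ μ := by
  simp [sgnPow]

theorem sgnPow_one_left (μ : ℂ) (x : ℝ) :
    sgnPow 1 μ x = ((Real.sign x : ℝ) : ℂ) * ((|x| : ℝ) : ℂ) ^ μ := by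
  simp [sgnPow, ZMod.val_one]

theorem zmod_two_cases (ε : ZMod 2) : ε = 0 ∨ ε = 1 := by
  revert ε; decide

theorem real_sign_mul (x y : ℝ) : Real.sign (x * y) = Real.sign x * Real.sign y := by
  rcases lt_trichotomy x 0 with hx | rfl | hx <;> rcases lt_trichotomy y 0 with hy | rfl | hy <;>
    simp [Real.sign_of_neg, Real.sign_of_pos, mul_pos_of_neg_of_neg, mul_neg_of_neg_of_pos,
      mul_neg_of_pos_of_neg, *]

theorem sgnPow_mul (ε : ZMod 2) (μ : ℂ) (x y : ℝ) :
    sgnPow ε μ (x * y) = sgnPow ε μ x * sgnPow ε μ y := by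
  unfold sgnPow
  rw [real_sign_mul, abs_mul, Complex.ofReal_mul, Complex.ofReal_mul,
    Complex.mul_cpow_ofReal_nonneg (abs_nonneg _) (abs_nonneg _)]
  ring

theorem sign_pow_add (ε ε' : ZMod 2) {x : ℝ} (hx : x ≠ 0) :
    ((Real.sign x : ℝ) : ℂ) ^ (ε + ε').val =
      ((Real.sign x : ℝ) : ℂ) ^ ε.val * ((Real.sign x : ℝ) : ℂ) ^ ε'.val := by
  have h : Real.sign x = -1 ∨ Real.sign x = 1 := Real.sign_apply_eq_of_ne_zero x hx
  have h11 : (1 + 1 : ZMod 2) = 0 := by decide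
  rcases zmod_two_cases ε with rfl | rfl <;> rcases zmod_two_cases ε' with rfl | rfl <;>
    rcases h with h | h <;> simp [h, ZMod.val_one, h11]

theorem sgnPow_mul_sgnPow (ε ε' : ZMod 2) (μ μ' : ℂ) {x : ℝ} (hx : x ≠ 0) :
    sgnPow ε μ x * sgnPow ε' μ' x = sgnPow (ε + ε') (μ + μ') x := by
  unfold sgnPow
  rw [sign_pow_add ε ε' hx, Complex.cpow_add _ _ (by simpa using hx)]
  ring

theorem sgnPow_ne_zero (ε : ZMod 2) (μ : ℂ) {x : ℝ} (hx : x ≠ 0) : sgnPow ε μ x ≠ 0 := by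
  unfold sgnPow
  refine mul_ne_zero (pow_ne_zero _ ?_) ?_
  · rcases Real.sign_apply_eq_of_ne_zero x hx with h | h <;> simp [h]
  · rw [Complex.cpow_ne_zero_iff]
    left
    simpa using hx

theorem sgnPow_one_right (ε : ZMod 2) (μ : ℂ) : sgnPow ε μ 1 = 1 := by
  simp [sgnPow]

theorem sgnPow_inv (ε : ZMod 2) (μ : ℂ) {x : ℝ} (hx : x ≠ 0) :
    sgnPow ε μ x⁻¹ = (sgnPow ε μ x)⁻¹ := by
  refine eq_inv_of_mul_eq_one_left ?_
  rw [← sgnPow_mul, inv_mul_cancel₀ hx, sgnPow_one_right]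

theorem sgnPow_neg (ε : ZMod 2) (μ : ℂ) {x : ℝ} (hx : x ≠ 0) :
    sgnPow ε (-μ) x = (sgnPow ε μ x)⁻¹ := by
  refine eq_inv_of_mul_eq_one_left ?_
  rw [sgnPow_mul_sgnPow _ _ _ _ hx]
  have : ε + ε = 0 := by revert ε; decide
  simp [this, sgnPow]

theorem norm_sgnPow (ε : ZMod 2) (μ : ℂ) {x : ℝ} (hx : x ≠ 0) :
    ‖sgnPow ε μ x‖ = |x| ^ μ.re := by
  unfold sgnPow
  rw [norm_mul, norm_pow, Complex.norm_cpow_eq_rpow_re_of_pos (abs_pos.2 hx)]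
  rcases Real.sign_apply_eq_of_ne_zero x hx with h | h <;> simp [h]

theorem measurable_sgnPow (ε : ZMod 2) (μ : ℂ) : Measurable (sgnPow ε μ) := by
  have h1 : Measurable Real.sign := by
    unfold Real.sign
    exact Measurable.ite measurableSet_Iio measurable_const
      (Measurable.ite measurableSet_Ioi measurable_const measurable_const)
  have h2 : Measurable fun x : ℝ => ((|x| : ℝ) : ℂ) ^ μ := by
    have : Measurable fun x : ℝ => ((|x| : ℝ) : ℂ) := by fun_prop
    exact this.pow_const μ
  unfold sgnPow
  exact ((Complex.measurable_ofReal.comp h1).pow_const _).mul h2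

end SgnPow

section OneDim

/-- The weights `|t|^{μ-1} (log |t|)^j`. -/
def logWeight (j : ℕ) (μ : ℂ) (t : ℝ) : ℂ :=
  ((|t| : ℝ) : ℂ) ^ (μ - 1) * ((Real.log t : ℝ) : ℂ) ^ j

theorem continuousAt_logWeight {j : ℕ} {μ : ℂ} (hμ : (j : ℝ) + 1 < μ.re) (t : ℝ) :
    ContinuousAt (fun z : ℂ × ℝ => logWeight j z.1 z.2) (μ, t) := by
  have h1 : ContinuousAt (fun z : ℂ × ℝ => ((|z.2| : ℝ) : ℂ) ^ (z.1 - 1 - j)) (μ, t) := by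
    have h2 := Complex.continuousAt_ofReal_cpow |t| (μ - 1 - j) (Or.inl (by simp; linarith))
    exact ContinuousAt.comp (f := fun z : ℂ × ℝ => (|z.2|, z.1 - 1 - (j : ℂ))) (x := (μ, t))
      h2 (by fun_prop)
  have h2 : Continuous fun z : ℂ × ℝ => (((z.2 * Real.log z.2 : ℝ) : ℂ) * (Real.sign z.2 : ℝ)) := by
    have h3 : (fun z : ℂ × ℝ => (((z.2 * Real.log z.2 : ℝ) : ℂ) * (Real.sign z.2 : ℝ))) =
        fun z : ℂ × ℝ => ((|z.2| * Real.log |z.2| : ℝ) : ℂ) := by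
      funext z
      rw [← Complex.ofReal_mul]
      congr 1
      rcases lt_trichotomy z.2 0 with hx | hx | hx
      · simp [Real.sign_of_neg hx, abs_of_neg hx]
      · simp [hx]
      · simp [Real.sign_of_pos hx, abs_of_pos hx]
    rw [h3]
    exact Complex.continuous_ofReal.comp (Real.continuous_mul_log.comp (by fun_prop))
  have h4 : (fun z : ℂ × ℝ => logWeight j z.1 z.2) =ᶠ[𝓝 (μ, t)] fun z =>
      ((|z.2| : ℝ) : ℂ) ^ (z.1 - 1 - j) *
        ((((z.2 * Real.log z.2 : ℝ) : ℂ) * (Real.sign z.2 : ℝ))) ^ j := by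
    have h5 : ∀ᶠ z : ℂ × ℝ in 𝓝 (μ, t), (j : ℝ) + 1 < z.1.re :=
      (Complex.continuous_re.comp continuous_fst).continuousAt.eventually_const_lt hμ
    filter_upwards [h5] with z hz
    unfold logWeight
    by_cases h0 : z.2 = 0
    · have h6 : z.1 - 1 ≠ 0 := by
        intro h
        have := congrArg Complex.re h
        simp at this
        have : (0 : ℝ) ≤ j := Nat.cast_nonneg j
        linarith
      have h7 : z.1 - 1 - j ≠ 0 := by
        intro h
        have := congrArg Complex.re h
        simp at this
        linarith
      simp [h0, Complex.zero_cpow h6, Complex.zero_cpow h7]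
    · have h8 : ((z.2 * Real.log z.2 : ℝ) : ℂ) * ((Real.sign z.2 : ℝ) : ℂ) =
          ((|z.2| : ℝ) : ℂ) * ((Real.log z.2 : ℝ) : ℂ) := by
        rw [← Complex.ofReal_mul, ← Complex.ofReal_mul]
        congr 1
        rcases lt_or_gt_of_ne h0 with hx | hx
        · simp [Real.sign_of_neg hx, abs_of_neg hx]
        · simp [Real.sign_of_pos hx, abs_of_pos hx]
      have h9 : ((|z.2| : ℝ) : ℂ) ≠ 0 := by simpa using h0
      rw [h8, mul_pow, ← mul_assoc, Complex.cpow_sub (z.1 - 1) _ h9, Complex.cpow_natCast]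
      field_simp
  exact (h1.mul ((h2.pow j).continuousAt)).congr h4.symm

theorem hasFDerivAt_logWeight {Q : Type} [NormedAddCommGroup Q] [NormedSpace ℝ Q] {μ : Q → ℂ}
    {D : Q →L[ℝ] ℂ} {q : Q} (hμ : HasFDerivAt μ D q) (h1 : 1 < (μ q).re) (j : ℕ) (t : ℝ) :
    HasFDerivAt (fun q => logWeight j (μ q) t) (logWeight (j + 1) (μ q) t • D) q := by
  by_cases ht : t = 0
  · subst ht
    have h0 : logWeight (j + 1) (μ q) 0 = 0 := by simp [logWeight]
    have h00 : (0 : ℂ) • D = 0 := by ext; simp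
    rw [h0, h00]
    refine (hasFDerivAt_const (0 : ℂ) q).congr_of_eventuallyEq ?_
    have h5 : ∀ᶠ z in 𝓝 q, 1 < (μ z).re :=
      (Complex.continuous_re.continuousAt.comp hμ.continuousAt).eventually_const_lt h1
    filter_upwards [h5] with z hz
    have h6 : μ z - 1 ≠ 0 := by
      intro h
      have := congrArg Complex.re h
      simp at this
      linarith
    simp [logWeight, Complex.zero_cpow h6]
  · have h9 : ((|t| : ℝ) : ℂ) ≠ 0 := by simpa using ht
    have h2 : HasDerivAt (fun s : ℂ => logWeight j s t) (logWeight (j + 1) (μ q) t) (μ q) := by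
      have h3 := (((hasDerivAt_id (μ q)).sub_const 1).const_cpow (c := ((|t| : ℝ) : ℂ))
        (Or.inl h9)).mul_const (((Real.log t : ℝ) : ℂ) ^ j)
      refine h3.congr_deriv ?_
      rw [← Complex.ofReal_log (abs_nonneg t), Real.log_abs]
      simp only [logWeight, id, pow_succ]
      ring
    have h4 := (h2.hasFDerivAt.restrictScalars ℝ).comp q hμ
    refine h4.congr_fderiv ?_
    ext v
    simp [mul_comm]

variable {Q E : Type} [NormedAddCommGroup Q] [NormedSpace ℂ Q]
  [NormedAddCommGroup E] [NormedSpace ℝ E]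

theorem HolSmooth.contDiffOn_integral_abs_cpow {Φ : Q × E × ℝ → ℂ} (h : HolSmooth Φ)
    {k : Set ℝ} (hk : IsCompact k) (h0 : ∀ q x, ∀ t ∉ k, Φ (q, x, t) = 0) {μ : Q → ℂ}
    (hμ : ContDiff ℂ ∞ μ) (n : ℕ) :
    ContDiffOn ℝ n (fun z : Q × E => ∫ t : ℝ, ((|t| : ℝ) : ℂ) ^ (μ z.1 - 1) * Φ (z.1, z.2, t))
      {z | n + 1 < (μ z.1).re} := by
  have hμ' : ContDiff ℝ ∞ fun z : Q × E => μ z.1 := (hμ.restrict_scalars ℝ).comp contDiff_fst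
  have hU : IsOpen {z : Q × E | (n : ℝ) + 1 < (μ z.1).re} :=
    isOpen_lt continuous_const (Complex.continuous_re.comp hμ'.continuous)
  have h1 := contDiffOn_integral_weight (μ := volume) hU hk (D := fderiv ℝ fun z : Q × E => μ z.1)
    (hμ'.fderiv_right (by simp)) (w := fun j z t => logWeight j (μ z.1) t) (N := n) ?_ ?_ n 0
    (by simp) ℂ (fun z t => Φ (z.1, z.2, t))
    (h.1.comp (f := fun z : (Q × E) × ℝ => (z.1.1, z.1.2, z.2)) (by fun_prop))
    (fun q v hv => h0 _ _ v hv)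
  · simpa [logWeight] using h1
  · intro j hj z hz
    refine ContinuousAt.continuousWithinAt ?_
    have h2 : (j : ℝ) + 1 < (μ z.1.1).re :=
      lt_of_le_of_lt (by simpa using (by exact_mod_cast hj : (j : ℝ) ≤ n)) hz.1
    exact ContinuousAt.comp (f := fun z : (Q × E) × ℝ => (μ z.1.1, z.2)) (x := z)
      (continuousAt_logWeight h2 z.2)
      ((hμ.continuous.comp (by fun_prop)).prodMk (by fun_prop)).continuousAt
  · intro j hj z hz t
    refine hasFDerivAt_logWeight (hμ'.differentiable (by simp)).differentiableAt.hasFDerivAt ?_ j t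
    exact lt_of_le_of_lt (by simp) hz

theorem HolSmooth.differentiableAt_integral_abs_cpow {Φ : Q × E × ℝ → ℂ} (h : HolSmooth Φ)
    {k : Set ℝ} (hk : IsCompact k) (h0 : ∀ q x, ∀ t ∉ k, Φ (q, x, t) = 0) {μ : Q → ℂ}
    (hμ : ContDiff ℂ ∞ μ) (x : E) (q : Q) (hq : 2 < (μ q).re) :
    DifferentiableAt ℂ (fun q => ∫ t : ℝ, ((|t| : ℝ) : ℂ) ^ (μ q - 1) * Φ (q, x, t)) q := by
  have hμ' : ContDiff ℝ ∞ μ := hμ.restrict_scalars ℝ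
  have hU : IsOpen {z : Q | 2 < (μ z).re} :=
    isOpen_lt continuous_const (Complex.continuous_re.comp hμ'.continuous)
  let H : Q → ℝ → ℂ := fun q t => Φ (q, x, t)
  have hH : ContDiff ℝ ∞ (Function.uncurry H) :=
    h.1.comp (f := fun z : Q × ℝ => (z.1, x, z.2)) (by fun_prop)
  let H' : Q → ℝ → Q →L[ℝ] ℂ := fun q t =>
    (fderiv ℝ (Function.uncurry H) (q, t)).comp (ContinuousLinearMap.inl ℝ Q ℝ)
  have hd : ∀ z v, HasFDerivAt (fun z => H z v) (H' z v) z :=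
    fun z v => ((hH.differentiable (by simp)).differentiableAt.hasFDerivAt).comp z
      (hasFDerivAt_prodMk_left z v)
  have hc : Continuous (Function.uncurry H') := by
    have : Continuous (fderiv ℝ (Function.uncurry H)) := hH.continuous_fderiv (by simp)
    exact (this.clm_comp continuous_const)
  have hw : ∀ j ≤ 1, ContinuousOn (Function.uncurry fun q t => logWeight j (μ q) t)
      ({z : Q | 2 < (μ z).re} ×ˢ univ) := by
    intro j hj z hz
    refine ContinuousAt.continuousWithinAt ?_
    have h2 : (j : ℝ) + 1 < (μ z.1).re := by
      have h3 : (j : ℝ) ≤ 1 := by exact_mod_cast hj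
      have h4 : 2 < (μ z.1).re := hz.1
      linarith
    exact ContinuousAt.comp (f := fun z : Q × ℝ => (μ z.1, z.2)) (x := z)
      (continuousAt_logWeight h2 z.2)
      ((hμ.continuous.comp (by fun_prop)).prodMk (by fun_prop)).continuousAt
  have hwd : ∀ q ∈ {z : Q | 2 < (μ z).re}, ∀ t, HasFDerivAt (fun q => logWeight 0 (μ q) t)
      (logWeight 1 (μ q) t • fderiv ℝ μ q) q := by
    intro q hq t
    refine hasFDerivAt_logWeight (hμ'.differentiable (by simp)).differentiableAt.hasFDerivAt ?_ 0 t
    exact lt_trans (by norm_num) hq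
  let G' : Q → ℝ → Q →L[ℝ] ℂ := fun q t =>
    logWeight 0 (μ q) t • H' q t + H q t • (logWeight 1 (μ q) t • fderiv ℝ μ q)
  have hG' : ContinuousOn (Function.uncurry G') ({z : Q | 2 < (μ z).re} ×ˢ univ) := by
    refine ((hw 0 (by simp)).smul hc.continuousOn).add
      (hH.continuous.continuousOn.smul ((hw 1 le_rfl).smul ?_))
    exact ((hμ'.continuous_fderiv (by simp)).comp continuous_fst).continuousOn
  have hGd : ∀ q ∈ {z : Q | 2 < (μ z).re}, ∀ t,
      HasFDerivAt (fun q => logWeight 0 (μ q) t * H q t) (G' q t) q :=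
    fun q hq t => (hwd q hq t).mul (hd q t)
  have h1 := hasFDerivAt_integral_of_compact_support (μ := volume) hU hk
    (H := fun q t => logWeight 0 (μ q) t * H q t) (H' := G')
    ((hw 0 (by simp)).mul hH.continuous.continuousOn) hG'
    (fun z _ v hv => by simp [H, h0 _ _ v hv]) hGd hq
  have h0' : ∀ v ∉ k, G' q v = 0 := by
    intro v hv
    exact (hGd q hq v).unique ((hasFDerivAt_const (0 : ℂ) q).congr_of_eventuallyEq
      (Eventually.of_forall fun z => by simp [H, h0 _ _ v hv]))
  have hint : Integrable (G' q) :=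
    continuous_integrable_of_support hk
      (hG'.comp_continuous (f := fun v => (q, v)) (by fun_prop) fun v => ⟨hq, mem_univ _⟩) h0'
  have h2 : (fun q => ∫ t : ℝ, ((|t| : ℝ) : ℂ) ^ (μ q - 1) * Φ (q, x, t)) =
      fun q => ∫ t, logWeight 0 (μ q) t * H q t := by simp [logWeight, H]
  rw [h2]
  refine differentiableAt_complex_of_real h1.differentiableAt fun v => ?_
  rw [h1.fderiv, ContinuousLinearMap.integral_apply hint, ContinuousLinearMap.integral_apply hint,
    ← integral_const_mul]
  congr 1
  funext t
  rw [← (hGd q hq t).fderiv]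
  refine fderiv_real_I_smul ?_ v
  refine DifferentiableAt.mul ?_ (h.2 (x, t) q)
  refine differentiableAt_complex_of_real (hwd q hq t).differentiableAt fun v => ?_
  rw [(hwd q hq t).fderiv]
  simp only [smul_apply, smul_eq_mul]
  rw [fderiv_real_I_smul (hμ.differentiable (by simp)).differentiableAt]
  ring

end OneDim

section HadamardQuotient

/-- The smooth extension of `t ↦ (φ(t) - φ(-t)) / t`. -/
def oddQuotient (φ : ℝ → ℂ) (t : ℝ) : ℂ := ∫ s in (-1 : ℝ)..1, deriv φ (t * s)

theorem mul_oddQuotient {φ : ℝ → ℂ} (hφ : ContDiff ℝ ∞ φ) (t : ℝ) :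
    (t : ℂ) * oddQuotient φ t = φ t - φ (-t) := by
  have h1 : ∀ s ∈ uIcc (-1 : ℝ) 1, HasDerivAt (fun s => φ (t * s)) ((t : ℂ) * deriv φ (t * s)) s := by
    intro s _
    have h2 : HasDerivAt φ (deriv φ (t * s)) (t * s) :=
      ((hφ.differentiable (by simp)).differentiableAt).hasDerivAt
    have h3 := h2.scomp s ((hasDerivAt_id s).const_mul t)
    exact h3.congr_deriv (by simp)
  have h4 : Continuous fun s => (t : ℂ) * deriv φ (t * s) := by
    have : Continuous (deriv φ) := hφ.continuous_deriv (by simp)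
    fun_prop
  have h5 := intervalIntegral.integral_eq_sub_of_hasDerivAt h1 (h4.intervalIntegrable _ _)
  rw [intervalIntegral.integral_const_mul] at h5
  simpa [oddQuotient] using h5

theorem oddQuotient_eq_zero {φ : ℝ → ℂ} (hφ : ContDiff ℝ ∞ φ) {R : ℝ} (hR : 0 ≤ R)
    (h0 : ∀ t ∉ Icc (-R) R, φ t = 0) : ∀ t ∉ Icc (-R) R, oddQuotient φ t = 0 := by
  intro t ht
  have h1 : -t ∉ Icc (-R) R := fun h => ht ⟨by linarith [h.2], by linarith [h.1]⟩
  have h2 := mul_oddQuotient hφ t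
  rw [h0 t ht, h0 _ h1, sub_zero] at h2
  have h3 : (t : ℂ) ≠ 0 := by
    rw [Ne, Complex.ofReal_eq_zero]
    rintro rfl
    exact ht ⟨by linarith, hR⟩
  exact (mul_eq_zero.1 h2).resolve_left h3

theorem deriv_eq_zero_of_support {φ : ℝ → ℂ} {R : ℝ}
    (h0 : ∀ t ∉ Icc (-R) R, φ t = 0) : ∀ t ∉ Icc (-R) R, deriv φ t = 0 := by
  intro t ht
  have h1 : φ =ᶠ[𝓝 t] fun _ => 0 := by
    filter_upwards [isClosed_Icc.isOpen_compl.mem_nhds ht] with s hs using h0 s hs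
  rw [h1.deriv_eq]
  simp

variable {Q E : Type} [NormedAddCommGroup Q] [NormedSpace ℂ Q]
  [NormedAddCommGroup E] [NormedSpace ℝ E]

theorem HolSmooth.deriv_last {Φ : Q × E × ℝ → ℂ} (h : HolSmooth Φ) :
    HolSmooth fun z : Q × E × ℝ => deriv (fun t => Φ (z.1, z.2.1, t)) z.2.2 := by
  have h1 : (fun z : Q × E × ℝ => deriv (fun t => Φ (z.1, z.2.1, t)) z.2.2) =
      fun z => fderiv ℝ Φ z (0, (0, 1)) := by
    funext z
    obtain ⟨q, x, t⟩ := z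
    have h2 : HasFDerivAt Φ (fderiv ℝ Φ (q, x, t)) (q, x, t) :=
      (h.1.differentiable (by simp)).differentiableAt.hasFDerivAt
    have h3 : HasDerivAt (fun t : ℝ => (q, x, t)) ((0 : Q), (0 : E), (1 : ℝ)) t :=
      (hasDerivAt_const t q).prodMk ((hasDerivAt_const t x).prodMk (hasDerivAt_id t))
    exact (h2.comp_hasDerivAt t h3).deriv
  rw [h1]
  exact h.deriv_snd (0, 1)

theorem HolSmooth.oddQuotient {Φ : Q × E × ℝ → ℂ} (h : HolSmooth Φ) :
    HolSmooth fun z : Q × E × ℝ =>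
      GLBranching.oddQuotient (fun t => Φ (z.1, z.2.1, t)) z.2.2 := by
  obtain ⟨b, hb1, hb2, hb3⟩ : ∃ b : ℝ → ℝ, ContDiff ℝ ∞ b ∧ (∀ s ∈ Icc (-1 : ℝ) 1, b s = 1) ∧
      ∀ s ∉ Icc (-2 : ℝ) 2, b s = 0 := by
    let f : ContDiffBump (0 : ℝ) := ⟨1, 2, by norm_num, by norm_num⟩
    refine ⟨f, f.contDiff, fun s hs => ?_, fun s hs => ?_⟩
    · exact f.one_of_mem_closedBall (by simpa [Real.closedBall_eq_Icc] using hs)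
    · refine f.zero_of_le_dist ?_
      rw [Real.dist_eq, sub_zero]
      by_contra hcon
      exact hs (abs_le.1 (le_of_lt (not_le.1 hcon)))
  have h1 : HolSmooth fun z : Q × (E × ℝ) × ℝ =>
      (b z.2.2 : ℂ) * deriv (fun t => Φ (z.1, z.2.1.1, t)) (z.2.1.2 * z.2.2) := by
    refine HolSmooth.mul ?_ ?_
    · exact HolSmooth.of_right (Q := Q) (E := (E × ℝ) × ℝ) (f := fun y => (b y.2 : ℂ))
        (Complex.ofRealCLM.contDiff.comp (hb1.comp contDiff_snd))
    · exact h.deriv_last.comp_right (θ := fun y : (E × ℝ) × ℝ => (y.1.1, y.1.2 * y.2))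
        (by fun_prop)
  have h2 := h1.integral (μ := volume.restrict (Ioc (-1 : ℝ) 1)) isCompact_Icc (k := Icc (-2) 2)
    (fun q x v hv => by simp [hb3 v hv])
  convert h2 using 2 with z
  rw [GLBranching.oddQuotient, intervalIntegral.integral_of_le (by norm_num)]
  refine setIntegral_congr_fun measurableSet_Ioc fun s hs => ?_
  simp [hb2 s (Ioc_subset_Icc_self hs)]

theorem contDiff_oddQuotient {φ : ℝ → ℂ} (hφ : ContDiff ℝ ∞ φ) :
    ContDiff ℝ ∞ (oddQuotient φ) := by
  have h1 : HolSmooth fun z : ℂ × ℝ × ℝ => φ z.2.2 :=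
    HolSmooth.of_right (f := fun y : ℝ × ℝ => φ y.2) (hφ.comp contDiff_snd)
  exact h1.oddQuotient.1.comp (f := fun t : ℝ => ((0 : ℂ), (0 : ℝ), t)) (by fun_prop)

/-- The smooth extension of `t ↦ (φ'(t) - φ'(-t)) / t`. -/
def evenStep (φ : ℝ → ℂ) : ℝ → ℂ := oddQuotient (deriv φ)

theorem contDiff_evenStep {φ : ℝ → ℂ} (hφ : ContDiff ℝ ∞ φ) : ContDiff ℝ ∞ (evenStep φ) :=
  contDiff_oddQuotient ((contDiff_infty_iff_deriv.1 hφ).2)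

theorem evenStep_eq_zero {φ : ℝ → ℂ} (hφ : ContDiff ℝ ∞ φ) {R : ℝ} (hR : 0 ≤ R)
    (h0 : ∀ t ∉ Icc (-R) R, φ t = 0) : ∀ t ∉ Icc (-R) R, evenStep φ t = 0 :=
  oddQuotient_eq_zero ((contDiff_infty_iff_deriv.1 hφ).2) hR (deriv_eq_zero_of_support h0)

theorem iterate_evenStep {φ : ℝ → ℂ} (hφ : ContDiff ℝ ∞ φ) {R : ℝ} (hR : 0 ≤ R)
    (h0 : ∀ t ∉ Icc (-R) R, φ t = 0) (n : ℕ) :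
    ContDiff ℝ ∞ (evenStep^[n] φ) ∧ ∀ t ∉ Icc (-R) R, (evenStep^[n] φ) t = 0 := by
  induction n with
  | zero => exact ⟨hφ, h0⟩
  | succ n ih =>
    rw [Function.iterate_succ_apply']
    exact ⟨contDiff_evenStep ih.1, evenStep_eq_zero ih.1 hR ih.2⟩

theorem HolSmooth.iterate_evenStep {Φ : Q × E × ℝ → ℂ} (h : HolSmooth Φ) (n : ℕ) :
    HolSmooth fun z : Q × E × ℝ => (evenStep^[n] fun t => Φ (z.1, z.2.1, t)) z.2.2 := by
  induction n with
  | zero => exact h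
  | succ n ih =>
    simp only [Function.iterate_succ_apply']
    exact ih.deriv_last.oddQuotient

end HadamardQuotient

section HalfLine

theorem integral_eq_integral_Ioi_add_neg {f : ℝ → ℂ} (hf : Integrable f) :
    ∫ t, f t = ∫ t in Ioi (0 : ℝ), (f t + f (-t)) := by
  have hn : Integrable fun t => f (-t) := hf.comp_neg
  rw [integral_add hf.integrableOn hn.integrableOn, integral_comp_neg_Ioi, neg_zero,
    ← integral_add_compl measurableSet_Ioi hf, compl_Ioi]

theorem integrableOn_Ioi_rpow_bounded {r R : ℝ} (hr : -1 < r) :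
    Integrable ((Icc (-R) R).indicator fun t : ℝ => |t| ^ r) := by
  have h1 : IntegrableOn ((Icc (-R) R).indicator fun t : ℝ => |t| ^ r) (Ioi 0) := by
    rcases le_or_gt R 0 with hR | hR
    · refine IntegrableOn.congr_fun integrableOn_zero (fun t ht => ?_) measurableSet_Ioi
      rw [indicator_of_notMem]
      exact fun h => absurd h.2 (not_le.2 (lt_of_le_of_lt hR ht))
    · have h2 : IntegrableOn (fun t : ℝ => t ^ r) (Ioc 0 R) :=
        (intervalIntegrable_iff_integrableOn_Ioc_of_le hR.le).1
          (intervalIntegral.intervalIntegrable_rpow' hr)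
      rw [← integrable_indicator_iff measurableSet_Ioc] at h2
      refine (h2.integrableOn (s := Ioi 0)).congr_fun (fun t (ht : 0 < t) => ?_) measurableSet_Ioi
      by_cases h : t ≤ R
      · rw [indicator_of_mem (show t ∈ Ioc 0 R from ⟨ht, h⟩),
          indicator_of_mem (show t ∈ Icc (-R) R from ⟨by linarith, h⟩), abs_of_pos ht]
      · rw [indicator_of_notMem (fun h' => h h'.2), indicator_of_notMem (fun h' => h h'.2)]
  have h3 : (fun t => (Icc (-R) R).indicator (fun t : ℝ => |t| ^ r) (-t)) =
      (Icc (-R) R).indicator fun t : ℝ => |t| ^ r := by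
    funext t
    by_cases h : t ∈ Icc (-R) R
    · rw [indicator_of_mem h, indicator_of_mem (show -t ∈ Icc (-R) R from
        ⟨by linarith [h.2], by linarith [h.1]⟩), abs_neg]
    · rw [indicator_of_notMem h, indicator_of_notMem]
      exact fun h' => h ⟨by linarith [h'.2], by linarith [h'.1]⟩
  have h4 : IntegrableOn ((Icc (-R) R).indicator fun t : ℝ => |t| ^ r) (Iio 0) := by
    rw [← h3]
    exact IntegrableOn.comp_neg_Iio (c := 0) (by rwa [neg_zero])
  rw [← integrableOn_univ, ← Iio_union_Ici (a := (0 : ℝ)), integrableOn_union,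
    integrableOn_Ici_iff_integrableOn_Ioi]
  exact ⟨h4, h1⟩

theorem integrable_sgnPow_mul (ε : ZMod 2) {μ : ℂ} (hμ : -1 < μ.re) {φ : ℝ → ℂ}
    (hφ : Continuous φ) (hc : HasCompactSupport φ) :
    Integrable fun t => sgnPow ε μ t * φ t := by
  obtain ⟨C, hC⟩ := hφ.bounded_above_of_compact_support hc
  obtain ⟨R, hR⟩ := hc.isBounded.subset_closedBall 0
  have h0 : ∀ t ∉ Icc (-R) R, φ t = 0 := by
    intro t ht
    refine image_eq_zero_of_notMem_tsupport fun h => ht ?_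
    simpa [Real.closedBall_eq_Icc] using hR h
  refine ((integrableOn_Ioi_rpow_bounded (R := R) hμ).const_mul C).mono'
    (((measurable_sgnPow ε μ).mul hφ.measurable).aestronglyMeasurable) ?_
  have hae : ∀ᵐ t : ℝ, t ≠ 0 := by simp [ae_iff]
  filter_upwards [hae] with t ht
  by_cases h : t ∈ Icc (-R) R
  · rw [indicator_of_mem h, norm_mul, norm_sgnPow _ _ ht, mul_comm]
    exact mul_le_mul_of_nonneg_right (hC t) (by positivity)
  · simp [h0 t h, indicator_of_notMem h]

theorem integrable_abs_cpow_mul {μ : ℂ} (hμ : -1 < μ.re) {φ : ℝ → ℂ}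
    (hφ : Continuous φ) (hc : HasCompactSupport φ) :
    Integrable fun t : ℝ => ((|t| : ℝ) : ℂ) ^ μ * φ t := by
  simpa only [sgnPow_zero_left] using integrable_sgnPow_mul 0 hμ hφ hc

theorem integral_sign_abs_cpow {μ : ℂ} (hμ : 0 < μ.re) {φ : ℝ → ℂ}
    (hφ : ContDiff ℝ ∞ φ) (hc : HasCompactSupport φ) :
    ∫ t, sgnPow 1 (μ - 1) t * φ t =
      2⁻¹ * ∫ t : ℝ, ((|t| : ℝ) : ℂ) ^ μ * oddQuotient φ t := by
  obtain ⟨R, hR0, hR⟩ := hc.isBounded.subset_closedBall_lt 0 0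
  have h0 : ∀ t ∉ Icc (-R) R, φ t = 0 := by
    intro t ht
    refine image_eq_zero_of_notMem_tsupport fun h => ht ?_
    simpa [Real.closedBall_eq_Icc] using hR h
  have h0' := oddQuotient_eq_zero hφ hR0.le h0
  have hc' : HasCompactSupport (oddQuotient φ) := HasCompactSupport.intro isCompact_Icc h0'
  rw [integral_eq_integral_Ioi_add_neg (integrable_sgnPow_mul 1 (by simpa using hμ)
    hφ.continuous hc), integral_eq_integral_Ioi_add_neg (integrable_abs_cpow_mul
    (by linarith) (contDiff_oddQuotient hφ).continuous hc'), ← integral_const_mul]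
  refine setIntegral_congr_fun measurableSet_Ioi fun t (ht : 0 < t) => ?_
  have h1 := mul_oddQuotient hφ t
  have h2 := mul_oddQuotient hφ (-t)
  have ht' : (t : ℂ) ≠ 0 := by exact_mod_cast ht.ne'
  have h3 : oddQuotient φ (-t) = oddQuotient φ t := by
    rw [neg_neg, Complex.ofReal_neg] at h2
    have : (t : ℂ) * oddQuotient φ (-t) = t * oddQuotient φ t := by
      rw [h1]; linear_combination -h2
    exact mul_left_cancel₀ ht' this
  have h4 : (t : ℂ) ^ μ = (t : ℂ) ^ (μ - 1) * t := by
    rw [Complex.cpow_sub _ _ ht', Complex.cpow_one]; field_simp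
  simp only [sgnPow_one_left, abs_neg, abs_of_pos ht, Real.sign_of_pos ht,
    Real.sign_of_neg (neg_neg_of_pos ht), h3, h4]
  push_cast
  linear_combination (-(t : ℂ) ^ (μ - 1)) * h1

theorem integral_abs_cpow_evenStep {μ : ℂ} (hμ : 0 < μ.re) {φ : ℝ → ℂ}
    (hφ : ContDiff ℝ ∞ φ) (hc : HasCompactSupport φ) :
    ∫ t : ℝ, ((|t| : ℝ) : ℂ) ^ (μ - 1) * φ t =
      -(1 / (2 * μ)) * ∫ t : ℝ, ((|t| : ℝ) : ℂ) ^ (μ + 2 - 1) * evenStep φ t := by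
  obtain ⟨R, hR0, hR⟩ := hc.isBounded.subset_closedBall_lt 0 0
  have h0 : ∀ t ∉ Icc (-R) R, φ t = 0 := by
    intro t ht
    refine image_eq_zero_of_notMem_tsupport fun h => ht ?_
    simpa [Real.closedBall_eq_Icc] using hR h
  have hφ' : ContDiff ℝ ∞ (deriv φ) := (contDiff_infty_iff_deriv.1 hφ).2
  have hc' : HasCompactSupport (evenStep φ) :=
    HasCompactSupport.intro isCompact_Icc (evenStep_eq_zero hφ hR0.le h0)
  have hcd : HasCompactSupport (deriv φ) :=
    HasCompactSupport.intro isCompact_Icc (deriv_eq_zero_of_support h0)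
  have hμ0 : μ ≠ 0 := by rintro rfl; simp at hμ
  have hi1 := integrable_abs_cpow_mul (μ := μ - 1) (by simpa using hμ) hφ.continuous hc
  have hi2 := integrable_abs_cpow_mul (μ := μ + 2 - 1) (by simp; linarith)
    (contDiff_evenStep hφ).continuous hc'
  have hi3 := integrable_abs_cpow_mul (μ := μ) (by linarith) hφ'.continuous hcd
  rw [integral_eq_integral_Ioi_add_neg hi1, integral_eq_integral_Ioi_add_neg hi2]
  let u : ℝ → ℂ := fun t => (t : ℂ) ^ μ / μ
  let v : ℝ → ℂ := fun t => φ t + φ (-t)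
  let u' : ℝ → ℂ := fun t => (t : ℂ) ^ (μ - 1)
  let v' : ℝ → ℂ := fun t => deriv φ t - deriv φ (-t)
  have hu : ∀ t ∈ Ioi (0 : ℝ), HasDerivAt u (u' t) t := by
    intro t ht
    have h1 := (hasDerivAt_ofReal_cpow_const (x := t) (r := μ) (ne_of_gt ht) hμ0).div_const μ
    exact h1.congr_deriv (by simp only [u']; field_simp)
  have hv : ∀ t ∈ Ioi (0 : ℝ), HasDerivAt v (v' t) t := by
    intro t _
    have hd : ∀ s, HasDerivAt φ (deriv φ s) s := fun s =>
      ((hφ.differentiable (by simp)).differentiableAt).hasDerivAt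
    have h2 := (hd (-t)).scomp t (hasDerivAt_neg t)
    exact ((hd t).add h2).congr_deriv (by simp [v', sub_eq_add_neg])
  have e1 : ∀ t ∈ Ioi (0 : ℝ), ((|t| : ℝ) : ℂ) ^ (μ - 1) * φ t +
      ((|-t| : ℝ) : ℂ) ^ (μ - 1) * φ (-t) = (u' * v) t := by
    intro t (ht : 0 < t)
    simp [u', v, abs_of_pos ht, mul_add]
  have e2 : ∀ t ∈ Ioi (0 : ℝ), ((|t| : ℝ) : ℂ) ^ (μ + 2 - 1) * evenStep φ t +
      ((|-t| : ℝ) : ℂ) ^ (μ + 2 - 1) * evenStep φ (-t) = (2 * μ) * (u * v') t := by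
    intro t (ht : 0 < t)
    have h1 := mul_oddQuotient hφ' t
    have h2 := mul_oddQuotient hφ' (-t)
    have ht' : (t : ℂ) ≠ 0 := by exact_mod_cast ht.ne'
    have h3 : oddQuotient (deriv φ) (-t) = oddQuotient (deriv φ) t := by
      rw [neg_neg, Complex.ofReal_neg] at h2
      have : (t : ℂ) * oddQuotient (deriv φ) (-t) = t * oddQuotient (deriv φ) t := by
        rw [h1]; linear_combination -h2
      exact mul_left_cancel₀ ht' this
    have h4 : (t : ℂ) ^ (μ + 2 - 1) = (t : ℂ) ^ μ * t := by
      rw [show μ + 2 - 1 = μ + 1 by ring, Complex.cpow_add _ _ ht', Complex.cpow_one]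
    simp only [evenStep, abs_neg, abs_of_pos ht, h3, h4, Pi.mul_apply, u, v']
    field_simp
    linear_combination (2 * (t : ℂ) ^ μ) * h1
  rw [setIntegral_congr_fun measurableSet_Ioi e1, setIntegral_congr_fun measurableSet_Ioi e2,
    integral_const_mul]
  have hI1 : IntegrableOn (u' * v) (Ioi 0) :=
    ((hi1.add hi1.comp_neg).integrableOn (s := Ioi 0)).congr_fun e1 measurableSet_Ioi
  have hI2 : IntegrableOn (u * v') (Ioi 0) := by
    have := ((hi2.add hi2.comp_neg).integrableOn (s := Ioi 0)).congr_fun e2 measurableSet_Ioi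
    have h2 : IntegrableOn (fun t => (2 * μ)⁻¹ * (2 * μ * (u * v') t)) (Ioi 0) :=
      this.const_mul (2 * μ)⁻¹
    refine h2.congr_fun (fun t _ => ?_) measurableSet_Ioi
    field_simp
  have hz : Tendsto (u * v) (𝓝[>] 0) (𝓝 0) := by
    have h1 : ContinuousAt (u * v) 0 := by
      refine ContinuousAt.mul (ContinuousAt.div_const ?_ _) ?_
      · exact Complex.continuousAt_ofReal_cpow_const 0 μ (Or.inl hμ)
      · exact (hφ.continuous.add (hφ.continuous.comp continuous_neg)).continuousAt
    have h2 : (u * v) 0 = 0 := by simp [u, Complex.zero_cpow hμ0]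
    rw [← h2]
    exact h1.tendsto.mono_left nhdsWithin_le_nhds
  have hinf : Tendsto (u * v) atTop (𝓝 0) := by
    refine tendsto_const_nhds.congr' ?_
    filter_upwards [eventually_gt_atTop R] with t ht
    have h1 : φ t = 0 := h0 t fun h => absurd h.2 (not_le.2 ht)
    have h2 : φ (-t) = 0 := h0 _ fun h => by linarith [h.1]
    simp [v, h1, h2]
  have h := integral_Ioi_mul_deriv_eq_deriv_mul hu hv hI2 hI1 hz hinf
  have h' : ∫ t in Ioi (0 : ℝ), (u * v') t = -∫ t in Ioi (0 : ℝ), (u' * v) t := by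
    simpa using h
  rw [h']
  field_simp

end HalfLine

section Regularization

variable {A V V₁ V₂ : Type} [NormedAddCommGroup A] [NormedSpace ℂ A]
  [NormedAddCommGroup V] [NormedSpace ℝ V] [MeasureSpace V] [BorelSpace V]
  [SecondCountableTopology V] [IsFiniteMeasureOnCompacts (volume : Measure V)]
  [NormedAddCommGroup V₁] [NormedSpace ℝ V₁] [MeasureSpace V₁] [BorelSpace V₁]
  [SecondCountableTopology V₁] [IsFiniteMeasureOnCompacts (volume : Measure V₁)]
  [NormedAddCommGroup V₂] [NormedSpace ℝ V₂] [MeasureSpace V₂] [BorelSpace V₂]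
  [SecondCountableTopology V₂] [IsFiniteMeasureOnCompacts (volume : Measure V₂)]

/-- `ζ a` is, for `a ∈ D`, integration against the locally integrable kernel `K a`, multiplied by
`N a`, and it extends holomorphically to all parameters `a`. -/
structure IsRegularization (K : A → V → ℂ) (N : A → ℂ) (D : Set A) (ζ : A → (V → ℂ) → ℂ) :
    Prop where
  measurable : ∀ a, Measurable (K a)
  map_zero : ∀ a, ζ a (fun _ => 0) = 0
  integrableOn : ∀ a ∈ D, ∀ k, IsCompact k → IntegrableOn (K a) k
  eq_integral : ∀ a ∈ D, ∀ φ, ContDiff ℝ ∞ φ → HasCompactSupport φ →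
    ζ a φ = N a * ∫ v, K a v * φ v
  holSmooth : ∀ {Q E : Type} [NormedAddCommGroup Q] [NormedSpace ℂ Q] [NormedAddCommGroup E]
    [NormedSpace ℝ E] (a : Q → A), ContDiff ℂ ∞ a → ∀ (Φ : Q × E × V → ℂ), HolSmooth Φ →
    ∀ k, IsCompact k → (∀ q x, ∀ v ∉ k, Φ (q, x, v) = 0) →
    HolSmooth fun z : Q × E => ζ (a z.1) fun v => Φ (z.1, z.2, v)

/-- The family of kernels `K`, normalized by `N`, extends holomorphically from `D`. -/
def Regularizable (K : A → V → ℂ) (N : A → ℂ) (D : Set A) : Prop :=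
  ∃ ζ, IsRegularization K N D ζ

theorem integrable_mul_of_integrableOn {K φ : V → ℂ} {k : Set V} (hk : IsCompact k)
    (hK : IntegrableOn K k) (hφ : Measurable φ) {C : ℝ} (hC : ∀ v, ‖φ v‖ ≤ C)
    (h0 : ∀ v ∉ k, φ v = 0) : Integrable fun v => K v * φ v := by
  have h1 : Integrable (k.indicator K) := (integrable_indicator_iff hk.measurableSet).2 hK
  have h2 := h1.mul_bdd (c := C) hφ.aestronglyMeasurable (Eventually.of_forall hC)
  refine h2.congr (Eventually.of_forall fun v => ?_)
  by_cases hv : v ∈ k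
  · simp [hv]
  · simp [hv, h0 v hv]

theorem IsRegularization.integrable {K : A → V → ℂ} {N : A → ℂ} {D : Set A}
    {ζ : A → (V → ℂ) → ℂ} (h : IsRegularization K N D ζ) {a : A} (ha : a ∈ D) {φ : V → ℂ}
    (hφ : Continuous φ) (hc : HasCompactSupport φ) : Integrable fun v => K a v * φ v := by
  obtain ⟨C, hC⟩ := hφ.bounded_above_of_compact_support hc
  exact integrable_mul_of_integrableOn hc (h.integrableOn a ha _ hc) hφ.measurable hC
    fun v hv => image_eq_zero_of_notMem_tsupport hv

theorem IsRegularization.contDiff {K : A → V → ℂ} {N : A → ℂ} {D : Set A}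
    {ζ : A → (V → ℂ) → ℂ} (h : IsRegularization K N D ζ) (a : A) {E : Type}
    [NormedAddCommGroup E] [NormedSpace ℝ E] {Φ : E × V → ℂ} (hΦ : ContDiff ℝ ∞ Φ) {k : Set V}
    (hk : IsCompact k) (h0 : ∀ x, ∀ v ∉ k, Φ (x, v) = 0) :
    ContDiff ℝ ∞ fun x => ζ a fun v => Φ (x, v) := by
  have h1 := h.holSmooth (Q := ℂ) (E := E) (fun _ => a) contDiff_const
    (fun z => Φ (z.2.1, z.2.2)) (HolSmooth.of_right (f := fun y : E × V => Φ (y.1, y.2)) hΦ) k hk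
    (fun q x v hv => h0 x v hv)
  exact h1.1.comp (f := fun x : E => ((0 : ℂ), x)) (by fun_prop)

theorem Regularizable.comp {A' : Type} [NormedAddCommGroup A'] [NormedSpace ℂ A']
    {K : A → V → ℂ} {N : A → ℂ} {D : Set A} (h : Regularizable K N D) {f : A' → A}
    (hf : ContDiff ℂ ∞ f) : Regularizable (fun a => K (f a)) (fun a => N (f a)) (f ⁻¹' D) := by
  obtain ⟨ζ, h⟩ := h
  exact ⟨fun a => ζ (f a), fun a => h.1 _, fun a => h.2 _, fun a ha => h.3 _ ha,
    fun a ha => h.4 _ ha, fun a ha => h.5 (fun q => f (a q)) (hf.comp ha)⟩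

theorem Regularizable.mono {K : A → V → ℂ} {N : A → ℂ} {D D' : Set A} (h : Regularizable K N D)
    (hD : D' ⊆ D) : Regularizable K N D' := by
  obtain ⟨ζ, h⟩ := h
  exact ⟨ζ, h.1, h.2, fun a ha => h.3 _ (hD ha), fun a ha => h.4 _ (hD ha), h.5⟩

theorem Regularizable.mul_norm {K : A → V → ℂ} {N N' : A → ℂ} {D : Set A}
    (h : Regularizable K N D) (hN : ContDiff ℂ ∞ N') :
    Regularizable K (fun a => N' a * N a) D := by
  obtain ⟨ζ, h⟩ := h
  refine ⟨fun a φ => N' a * ζ a φ, h.1, fun a => by simp [h.2], h.3, fun a ha φ hφ hc => ?_,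
    fun a ha Φ hΦ k hk h0 => ?_⟩
  · rw [h.4 a ha φ hφ hc, mul_assoc]
  · exact (HolSmooth.of_left (f := fun q => N' (a q)) (hN.comp ha)).mul (h.5 a ha Φ hΦ k hk h0)

theorem Regularizable.of_const_mul {K : A → V → ℂ} {N : A → ℂ} {D : Set A} {c : ℂ} (hc : c ≠ 0)
    (h : Regularizable K (fun a => c * N a) D) : Regularizable K N D := by
  obtain ⟨ζ, h⟩ := h.mul_norm (N' := fun _ => c⁻¹) contDiff_const
  refine ⟨ζ, h.1, h.2, h.3, fun a ha φ hφ hφ' => ?_, h.5⟩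
  rw [h.4 a ha φ hφ hφ', inv_mul_cancel_left₀ hc]

theorem Regularizable.const_mul_kernel {K : A → V → ℂ} {N : A → ℂ} {D : Set A}
    (h : Regularizable K N D) (c : ℂ) : Regularizable (fun a v => c * K a v) N D := by
  obtain ⟨ζ, h⟩ := h
  refine ⟨fun a φ => c * ζ a φ, fun a => (h.1 a).const_mul c, fun a => by simp [h.2],
    fun a ha k hk => (h.3 a ha k hk).const_mul c, fun a ha φ hφ hc => ?_,
    fun a ha Φ hΦ k hk h0 => (h.5 a ha Φ hΦ k hk h0).const_mul c⟩
  rw [h.4 a ha φ hφ hc]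
  simp_rw [mul_assoc, integral_const_mul]
  ring

theorem Regularizable.congr {K K' : A → V → ℂ} {N N' : A → ℂ} {D : Set A}
    (h : Regularizable K N D) (hK' : ∀ a, Measurable (K' a)) (hKK : ∀ a ∈ D, K a =ᵐ[volume] K' a)
    (hN : ∀ a, N a = N' a) : Regularizable K' N' D := by
  obtain ⟨ζ, h⟩ := h
  refine ⟨ζ, hK', h.2, fun a ha k hk => ?_, fun a ha φ hφ hc => ?_, h.5⟩
  · exact (h.3 a ha k hk).congr (ae_restrict_of_ae (hKK a ha))
  · rw [h.4 a ha φ hφ hc, hN]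
    congr 1
    refine integral_congr_ae ?_
    filter_upwards [hKK a ha] with v hv
    rw [hv]

theorem Regularizable.sum {ι : Type} (s : Finset ι) {K : ι → A → V → ℂ} {N : A → ℂ} {D : Set A}
    (h : ∀ i ∈ s, Regularizable (K i) N D) :
    Regularizable (fun a v => ∑ i ∈ s, K i a v) N D := by
  classical
  choose! ζ h using h
  refine ⟨fun a φ => ∑ i ∈ s, ζ i a φ, fun a => Finset.measurable_sum _ fun i hi => (h i hi).1 a,
    fun a => Finset.sum_eq_zero fun i hi => (h i hi).2 a, fun a ha k hk => ?_,
    fun a ha φ hφ hc => ?_, fun a ha Φ hΦ k hk h0 => ?_⟩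
  · exact integrable_finsetSum _ fun i hi => (h i hi).3 a ha k hk
  · rw [Finset.sum_congr rfl fun i hi => (h i hi).4 a ha φ hφ hc, ← Finset.mul_sum,
      ← integral_finsetSum _ fun i hi => (h i hi).integrable ha hφ.continuous hc]
    simp_rw [Finset.sum_mul]
  · exact HolSmooth.sum s fun i hi => (h i hi).5 a ha Φ hΦ k hk h0

theorem regularizable_one : Regularizable (A := A) (V := V) (fun _ _ => 1) (fun _ => 1) univ := by
  refine ⟨fun _ φ => ∫ v, φ v, fun a => measurable_const, fun a => by simp, fun a _ k hk => ?_,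
    fun a _ φ _ _ => by simp, fun a ha Φ hΦ k hk h0 => hΦ.integral hk h0⟩
  exact integrableOn_const hk.measure_ne_top

theorem Regularizable.prod [SFinite (volume : Measure V₁)] [SFinite (volume : Measure V₂)]
    {K₁ : A → V₁ → ℂ} {K₂ : A → V₂ → ℂ} {N₁ N₂ : A → ℂ} {D : Set A}
    (h₁ : Regularizable K₁ N₁ D) (h₂ : Regularizable K₂ N₂ D) :
    Regularizable (fun a (v : V₁ × V₂) => K₁ a v.1 * K₂ a v.2) (fun a => N₁ a * N₂ a) D := by
  obtain ⟨ζ₁, h₁⟩ := h₁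
  obtain ⟨ζ₂, h₂⟩ := h₂
  have hI : ∀ a ∈ D, ∀ k : Set (V₁ × V₂), IsCompact k →
      IntegrableOn (fun v : V₁ × V₂ => K₁ a v.1 * K₂ a v.2) k := by
    intro a ha k hk
    have h1 := (h₁.3 a ha _ (hk.image continuous_fst)).mul_prod
      (h₂.3 a ha _ (hk.image continuous_snd))
    rw [Measure.prod_restrict] at h1
    exact IntegrableOn.mono_set h1 fun v hv => ⟨mem_image_of_mem _ hv, mem_image_of_mem _ hv⟩
  refine ⟨fun a φ => ζ₁ a fun v₁ => ζ₂ a fun v₂ => φ (v₁, v₂), ?_, ?_, hI, ?_, ?_⟩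
  · exact fun a => ((h₁.1 a).comp measurable_fst).mul ((h₂.1 a).comp measurable_snd)
  · intro a
    simp only [h₂.2 a, h₁.2 a]
  · intro a ha φ hφ hc
    have hk1 := hc.image continuous_fst
    have hk2 := hc.image continuous_snd
    have z1 : ∀ v₁ v₂, v₁ ∉ Prod.fst '' tsupport φ → φ (v₁, v₂) = 0 := fun v₁ v₂ h =>
      image_eq_zero_of_notMem_tsupport fun h' => h ⟨_, h', rfl⟩
    have z2 : ∀ v₁ v₂, v₂ ∉ Prod.snd '' tsupport φ → φ (v₁, v₂) = 0 := fun v₁ v₂ h =>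
      image_eq_zero_of_notMem_tsupport fun h' => h ⟨_, h', rfl⟩
    have hsm : ContDiff ℝ ∞ fun v₁ => ζ₂ a fun v₂ => φ (v₁, v₂) :=
      h₂.contDiff a hφ hk2 fun v₁ v₂ h => z2 v₁ v₂ h
    have hcs : HasCompactSupport fun v₁ => ζ₂ a fun v₂ => φ (v₁, v₂) :=
      HasCompactSupport.intro hk1 fun v₁ h => by
        have : (fun v₂ => φ (v₁, v₂)) = fun _ => 0 := funext fun v₂ => z1 v₁ v₂ h
        rw [this, h₂.2]
    rw [h₁.4 a ha _ hsm hcs]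
    have e : ∀ v₁, ζ₂ a (fun v₂ => φ (v₁, v₂)) = N₂ a * ∫ v₂, K₂ a v₂ * φ (v₁, v₂) := by
      intro v₁
      refine h₂.4 a ha _ (hφ.comp (contDiff_prodMk_right v₁)) ?_
      exact HasCompactSupport.intro hk2 fun v₂ h => z2 v₁ v₂ h
    simp_rw [e]
    obtain ⟨C, hC⟩ := hφ.continuous.bounded_above_of_compact_support hc
    have hint := integrable_mul_of_integrableOn hc (hI a ha _ hc) hφ.continuous.measurable hC
      fun v hv => image_eq_zero_of_notMem_tsupport hv
    rw [Measure.volume_eq_prod] at hint ⊢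
    rw [integral_prod _ hint]
    simp_rw [mul_left_comm (K₁ a _) (N₂ a), mul_assoc, integral_const_mul]
  · intro Q E _ _ _ _ a ha Φ hΦ k hk h0
    refine h₁.5 a ha (fun z => ζ₂ (a z.1) fun v₂ => Φ (z.1, z.2.1, z.2.2, v₂)) ?_ _
      (hk.image continuous_fst) ?_
    · refine h₂.5 (E := E × V₁) a ha (fun z => Φ (z.1, z.2.1.1, z.2.1.2, z.2.2)) ?_ _
        (hk.image continuous_snd) ?_
      · exact hΦ.comp_right (θ := fun y : (E × V₁) × V₂ => (y.1.1, y.1.2, y.2)) (by fun_prop)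
      · exact fun q x v₂ h => h0 _ _ _ fun h' => h ⟨_, h', rfl⟩
    · intro q x v₁ h
      have : (fun v₂ => Φ (q, x, v₁, v₂)) = fun _ => 0 :=
        funext fun v₂ => h0 _ _ _ fun h' => h ⟨_, h', rfl⟩
      simp only [this, h₂.2]

/-- Regularization of a kernel that is obtained from another one by a smooth substitution. -/
theorem Regularizable.transport {K₁ : A → V₁ → ℂ} {N : A → ℂ} {D : Set A}
    (h : Regularizable K₁ N D) {K : A → V → ℂ} (hK : ∀ a, Measurable (K a)) {θ : V₁ → V}
    (hθ : ContDiff ℝ ∞ θ) {m : A × V₁ → ℂ} (hm : HolSmooth m)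
    (hcpt : ∀ k : Set V, IsCompact k → ∃ k₁ : Set V₁, IsCompact k₁ ∧
      ∀ a, ∀ v ∉ k₁, m (a, v) = 0 ∨ θ v ∉ k) (c : ℂ)
    (hint : ∀ a ∈ D, ∀ φ : V → ℂ, Measurable φ →
      Integrable (fun v => K₁ a v * (m (a, v) * φ (θ v))) →
      Integrable (fun v => K a v * φ v) ∧
        ∫ v, K₁ a v * (m (a, v) * φ (θ v)) = c * ∫ v, K a v * φ v) :
    Regularizable K (fun a => c * N a) D := by
  obtain ⟨ζ, h⟩ := h
  have hmc : ∀ a, Continuous fun v => m (a, v) := fun a =>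
    hm.1.continuous.comp (by fun_prop)
  have key : ∀ a ∈ D, ∀ φ : V → ℂ, Measurable φ → ∀ C : ℝ, (∀ v, ‖φ v‖ ≤ C) → ∀ k, IsCompact k →
      (∀ v ∉ k, φ v = 0) → Integrable (fun v => K₁ a v * (m (a, v) * φ (θ v))) := by
    intro a ha φ hφ C hC k hk h0
    obtain ⟨k₁, hk₁, hk₁'⟩ := hcpt k hk
    obtain ⟨C', hC'⟩ := hk₁.exists_bound_of_continuousOn (hmc a).continuousOn
    have hz : ∀ v ∉ k₁, m (a, v) * φ (θ v) = 0 := by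
      intro v hv
      rcases hk₁' a v hv with h1 | h1
      · rw [h1, zero_mul]
      · rw [h0 _ h1, mul_zero]
    have hC0 : 0 ≤ C := (norm_nonneg _).trans (hC 0)
    refine integrable_mul_of_integrableOn hk₁ (h.3 a ha _ hk₁)
      ((hmc a).measurable.mul (hφ.comp hθ.continuous.measurable)) (C := |C'| * C) ?_ hz
    intro v
    by_cases hv : v ∈ k₁
    · rw [norm_mul]
      exact mul_le_mul ((hC' v hv).trans (le_abs_self _)) (hC _) (norm_nonneg _) (abs_nonneg _)
    · simp only [hz v hv, norm_zero]
      positivity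
  refine ⟨fun a φ => ζ a fun v => m (a, v) * φ (θ v), hK, fun a => by simp [h.2], ?_, ?_, ?_⟩
  · intro a ha k hk
    have h1 := (hint a ha (k.indicator fun _ => 1) (measurable_const.indicator hk.measurableSet)
      (key a ha _ (measurable_const.indicator hk.measurableSet) 1
        (fun v => by by_cases hv : v ∈ k <;> simp [hv]) k hk fun v hv => by simp [hv])).1
    rw [← integrable_indicator_iff hk.measurableSet]
    refine h1.congr (Eventually.of_forall fun v => ?_)
    by_cases hv : v ∈ k <;> simp [hv]
  · intro a ha φ hφ hc
    obtain ⟨C, hC⟩ := hφ.continuous.bounded_above_of_compact_support hc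
    have h1 := (hint a ha φ hφ.continuous.measurable (key a ha φ hφ.continuous.measurable C hC _ hc
      fun v hv => image_eq_zero_of_notMem_tsupport hv)).2
    obtain ⟨k₁, hk₁, hk₁'⟩ := hcpt _ hc
    rw [h.4 a ha]
    · rw [h1]; ring
    · exact (hm.1.comp (contDiff_prodMk_right a)).mul (hφ.comp hθ)
    · refine HasCompactSupport.intro hk₁ fun v hv => ?_
      rcases hk₁' a v hv with h1 | h1
      · simp only [h1, zero_mul]
      · simp only [image_eq_zero_of_notMem_tsupport h1, mul_zero]
  · intro Q E _ _ _ _ a ha Φ hΦ k hk h0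
    obtain ⟨k₁, hk₁, hk₁'⟩ := hcpt k hk
    refine h.5 a ha (fun z => m (a z.1, z.2.2) * Φ (z.1, z.2.1, θ z.2.2)) ?_ k₁ hk₁ ?_
    · refine HolSmooth.mul ?_ ?_
      · exact hm.comp ha (θ := fun y : E × V₁ => y.2) (by fun_prop)
      · exact hΦ.comp_right (θ := fun y : E × V₁ => (y.1, θ y.2)) (by fun_prop)
    · intro q x v hv
      rcases hk₁' (a q) v hv with h1 | h1
      · simp only [h1, zero_mul]
      · simp only [h0 _ _ _ h1, mul_zero]

theorem Regularizable.of_linearEquiv [FiniteDimensional ℝ V₁]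
    [(volume : Measure V₁).IsAddHaarMeasure] [(volume : Measure V).IsAddHaarMeasure]
    {K₁ : A → V₁ → ℂ} {N : A → ℂ} {D : Set A} (h : Regularizable K₁ N D) (L : V ≃L[ℝ] V₁) :
    Regularizable (fun a v => K₁ a (L v)) N D := by
  have : FiniteDimensional ℝ V := L.symm.toLinearEquiv.finiteDimensional
  have hH : ((volume : Measure V).map L).IsAddHaarMeasure := L.isAddHaarMeasure_map _
  have hμ : (volume : Measure V₁) =
      Measure.addHaarScalarFactor volume ((volume : Measure V).map L) •
        ((volume : Measure V).map L) := Measure.isAddLeftInvariant_eq_smul _ _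
  set c := Measure.addHaarScalarFactor volume ((volume : Measure V).map L) with hc
  have hc0 : c ≠ 0 := (Measure.addHaarScalarFactor_pos_of_isAddHaarMeasure _ _).ne'
  have hmeas : ∀ a, Measurable (K₁ a) := fun a => h.choose_spec.1 a
  have hemb : MeasurableEmbedding L := L.toHomeomorph.measurableEmbedding
  refine Regularizable.of_const_mul (c := (c : ℝ)) (by exact_mod_cast hc0) (h.transport (θ := L.symm) (m := fun _ => 1)
    (fun a => (hmeas a).comp L.continuous.measurable) L.symm.contDiff (HolSmooth.const 1) ?_ _ ?_)
  · intro k hk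
    refine ⟨L '' k, hk.image L.continuous, fun a v hv => Or.inr fun h' => hv ⟨_, h', by simp⟩⟩
  · intro a _ φ hφ hi
    simp only [one_mul] at hi ⊢
    rw [hμ] at hi ⊢
    have hi' := (integrable_smul_measure (c := (c : ENNReal)) (by simpa using hc0)
      ENNReal.coe_ne_top).1 hi
    rw [hemb.integrable_map_iff] at hi'
    rw [integral_smul_nnreal_measure, hemb.integral_map]
    refine ⟨by simpa [Function.comp_def] using hi', ?_⟩
    simp [NNReal.smul_def]

theorem Regularizable.of_surjective [FiniteDimensional ℝ V₁] [FiniteDimensional ℝ V]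
    [(volume : Measure V₁).IsAddHaarMeasure] [(volume : Measure V).IsAddHaarMeasure]
    {K₁ : A → V₁ → ℂ} {N : A → ℂ} {D : Set A} (h : Regularizable K₁ N D) (π : V →L[ℝ] V₁)
    (hπ : Function.Surjective π) :
    Regularizable (fun a v => K₁ a (π v)) N D := by
  obtain ⟨s, hs⟩ := (π : V →ₗ[ℝ] V₁).exists_rightInverse_of_surjective
    (LinearMap.range_eq_top.2 hπ)
  have hs' : ∀ v, π (s v) = v := fun v => LinearMap.congr_fun hs v
  let κ := LinearMap.ker (π : V →ₗ[ℝ] V₁)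
  let b : κ ≃ₗ[ℝ] (Fin (Module.finrank ℝ κ) → ℝ) := (Module.finBasis ℝ κ).equivFun
  let L : V ≃ₗ[ℝ] V₁ × (Fin (Module.finrank ℝ κ) → ℝ) :=
    { toFun := fun v => (π v, b ⟨v - s (π v), by simp [κ, hs']⟩)
      map_add' := by
        intro v w
        refine Prod.ext (by simp) ?_
        simp only [Prod.mk_add_mk, ← map_add]
        congr 1
        ext
        simp
        abel
      map_smul' := by
        intro c v
        refine Prod.ext (by simp) ?_
        simp only [RingHom.id_apply, Prod.smul_mk, ← map_smul]
        congr 1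
        ext
        simp [smul_sub]
      invFun := fun z => s z.1 + b.symm z.2
      left_inv := by intro v; simp
      right_inv := by
        rintro ⟨v, w⟩
        have h1 : π (b.symm w : V) = 0 := (b.symm w).2
        refine Prod.ext (by simp [hs', h1]) ?_
        simp only [map_add, hs', h1, add_zero]
        refine (congrArg b (Subtype.ext ?_)).trans (b.apply_symm_apply w)
        simp }
  have h1 := h.prod ((regularizable_one (A := A)
    (V := Fin (Module.finrank ℝ κ) → ℝ)).mono (subset_univ D))
  have : (volume : Measure (V₁ × (Fin (Module.finrank ℝ κ) → ℝ))).IsAddHaarMeasure := by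
    rw [Measure.volume_eq_prod]; infer_instance
  simpa [L] using h1.of_linearEquiv L.toContinuousLinearEquiv

end Regularization

section OneDimRegularization

/-- `Γ((μ+2k)/2)⁻¹ ∫ |t|^{μ-1} φ(t) dt`, after `k` integrations by parts. -/
def evenZetaAux (k : ℕ) (μ : ℂ) (φ : ℝ → ℂ) : ℂ :=
  (-4⁻¹) ^ k * (Gamma ((μ + 2 * k) / 2))⁻¹ *
    ∫ t : ℝ, ((|t| : ℝ) : ℂ) ^ (μ + 2 * k - 1) * (evenStep^[k] φ) t

theorem evenZetaAux_succ {k : ℕ} {μ : ℂ} (h : 0 < μ.re + 2 * k) {φ : ℝ → ℂ}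
    (hφ : ContDiff ℝ ∞ φ) (hc : HasCompactSupport φ) :
    evenZetaAux (k + 1) μ φ = evenZetaAux k μ φ := by
  obtain ⟨R, hR0, hR⟩ := hc.isBounded.subset_closedBall_lt 0 0
  have h0 : ∀ t ∉ Icc (-R) R, φ t = 0 := by
    intro t ht
    refine image_eq_zero_of_notMem_tsupport fun h => ht ?_
    simpa [Real.closedBall_eq_Icc] using hR h
  obtain ⟨h1, h2⟩ := iterate_evenStep hφ hR0.le h0 k
  have h3 : 0 < (μ + 2 * k).re := by simpa using h
  have h4 : μ + 2 * k ≠ 0 := by intro h'; rw [h'] at h3; simp at h3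
  unfold evenZetaAux
  rw [integral_abs_cpow_evenStep h3 h1 (HasCompactSupport.intro isCompact_Icc h2),
    Function.iterate_succ_apply']
  have h5 : (μ + 2 * ((k + 1 : ℕ) : ℂ)) / 2 = (μ + 2 * k) / 2 + 1 := by push_cast; ring
  have h6 : μ + 2 * ((k + 1 : ℕ) : ℂ) - 1 = μ + 2 * k + 2 - 1 := by push_cast; ring
  rw [h5, h6, Complex.Gamma_add_one _ (div_ne_zero h4 two_ne_zero), pow_succ, mul_inv]
  field_simp
  norm_num

theorem evenZetaAux_eq {k l : ℕ} {μ : ℂ} (hk : 0 < μ.re + 2 * k) (hl : 0 < μ.re + 2 * l)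
    {φ : ℝ → ℂ} (hφ : ContDiff ℝ ∞ φ) (hc : HasCompactSupport φ) :
    evenZetaAux k μ φ = evenZetaAux l μ φ := by
  have key : ∀ (k j : ℕ), 0 < μ.re + 2 * k → evenZetaAux (k + j) μ φ = evenZetaAux k μ φ := by
    intro k j hk
    induction j with
    | zero => rfl
    | succ j ih =>
      rw [← add_assoc, evenZetaAux_succ _ hφ hc, ih]
      push_cast
      have : (0 : ℝ) ≤ j := Nat.cast_nonneg j
      linarith
  rcases le_total k l with h | h
  · obtain ⟨j, rfl⟩ := Nat.exists_eq_add_of_le h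
    exact (key k j hk).symm
  · obtain ⟨j, rfl⟩ := Nat.exists_eq_add_of_le h
    exact key l j hl

/-- The holomorphic continuation of `Γ(μ/2)⁻¹ ∫ |t|^{μ-1} φ(t) dt`. -/
def evenZeta (μ : ℂ) (φ : ℝ → ℂ) : ℂ := evenZetaAux (⌈|μ.re|⌉₊ + 1) μ φ

theorem evenZeta_eq {k : ℕ} {μ : ℂ} (hk : 0 < μ.re + 2 * k) {φ : ℝ → ℂ}
    (hφ : ContDiff ℝ ∞ φ) (hc : HasCompactSupport φ) : evenZeta μ φ = evenZetaAux k μ φ := by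
  refine evenZetaAux_eq ?_ hk hφ hc
  have h1 := Nat.le_ceil |μ.re|
  have h2 := neg_abs_le μ.re
  push_cast
  linarith [abs_nonneg μ.re]

theorem contDiff_inv_Gamma {A : Type} [NormedAddCommGroup A] [NormedSpace ℂ A] {f : A → ℂ}
    (hf : ContDiff ℂ ∞ f) : ContDiff ℂ ∞ fun a => (Gamma (f a))⁻¹ :=
  Complex.differentiable_one_div_Gamma.contDiff.comp hf

variable {Q E : Type} [NormedAddCommGroup Q] [NormedSpace ℂ Q]
  [NormedAddCommGroup E] [NormedSpace ℝ E]

theorem HolSmooth.evenZeta {Φ : Q × E × ℝ → ℂ} (h : HolSmooth Φ) {μ : Q → ℂ}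
    (hμ : ContDiff ℂ ∞ μ) {k : Set ℝ} (hk : IsCompact k)
    (h0 : ∀ q x, ∀ t ∉ k, Φ (q, x, t) = 0) :
    HolSmooth fun z : Q × E => GLBranching.evenZeta (μ z.1) fun t => Φ (z.1, z.2, t) := by
  obtain ⟨R, hR0, hR⟩ := hk.isBounded.subset_closedBall_lt 0 0
  have h0' : ∀ q x, ∀ t ∉ Icc (-R) R, Φ (q, x, t) = 0 := fun q x t ht =>
    h0 q x t fun h => ht (by simpa [Real.closedBall_eq_Icc] using hR h)
  have hφ : ∀ q x, ContDiff ℝ ∞ fun t => Φ (q, x, t) := fun q x =>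
    h.1.comp (f := fun t : ℝ => (q, x, t)) (by fun_prop)
  have hc : ∀ q x, HasCompactSupport fun t => Φ (q, x, t) := fun q x =>
    HasCompactSupport.intro isCompact_Icc (h0' q x)
  have hev : ∀ (l : ℕ) (q₀ : Q), 0 < (μ q₀).re + 2 * l → ∀ᶠ q in 𝓝 q₀, ∀ x,
      GLBranching.evenZeta (μ q) (fun t => Φ (q, x, t)) =
        evenZetaAux l (μ q) fun t => Φ (q, x, t) := by
    intro l q₀ hl
    have h1 : Continuous fun q => (μ q).re + 2 * (l : ℝ) :=
      (Complex.continuous_re.comp hμ.continuous).add continuous_const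
    filter_upwards [h1.continuousAt.eventually_const_lt hl] with q hq x
    exact evenZeta_eq hq (hφ q x) (hc q x)
  have hG : ∀ l : ℕ, ContDiff ℂ ∞ fun q => (-4⁻¹) ^ l * (Gamma ((μ q + 2 * l) / 2))⁻¹ :=
    fun l => contDiff_const.mul (contDiff_inv_Gamma ((hμ.add contDiff_const).div_const 2))
  have hl : ∀ (q₀ : Q) (n : ℕ), ∃ l : ℕ, n + 1 < (μ q₀).re + 2 * l := by
    intro q₀ n
    obtain ⟨l, hl⟩ := exists_nat_gt (n + 1 - (μ q₀).re)
    exact ⟨l, by linarith [(Nat.cast_nonneg l : (0 : ℝ) ≤ l)]⟩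
  have hΨ := fun l : ℕ => h.iterate_evenStep l
  have hΨ0 : ∀ l : ℕ, ∀ q x, ∀ t ∉ Icc (-R) R, (evenStep^[l] fun t => Φ (q, x, t)) t = 0 :=
    fun l q x => (GLBranching.iterate_evenStep (hφ q x) hR0.le (h0' q x) l).2
  constructor
  · rw [contDiff_iff_contDiffAt]
    rintro ⟨q₀, x₀⟩
    rw [contDiffAt_infty]
    intro n
    obtain ⟨l, hl⟩ := hl q₀ n
    have hpos : 0 < (μ q₀).re + 2 * l := by linarith [(Nat.cast_nonneg n : (0 : ℝ) ≤ n)]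
    have e : (fun z : Q × E => GLBranching.evenZeta (μ z.1) fun t => Φ (z.1, z.2, t))
        =ᶠ[𝓝 (q₀, x₀)] fun z => evenZetaAux l (μ z.1) fun t => Φ (z.1, z.2, t) := by
      have := (continuous_fst.tendsto (q₀, x₀)).eventually (hev l q₀ hpos)
      filter_upwards [this] with z hz using hz z.2
    refine ContDiffAt.congr_of_eventuallyEq ?_ e
    have h1 := (hΨ l).contDiffOn_integral_abs_cpow isCompact_Icc (hΨ0 l)
      (hμ.add (contDiff_const (c := (2 * l : ℂ)))) n
    have hU : IsOpen {z : Q × E | (n : ℝ) + 1 < (μ z.1 + 2 * l).re} :=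
      isOpen_lt continuous_const (Complex.continuous_re.comp
        ((hμ.continuous.comp continuous_fst).add continuous_const))
    have h2 := h1.contDiffAt (x := (q₀, x₀)) (hU.mem_nhds (by simpa using hl))
    have h3 : ContDiff ℝ ∞ fun z : Q × E =>
        (-4⁻¹) ^ l * (Gamma ((μ z.1 + 2 * l) / 2))⁻¹ :=
      ((hG l).restrict_scalars ℝ).comp contDiff_fst
    exact (h3.contDiffAt.of_le (by exact_mod_cast le_top)).mul h2
  · intro x q₀
    obtain ⟨l, hl⟩ := hl q₀ 1
    have hpos : 0 < (μ q₀).re + 2 * l := by push_cast at hl; linarith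
    have e : (fun q => GLBranching.evenZeta (μ q) fun t => Φ (q, x, t))
        =ᶠ[𝓝 q₀] fun q => evenZetaAux l (μ q) fun t => Φ (q, x, t) := by
      filter_upwards [hev l q₀ hpos] with q hq using hq x
    refine DifferentiableAt.congr_of_eventuallyEq ?_ e
    have h1 := (hΨ l).differentiableAt_integral_abs_cpow isCompact_Icc (hΨ0 l)
      (hμ.add (contDiff_const (c := (2 * l : ℂ)))) x q₀ (by simp; push_cast at hl; linarith)
    exact ((hG l).differentiable (by simp) q₀).mul h1

theorem isRegularization_evenZeta :
    IsRegularization (fun μ t => sgnPow 0 (μ - 1) t) (fun μ => (Gamma (μ / 2))⁻¹)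
      {μ | 0 < μ.re} evenZeta where
  measurable μ := measurable_sgnPow _ _
  map_zero μ := by
    have h : ∀ l : ℕ, (evenStep^[l] fun _ => (0 : ℂ)) = fun _ => 0 := by
      intro l
      induction l with
      | zero => rfl
      | succ l ih =>
        rw [Function.iterate_succ_apply', ih]
        funext t
        simp [evenStep, oddQuotient]
    unfold evenZeta evenZetaAux
    simp only [h]
    simp
  integrableOn μ hμ k hk := by
    obtain ⟨R, hR⟩ := hk.isBounded.subset_closedBall 0
    have h1 := integrableOn_Ioi_rpow_bounded (r := (μ - 1).re) (R := R) (by simpa using hμ)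
    rw [integrable_indicator_iff measurableSet_Icc] at h1
    refine (h1.mono_set (hR.trans ?_)).mono' (measurable_sgnPow _ _).aestronglyMeasurable ?_
    · rw [Real.closedBall_eq_Icc]; simp
    · have hae : ∀ᵐ t : ℝ, t ≠ 0 := by simp [ae_iff]
      filter_upwards [ae_restrict_of_ae hae] with t ht
      rw [norm_sgnPow _ _ ht]
  eq_integral μ hμ φ hφ hc := by
    have hμ' : 0 < μ.re := hμ
    rw [evenZeta_eq (k := 0) (by simpa using hμ') hφ hc]
    simp [evenZetaAux, sgnPow_zero_left]
  holSmooth a ha Φ hΦ k hk h0 := hΦ.evenZeta ha hk h0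

theorem isRegularization_oddZeta :
    IsRegularization (fun μ t => sgnPow 1 (μ - 1) t) (fun μ => (Gamma ((μ + 1) / 2))⁻¹)
      {μ | 0 < μ.re} (fun μ φ => 2⁻¹ * evenZeta (μ + 1) (oddQuotient φ)) where
  measurable μ := measurable_sgnPow _ _
  map_zero μ := by
    have : oddQuotient (fun _ => 0) = fun _ => 0 := by
      funext t; simp [oddQuotient]
    rw [this, isRegularization_evenZeta.map_zero, mul_zero]
  integrableOn μ hμ k hk := by
    have h1 := isRegularization_evenZeta.integrableOn μ hμ k hk
    refine Integrable.mono h1 (measurable_sgnPow _ _).aestronglyMeasurable ?_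
    have hae : ∀ᵐ t : ℝ, t ≠ 0 := by simp [ae_iff]
    filter_upwards [ae_restrict_of_ae hae] with t ht
    rw [norm_sgnPow _ _ ht, norm_sgnPow _ _ ht]
  eq_integral μ hμ φ hφ hc := by
    have hμ' : 0 < μ.re := hμ
    obtain ⟨R, hR0, hR⟩ := hc.isBounded.subset_closedBall_lt 0 0
    have h0 : ∀ t ∉ Icc (-R) R, φ t = 0 := by
      intro t ht
      refine image_eq_zero_of_notMem_tsupport fun h => ht ?_
      simpa [Real.closedBall_eq_Icc] using hR h
    rw [evenZeta_eq (k := 0) (by simp; linarith) (contDiff_oddQuotient hφ)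
      (HasCompactSupport.intro isCompact_Icc (oddQuotient_eq_zero hφ hR0.le h0)),
      integral_sign_abs_cpow hμ' hφ hc]
    simp [evenZetaAux]
    ring
  holSmooth a ha Φ hΦ k hk h0 := by
    obtain ⟨R, hR0, hR⟩ := hk.isBounded.subset_closedBall_lt 0 0
    have h0' : ∀ q x, ∀ t ∉ Icc (-R) R, Φ (q, x, t) = 0 := fun q x t ht =>
      h0 q x t fun h => ht (by simpa [Real.closedBall_eq_Icc] using hR h)
    refine HolSmooth.const_mul (HolSmooth.evenZeta hΦ.oddQuotient (ha.add contDiff_const)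
      (isCompact_Icc (a := -R) (b := R)) fun q x => ?_) _
    exact oddQuotient_eq_zero (hΦ.1.comp (f := fun t : ℝ => (q, x, t)) (by fun_prop)) hR0.le
      (h0' q x)

theorem regularizable_sgnPow (ε : ZMod 2) :
    Regularizable (fun μ t => sgnPow ε (μ - 1) t)
      (fun μ => (Gamma ((μ + rep ε) / 2))⁻¹) {μ | 0 < μ.re} := by
  rcases zmod_two_cases ε with rfl | rfl
  · refine ⟨evenZeta, ?_⟩
    simpa [rep] using isRegularization_evenZeta
  · refine ⟨fun μ φ => 2⁻¹ * evenZeta (μ + 1) (oddQuotient φ), ?_⟩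
    simpa [rep, ZMod.val_one] using isRegularization_oddZeta

end OneDimRegularization

section ChangeOfVariables

/-- A change of variables formula for nonnegative functions gives one for complex functions. -/
theorem integrable_integral_of_lintegral {X Y : Type} [MeasurableSpace X] [MeasurableSpace Y]
    {μ : Measure X} {ν : Measure Y} {θ : X → Y} (hθ : Measurable θ) {w : X → NNReal}
    (hw : Measurable w) {c : ENNReal} (hc0 : c ≠ 0) (hc : c ≠ ⊤)
    (h : ∀ G : Y → ENNReal, Measurable G → ∫⁻ x, w x * G (θ x) ∂μ = c * ∫⁻ y, G y ∂ν)
    {H : Y → ℂ} (hH : AEStronglyMeasurable H ν) :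
    (Integrable (fun x => ((w x : ℝ) : ℂ) * H (θ x)) μ ↔ Integrable H ν) ∧
      ∫ x, ((w x : ℝ) : ℂ) * H (θ x) ∂μ = ((c.toReal : ℝ) : ℂ) * ∫ y, H y ∂ν := by
  have hm : (μ.withDensity fun x => (w x : ENNReal)).map θ = c • ν := by
    ext s hs
    have h1 := h (s.indicator fun _ => 1) (measurable_const.indicator hs)
    rw [lintegral_indicator_const hs, one_mul] at h1
    rw [Measure.map_apply hθ hs, withDensity_apply _ (hθ hs), Measure.smul_apply, smul_eq_mul, ← h1,
      ← lintegral_indicator (hθ hs)]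
    congr 1
    funext x
    by_cases hx : θ x ∈ s
    · rw [indicator_of_mem (show x ∈ θ ⁻¹' s from hx), indicator_of_mem hx, mul_one]
    · rw [indicator_of_notMem (show x ∉ θ ⁻¹' s from hx), indicator_of_notMem hx, mul_zero]
  have hH' : AEStronglyMeasurable H ((μ.withDensity fun x => (w x : ENNReal)).map θ) := by
    rw [hm]
    exact hH.smul_measure c
  constructor
  · have h1 := integrable_map_measure hH' hθ.aemeasurable
    rw [hm, integrable_smul_measure hc0 hc, integrable_withDensity_iff_integrable_smul hw] at h1
    rw [h1]
    simp [NNReal.smul_def]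
  · have h1 := integral_map hθ.aemeasurable hH'
    rw [hm, integral_smul_measure, integral_withDensity_eq_integral_smul hw] at h1
    rw [← Complex.real_smul, h1]
    simp [NNReal.smul_def]

theorem lintegral_comp_smul_pi {d : ℕ} {r : ℝ} (hr : r ≠ 0) {g : (Fin d → ℝ) → ENNReal}
    (hg : Measurable g) : (‖r‖₊ ^ d : NNReal) * ∫⁻ y, g (r • y) = ∫⁻ y, g y := by
  have h1 := Measure.map_addHaar_smul (volume : Measure (Fin d → ℝ)) hr
  have h2 : ∫⁻ y, g (r • y) = ∫⁻ y, g y ∂((volume : Measure (Fin d → ℝ)).map (r • ·)) :=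
    (lintegral_map hg (by fun_prop)).symm
  rw [h2, h1, lintegral_smul_measure, Module.finrank_fin_fun, smul_eq_mul, ← mul_assoc]
  have h3 : ((‖r‖₊ ^ d : NNReal) : ENNReal) * ENNReal.ofReal |(r ^ d)⁻¹| = 1 := by
    have h4 : (‖r‖₊ ^ d : NNReal) = Real.toNNReal (|r| ^ d) := by
      ext
      simp [Real.coe_toNNReal _ (pow_nonneg (abs_nonneg r) d)]
    rw [h4, ← ENNReal.ofReal, ← ENNReal.ofReal_mul (by positivity), abs_inv, abs_pow,
      mul_inv_cancel₀ (pow_ne_zero _ (abs_ne_zero.2 hr)), ENNReal.ofReal_one]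
  rw [h3, one_mul]

theorem ae_apply_ne_zero {V : Type} [NormedAddCommGroup V] [NormedSpace ℝ V] [MeasurableSpace V]
    [BorelSpace V] [FiniteDimensional ℝ V] (μ : Measure V) [μ.IsAddHaarMeasure] {l : V →ₗ[ℝ] ℝ}
    (hl : l ≠ 0) : ∀ᵐ v ∂μ, l v ≠ 0 := by
  have h1 : μ (LinearMap.ker l : Set V) = 0 :=
    Measure.addHaar_submodule μ _ fun h => hl (LinearMap.ker_eq_top.1 h)
  exact measure_mono_null (fun v hv => by simpa using hv) h1

end ChangeOfVariables

theorem isAddHaarMeasure_volume_prod (X Y : Type) [NormedAddCommGroup X]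
    [MeasureSpace X] [BorelSpace X] [SecondCountableTopology X] [SFinite (volume : Measure X)]
    [(volume : Measure X).IsAddHaarMeasure] [NormedAddCommGroup Y]
    [MeasureSpace Y] [BorelSpace Y] [SecondCountableTopology Y] [SFinite (volume : Measure Y)]
    [(volume : Measure Y).IsAddHaarMeasure] : (volume : Measure (X × Y)).IsAddHaarMeasure := by
  rw [Measure.volume_eq_prod]
  infer_instance

section MeasurePreserving

variable {A V V₁ : Type} [NormedAddCommGroup A] [NormedSpace ℂ A]
  [NormedAddCommGroup V] [NormedSpace ℝ V] [MeasureSpace V] [BorelSpace V]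
  [SecondCountableTopology V] [IsFiniteMeasureOnCompacts (volume : Measure V)]
  [NormedAddCommGroup V₁] [NormedSpace ℝ V₁] [MeasureSpace V₁] [BorelSpace V₁]
  [SecondCountableTopology V₁] [IsFiniteMeasureOnCompacts (volume : Measure V₁)]

theorem Regularizable.of_measurePreserving {K₁ : A → V₁ → ℂ} {N : A → ℂ} {D : Set A}
    (h : Regularizable K₁ N D) {θ : V₁ → V} (hθ : ContDiff ℝ ∞ θ) {θ' : V → V₁}
    (hθ' : Continuous θ') (hl : ∀ v, θ' (θ v) = v) (hr : ∀ v, θ (θ' v) = v)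
    (hmp : MeasurePreserving θ) : Regularizable (fun a v => K₁ a (θ' v)) N D := by
  have hmeas : ∀ a, Measurable (K₁ a) := fun a => h.choose_spec.1 a
  have hemb : MeasurableEmbedding θ :=
    (Homeomorph.mk ⟨θ, θ', hl, hr⟩ hθ.continuous hθ').measurableEmbedding
  refine Regularizable.of_const_mul (c := 1) one_ne_zero (h.transport (θ := θ) (m := fun _ => 1)
    (fun a => (hmeas a).comp hθ'.measurable) hθ (HolSmooth.const 1) ?_ _ ?_)
  · intro k hk
    exact ⟨θ' '' k, hk.image hθ', fun a v hv => Or.inr fun h' => hv ⟨_, h', hl v⟩⟩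
  · intro a _ φ hφ hi
    have e : (fun v => K₁ a v * (1 * φ (θ v))) = (fun v => K₁ a (θ' v) * φ v) ∘ θ := by
      funext v
      simp [hl]
    rw [e] at hi
    refine ⟨(hmp.integrable_comp_emb hemb).1 hi, ?_⟩
    rw [one_mul, ← hmp.integral_comp hemb, e]
    rfl

end MeasurePreserving

section BlowUp

variable {A W : Type} [NormedAddCommGroup A] [NormedSpace ℂ A]
  [NormedAddCommGroup W] [NormedSpace ℝ W] [MeasureSpace W] [BorelSpace W]
  [SecondCountableTopology W] [IsFiniteMeasureOnCompacts (volume : Measure W)]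
  [SFinite (volume : Measure W)]

theorem ae_fst_fst_ne_zero (d : ℕ) : ∀ᵐ v : (ℝ × (Fin d → ℝ)) × W, v.1.1 ≠ 0 := by
  rw [Measure.volume_eq_prod, Measure.volume_eq_prod]
  refine Measure.ae_prod_mem_iff_ae_ae_mem (s := {v : (ℝ × (Fin d → ℝ)) × W | v.1.1 ≠ 0})
    (measurable_fst.fst (measurableSet_singleton (0 : ℝ)).compl) |>.2 ?_
  have hae : ∀ᵐ t : ℝ, t ≠ 0 := by simp [ae_iff]
  have h2 : ∀ᵐ x : ℝ × (Fin d → ℝ) ∂(volume.prod volume), x.1 ≠ 0 :=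
    Measure.quasiMeasurePreserving_fst.ae hae
  filter_upwards [h2] with x hx
  exact Eventually.of_forall fun _ => hx

theorem Regularizable.blowUp {d : ℕ} {K : A → (ℝ × (Fin d → ℝ)) × W → ℂ} {N : A → ℂ} {D : Set A}
    (hK : ∀ a, Measurable (K a)) {χ : (Fin d → ℝ) → ℂ} (hχ : ContDiff ℝ ∞ χ)
    (hχc : HasCompactSupport χ)
    (h : Regularizable (fun a (v : (ℝ × (Fin d → ℝ)) × W) =>
      ((|v.1.1| ^ d : ℝ) : ℂ) * K a ((v.1.1, v.1.1 • v.1.2), v.2)) N D) :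
    Regularizable (fun a v => χ (v.1.1⁻¹ • v.1.2) * K a v) N D := by
  have hKm : ∀ a, Measurable fun v : (ℝ × (Fin d → ℝ)) × W => χ (v.1.1⁻¹ • v.1.2) * K a v := by
    intro a
    refine (hχ.continuous.measurable.comp ?_).mul (hK a)
    exact (measurable_fst.fst.inv).smul measurable_fst.snd
  refine Regularizable.of_const_mul (c := 1) one_ne_zero
    (h.transport hKm (θ := fun v => ((v.1.1, v.1.1 • v.1.2), v.2)) (by fun_prop)
    (m := fun z => χ z.2.1.2) (HolSmooth.of_right (f := fun v : (ℝ × (Fin d → ℝ)) × W => χ v.1.2)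
      (hχ.comp (by fun_prop))) ?_ 1 ?_)
  · intro k hk
    refine ⟨(((fun v : (ℝ × (Fin d → ℝ)) × W => v.1.1) '' k) ×ˢ tsupport χ) ×ˢ (Prod.snd '' k),
      ((hk.image (by fun_prop)).prod hχc).prod (hk.image continuous_snd), fun a v hv => ?_⟩
    by_contra! hcon
    refine hv ⟨⟨⟨_, hcon.2, rfl⟩, ?_⟩, ⟨_, hcon.2, rfl⟩⟩
    by_contra h'
    exact hcon.1 (image_eq_zero_of_notMem_tsupport h')
  · intro a ha φ hφ hi
    let H : (ℝ × (Fin d → ℝ)) × W → ℂ := fun v => χ (v.1.1⁻¹ • v.1.2) * K a v * φ v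
    have hH : Measurable H := (hKm a).mul hφ
    have hr := ae_fst_fst_ne_zero (W := W) d
    have key := integrable_integral_of_lintegral (μ := volume) (ν := volume)
      (θ := fun v : (ℝ × (Fin d → ℝ)) × W => ((v.1.1, v.1.1 • v.1.2), v.2))
      (((measurable_fst.fst).prodMk (measurable_fst.fst.smul measurable_fst.snd)).prodMk
        measurable_snd)
      (w := fun v => ‖v.1.1‖₊ ^ d) (measurable_fst.fst.nnnorm.pow_const d) (c := 1) one_ne_zero
      ENNReal.one_ne_top ?_ hH.aestronglyMeasurable
    · have e : (fun v : (ℝ × (Fin d → ℝ)) × W => (((‖v.1.1‖₊ ^ d : NNReal) : ℝ) : ℂ) *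
          H ((v.1.1, v.1.1 • v.1.2), v.2)) =ᵐ[volume] fun v => ((|v.1.1| ^ d : ℝ) : ℂ) *
          K a ((v.1.1, v.1.1 • v.1.2), v.2) *
            (χ v.1.2 * φ ((v.1.1, v.1.1 • v.1.2), v.2)) := by
        filter_upwards [hr] with v hv
        simp only [H, NNReal.coe_pow, coe_nnnorm, Real.norm_eq_abs, inv_smul_smul₀ hv]
        ring
      refine ⟨key.1.1 (hi.congr e.symm), ?_⟩
      rw [← integral_congr_ae e, key.2]
      simp [H]
    · intro G hG
      rw [one_mul, Measure.volume_eq_prod, Measure.volume_eq_prod]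
      have hθm : Measurable (fun v : (ℝ × (Fin d → ℝ)) × W =>
          ((v.1.1, v.1.1 • v.1.2), v.2)) :=
        ((measurable_fst.fst).prodMk (measurable_fst.fst.smul measurable_fst.snd)).prodMk
          measurable_snd
      have m1 : Measurable fun v : (ℝ × (Fin d → ℝ)) × W =>
          ((‖v.1.1‖₊ ^ d : NNReal) : ENNReal) * G ((v.1.1, v.1.1 • v.1.2), v.2) :=
        ((measurable_fst.fst.nnnorm.pow_const d).coe_nnreal_ennreal).mul (hG.comp hθm)
      rw [lintegral_prod _ m1.aemeasurable, lintegral_prod _ hG.aemeasurable,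
        lintegral_prod _ (Measurable.lintegral_prod_right' m1).aemeasurable,
        lintegral_prod _ (Measurable.lintegral_prod_right' hG).aemeasurable]
      have hae : ∀ᵐ t : ℝ, t ≠ 0 := by simp [ae_iff]
      refine lintegral_congr_ae ?_
      filter_upwards [hae] with r hr
      have m2 : Measurable fun y : Fin d → ℝ => ∫⁻ w, G ((r, y), w) :=
        (Measurable.lintegral_prod_right' hG).comp (by fun_prop)
      have m3 : Measurable fun y : Fin d → ℝ => ∫⁻ w : W, G ((r, r • y), w) :=
        m2.comp (measurable_const_smul r)
      rw [← lintegral_comp_smul_pi hr m2, ← lintegral_const_mul _ m3]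
      refine lintegral_congr fun y => ?_
      have m4 : Measurable fun w : W => G ((r, r • y), w) := hG.comp (by fun_prop)
      exact lintegral_const_mul _ m4

end BlowUp

section Partition

variable {n : ℕ}

/-- A function that is homogeneous of degree `0`, and nonzero only where `x i` is comparable to
the norm of `x`. -/
def coneBump (i : Fin (n + 1)) (x : Fin (n + 1) → ℝ) : ℝ :=
  Real.smoothTransition (2 * (n + 1) * x i ^ 2 / (∑ j, x j ^ 2) - 1)

theorem coneBump_smul (i : Fin (n + 1)) {r : ℝ} (hr : r ≠ 0) (x : Fin (n + 1) → ℝ) :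
    coneBump i (r • x) = coneBump i x := by
  unfold coneBump
  have h : ∑ j, (r • x) j ^ 2 = r ^ 2 * ∑ j, x j ^ 2 := by
    rw [Finset.mul_sum]; simp [mul_pow]
  rw [h, Pi.smul_apply, smul_eq_mul, mul_pow]
  congr 2
  rw [show 2 * ((n : ℝ) + 1) * (r ^ 2 * x i ^ 2) = r ^ 2 * (2 * (n + 1) * x i ^ 2) by ring,
    mul_div_mul_left _ _ (pow_ne_zero 2 hr)]

theorem sum_coneBump_pos {x : Fin (n + 1) → ℝ} (hx : ∃ i, x i ≠ 0) :
    0 < ∑ i, coneBump i x := by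
  have hS : 0 < ∑ j, x j ^ 2 := by
    obtain ⟨i, hi⟩ := hx
    exact Finset.sum_pos' (fun j _ => sq_nonneg _) ⟨i, Finset.mem_univ _, by positivity⟩
  obtain ⟨i, -, hi⟩ := Finset.exists_max_image Finset.univ (fun i => x i ^ 2)
    Finset.univ_nonempty
  refine Finset.sum_pos' (fun j _ => Real.smoothTransition.nonneg _) ⟨i, Finset.mem_univ _, ?_⟩
  refine Real.smoothTransition.pos_of_pos ?_
  have h1 : ∑ j, x j ^ 2 ≤ (n + 1) * x i ^ 2 := by
    have := Finset.sum_le_card_nsmul Finset.univ (fun j => x j ^ 2) (x i ^ 2) fun j hj => hi j hj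
    simpa using this
  rw [sub_pos, lt_div_iff₀ hS]
  nlinarith

/-- The partition of unity in the chart `x i = 1`. -/
def coneChart (i : Fin (n + 1)) (y : Fin n → ℝ) : ℂ :=
  ((coneBump i (i.insertNth 1 y) / ∑ j, coneBump j (i.insertNth 1 y) : ℝ) : ℂ)

theorem insertNth_one_ne_zero (i : Fin (n + 1)) (y : Fin n → ℝ) :
    ∃ j, (i.insertNth (1 : ℝ) y : Fin (n + 1) → ℝ) j ≠ 0 := ⟨i, by simp⟩

theorem contDiff_coneChart (i : Fin (n + 1)) : ContDiff ℝ ∞ (coneChart i) := by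
  have h0 : ContDiff ℝ ∞ fun y : Fin n → ℝ => (i.insertNth (1 : ℝ) y : Fin (n + 1) → ℝ) := by
    rw [contDiff_pi]
    intro j
    refine Fin.succAboveCases i ?_ (fun j => ?_) j
    · simpa using contDiff_const
    · simpa using contDiff_apply ℝ ℝ j
  have h1 : ∀ j, ContDiff ℝ ∞ fun y : Fin n → ℝ => coneBump j (i.insertNth (1 : ℝ) y) := by
    intro j
    refine Real.smoothTransition.contDiff.comp (ContDiff.sub (ContDiff.div ?_ ?_ ?_)
      contDiff_const)
    · exact contDiff_const.mul ((contDiff_pi.1 h0 j).pow 2)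
    · exact ContDiff.sum fun l _ => (contDiff_pi.1 h0 l).pow 2
    · intro y
      obtain ⟨l, hl⟩ := insertNth_one_ne_zero i y
      exact (Finset.sum_pos' (fun j _ => sq_nonneg _) ⟨l, Finset.mem_univ _, by positivity⟩).ne'
  exact Complex.ofRealCLM.contDiff.comp ((h1 i).div (ContDiff.sum fun j _ => h1 j)
    fun y => (sum_coneBump_pos (insertNth_one_ne_zero i y)).ne')

theorem hasCompactSupport_coneChart (i : Fin (n + 1)) : HasCompactSupport (coneChart i) := by
  refine HasCompactSupport.intro (isCompact_closedBall (0 : Fin n → ℝ) (2 * (n + 1))) fun y hy => ?_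
  have h1 : coneBump i (i.insertNth 1 y) = 0 := by
    refine Real.smoothTransition.zero_of_nonpos ?_
    have h2 : ∃ j, 2 * ((n : ℝ) + 1) < |y j| := by
      by_contra! hcon
      refine hy ?_
      rw [mem_closedBall_zero_iff, pi_norm_le_iff_of_nonneg (by positivity)]
      exact hcon
    obtain ⟨j, hj⟩ := h2
    have h3 : 2 * ((n : ℝ) + 1) ≤ ∑ l, (i.insertNth (1 : ℝ) y : Fin (n + 1) → ℝ) l ^ 2 := by
      have h4 := Finset.single_le_sum (f := fun l => (i.insertNth (1 : ℝ) y : Fin (n + 1) → ℝ) l ^ 2)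
        (fun l _ => sq_nonneg _) (Finset.mem_univ (i.succAbove j))
      simp only [Fin.insertNth_apply_succAbove] at h4
      have h5 : (1 : ℝ) ≤ 2 * (n + 1) := by linarith [(Nat.cast_nonneg n : (0 : ℝ) ≤ n)]
      have h6 := sq_abs (y j)
      nlinarith
    simp only [Fin.insertNth_apply_same, one_pow, mul_one]
    rw [sub_nonpos]
    exact div_le_one_of_le₀ h3 (Finset.sum_nonneg fun _ _ => sq_nonneg _)
  simp [coneChart, h1]

theorem sum_coneChart {x : Fin (n + 1) → ℝ} (hx : ∀ i, x i ≠ 0) :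
    ∑ i : Fin (n + 1), coneChart i ((x i)⁻¹ • fun j => x (i.succAbove j)) = 1 := by
  have h1 : ∀ i, coneChart i ((x i)⁻¹ • fun j => x (i.succAbove j)) =
      ((coneBump i x / ∑ j, coneBump j x : ℝ) : ℂ) := by
    intro i
    have h2 : (i.insertNth (1 : ℝ) ((x i)⁻¹ • fun j => x (i.succAbove j)) : Fin (n + 1) → ℝ) =
        (x i)⁻¹ • x := by
      funext l
      refine Fin.succAboveCases i ?_ (fun j => ?_) l
      · simp [hx i]
      · simp
    unfold coneChart
    rw [h2]
    simp_rw [coneBump_smul _ (inv_ne_zero (hx i))]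
  simp_rw [h1]
  rw [← Complex.ofReal_sum, ← Finset.sum_div, div_self (sum_coneBump_pos ⟨0, hx 0⟩).ne']
  simp

end Partition

section PairKernel

/-- The determinant of the rows of `M` without the last one. -/
def detDropLast {k : ℕ} (M : Fin (k + 2) → Fin (k + 1) → ℝ) : ℝ :=
  Matrix.det (Matrix.of fun a => M a.castSucc)

/-- The determinant of the rows of `M` without the last but one. -/
def detDropPrev {k : ℕ} (M : Fin (k + 2) → Fin (k + 1) → ℝ) : ℝ :=
  Matrix.det (Matrix.of fun a => M ((Fin.last k).castSucc.succAbove a))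

theorem det_pivot {k : ℕ} (M : Fin (k + 2) → Fin (k + 2) → ℝ) (i : Fin (k + 2))
    (r : ℝ) (y : Fin (k + 1) → ℝ) (hr : M 0 i = r) (hy : ∀ j, M 0 (i.succAbove j) = r * y j) :
    Matrix.det (Matrix.of M) = (-1) ^ (i : ℕ) * r *
      Matrix.det (Matrix.of fun (a j : Fin (k + 1)) =>
        M a.succ (i.succAbove j) - M a.succ i * y j) := by
  have h1 : Matrix.det (Matrix.of M) = Matrix.det (Matrix.of fun a j =>
      M a j - M a i * (i.insertNth (0 : ℝ) y : Fin (k + 2) → ℝ) j) := by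
    rw [← Matrix.det_transpose, ← Matrix.det_transpose (Matrix.of fun a j => _)]
    refine Matrix.det_eq_of_forall_row_eq_smul_add_const (i.insertNth (0 : ℝ) y) i (by simp) ?_
    intro j a
    simp
    ring
  rw [h1, Matrix.det_succ_row_zero, Finset.sum_eq_single i]
  · simp only [Matrix.of_apply, Fin.insertNth_apply_same, mul_zero, sub_zero, hr]
    congr 2
    ext a j
    simp
  · intro j _ hj
    obtain ⟨l, rfl⟩ := Fin.exists_succAbove_eq hj
    simp [hr, hy]
  · simp

/-- The kernel `|det_A|^{α} |det_B|^{β}` in terms of two maximal minors with all but one row in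
common. -/
def pairKernel (k : ℕ) (ε₁ ε₂ : ZMod 2) (a : ℂ × ℂ) (M : Fin (k + 2) → Fin (k + 1) → ℝ) : ℂ :=
  sgnPow ε₁ a.1 (detDropLast M) * sgnPow ε₂ a.2 (detDropPrev M)

/-- The normalization of `pairKernel`. -/
def pairNorm (k : ℕ) (ε₁ ε₂ : ZMod 2) (a : ℂ × ℂ) : ℂ :=
  (Gamma ((a.1 + 1 + rep ε₁) / 2))⁻¹ * (Gamma ((a.2 + 1 + rep ε₂) / 2))⁻¹ *
    ∏ i ∈ Finset.Icc 2 (k + 1), (Gamma ((a.1 + a.2 + i + rep (ε₁ + ε₂)) / 2))⁻¹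

theorem measurable_pairKernel (k : ℕ) (ε₁ ε₂ : ZMod 2) (a : ℂ × ℂ) :
    Measurable (pairKernel k ε₁ ε₂ a) := by
  have h1 : Continuous (detDropLast (k := k)) := by
    unfold detDropLast
    exact Continuous.matrix_det (continuous_pi fun a => continuous_apply a.castSucc)
  have h2 : Continuous (detDropPrev (k := k)) := by
    unfold detDropPrev
    exact Continuous.matrix_det (continuous_pi fun a => continuous_apply _)
  exact ((measurable_sgnPow _ _).comp h1.measurable).mul
    ((measurable_sgnPow _ _).comp h2.measurable)

theorem sgnPow_neg_one_pow (ε : ZMod 2) (μ : ℂ) (i : ℕ) :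
    sgnPow ε μ ((-1) ^ i) = ((-1) ^ i) ^ ε.val := by
  rcases neg_one_pow_eq_or ℝ i with h | h <;> rcases neg_one_pow_eq_or ℂ i with h' | h'
  · simp [h, h', sgnPow]
  · exfalso
    have := congrArg ((↑) : ℝ → ℂ) h
    push_cast at this
    rw [h'] at this
    norm_num at this
  · exfalso
    have := congrArg ((↑) : ℝ → ℂ) h
    push_cast at this
    rw [h'] at this
    norm_num at this
  · simp [h, h', sgnPow, Real.sign_of_neg]

theorem pairKernel_pivot {k : ℕ} (ε₁ ε₂ : ZMod 2) (a : ℂ × ℂ) (M : Fin (k + 3) → Fin (k + 2) → ℝ)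
    (i : Fin (k + 2)) {r : ℝ} (hr0 : r ≠ 0) (y : Fin (k + 1) → ℝ) (hr : M 0 i = r)
    (hy : ∀ j, M 0 (i.succAbove j) = r * y j) :
    pairKernel (k + 1) ε₁ ε₂ a M = ((-1) ^ (i : ℕ)) ^ ε₁.val * ((-1) ^ (i : ℕ)) ^ ε₂.val *
      (sgnPow (ε₁ + ε₂) (a.1 + a.2) r *
      pairKernel k ε₁ ε₂ a fun b j => M b.succ (i.succAbove j) - M b.succ i * y j) := by
  have h1 : detDropLast M = (-1) ^ (i : ℕ) * r *
      detDropLast fun b j => M b.succ (i.succAbove j) - M b.succ i * y j :=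
    det_pivot (fun b => M b.castSucc) i r y hr hy
  have h2 : detDropPrev M = (-1) ^ (i : ℕ) * r *
      detDropPrev fun b j => M b.succ (i.succAbove j) - M b.succ i * y j := by
    have h3 := det_pivot (fun b => M ((Fin.last (k + 1)).castSucc.succAbove b)) i r y
      (by simpa using hr) (by simpa using hy)
    refine h3.trans ?_
    congr 2
    ext b j
    have h4 : (Fin.last (k + 1)).castSucc.succAbove b.succ =
        ((Fin.last k).castSucc.succAbove b).succ := by
      rw [← Fin.succ_last, ← Fin.succ_castSucc, Fin.succ_succAbove_succ]
    simp only [Matrix.of_apply, h4]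
  unfold pairKernel
  rw [h1, h2, sgnPow_mul, sgnPow_mul, sgnPow_mul, sgnPow_mul, sgnPow_neg_one_pow,
    sgnPow_neg_one_pow, ← sgnPow_mul_sgnPow _ _ _ _ hr0]
  ring

/-- The coordinates of a matrix that are adapted to the `i`-th entry of its first row. -/
def pivotEquiv (k : ℕ) (i : Fin (k + 2)) : (Fin (k + 3) → Fin (k + 2) → ℝ) ≃ₗ[ℝ]
    (ℝ × (Fin (k + 1) → ℝ)) × ((Fin (k + 2) → ℝ) × (Fin (k + 2) → Fin (k + 1) → ℝ)) where
  toFun M := ((M 0 i, fun j => M 0 (i.succAbove j)),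
    (fun b => M b.succ i, fun b j => M b.succ (i.succAbove j)))
  map_add' _ _ := rfl
  map_smul' _ _ := rfl
  invFun v := Fin.cons (i.insertNth v.1.1 v.1.2) fun b => i.insertNth (v.2.1 b) (v.2.2 b)
  left_inv M := by
    funext b
    refine Fin.cases ?_ (fun b => ?_) b <;> funext j <;>
      refine Fin.succAboveCases i ?_ (fun j => ?_) j <;> simp
  right_inv v := by simp

theorem regularizable_pairKernel (k : ℕ) (ε₁ ε₂ : ZMod 2) :
    Regularizable (pairKernel k ε₁ ε₂) (pairNorm k ε₁ ε₂) {a | -1 < a.1.re ∧ -1 < a.2.re} := by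
  induction k with
  | zero =>
    have c1 : ContDiff ℂ ∞ fun a : ℂ × ℂ => a.1 + 1 := by fun_prop
    have c2 : ContDiff ℂ ∞ fun a : ℂ × ℂ => a.2 + 1 := by fun_prop
    have h1 := ((regularizable_sgnPow ε₁).comp c1).mono
      (D' := {a | -1 < a.1.re ∧ -1 < a.2.re}) (fun a ha => by
        have := ha.1; simp; linarith)
    have h2 := ((regularizable_sgnPow ε₂).comp c2).mono
      (D' := {a | -1 < a.1.re ∧ -1 < a.2.re}) (fun a ha => by
        have := ha.2; simp; linarith)
    let L : (Fin 2 → Fin 1 → ℝ) ≃ₗ[ℝ] ℝ × ℝ :=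
      { toFun := fun M => (M 0 0, M 1 0)
        map_add' := fun _ _ => rfl
        map_smul' := fun _ _ => rfl
        invFun := fun v => ![fun _ => v.1, fun _ => v.2]
        left_inv := by
          intro M; funext b j
          fin_cases b <;> fin_cases j <;> rfl
        right_inv := fun v => rfl }
    have : (volume : Measure (ℝ × ℝ)).IsAddHaarMeasure := by
      rw [Measure.volume_eq_prod]; infer_instance
    refine ((h1.prod h2).of_linearEquiv L.toContinuousLinearEquiv).congr
      (measurable_pairKernel 0 ε₁ ε₂) (fun a _ => Eventually.of_forall fun M => ?_) fun a => ?_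
    · have e : (Fin.last 0).castSucc.succAbove (0 : Fin 1) = (1 : Fin 2) := rfl
      simp [pairKernel, detDropLast, detDropPrev]
      rfl
    · simp [pairNorm]
  | succ k ih =>
    have c1 : ContDiff ℂ ∞ fun a : ℂ × ℂ => a.1 + a.2 + (k + 2) := by fun_prop
    have h1 := ((regularizable_sgnPow (ε₁ + ε₂)).comp c1).mono
      (D' := {a | -1 < a.1.re ∧ -1 < a.2.re}) (fun a ha => by
        have := ha.1; have := ha.2
        have : (0 : ℝ) ≤ k := Nat.cast_nonneg k
        simp; linarith)
    have h2 := (h1.prod ((regularizable_one (A := ℂ × ℂ) (V := Fin (k + 1) → ℝ)).mono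
      (subset_univ _))).prod (((regularizable_one (A := ℂ × ℂ) (V := Fin (k + 2) → ℝ)).mono
      (subset_univ _)).prod ih)
    have h3 := h2.of_measurePreserving (V := (ℝ × (Fin (k + 1) → ℝ)) × ((Fin (k + 2) → ℝ) ×
        (Fin (k + 2) → Fin (k + 1) → ℝ)))
      (θ := fun v => (v.1, (v.2.1, v.2.2 + fun b j => v.2.1 b * v.1.2 j)))
      (θ' := fun v => (v.1, (v.2.1, v.2.2 - fun b j => v.2.1 b * v.1.2 j)))
      (by fun_prop) (by fun_prop) (by intro v; simp) (by intro v; simp) ?_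
    · have : (volume : Measure ((ℝ × (Fin (k + 1) → ℝ)) × ((Fin (k + 2) → ℝ) ×
          (Fin (k + 2) → Fin (k + 1) → ℝ)))).IsAddHaarMeasure := by
        have := isAddHaarMeasure_volume_prod ℝ (Fin (k + 1) → ℝ)
        have := isAddHaarMeasure_volume_prod (Fin (k + 2) → ℝ) (Fin (k + 2) → Fin (k + 1) → ℝ)
        exact isAddHaarMeasure_volume_prod _ _
      have h4 : ∀ i : Fin (k + 2), Regularizable (fun a M =>
          coneChart i ((M 0 i)⁻¹ • fun j => M 0 (i.succAbove j)) *
            pairKernel (k + 1) ε₁ ε₂ a M) (fun a => (Gamma ((a.1 + a.2 + (k + 2) + rep (ε₁ + ε₂)) / 2))⁻¹ * 1 *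
            (1 * pairNorm k ε₁ ε₂ a)) {a | -1 < a.1.re ∧ -1 < a.2.re} := by
        intro i
        have hKm : ∀ a : ℂ × ℂ, Measurable fun v => pairKernel (k + 1) ε₁ ε₂ a
            ((pivotEquiv k i).symm v) := fun a => (measurable_pairKernel _ _ _ _).comp
          (pivotEquiv k i).symm.toContinuousLinearEquiv.continuous.measurable
        have h5 := Regularizable.blowUp hKm (contDiff_coneChart i) (hasCompactSupport_coneChart i)
          ((h3.const_mul_kernel (((-1) ^ (i : ℕ)) ^ ε₁.val * ((-1) ^ (i : ℕ)) ^ ε₂.val)).congr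
            (N' := (fun a => (Gamma ((a.1 + a.2 + (k + 2) + rep (ε₁ + ε₂)) / 2))⁻¹ * 1 *
            (1 * pairNorm k ε₁ ε₂ a))) ?_ ?_ fun _ => rfl)
        · have h6 := h5.of_linearEquiv (pivotEquiv k i).toContinuousLinearEquiv
          refine h6.congr ?_ (fun a _ => Eventually.of_forall fun M => ?_) fun _ => rfl
          · intro a
            refine Measurable.mul ((contDiff_coneChart i).continuous.measurable.comp ?_)
              (measurable_pairKernel _ _ _ _)
            fun_prop
          · change coneChart i _ * pairKernel (k + 1) ε₁ ε₂ a
              ((pivotEquiv k i).symm (pivotEquiv k i M)) = _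
            rw [LinearEquiv.symm_apply_apply]
            rfl
        · intro a
          refine (Measurable.mul ?_ ?_)
          · exact Complex.measurable_ofReal.comp ((continuous_abs.measurable.comp
              measurable_fst.fst).pow_const _)
          · exact (hKm a).comp (((measurable_fst.fst).prodMk
              (measurable_fst.fst.smul measurable_fst.snd)).prodMk measurable_snd)
        · intro a _
          filter_upwards [ae_fst_fst_ne_zero (W := (Fin (k + 2) → ℝ) ×
            (Fin (k + 2) → Fin (k + 1) → ℝ)) (k + 1)] with v hv
          rw [pairKernel_pivot ε₁ ε₂ a _ i hv v.1.2 (by simp [pivotEquiv]) (by simp [pivotEquiv])]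
          have h7 : sgnPow (ε₁ + ε₂) (a.1 + a.2 + (k + 2) - 1) v.1.1 =
              sgnPow (ε₁ + ε₂) (a.1 + a.2) v.1.1 * ((|v.1.1| ^ (k + 1) : ℝ) : ℂ) := by
            have h8 : ((|v.1.1| : ℝ) : ℂ) ≠ 0 := by simpa using hv
            unfold sgnPow
            rw [show a.1 + a.2 + (k + 2) - 1 = a.1 + a.2 + ((k + 1 : ℕ) : ℂ) by push_cast; ring,
              Complex.cpow_add _ _ h8, Complex.cpow_natCast]
            push_cast
            ring
          simp only [h7, mul_one, one_mul]
          have h9 : (fun (b : Fin (k + 2)) (j : Fin (k + 1)) =>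
              (pivotEquiv k i).symm ((v.1.1, v.1.1 • v.1.2), v.2) b.succ (i.succAbove j) -
              (pivotEquiv k i).symm ((v.1.1, v.1.1 • v.1.2), v.2) b.succ i * v.1.2 j) =
              v.2.2 - fun b j => v.2.1 b * v.1.2 j := by
            funext b j
            simp [pivotEquiv]
          rw [h9]
          ring
      refine (Regularizable.sum Finset.univ fun i _ => h4 i).congr (measurable_pairKernel _ _ _)
        (fun a _ => ?_) fun a => ?_
      · have h5 : ∀ᵐ M : Fin (k + 3) → Fin (k + 2) → ℝ, ∀ i, M 0 i ≠ 0 := by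
          rw [ae_all_iff]
          intro i
          let l : (Fin (k + 3) → Fin (k + 2) → ℝ) →ₗ[ℝ] ℝ :=
            { toFun := fun M => M 0 i, map_add' := fun _ _ => rfl, map_smul' := fun _ _ => rfl }
          refine ae_apply_ne_zero volume (l := l) fun h => ?_
          simpa [l] using LinearMap.congr_fun h fun _ _ => 1
        filter_upwards [h5] with M hM
        rw [← Finset.sum_mul, sum_coneChart hM, one_mul]
      · rw [pairNorm, pairNorm, Finset.prod_Icc_succ_top (b := k + 1) (by omega)]
        push_cast
        ring_nf
    · refine (MeasurePreserving.id volume).skew_product 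
        (g := fun (z : ℝ × (Fin (k + 1) → ℝ)) (w : (Fin (k + 2) → ℝ) ×
          (Fin (k + 2) → Fin (k + 1) → ℝ)) => (w.1, w.2 + fun b j => w.1 b * z.2 j))
        (by fun_prop) (Eventually.of_forall fun z => ?_)
      refine ((MeasurePreserving.id volume).skew_product 
        (g := fun (w : Fin (k + 2) → ℝ) (v : Fin (k + 2) → Fin (k + 1) → ℝ) =>
          v + fun b j => w b * z.2 j) (by fun_prop) (Eventually.of_forall fun w => ?_)).map_eq
      exact map_add_right_eq_self volume _

end PairKernel

section MatrixScaling

variable {ι κ : Type} [Fintype ι] [DecidableEq ι] [Fintype κ] [DecidableEq κ]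

theorem lintegral_comp_linearMap {E : Type} [NormedAddCommGroup E] [NormedSpace ℝ E]
    [MeasurableSpace E] [BorelSpace E] [FiniteDimensional ℝ E] (μ : Measure E) [μ.IsAddHaarMeasure]
    {f : E →ₗ[ℝ] E} (hf : LinearMap.det f ≠ 0) {G : E → ENNReal} (hG : Measurable G) :
    ENNReal.ofReal |LinearMap.det f| * ∫⁻ x, G (f x) ∂μ = ∫⁻ x, G x ∂μ := by
  have h1 : ∫⁻ x, G (f x) ∂μ = ∫⁻ x, G x ∂(μ.map f) :=
    (lintegral_map hG f.continuous_of_finiteDimensional.measurable).symm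
  rw [h1, Measure.map_linearMap_addHaar_eq_smul_addHaar μ hf, lintegral_smul_measure, smul_eq_mul,
    ← mul_assoc, ← ENNReal.ofReal_mul (abs_nonneg _), abs_inv, mul_inv_cancel₀ (abs_ne_zero.2 hf),
    ENNReal.ofReal_one, one_mul]

/-- The linear map `X ↦ A X` on matrices. -/
def mulLeftMap (κ : Type) (A : Matrix ι ι ℝ) : (ι → κ → ℝ) →ₗ[ℝ] (ι → κ → ℝ) where
  toFun X := A * Matrix.of X
  map_add' X Y := Matrix.mul_add A (Matrix.of X) (Matrix.of Y)
  map_smul' c X := Matrix.mul_smul A c (Matrix.of X)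

/-- The linear map `X ↦ X A` on matrices. -/
def mulRightMap (ι : Type) (A : Matrix κ κ ℝ) : (ι → κ → ℝ) →ₗ[ℝ] (ι → κ → ℝ) where
  toFun X := (Matrix.of X * A : Matrix ι κ ℝ)
  map_add' X Y := Matrix.add_mul (Matrix.of X) (Matrix.of Y) A
  map_smul' c X := Matrix.smul_mul c (Matrix.of X) A

theorem mulLeftMap_apply (A : Matrix ι ι ℝ) (X : ι → κ → ℝ) (i : ι) (j : κ) :
    mulLeftMap κ A X i j = ∑ l, A i l * X l j := rfl

theorem mulRightMap_apply (A : Matrix κ κ ℝ) (X : ι → κ → ℝ) (i : ι) (j : κ) :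
    mulRightMap ι A X i j = ∑ l, X i l * A l j := rfl

theorem det_mulRightMap (A : Matrix κ κ ℝ) :
    LinearMap.det (mulRightMap ι A) = A.det ^ Fintype.card ι := by
  have h : mulRightMap ι A = LinearMap.pi fun i =>
      (Matrix.toLin' A.transpose).comp (LinearMap.proj i) := by
    refine LinearMap.ext fun X => ?_
    funext i j
    simp [mulRightMap_apply, Matrix.mulVec, dotProduct, mul_comm]
  rw [h, LinearMap.det_pi]
  simp

theorem det_mulLeftMap (A : Matrix ι ι ℝ) :
    LinearMap.det (mulLeftMap κ A) = A.det ^ Fintype.card κ := by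
  let e : (ι → κ → ℝ) ≃ₗ[ℝ] (κ → ι → ℝ) :=
    { toFun := fun X j i => X i j
      map_add' := fun _ _ => rfl
      map_smul' := fun _ _ => rfl
      invFun := fun X i j => X j i
      left_inv := fun _ => rfl
      right_inv := fun _ => rfl }
  have h : e.toLinearMap ∘ₗ mulLeftMap κ A ∘ₗ e.symm.toLinearMap =
      mulRightMap κ A.transpose := by
    refine LinearMap.ext fun X => ?_
    funext j i
    simp [e, mulRightMap_apply, mulLeftMap_apply, mul_comm]
  rw [← LinearMap.det_conj _ e, h, det_mulRightMap, Matrix.det_transpose]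

theorem lintegral_mulRight (A : Matrix κ κ ℝ) (hA : A.det ≠ 0) {G : (ι → κ → ℝ) → ENNReal}
    (hG : Measurable G) : ENNReal.ofReal (|A.det| ^ Fintype.card ι) *
      ∫⁻ X : ι → κ → ℝ, G (mulRightMap ι A X) = ∫⁻ X, G X := by
  have h := lintegral_comp_linearMap (volume : Measure (ι → κ → ℝ)) (f := mulRightMap ι A)
    (by rw [det_mulRightMap]; exact pow_ne_zero _ hA) hG
  rwa [det_mulRightMap, abs_pow] at h

theorem lintegral_mulLeft (A : Matrix ι ι ℝ) (hA : A.det ≠ 0) {G : (ι → κ → ℝ) → ENNReal}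
    (hG : Measurable G) : ENNReal.ofReal (|A.det| ^ Fintype.card κ) *
      ∫⁻ X : ι → κ → ℝ, G (mulLeftMap κ A X) = ∫⁻ X, G X := by
  have h := lintegral_comp_linearMap (volume : Measure (ι → κ → ℝ)) (f := mulLeftMap κ A)
    (by rw [det_mulLeftMap]; exact pow_ne_zero _ hA) hG
  rwa [det_mulLeftMap, abs_pow] at h

end MatrixScaling

section FlagKernel

variable {k : ℕ}

/-- A smooth positive function on `ℝ` that is the identity near `1`. -/
def posIdent (x : ℝ) : ℝ :=
  1 + (⟨1 / 4, 1 / 2, by norm_num, by norm_num⟩ : ContDiffBump (1 : ℝ)) x * (x - 1)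

theorem contDiff_posIdent : ContDiff ℝ ∞ posIdent :=
  contDiff_const.add ((ContDiffBump.contDiff _).mul (contDiff_id.sub contDiff_const))

theorem posIdent_pos (x : ℝ) : 0 < posIdent x := by
  unfold posIdent
  set b : ContDiffBump (1 : ℝ) := ⟨1 / 4, 1 / 2, by norm_num, by norm_num⟩ with hb
  by_cases hx : dist x 1 < 1 / 2
  · have h1 : b x ≤ 1 := b.le_one
    have h0 : 0 ≤ b x := b.nonneg
    rw [Real.dist_eq, abs_lt] at hx
    nlinarith
  · have h2 : b x = 0 := b.zero_of_le_dist (by simpa [hb] using not_lt.1 hx)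
    rw [h2]
    norm_num

theorem posIdent_eq {x : ℝ} (hx : dist x 1 ≤ 1 / 4) : posIdent x = x := by
  unfold posIdent
  rw [ContDiffBump.one_of_mem_closedBall _ (by simpa using hx)]
  ring

/-- The inverse of the matrix with the rows `e₁, …, e_k` of the identity matrix and the last row
`e`. -/
def rowShear (e : Fin (k + 1) → ℝ) : Matrix (Fin (k + 1)) (Fin (k + 1)) ℝ :=
  (1 : Matrix (Fin (k + 1)) (Fin (k + 1)) ℝ).updateRow (Fin.last k)
    (Fin.snoc (fun j => -e j.castSucc / posIdent (e (Fin.last k))) (posIdent (e (Fin.last k)))⁻¹)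

theorem det_rowShear (e : Fin (k + 1) → ℝ) :
    (rowShear e).det = (posIdent (e (Fin.last k)))⁻¹ := by
  rw [rowShear, Matrix.det_of_isLowerTriangular]
  · rw [Finset.prod_eq_single (Fin.last k)]
    · simp
    · intro b _ hb
      simp [hb]
    · simp
  · intro i j hij
    have hi : i ≠ Fin.last k := fun h => by
      subst h
      exact absurd (Fin.le_last j) (not_le.2 (by simpa using hij))
    have hij' : i < j := by simpa using hij
    simp [hi, hij'.ne]

/-- The kernel in terms of the determinant and the upper left minor of a square matrix. -/
def flagKernel (k : ℕ) (ε₁ ε₂ : ZMod 2) (a : ℂ × ℂ) (Y : Sq (Fin (k + 1))) : ℂ :=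
  sgnPow ε₁ a.1 (Matrix.of Y).det *
    sgnPow ε₂ a.2 (Matrix.of fun i j : Fin k => Y i.castSucc j.castSucc).det

theorem measurable_flagKernel (k : ℕ) (ε₁ ε₂ : ZMod 2) (a : ℂ × ℂ) :
    Measurable (flagKernel k ε₁ ε₂ a) := by
  have h1 : Continuous fun Y : Sq (Fin (k + 1)) => (Matrix.of Y).det :=
    Continuous.matrix_det continuous_id
  have h2 : Continuous fun Y : Sq (Fin (k + 1)) =>
      (Matrix.of fun i j : Fin k => Y i.castSucc j.castSucc).det :=
    Continuous.matrix_det (by fun_prop)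
  exact ((measurable_sgnPow _ _).comp h1.measurable).mul
    ((measurable_sgnPow _ _).comp h2.measurable)

theorem contDiff_rowShear (i j : Fin (k + 1)) :
    ContDiff ℝ ∞ fun e : Fin (k + 1) → ℝ => rowShear e i j := by
  have hp : ContDiff ℝ ∞ fun e : Fin (k + 1) → ℝ => posIdent (e (Fin.last k)) :=
    contDiff_posIdent.comp (contDiff_apply ℝ ℝ _)
  have hp0 : ∀ e : Fin (k + 1) → ℝ, posIdent (e (Fin.last k)) ≠ 0 := fun e => (posIdent_pos _).ne'
  by_cases hi : i = Fin.last k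
  · subst hi
    refine Fin.lastCases ?_ (fun j => ?_) j
    · simp only [rowShear, Matrix.updateRow_self, Fin.snoc_last]
      exact hp.inv hp0
    · simp only [rowShear, Matrix.updateRow_self, Fin.snoc_castSucc]
      exact (contDiff_apply ℝ ℝ j.castSucc).neg.div hp hp0
  · simpa [rowShear, hi] using contDiff_const

theorem det_last_row_single (A : Matrix (Fin (k + 1)) (Fin (k + 1)) ℝ)
    (h : ∀ j, A (Fin.last k) j = Pi.single (M := fun _ => ℝ) (Fin.last k) 1 j) :
    A.det = (Matrix.of fun i j : Fin k => A i.castSucc j.castSucc).det := by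
  rw [Matrix.det_succ_row _ (Fin.last k), Finset.sum_eq_single (Fin.last k)]
  · rw [h]
    simp only [Fin.val_last, ← two_mul, pow_mul, neg_one_sq, one_pow, Pi.single_eq_same, one_mul,
      Fin.succAbove_last]
    rfl
  · intro j _ hj
    simp [h, hj]
  · simp

theorem pairKernel_snoc (ε₁ ε₂ : ZMod 2) (a : ℂ × ℂ) (Y : Sq (Fin (k + 1)))
    (e : Fin (k + 1) → ℝ) (he : dist (e (Fin.last k)) 1 ≤ 1 / 4) :
    pairKernel k ε₁ ε₂ a (Fin.snoc (α := fun _ => Fin (k + 1) → ℝ) Y e) =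
      ((posIdent (e (Fin.last k)) : ℝ) : ℂ) ^ (a.1 + a.2) *
        flagKernel k ε₁ ε₂ a (mulRightMap _ (rowShear e) Y) := by
  have hp := posIdent_pos (e (Fin.last k))
  have hpe := posIdent_eq he
  set l := posIdent (e (Fin.last k)) with hl
  have hdet : (rowShear e).det = l⁻¹ := det_rowShear e
  have key : ∀ Z : Matrix (Fin (k + 1)) (Fin (k + 1)) ℝ, Z.det = l * (Z * rowShear e).det := by
    intro Z
    rw [Matrix.det_mul, hdet]
    field_simp
  have hR : ∀ (v : Fin (k + 1) → ℝ) (j : Fin (k + 1)), ∑ b, v b * rowShear e b j =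
      (Fin.snoc (α := fun _ => ℝ) (fun j : Fin k => v j.castSucc + v (Fin.last k) *
        (-e j.castSucc / l)) (v (Fin.last k) * l⁻¹)) j := by
    intro v j
    rw [Fin.sum_univ_castSucc]
    refine Fin.lastCases ?_ (fun j => ?_) j
    · simp [rowShear, hl]
    · simp [rowShear, Matrix.one_apply, hl]
  have h1 : detDropLast (Fin.snoc (α := fun _ => Fin (k + 1) → ℝ) Y e) =
      l * (Matrix.of (mulRightMap _ (rowShear e) Y)).det := by
    have h2 : (Matrix.of fun a : Fin (k + 1) =>
        (Fin.snoc (α := fun _ => Fin (k + 1) → ℝ) Y e : Fin (k + 2) → Fin (k + 1) → ℝ)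
          a.castSucc) = Matrix.of Y := by
      ext i j
      simp
    rw [detDropLast, h2]
    exact key _
  have h2 : detDropPrev (Fin.snoc (α := fun _ => Fin (k + 1) → ℝ) Y e) =
      l * (Matrix.of fun i j : Fin k =>
        mulRightMap _ (rowShear e) Y i.castSucc j.castSucc).det := by
    rw [detDropPrev, key, det_last_row_single]
    · congr 3
      ext i j
      change ∑ b : Fin (k + 1), _ = ∑ b : Fin (k + 1), _
      refine Finset.sum_congr rfl fun b _ => ?_
      have h4 : (Fin.snoc (α := fun _ => Fin (k + 1) → ℝ) Y e : Fin (k + 2) → Fin (k + 1) → ℝ)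
          ((Fin.last k).castSucc.succAbove i.castSucc) b = Y i.castSucc b := by
        rw [Fin.succAbove_of_castSucc_lt _ _ (by simp [Fin.lt_def]), Fin.snoc_castSucc]
      exact congrArg (· * rowShear e b j.castSucc) h4
    · intro j
      have h3 : (Fin.last k).castSucc.succAbove (Fin.last k) = Fin.last (k + 1) := by
        rw [Fin.succAbove_of_le_castSucc _ _ le_rfl, Fin.succ_last]
      simp only [Matrix.mul_apply, Matrix.of_apply, h3, Fin.snoc_last]
      rw [hR]
      refine Fin.lastCases ?_ (fun j => ?_) j
      · simp [← hpe, hp.ne']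
      · simp only [Fin.snoc_castSucc]
        rw [← hpe, Pi.single_eq_of_ne (Fin.castSucc_lt_last j).ne]
        field_simp
        ring
  have h3 : ∀ ε μ, sgnPow ε μ l = (l : ℂ) ^ μ := by
    intro ε μ
    simp [sgnPow, Real.sign_of_pos hp, abs_of_pos hp]
  rw [pairKernel, flagKernel, h1, h2, sgnPow_mul, sgnPow_mul, h3, h3,
    Complex.cpow_add _ _ (by exact_mod_cast hp.ne')]
  ring

theorem regularizable_flagKernel (k : ℕ) (ε₁ ε₂ : ZMod 2) :
    Regularizable (flagKernel k ε₁ ε₂) (pairNorm k ε₁ ε₂) {a | -1 < a.1.re ∧ -1 < a.2.re} := by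
  let L : (Sq (Fin (k + 1)) × (Fin (k + 1) → ℝ)) ≃ₗ[ℝ]
      (Fin (k + 2) → Fin (k + 1) → ℝ) :=
    { toFun := fun v => Fin.snoc (α := fun _ => Fin (k + 1) → ℝ) v.1 v.2
      map_add' := by
        intro v w
        funext b
        refine Fin.lastCases ?_ (fun b => ?_) b <;> simp
      map_smul' := by
        intro c v
        funext b
        refine Fin.lastCases ?_ (fun b => ?_) b <;> simp
      invFun := fun M => (fun b => M b.castSucc, M (Fin.last _))
      left_inv := by intro v; simp
      right_inv := by
        intro M
        funext b
        refine Fin.lastCases ?_ (fun b => ?_) b <;> simp }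
  have := isAddHaarMeasure_volume_prod (Sq (Fin (k + 1))) (Fin (k + 1) → ℝ)
  have h1 := (regularizable_pairKernel k ε₁ ε₂).of_linearEquiv L.toContinuousLinearEquiv
  let ρ : ContDiffBump (fun _ => 1 : Fin (k + 1) → ℝ) := ⟨1 / 8, 1 / 4, by norm_num, by norm_num⟩
  have hρ : ∀ e, ρ e ≠ 0 → dist (e (Fin.last k)) 1 ≤ 1 / 4 := by
    intro e he
    by_contra! hcon
    exact he (ρ.zero_of_le_dist (hcon.le.trans (dist_le_pi_dist e (fun _ => 1) (Fin.last k))))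
  let l : (Fin (k + 1) → ℝ) → ℝ := fun e => posIdent (e (Fin.last k))
  have hl0 : ∀ e, 0 < l e := fun e => posIdent_pos _
  have hl : ContDiff ℝ ∞ l := contDiff_posIdent.comp (contDiff_apply ℝ ℝ _)
  have hRc : Continuous fun e : Fin (k + 1) → ℝ => rowShear e :=
    continuous_pi fun i => continuous_pi fun j => (contDiff_rowShear i j).continuous
  let θ : Sq (Fin (k + 1)) × (Fin (k + 1) → ℝ) → Sq (Fin (k + 1)) :=
    fun v => mulRightMap _ (rowShear v.2) v.1
  have hθ : ContDiff ℝ ∞ θ := by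
    refine contDiff_pi.2 fun i => contDiff_pi.2 fun j => ?_
    change ContDiff ℝ ∞ fun v : Sq (Fin (k + 1)) × (Fin (k + 1) → ℝ) =>
      ∑ b, v.1 i b * rowShear v.2 b j
    refine ContDiff.sum fun b _ => ContDiff.mul ?_ ?_
    · exact (contDiff_apply_apply ℝ ℝ i b).comp contDiff_fst
    · exact (contDiff_rowShear b j).comp contDiff_snd
  let m : (ℂ × ℂ) × Sq (Fin (k + 1)) × (Fin (k + 1) → ℝ) → ℂ := fun z =>
    ((ρ z.2.2 * (l z.2.2)⁻¹ ^ (k + 1) : ℝ) : ℂ) * Complex.exp (-(z.1.1 + z.1.2) *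
      ((Real.log (l z.2.2) : ℝ) : ℂ))
  have hm : HolSmooth m := by
    refine HolSmooth.mul ?_ (HolSmooth.cexp (HolSmooth.mul ?_ ?_))
    · refine HolSmooth.of_right (f := fun v : Sq (Fin (k + 1)) ×
        (Fin (k + 1) → ℝ) => ((ρ v.2 * (l v.2)⁻¹ ^ (k + 1) : ℝ) : ℂ)) ?_
      refine Complex.ofRealCLM.contDiff.comp ((ρ.contDiff.comp contDiff_snd).mul
        (((hl.comp contDiff_snd).inv fun v => (hl0 _).ne').pow _))
    · exact HolSmooth.of_left (f := fun a : ℂ × ℂ => -(a.1 + a.2)) (by fun_prop)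
    · refine HolSmooth.of_right (f := fun v : Sq (Fin (k + 1)) ×
        (Fin (k + 1) → ℝ) => ((Real.log (l v.2) : ℝ) : ℂ)) ?_
      exact Complex.ofRealCLM.contDiff.comp ((hl.comp contDiff_snd).log fun v => (hl0 _).ne')
  have hρi : Integrable fun e => ρ e := ρ.integrable
  have hρ0 : 0 < ∫ e, ρ e := ρ.integral_pos
  let c : ENNReal := ENNReal.ofReal (∫ e, ρ e)
  have hc0 : c ≠ 0 := by simpa [c] using hρ0
  refine Regularizable.of_const_mul (c := ((∫ e, ρ e : ℝ) : ℂ)) (by exact_mod_cast hρ0.ne')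
    (h1.transport (measurable_flagKernel k ε₁ ε₂) hθ hm ?_ _ ?_)
  · intro s hs
    refine ⟨(fun z : Sq (Fin (k + 1)) × (Fin (k + 1) → ℝ) =>
      ((mulRightMap (Fin (k + 1)) (l z.2 • (rowShear z.2).adjugate) z.1 :
        Fin (k + 1) → Fin (k + 1) → ℝ), z.2)) '' (s ×ˢ tsupport ρ),
      (hs.prod ρ.hasCompactSupport).image ?_, ?_⟩
    · refine Continuous.prodMk ?_ continuous_snd
      have hadj : Continuous fun z : Sq (Fin (k + 1)) × (Fin (k + 1) → ℝ) =>
          l z.2 • (rowShear z.2).adjugate :=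
        (hl.continuous.comp continuous_snd).smul (hRc.comp continuous_snd).matrix_adjugate
      exact (continuous_fst (X := Matrix (Fin (k + 1)) (Fin (k + 1)) ℝ)).matrix_mul hadj
    · intro a v hv
      by_contra! hcon
      refine hv ⟨(θ v, v.2), ⟨hcon.2, ?_⟩, ?_⟩
      · by_contra h'
        refine hcon.1 ?_
        simp only [m, image_eq_zero_of_notMem_tsupport h']
        simp
      · refine Prod.ext ?_ rfl
        change (Matrix.of v.1 * rowShear v.2) * (l v.2 • (rowShear v.2).adjugate) = Matrix.of v.1
        rw [Matrix.mul_smul, Matrix.mul_assoc, Matrix.mul_adjugate, det_rowShear, Matrix.mul_smul,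
          smul_smul, mul_inv_cancel₀ (hl0 v.2).ne', one_smul, mul_one]
  · intro a _ φ hφ hi
    have hw0 : ∀ e, 0 ≤ ρ e * (l e)⁻¹ ^ (k + 1) := fun e =>
      mul_nonneg ρ.nonneg (pow_nonneg (inv_nonneg.2 (hl0 e).le) _)
    have hwm : Measurable fun e => Real.toNNReal (ρ e * (l e)⁻¹ ^ (k + 1)) :=
      ((ρ.continuous.measurable).mul ((hl.continuous.measurable.inv).pow_const _)).real_toNNReal
    have key := integrable_integral_of_lintegral (μ := volume) (ν := volume) hθ.continuous.measurable
      (w := fun v => Real.toNNReal (ρ v.2 * (l v.2)⁻¹ ^ (k + 1))) (hwm.comp measurable_snd)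
      hc0 ENNReal.ofReal_ne_top ?_
      (((measurable_flagKernel k ε₁ ε₂ a).mul hφ).aestronglyMeasurable)
    · have e : (fun v => pairKernel k ε₁ ε₂ a (L v) * (m (a, v) * φ (θ v))) = fun v =>
          (((Real.toNNReal (ρ v.2 * (l v.2)⁻¹ ^ (k + 1)) : NNReal) : ℝ) : ℂ) *
            (flagKernel k ε₁ ε₂ a (θ v) * φ (θ v)) := by
        funext v
        simp only [Real.coe_toNNReal _ (hw0 _), m]
        by_cases hv : ρ v.2 = 0
        · simp [hv]
        · have h2 : pairKernel k ε₁ ε₂ a (L v) = _ := pairKernel_snoc ε₁ ε₂ a v.1 v.2 (hρ _ hv)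
          rw [h2, Complex.cpow_def_of_ne_zero (by exact_mod_cast (posIdent_pos _).ne'),
            ← Complex.ofReal_log (posIdent_pos _).le]
          have h3 : Complex.exp (((Real.log (l v.2) : ℝ) : ℂ) * (a.1 + a.2)) *
              Complex.exp (-(a.1 + a.2) * ((Real.log (l v.2) : ℝ) : ℂ)) = 1 := by
            rw [← Complex.exp_add, ← Complex.exp_zero]
            congr 1
            ring
          linear_combination (((ρ v.2 * (l v.2)⁻¹ ^ (k + 1) : ℝ) : ℂ) *
            (flagKernel k ε₁ ε₂ a (θ v) * φ (θ v))) * h3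
      refine ⟨key.1.1 ?_, ?_⟩
      · exact hi.congr (Eventually.of_forall fun v => congrFun e v)
      · have h4 := key.2
        rw [ENNReal.toReal_ofReal hρ0.le] at h4
        exact (integral_congr_ae (Eventually.of_forall fun v => congrFun e v)).trans h4
    · intro G hG
      have hm1 : Measurable fun v : Sq (Fin (k + 1)) × (Fin (k + 1) → ℝ) =>
          ((Real.toNNReal (ρ v.2 * (l v.2)⁻¹ ^ (k + 1)) : NNReal) : ENNReal) * G (θ v) :=
        ((hwm.comp measurable_snd).coe_nnreal_ennreal).mul (hG.comp hθ.continuous.measurable)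
      rw [Measure.volume_eq_prod, lintegral_prod_symm _ hm1.aemeasurable]
      have h5 : ∀ e, ∫⁻ Y, ((Real.toNNReal (ρ e * (l e)⁻¹ ^ (k + 1)) : NNReal) : ENNReal) *
          G (θ (Y, e)) = ENNReal.ofReal (ρ e) * ∫⁻ Y, G Y := by
        intro e
        rw [lintegral_const_mul' _ _ ENNReal.coe_ne_top, ← lintegral_mulRight (rowShear e)
          (by rw [det_rowShear]; exact inv_ne_zero (hl0 e).ne') hG, ← mul_assoc, det_rowShear,
          Fintype.card_fin, ← ENNReal.ofReal_mul ρ.nonneg, abs_of_pos (inv_pos.2 (posIdent_pos _))]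
        rfl
      simp_rw [h5]
      rw [lintegral_mul_const _ ρ.continuous.measurable.ennreal_ofReal,
        ← ofReal_integral_eq_lintegral_ofReal hρi (Eventually.of_forall fun _ => ρ.nonneg)]

end FlagKernel

section Blocks

variable {α β γ δ : Type} [Fintype α] [DecidableEq α] [Fintype β] [DecidableEq β]
  [Fintype γ] [DecidableEq γ] [Fintype δ] [DecidableEq δ]

/-- The product of matrices, for matrices as elements of a normed space of functions. -/
def mmul (X : α → β → ℝ) (Y : β → γ → ℝ) : α → γ → ℝ := fun i k => ∑ j, X i j * Y j k

/-- The identity matrix. -/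
def mone (α : Type) [DecidableEq α] : Sq α := (1 : Matrix α α ℝ)

theorem mone_apply (i j : α) : mone α i j = if i = j then 1 else 0 := Matrix.one_apply

theorem mmul_assoc (X : α → β → ℝ) (Y : β → γ → ℝ) (Z : γ → δ → ℝ) :
    mmul (mmul X Y) Z = mmul X (mmul Y Z) :=
  Matrix.mul_assoc (Matrix.of X) (Matrix.of Y) (Matrix.of Z)

theorem mone_mmul (X : α → β → ℝ) : mmul (mone α) X = X := Matrix.one_mul (Matrix.of X)

theorem mmul_mone (X : α → β → ℝ) : mmul X (mone β) = X := Matrix.mul_one (Matrix.of X)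

theorem mmul_zero (X : α → β → ℝ) : mmul X (0 : β → γ → ℝ) = 0 := Matrix.mul_zero (Matrix.of X)

theorem zero_mmul (X : β → γ → ℝ) : mmul (0 : α → β → ℝ) X = 0 := Matrix.zero_mul (Matrix.of X)

/-- The determinant. -/
def mdet (X : Sq α) : ℝ := (Matrix.of X).det

theorem mdet_mmul (X Y : Sq α) : mdet (mmul X Y) = mdet X * mdet Y :=
  Matrix.det_mul (Matrix.of X) (Matrix.of Y)

theorem mdet_mone : mdet (mone α) = 1 := Matrix.det_one

/-- The inverse matrix. -/
def minv (X : Sq α) : Sq α := ((Matrix.of X)⁻¹ : Matrix α α ℝ)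

theorem mmul_minv {X : Sq α} (h : mdet X ≠ 0) : mmul X (minv X) = mone α :=
  Matrix.mul_nonsing_inv _ (isUnit_iff_ne_zero.2 h)

theorem minv_mmul {X : Sq α} (h : mdet X ≠ 0) : mmul (minv X) X = mone α :=
  Matrix.nonsing_inv_mul _ (isUnit_iff_ne_zero.2 h)

theorem mdet_minv (X : Sq α) : mdet (minv X) = (mdet X)⁻¹ := by
  rw [← Ring.inverse_eq_inv']
  exact Matrix.det_nonsing_inv (Matrix.of X)

/-- A matrix from blocks. -/
def blk (A : α → γ → ℝ) (Y : α → δ → ℝ) (C : β → γ → ℝ) (D : β → δ → ℝ) : α ⊕ β → γ ⊕ δ → ℝ :=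
  Matrix.fromBlocks A Y C D

/-- The upper left block. -/
def blk₁₁ (M : α ⊕ β → γ ⊕ δ → ℝ) : α → γ → ℝ := fun i j => M (Sum.inl i) (Sum.inl j)

/-- The lower left block. -/
def blk₂₁ (M : α ⊕ β → γ ⊕ δ → ℝ) : β → γ → ℝ := fun i j => M (Sum.inr i) (Sum.inl j)

/-- The upper right block. -/
def blk₁₂ (M : α ⊕ β → γ ⊕ δ → ℝ) : α → δ → ℝ := fun i j => M (Sum.inl i) (Sum.inr j)

/-- The lower right block. -/
def blk₂₂ (M : α ⊕ β → γ ⊕ δ → ℝ) : β → δ → ℝ := fun i j => M (Sum.inr i) (Sum.inr j)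

@[simp] theorem blk₁₁_blk (A : α → γ → ℝ) (Y : α → δ → ℝ) (C : β → γ → ℝ) (D : β → δ → ℝ) :
    blk₁₁ (blk A Y C D) = A := rfl

@[simp] theorem blk₁₂_blk (A : α → γ → ℝ) (Y : α → δ → ℝ) (C : β → γ → ℝ) (D : β → δ → ℝ) :
    blk₁₂ (blk A Y C D) = Y := rfl

@[simp] theorem blk₂₁_blk (A : α → γ → ℝ) (Y : α → δ → ℝ) (C : β → γ → ℝ) (D : β → δ → ℝ) :
    blk₂₁ (blk A Y C D) = C := rfl

@[simp] theorem blk₂₂_blk (A : α → γ → ℝ) (Y : α → δ → ℝ) (C : β → γ → ℝ) (D : β → δ → ℝ) :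
    blk₂₂ (blk A Y C D) = D := rfl

theorem blk_eta (M : α ⊕ β → γ ⊕ δ → ℝ) : blk (blk₁₁ M) (blk₁₂ M) (blk₂₁ M) (blk₂₂ M) = M :=
  Matrix.fromBlocks_toBlocks (Matrix.of M)

theorem mmul_blk {α' β' : Type} (A : α' → α → ℝ) (Y : α' → β → ℝ) (C : β' → α → ℝ)
    (D : β' → β → ℝ) (A' : α → γ → ℝ) (Y' : α → δ → ℝ) (C' : β → γ → ℝ) (D' : β → δ → ℝ) :
    mmul (blk A Y C D) (blk A' Y' C' D') = blk (mmul A A' + mmul Y C') (mmul A Y' + mmul Y D')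
      (mmul C A' + mmul D C') (mmul C Y' + mmul D D') :=
  Matrix.fromBlocks_multiply (Matrix.of A) (Matrix.of Y) (Matrix.of C) (Matrix.of D) _ _ _ _

theorem mdet_blk_zero (A : Sq α) (Y : α → β → ℝ) (D : Sq β) :
    mdet (blk A Y 0 D) = mdet A * mdet D := Matrix.det_fromBlocks_zero₂₁ _ _ _

section Continuity

variable {Z : Type} [TopologicalSpace Z]

@[fun_prop] theorem Continuous.mmul {f : Z → α → β → ℝ} {g : Z → β → γ → ℝ} (hf : Continuous f)
    (hg : Continuous g) : Continuous fun z => mmul (f z) (g z) := by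
  unfold GLBranching.mmul
  fun_prop

@[fun_prop] theorem Continuous.mdet {f : Z → Sq α} (hf : Continuous f) :
    Continuous fun z => mdet (f z) := _root_.Continuous.matrix_det hf

@[fun_prop] theorem Continuous.blk₁₁ {f : Z → α ⊕ β → γ ⊕ δ → ℝ} (hf : Continuous f) :
    Continuous fun z => blk₁₁ (f z) := by unfold GLBranching.blk₁₁; fun_prop

@[fun_prop] theorem Continuous.blk₁₂ {f : Z → α ⊕ β → γ ⊕ δ → ℝ} (hf : Continuous f) :
    Continuous fun z => blk₁₂ (f z) := by unfold GLBranching.blk₁₂; fun_prop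

@[fun_prop] theorem Continuous.blk₂₁ {f : Z → α ⊕ β → γ ⊕ δ → ℝ} (hf : Continuous f) :
    Continuous fun z => blk₂₁ (f z) := by unfold GLBranching.blk₂₁; fun_prop

@[fun_prop] theorem Continuous.blk₂₂ {f : Z → α ⊕ β → γ ⊕ δ → ℝ} (hf : Continuous f) :
    Continuous fun z => blk₂₂ (f z) := by unfold GLBranching.blk₂₂; fun_prop

end Continuity

section Measurability

variable {Z : Type} [MeasurableSpace Z]

@[fun_prop] theorem Measurable.mmul {f : Z → α → β → ℝ} {g : Z → β → γ → ℝ} (hf : Measurable f)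
    (hg : Measurable g) : Measurable fun z => mmul (f z) (g z) := by
  unfold GLBranching.mmul
  fun_prop

@[fun_prop] theorem Measurable.mdet {f : Z → Sq α} (hf : Measurable f) :
    Measurable fun z => mdet (f z) :=
  (show Continuous (GLBranching.mdet (α := α)) by fun_prop).measurable.comp hf

@[fun_prop] theorem Measurable.minv {f : Z → Sq α} (hf : Measurable f) :
    Measurable fun z => minv (f z) := by
  have h : (fun z => GLBranching.minv (f z)) = fun z i j => (GLBranching.mdet (f z))⁻¹ *
      (Matrix.of (f z)).adjugate i j := by
    funext z i j
    rw [GLBranching.minv, Matrix.inv_def, Ring.inverse_eq_inv']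
    rfl
  rw [h]
  have hadj : Continuous fun X : Sq α => (Matrix.of X).adjugate :=
    _root_.Continuous.matrix_adjugate continuous_id
  refine measurable_pi_lambda _ fun i => measurable_pi_lambda _ fun j => Measurable.mul ?_ ?_
  · fun_prop
  · exact ((hadj.matrix_elem i j).measurable).comp hf

@[fun_prop] theorem Measurable.blk {A : Z → α → γ → ℝ} {Y : Z → α → δ → ℝ} {C : Z → β → γ → ℝ}
    {D : Z → β → δ → ℝ} (hA : Measurable A) (hY : Measurable Y) (hC : Measurable C)
    (hD : Measurable D) : Measurable fun z => blk (A z) (Y z) (C z) (D z) := by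
  refine measurable_pi_lambda _ fun i => measurable_pi_lambda _ fun j => ?_
  rcases i with i | i <;> rcases j with j | j
  · exact (measurable_pi_apply j).comp ((measurable_pi_apply i).comp hA)
  · exact (measurable_pi_apply j).comp ((measurable_pi_apply i).comp hY)
  · exact (measurable_pi_apply j).comp ((measurable_pi_apply i).comp hC)
  · exact (measurable_pi_apply j).comp ((measurable_pi_apply i).comp hD)

@[fun_prop] theorem Measurable.blk₁₁ {f : Z → α ⊕ β → γ ⊕ δ → ℝ} (hf : Measurable f) :
    Measurable fun z => blk₁₁ (f z) := by unfold GLBranching.blk₁₁; fun_prop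

@[fun_prop] theorem Measurable.blk₂₁ {f : Z → α ⊕ β → γ ⊕ δ → ℝ} (hf : Measurable f) :
    Measurable fun z => blk₂₁ (f z) := by unfold GLBranching.blk₂₁; fun_prop

@[fun_prop] theorem Measurable.blk₂₂ {f : Z → α ⊕ β → γ ⊕ δ → ℝ} (hf : Measurable f) :
    Measurable fun z => blk₂₂ (f z) := by unfold GLBranching.blk₂₂; fun_prop

end Measurability

/-- The power `|det X|^{-b}`. -/
def dpow (b : ℕ) (X : Sq α) : NNReal := (‖mdet X‖₊ ^ b)⁻¹

@[fun_prop] theorem Measurable.dpow {Z : Type} [MeasurableSpace Z] (b : ℕ) {f : Z → Sq α}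
    (hf : Measurable f) : Measurable fun z => dpow b (f z) := by
  unfold GLBranching.dpow
  fun_prop

theorem dpow_mmul (b : ℕ) (X Y : Sq α) : dpow b (mmul X Y) = dpow b X * dpow b Y := by
  simp [dpow, mdet_mmul, mul_pow, mul_comm]

theorem dpow_ne_zero {b : ℕ} {X : Sq α} (h : mdet X ≠ 0) : dpow b X ≠ 0 := by
  simp [dpow, h]

theorem coe_dpow (b : ℕ) (X : Sq α) : (dpow b X : ℝ) = (|mdet X| ^ b)⁻¹ := by
  simp [dpow]

theorem dpow_mul_ofReal (b : ℕ) {A : Sq α} (hA : mdet A ≠ 0) :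
    (dpow b A : ENNReal) * ENNReal.ofReal (|mdet A| ^ b) = 1 := by
  rw [ENNReal.ofReal, ← ENNReal.coe_mul]
  norm_cast
  ext
  rw [NNReal.coe_mul, coe_dpow, Real.coe_toNNReal _ (by positivity)]
  exact inv_mul_cancel₀ (pow_ne_zero _ (abs_ne_zero.2 hA))

theorem lintegral_mmul_left {A : Sq α} (hA : mdet A ≠ 0) {G : (α → γ → ℝ) → ENNReal}
    (hG : Measurable G) : ∫⁻ X, G (mmul A X) = dpow (Fintype.card γ) A * ∫⁻ X, G X := by
  rw [← lintegral_mulLeft (Matrix.of A) hA hG, ← mul_assoc]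
  exact ((congrArg (· * _) (dpow_mul_ofReal _ hA)).trans (one_mul _)).symm

theorem lintegral_mmul_right {A : Sq α} (hA : mdet A ≠ 0) {G : (γ → α → ℝ) → ENNReal}
    (hG : Measurable G) : ∫⁻ X, G (mmul X A) = dpow (Fintype.card γ) A * ∫⁻ X, G X := by
  rw [← lintegral_mulRight (Matrix.of A) hA hG, ← mul_assoc]
  exact ((congrArg (· * _) (dpow_mul_ofReal _ hA)).trans (one_mul _)).symm

theorem measurePreserving_sumElim (α γ δ : Type) [Fintype α] [Fintype γ]
    [Fintype δ] :
    MeasurePreserving (fun z : (α → γ → ℝ) × (α → δ → ℝ) => fun i =>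
      (Sum.elim (z.1 i) (z.2 i) : γ ⊕ δ → ℝ)) := by
  have h2 := volume_measurePreserving_sumPiEquivProdPi_symm (fun _ : γ ⊕ δ => ℝ)
  have h4 := (measurePreserving_pi (fun _ : α => volume) (fun _ : α => volume) fun _ : α => h2).comp
    (volume_measurePreserving_arrowProdEquivProdArrow (γ → ℝ) (δ → ℝ) α).symm
  have e : (fun z : (α → γ → ℝ) × (α → δ → ℝ) => fun i =>
      (Sum.elim (z.1 i) (z.2 i) : γ ⊕ δ → ℝ)) =
      (fun a i => (MeasurableEquiv.sumPiEquivProdPi fun _ : γ ⊕ δ => ℝ).symm (a i)) ∘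
        (MeasurableEquiv.arrowProdEquivProdArrow (γ → ℝ) (δ → ℝ) α).symm := by
    funext z i j
    rcases j with j | j <;> rfl
  rw [e]
  exact h4

theorem measurePreserving_blk : MeasurePreserving
    (fun z : ((α → γ → ℝ) × (α → δ → ℝ)) × ((β → γ → ℝ) × (β → δ → ℝ)) =>
      blk z.1.1 z.1.2 z.2.1 z.2.2) := by
  have h1 := volume_measurePreserving_sumPiEquivProdPi_symm (fun _ : α ⊕ β => γ ⊕ δ → ℝ)
  have h5 := h1.comp ((measurePreserving_sumElim α γ δ).prod (measurePreserving_sumElim β γ δ))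
  have e : (fun z : ((α → γ → ℝ) × (α → δ → ℝ)) × ((β → γ → ℝ) × (β → δ → ℝ)) =>
      blk z.1.1 z.1.2 z.2.1 z.2.2) = (MeasurableEquiv.sumPiEquivProdPi
        fun _ : α ⊕ β => γ ⊕ δ → ℝ).symm ∘ Prod.map
        (fun (z : (α → γ → ℝ) × (α → δ → ℝ)) i => Sum.elim (z.1 i) (z.2 i))
        (fun (z : (β → γ → ℝ) × (β → δ → ℝ)) i => Sum.elim (z.1 i) (z.2 i)) := by
    funext z i j
    rcases i with i | i <;> rcases j with j | j <;> rfl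
  rw [e]
  exact h5

theorem lintegral_blk {G : (α ⊕ β → γ ⊕ δ → ℝ) → ENNReal} (hG : Measurable G) :
    ∫⁻ M, G M = ∫⁻ A, ∫⁻ Y, ∫⁻ C, ∫⁻ D, G (blk A Y C D) := by
  have h := measurePreserving_blk (α := α) (β := β) (γ := γ) (δ := δ)
  have hm : Measurable fun z : ((α → γ → ℝ) × (α → δ → ℝ)) × ((β → γ → ℝ) × (β → δ → ℝ)) =>
      G (blk z.1.1 z.1.2 z.2.1 z.2.2) := hG.comp (by fun_prop)
  rw [← h.lintegral_comp hG, Measure.volume_eq_prod, lintegral_prod _ hm.aemeasurable,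
    Measure.volume_eq_prod, lintegral_prod _ hm.lintegral_prod_right'.aemeasurable]
  refine lintegral_congr fun A => lintegral_congr fun Y => ?_
  have hm' : Measurable fun z : (β → γ → ℝ) × (β → δ → ℝ) => G (blk A Y z.1 z.2) :=
    hG.comp (by fun_prop)
  rw [Measure.volume_eq_prod, lintegral_prod _ hm'.aemeasurable]

/-- The polynomial `mdet` is not zero almost everywhere. -/
theorem ae_mdet_ne_zero (α : Type) [Fintype α] [DecidableEq α] :
    ∀ᵐ A : Sq α, mdet A ≠ 0 := by
  let Z : Set (Sq α) := {A | mdet A = 0}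
  have hZ : MeasurableSet Z := (show Measurable (mdet (α := α)) by fun_prop)
    (measurableSet_singleton 0)
  let F : Sq α × ℝ → ENNReal := fun z => Z.indicator 1 (z.1 + z.2 • mone α)
  have hF : Measurable F := (measurable_one.indicator hZ).comp (by fun_prop)
  have h1 : ∫⁻ t in Icc (0 : ℝ) 1, ∫⁻ A, F (A, t) = ∫⁻ A, ∫⁻ t in Icc (0 : ℝ) 1, F (A, t) :=
    lintegral_lintegral_swap (f := fun t A => F (A, t)) (hF.comp measurable_swap).aemeasurable
  have h2 : ∀ t, ∫⁻ A, F (A, t) = volume Z := by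
    intro t
    have h3 := lintegral_add_right_eq_self (μ := (volume : Measure (Sq α)))
      (fun A => Z.indicator (1 : Sq α → ENNReal) A) (t • mone α)
    rw [lintegral_indicator_one hZ] at h3
    exact h3
  have h4 : ∀ A, ∫⁻ t in Icc (0 : ℝ) 1, F (A, t) = 0 := by
    intro A
    have hfin : {t : ℝ | A + t • mone α ∈ Z}.Finite := by
      have h5 : (Matrix.of (-A)).charpoly ≠ 0 := (Matrix.charpoly_monic _).ne_zero
      refine (Polynomial.finite_setOfPred_isRoot h5).subset fun t ht => ?_
      change (Matrix.charpoly (Matrix.of (-A))).eval t = 0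
      rw [Matrix.eval_charpoly]
      refine Eq.trans ?_ ht
      unfold mdet
      congr 1
      ext i j
      simp only [mone_apply, Matrix.scalar_apply, Matrix.sub_apply, Matrix.diagonal_apply,
        Matrix.of_apply, Pi.add_apply, Pi.neg_apply, Pi.smul_apply, smul_eq_mul]
      split_ifs <;> ring
    have h6 : ∀ᵐ t ∂(volume.restrict (Icc (0 : ℝ) 1)), F (A, t) = 0 := by
      refine ae_restrict_of_ae ?_
      have h7 : ∀ᵐ t : ℝ, t ∉ {t : ℝ | A + t • mone α ∈ Z} :=
        measure_eq_zero_iff_ae_notMem.1 (hfin.measure_zero volume)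
      filter_upwards [h7] with t ht
      exact indicator_of_notMem ht _
    rw [lintegral_congr_ae h6, lintegral_zero]
  simp_rw [h2, h4] at h1
  have h8 : volume Z = 0 := by simpa using h1
  exact measure_eq_zero_iff_ae_notMem.1 h8

end Blocks

section Unfolding

variable {α β X : Type} [Fintype α] [DecidableEq α] [Fintype β] [DecidableEq β] [MeasurableSpace X]

/-- The transposed matrix. -/
def mtrans (M : α → β → ℝ) : β → α → ℝ := fun i j => M j i

/-- The Gram matrix `Mᵀ M`. -/
def mgram (M : Sq α) : Sq α := mmul (mtrans M) M

theorem mtrans_mmul {γ : Type} (M : α → β → ℝ) (N : β → γ → ℝ) :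
    mtrans (mmul M N) = mmul (mtrans N) (mtrans M) :=
  Matrix.transpose_mul (Matrix.of M) (Matrix.of N)

@[fun_prop] theorem Continuous.mgram {Z : Type} [TopologicalSpace Z] {f : Z → Sq α}
    (hf : Continuous f) : Continuous fun z => mgram (f z) := by
  unfold GLBranching.mgram mtrans
  fun_prop

theorem mdet_mgram (M : Sq α) : mdet (mgram M) = mdet M ^ 2 := by
  rw [mgram, mdet_mmul, sq]
  congr 1
  exact Matrix.det_transpose (Matrix.of M)

theorem mgram_mmul (M N : Sq α) : mgram (mmul M N) = mmul (mtrans N) (mmul (mgram M) N) := by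
  simp only [mgram, mtrans_mmul, mmul_assoc]

/-- Integration over `GL(α)` in the coordinates `n̄(x) p` with `x : X` and `p` in a subgroup `P`
that is transitive on positive definite forms; `μ` is a left Haar measure of `P`. -/
structure IsUnfolding (ν : Measure X) (nb : X → Sq α) (P : Set (Sq α))
    (μ : Measure (Sq α)) (wt : Sq α → NNReal) (θ : Sq α → X) : Prop where
  sFinite_left : SFinite ν
  sFinite_right : SFinite μ
  measurable_nb : Measurable nb
  measurable_weight : Measurable wt
  measurable_coord : Measurable θ
  measurableSet : MeasurableSet P
  mdet_nb : ∀ x, mdet (nb x) = 1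
  mdet_ne_zero : ∀ p ∈ P, mdet p ≠ 0
  lintegral_mul_left : ∀ p ∈ P, ∀ F : Sq α → ENNReal, Measurable F →
    ∫⁻ q, F (mmul p q) ∂μ = ∫⁻ q, F q ∂μ
  unfold : ∀ F : Sq α → ENNReal, Measurable F →
    ∫⁻ A, wt A * F A = ∫⁻ x, ∫⁻ p, F (mmul (nb x) p) ∂μ ∂ν
  exists_mgram : ∀ S : Sq α, (Matrix.of S).PosDef → ∃ p ∈ P, S = mgram p
  coord_mmul : ∀ x, ∀ p ∈ P, θ (mmul (nb x) p) = x
  ae_mem_left : ∀ᵐ M : Sq α, ∃ p ∈ P, M = mmul (nb (θ M)) p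
  ae_mem : ∀ᵐ p ∂μ, p ∈ P
  ae_weight_ne_zero : ∀ᵐ M : Sq α, wt M ≠ 0
  measure_lt_top : ∀ k : Set (Sq α), IsCompact k → (∀ M ∈ k, mdet M ≠ 0) → μ k < ⊤

theorem exists_mgram_of_posDef {S : Sq α} (hS : (Matrix.of S).PosDef) :
    ∃ p : Sq α, mdet p ≠ 0 ∧ S = mgram p := by
  open scoped MatrixOrder in
  have h0 : (0 : Matrix α α ℝ) ≤ Matrix.of S := hS.posSemidef.nonneg
  have h1 : CFC.sqrt (Matrix.of S) * CFC.sqrt (Matrix.of S) = Matrix.of S :=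
    CFC.sqrt_mul_sqrt_self _ h0
  have h2 : (CFC.sqrt (Matrix.of S)).transpose = CFC.sqrt (Matrix.of S) := by
    have h3 := (Matrix.nonneg_iff_posSemidef.1 (CFC.sqrt_nonneg (Matrix.of S))).isHermitian
    rwa [Matrix.IsHermitian, Matrix.conjTranspose_eq_transpose_of_trivial] at h3
  refine ⟨(CFC.sqrt (Matrix.of S) : Matrix α α ℝ), fun h => ?_, ?_⟩
  · have h4 := congrArg Matrix.det h1
    rw [Matrix.det_mul] at h4
    have h5 : (CFC.sqrt (Matrix.of S)).det = 0 := h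
    rw [h5, zero_mul] at h4
    exact hS.det_pos.ne h4
  · refine h1.symm.trans ?_
    change _ = (CFC.sqrt (Matrix.of S)).transpose * CFC.sqrt (Matrix.of S)
    rw [h2]

theorem withDensity_dpow_lt_top {μ : Measure (Sq α)} (b : ℕ) {k : Set (Sq α)}
    (hk : IsCompact k) (h0 : ∀ M ∈ k, mdet M ≠ 0) (hμ : μ k < ⊤) :
    μ.withDensity (fun A => (dpow b A : ENNReal)) k < ⊤ := by
  rw [withDensity_apply _ hk.measurableSet]
  have hc : ContinuousOn (fun A : Sq α => (|mdet A| ^ b)⁻¹) k :=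
    ContinuousOn.inv₀ (by fun_prop) fun A hA => pow_ne_zero _ (abs_ne_zero.2 (h0 A hA))
  obtain ⟨C, hC⟩ := hk.exists_bound_of_continuousOn hc
  refine (setLIntegral_mono (g := fun _ => ENNReal.ofReal C) measurable_const
    fun A hA => ?_).trans_lt ?_
  · have h1 := hC A hA
    rw [← coe_dpow, Real.norm_eq_abs, NNReal.abs_eq] at h1
    rw [← ENNReal.ofReal_coe_nnreal]
    exact ENNReal.ofReal_le_ofReal h1
  · rw [setLIntegral_const]
    exact ENNReal.mul_lt_top ENNReal.ofReal_lt_top hμ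

theorem lintegral_withDensity_dpow (μ : Measure (Sq α)) (b : ℕ) {F : Sq α → ENNReal}
    (hF : Measurable F) :
    ∫⁻ A, F A ∂(μ.withDensity fun A => (dpow b A : ENNReal)) = ∫⁻ A, dpow b A * F A ∂μ :=
  lintegral_withDensity_eq_lintegral_mul _ (by fun_prop) hF

theorem isUnfolding_gl (α : Type) [Fintype α] [DecidableEq α] :
    IsUnfolding (Measure.dirac ()) (fun _ : Unit => mone α) {p | mdet p ≠ 0}
      ((volume : Measure (Sq α)).withDensity fun A => (dpow (Fintype.card α) A : ENNReal))
      (dpow (Fintype.card α)) (fun _ => ()) where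
  sFinite_left := inferInstance
  sFinite_right := inferInstance
  measurable_nb := measurable_const
  measurable_weight := by fun_prop
  measurable_coord := measurable_const
  measurableSet := (show Measurable (mdet (α := α)) by fun_prop) (measurableSet_singleton 0).compl
  mdet_nb _ := mdet_mone
  mdet_ne_zero _ hp := hp
  lintegral_mul_left p hp F hF := by
    rw [lintegral_withDensity_dpow _ _ (F := fun q => F (mmul p q)) (hF.comp (by fun_prop)),
      lintegral_withDensity_dpow _ _ hF]
    have h := lintegral_mmul_left hp (G := fun q => (dpow (Fintype.card α) q : ENNReal) * F q)
      (by fun_prop)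
    have h0 : (dpow (Fintype.card α) p : ENNReal) ≠ 0 := by
      exact_mod_cast dpow_ne_zero hp
    rw [← ENNReal.mul_right_inj h0 ENNReal.coe_ne_top]
    refine Eq.trans ?_ h
    rw [← lintegral_const_mul' _ _ ENNReal.coe_ne_top]
    simp only [dpow_mmul, ENNReal.coe_mul, mul_assoc]
  unfold F hF := by
    simp only [mone_mmul]
    rw [lintegral_dirac, lintegral_withDensity_dpow _ _ hF]
  exists_mgram S hS := exists_mgram_of_posDef hS
  coord_mmul _ _ _ := rfl
  ae_mem_left := by
    filter_upwards [ae_mdet_ne_zero α] with M hM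
    exact ⟨M, hM, (mone_mmul M).symm⟩
  ae_mem := withDensity_absolutelyContinuous _ _ (ae_mdet_ne_zero α)
  ae_weight_ne_zero := by
    filter_upwards [ae_mdet_ne_zero α] with M hM
    exact dpow_ne_zero hM
  measure_lt_top k hk h0 := withDensity_dpow_lt_top _ hk h0 hk.measure_lt_top

theorem ae_blk₁₁ {Q : Sq α → Prop} (h : ∀ᵐ A, Q A) :
    ∀ᵐ M : α ⊕ β → α ⊕ β → ℝ, Q (blk₁₁ M) := by
  have hq : Measure.QuasiMeasurePreserving
      (blk₁₁ : (α ⊕ β → α ⊕ β → ℝ) → Sq α) volume volume := by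
    refine ⟨by fun_prop, Measure.AbsolutelyContinuous.mk fun s hs h0 => ?_⟩
    have hm : Measurable (blk₁₁ : (α ⊕ β → α ⊕ β → ℝ) → Sq α) := by fun_prop
    rw [Measure.map_apply hm hs, ← lintegral_indicator_one (hm hs),
      lintegral_blk (measurable_one.indicator (hm hs))]
    have h1 : ∀ᵐ A : Sq α, A ∉ s := measure_eq_zero_iff_ae_notMem.1 h0
    refine (lintegral_congr_ae (g := 0) ?_).trans lintegral_zero
    filter_upwards [h1] with A hA
    simp [hA]
  exact hq.ae h

/-- The left Haar measure of the block triangular matrices whose first diagonal block is in a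
group with the left Haar measure `μ`. -/
def parHaar (β : Type) [Fintype β] [DecidableEq β] (μ : Measure (Sq α)) :
    Measure (α ⊕ β → α ⊕ β → ℝ) :=
  Measure.map (fun z : Sq α × (α → β → ℝ) × Sq β => blk z.1 z.2.1 0 z.2.2)
    ((μ.withDensity fun p => (dpow (Fintype.card β) p : ENNReal)).prod
      ((volume : Measure (α → β → ℝ)).prod
        ((volume : Measure (Sq β)).withDensity
          fun D => (dpow (Fintype.card β) D : ENNReal))))

theorem lintegral_parHaar {μ : Measure (Sq α)} [SFinite μ]
    {F : (α ⊕ β → α ⊕ β → ℝ) → ENNReal} (hF : Measurable F) :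
    ∫⁻ q, F q ∂(parHaar β μ) = ∫⁻ p, (dpow (Fintype.card β) p : ENNReal) *
      (∫⁻ Y : α → β → ℝ, ∫⁻ D : Sq β, (dpow (Fintype.card β) D : ENNReal) *
        F (blk p Y 0 D)) ∂μ := by
  have hF' : Measurable fun z : Sq α × (α → β → ℝ) × Sq β =>
      F (blk z.1 z.2.1 0 z.2.2) := hF.comp (by fun_prop)
  rw [parHaar, lintegral_map hF (by fun_prop), lintegral_prod _ hF'.aemeasurable,
    lintegral_withDensity_dpow _ _ hF'.lintegral_prod_right']
  refine lintegral_congr fun p => ?_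
  have hp : Measurable fun z : (α → β → ℝ) × Sq β => F (blk p z.1 0 z.2) :=
    hF.comp (by fun_prop)
  rw [lintegral_prod _ hp.aemeasurable]
  congr 1
  refine lintegral_congr fun Y => ?_
  have hY : Measurable fun D : Sq β => F (blk p Y 0 D) := hF.comp (by fun_prop)
  rw [lintegral_withDensity_dpow _ _ hY]

theorem lintegral_parHaar_aux {p₀ : Sq α} (hp₀ : mdet p₀ ≠ 0) (Y₀ : α → β → ℝ)
    {D₀ : Sq β} (hD₀ : mdet D₀ ≠ 0) {F : (α → β → ℝ) → Sq β → ENNReal}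
    (hF : Measurable (Function.uncurry F)) :
    ∫⁻ Y, ∫⁻ D, (dpow (Fintype.card β) D : ENNReal) *
        F (mmul p₀ Y + mmul Y₀ D) (mmul D₀ D) =
      dpow (Fintype.card β) p₀ * ∫⁻ Y, ∫⁻ D, (dpow (Fintype.card β) D : ENNReal) * F Y D := by
  have hF1 : Measurable fun z : (α → β → ℝ) × Sq β => F z.1 z.2 := hF
  have hm : Measurable fun z : (α → β → ℝ) × Sq β =>
      F (mmul p₀ z.1 + mmul Y₀ z.2) (mmul D₀ z.2) := hF1.comp
    (g := fun z : (α → β → ℝ) × Sq β => F z.1 z.2)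
    (f := fun z : (α → β → ℝ) × Sq β => (mmul p₀ z.1 + mmul Y₀ z.2, mmul D₀ z.2))
    (by fun_prop)
  rw [lintegral_lintegral_swap (by
      refine Measurable.aemeasurable ?_
      exact Measurable.mul (by fun_prop) hm),
    lintegral_lintegral_swap (f := fun Y D => (dpow (Fintype.card β) D : ENNReal) * F Y D) (by
      refine Measurable.aemeasurable ?_
      exact Measurable.mul (by fun_prop) hF1)]
  have h1 : ∀ D, ∫⁻ Y, (dpow (Fintype.card β) D : ENNReal) *
      F (mmul p₀ Y + mmul Y₀ D) (mmul D₀ D) = dpow (Fintype.card β) p₀ *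
        ((dpow (Fintype.card β) D : ENNReal) * ∫⁻ Y, F Y (mmul D₀ D)) := by
    intro D
    have hD : Measurable fun Y : α → β → ℝ => F Y (mmul D₀ D) :=
      hF1.comp (f := fun Y : α → β → ℝ => (Y, mmul D₀ D)) (by fun_prop)
    rw [lintegral_const_mul' _ _ ENNReal.coe_ne_top,
      lintegral_mmul_left hp₀ (G := fun Y => F (Y + mmul Y₀ D) (mmul D₀ D))
        (hD.comp (by fun_prop)),
      lintegral_add_right_eq_self (fun Y => F Y (mmul D₀ D))]
    ring
  simp_rw [h1]
  rw [lintegral_const_mul' _ _ ENNReal.coe_ne_top]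
  congr 1
  have hI : Measurable fun D => ∫⁻ Y, F Y D := hF1.lintegral_prod_left'
  have h2 := (isUnfolding_gl β).lintegral_mul_left D₀ hD₀ _ hI
  rw [lintegral_withDensity_dpow _ _ hI, lintegral_withDensity_dpow _ _
    (F := fun D => ∫⁻ Y, F Y (mmul D₀ D)) (hI.comp (by fun_prop))] at h2
  refine h2.trans (lintegral_congr fun D => ?_)
  rw [lintegral_const_mul' _ _ ENNReal.coe_ne_top]

theorem exists_mgram_blk {P : Set (Sq α)}
    (hP : ∀ S : Sq α, (Matrix.of S).PosDef → ∃ p ∈ P, S = mgram p)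
    (hP' : ∀ p ∈ P, mdet p ≠ 0) {S : α ⊕ β → α ⊕ β → ℝ} (hS : (Matrix.of S).PosDef) :
    ∃ p ∈ P, ∃ (Y : α → β → ℝ) (D : Sq β), mdet D ≠ 0 ∧ S = mgram (blk p Y 0 D) := by
  have hSt : mtrans S = S := by
    have h1 := hS.isHermitian
    rw [Matrix.IsHermitian, Matrix.conjTranspose_eq_transpose_of_trivial] at h1
    exact h1
  have hA : (Matrix.of (blk₁₁ S)).PosDef := hS.submatrix Sum.inl_injective
  obtain ⟨p, hp, ep⟩ := hP _ hA
  have hp0 := hP' p hp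
  have hpt : mdet (mtrans p) ≠ 0 := by
    have h1 : mdet (mtrans p) = mdet p := Matrix.det_transpose (Matrix.of p)
    rwa [h1]
  let Y : α → β → ℝ := mmul (minv (mtrans p)) (blk₁₂ S)
  have hY : mmul (mtrans p) Y = blk₁₂ S := by
    rw [← mmul_assoc, mmul_minv hpt, mone_mmul]
  have e21 : blk₂₁ S = mtrans (blk₁₂ S) := by
    conv_lhs => rw [← hSt]
    rfl
  have hY' : mmul (mtrans Y) p = blk₂₁ S := by
    rw [e21, ← hY, mtrans_mmul (mtrans p) Y]
    rfl
  let T : Sq β := blk₂₂ S - mmul (mtrans Y) Y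
  let q : α ⊕ β → α ⊕ β → ℝ := blk p Y 0 (mone β)
  have et : ∀ D : Sq β, mtrans (blk p Y 0 D) = blk (mtrans p) 0 (mtrans Y) (mtrans D) := by
    intro D
    funext i j
    rcases i with i | i <;> rcases j with j | j <;> rfl
  have hq : mdet q ≠ 0 := by
    rw [mdet_blk_zero, mdet_mone, mul_one]
    exact hp0
  have h1t : mtrans (mone β) = mone β := Matrix.transpose_one
  have hS' : S = mmul (mtrans q) (mmul (blk (mone α) 0 0 T) q) := by
    rw [et, mmul_blk, mmul_blk]
    simp only [mone_mmul, mmul_mone, mmul_zero, zero_mmul, add_zero, zero_add, hY, hY', h1t]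
    rw [← mgram, ← ep]
    conv_lhs => rw [← blk_eta S]
    simp [T]
  have hsch : (Matrix.of T).PosDef := by
    have h2 : (Matrix.of (minv q)).conjTranspose * Matrix.of S * Matrix.of (minv q) =
        Matrix.of (blk (mone α) 0 0 T) := by
      have h3 : mmul (mmul (mtrans (minv q)) S) (minv q) = blk (mone α) 0 0 T := by
        rw [hS', ← mmul_assoc (mtrans (minv q)), ← mtrans_mmul, mmul_minv hq]
        rw [mmul_assoc, mmul_assoc, mmul_minv hq, mmul_mone]
        have h4 : mtrans (mone (α ⊕ β)) = mone (α ⊕ β) := Matrix.transpose_one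
        rw [h4, mone_mmul]
      rw [Matrix.conjTranspose_eq_transpose_of_trivial]
      exact h3
    have h4 := hS.conjTranspose_mul_mul_same (B := Matrix.of (minv q)) ?_
    · rw [h2] at h4
      exact h4.submatrix Sum.inr_injective
    · refine Matrix.mulVec_injective_of_isUnit ?_
      rw [Matrix.isUnit_iff_isUnit_det, isUnit_iff_ne_zero]
      have h5 := mdet_minv q
      exact fun h6 => inv_ne_zero hq (h5.symm.trans h6)
  obtain ⟨D, hD, eD⟩ := exists_mgram_of_posDef hsch
  refine ⟨p, hp, Y, D, hD, ?_⟩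
  rw [mgram, et, mmul_blk, hY]
  simp only [mmul_zero, zero_mmul, add_zero, hY']
  rw [← mgram, ← mgram, ← ep, ← eD]
  conv_lhs => rw [← blk_eta S]
  simp [T]

theorem IsUnfolding.block {ν : Measure X} {nb : X → Sq α} {P : Set (Sq α)}
    {μ : Measure (Sq α)} {wt : Sq α → NNReal} {θ : Sq α → X}
    (h : IsUnfolding ν nb P μ wt θ) (β : Type) [Fintype β] [DecidableEq β] :
    IsUnfolding (ν.prod (volume : Measure (β → α → ℝ)))
      (fun z => blk (nb z.1) 0 (mmul z.2 (nb z.1)) (mone β))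
      {M | blk₁₁ M ∈ P ∧ blk₂₁ M = 0 ∧ mdet (blk₂₂ M) ≠ 0} (parHaar β μ)
      (fun M => wt (blk₁₁ M) * dpow (Fintype.card β) (blk₁₁ M) * dpow (Fintype.card β) M)
      (fun M => (θ (blk₁₁ M), mmul (blk₂₁ M) (minv (blk₁₁ M)))) := by
  have := h.sFinite_left
  have := h.sFinite_right
  have hnb := h.measurable_nb
  have hwt := h.measurable_weight
  have hθ := h.measurable_coord
  have hmul : ∀ (x : X) (Z : β → α → ℝ) (p : Sq α) (Y : α → β → ℝ) (D : Sq β),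
      mmul (blk (nb x) 0 (mmul Z (nb x)) (mone β)) (blk p Y 0 D) =
        blk (mmul (nb x) p) (mmul (nb x) Y) (mmul Z (mmul (nb x) p))
          (mmul Z (mmul (nb x) Y) + D) := by
    intro x Z p Y D
    simp [mmul_blk, mmul_zero, zero_mmul, mone_mmul, mmul_assoc]
  have hdet : ∀ (x : X) (Z : β → α → ℝ), mdet (blk (nb x) 0 (mmul Z (nb x)) (mone β)) = 1 := by
    intro x Z
    refine (Matrix.det_fromBlocks_zero₁₂ _ _ _).trans ?_
    have h1 := h.mdet_nb x
    have h2 : (Matrix.det (Matrix.of (mone β)) : ℝ) = 1 := mdet_mone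
    exact (congrArg₂ (· * ·) h1 h2).trans (mul_one 1)
  have hPm : MeasurableSet {M : α ⊕ β → α ⊕ β → ℝ | blk₁₁ M ∈ P ∧ blk₂₁ M = 0 ∧
      mdet (blk₂₂ M) ≠ 0} := by
    refine MeasurableSet.inter ?_ (MeasurableSet.inter ?_ ?_)
    · exact (show Measurable (blk₁₁ : (α ⊕ β → α ⊕ β → ℝ) → Sq α) by fun_prop) h.measurableSet
    · exact (show Measurable (blk₂₁ : (α ⊕ β → α ⊕ β → ℝ) → β → α → ℝ) by fun_prop)
        (measurableSet_singleton 0)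
    · exact (show Measurable fun M : α ⊕ β → α ⊕ β → ℝ => mdet (blk₂₂ M) by fun_prop)
        (measurableSet_singleton 0).compl
  refine ⟨inferInstance, by unfold parHaar; infer_instance, by fun_prop, by fun_prop, by fun_prop,
    hPm, fun x => hdet x.1 x.2, ?_, ?_, ?_, ?_, ?_, ?_, ?_, ?_, ?_⟩
  · rintro M ⟨h1, h2, h3⟩
    rw [← blk_eta M, h2, mdet_blk_zero]
    exact mul_ne_zero (h.mdet_ne_zero _ h1) h3
  · rintro q ⟨h1, h2, h3⟩ F hF
    have hp := h.mdet_ne_zero _ h1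
    rw [lintegral_parHaar hF, lintegral_parHaar (F := fun q' => F (mmul q q'))
      (hF.comp (by fun_prop))]
    let J : Sq α → ENNReal := fun p => (dpow (Fintype.card β) p : ENNReal) *
      ∫⁻ Y, ∫⁻ D, (dpow (Fintype.card β) D : ENNReal) * F (blk p Y 0 D)
    have hJ : Measurable J := by
      have h4 : Measurable fun z : (Sq α × (α → β → ℝ)) × Sq β =>
          (dpow (Fintype.card β) z.2 : ENNReal) * F (blk z.1.1 z.1.2 0 z.2) := by fun_prop
      exact Measurable.mul (by fun_prop) h4.lintegral_prod_right'.lintegral_prod_right'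
    rw [← h.lintegral_mul_left _ h1 J hJ]
    refine lintegral_congr fun p => ?_
    have e : ∀ (Y : α → β → ℝ) (D : Sq β), mmul q (blk p Y 0 D) =
        blk (mmul (blk₁₁ q) p) (mmul (blk₁₁ q) Y + mmul (blk₁₂ q) D) 0 (mmul (blk₂₂ q) D) := by
      intro Y D
      conv_lhs => rw [← blk_eta q, h2, mmul_blk]
      simp [mmul_zero, zero_mmul]
    simp_rw [e]
    rw [lintegral_parHaar_aux hp (blk₁₂ q) h3
      (F := fun Y D => F (blk (mmul (blk₁₁ q) p) Y 0 D)) (hF.comp (by fun_prop))]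
    simp only [J, dpow_mmul, ENNReal.coe_mul]
    ring
  · intro F hF
    have hb : ∀ (A : Sq α) (Y : α → β → ℝ) (Z : β → α → ℝ) (D : Sq β),
        dpow (Fintype.card β) (blk A Y (mmul Z A) (mmul Z Y + D)) =
          dpow (Fintype.card β) A * dpow (Fintype.card β) D := by
      intro A Y Z D
      have e : blk A Y (mmul Z A) (mmul Z Y + D) =
          mmul (blk (mone α) 0 Z (mone β)) (blk A Y 0 D) := by
        simp [mmul_blk, mmul_zero, zero_mmul, mone_mmul]
      have e2 : mdet (blk (mone α) 0 Z (mone β)) = 1 := by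
        refine (Matrix.det_fromBlocks_zero₁₂ _ _ _).trans ?_
        exact (congrArg₂ (· * ·) (mdet_mone (α := α)) (mdet_mone (α := β))).trans (mul_one 1)
      rw [e, dpow_mmul]
      simp [dpow, e2, mdet_blk_zero, mul_pow, mul_comm]
    let H : Sq α → ENNReal := fun A => ∫⁻ Z : β → α → ℝ, ∫⁻ Y : α → β → ℝ,
      ∫⁻ D : Sq β, (dpow (Fintype.card β) D : ENNReal) *
        F (blk A Y (mmul Z A) (mmul Z Y + D))
    have hH : Measurable H := by
      have h4 : Measurable fun z : ((Sq α × (β → α → ℝ)) × (α → β → ℝ)) × Sq β =>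
          (dpow (Fintype.card β) z.2 : ENNReal) * F (blk z.1.1.1 z.1.2 (mmul z.1.1.2 z.1.1.1)
            (mmul z.1.1.2 z.1.2 + z.2)) := by fun_prop
      exact h4.lintegral_prod_right'.lintegral_prod_right'.lintegral_prod_right'
    have key : ∀ A : Sq α, mdet A ≠ 0 → ∫⁻ Y : α → β → ℝ, ∫⁻ C : β → α → ℝ,
        ∫⁻ D : Sq β, (dpow (Fintype.card β) A : ENNReal) *
          (dpow (Fintype.card β) (blk A Y C D) * F (blk A Y C D)) =
            dpow (Fintype.card β) A * H A := by
      intro A hA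
      have h1 : ∀ Y : α → β → ℝ, ∫⁻ C : β → α → ℝ, ∫⁻ D : Sq β,
          (dpow (Fintype.card β) A : ENNReal) *
            (dpow (Fintype.card β) (blk A Y C D) * F (blk A Y C D)) =
          ∫⁻ Z : β → α → ℝ, dpow (Fintype.card β) A * ∫⁻ D : Sq β,
            (dpow (Fintype.card β) D : ENNReal) * F (blk A Y (mmul Z A) (mmul Z Y + D)) := by
        intro Y
        have hG : Measurable fun C : β → α → ℝ => ∫⁻ D : Sq β,
            (dpow (Fintype.card β) (blk A Y C D) : ENNReal) * F (blk A Y C D) :=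
          Measurable.lintegral_prod_right' (f := fun z : (β → α → ℝ) × Sq β =>
            (dpow (Fintype.card β) (blk A Y z.1 z.2) : ENNReal) * F (blk A Y z.1 z.2))
            (by fun_prop)
        simp_rw [lintegral_const_mul' (dpow (Fintype.card β) A : ENNReal) _ ENNReal.coe_ne_top]
        rw [← lintegral_mmul_right hA hG,
          ← lintegral_const_mul' (dpow (Fintype.card β) A : ENNReal) _ ENNReal.coe_ne_top]
        refine lintegral_congr fun Z => ?_
        rw [← lintegral_add_left_eq_self _ (mmul Z Y)]
        simp only [hb, ENNReal.coe_mul, mul_assoc]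
        rw [lintegral_const_mul' (dpow (Fintype.card β) A : ENNReal) _ ENNReal.coe_ne_top]
      simp_rw [h1, lintegral_const_mul' (dpow (Fintype.card β) A : ENNReal) _ ENNReal.coe_ne_top]
      congr 1
      refine lintegral_lintegral_swap (Measurable.aemeasurable ?_)
      have h4 : Measurable fun z : ((α → β → ℝ) × (β → α → ℝ)) × Sq β =>
          (dpow (Fintype.card β) z.2 : ENNReal) * F (blk A z.1.1 (mmul z.1.2 A)
            (mmul z.1.2 z.1.1 + z.2)) := by fun_prop
      exact h4.lintegral_prod_right'
    have hM : Measurable fun M : α ⊕ β → α ⊕ β → ℝ => ((wt (blk₁₁ M) *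
        dpow (Fintype.card β) (blk₁₁ M) * dpow (Fintype.card β) M : NNReal) : ENNReal) * F M := by
      fun_prop
    rw [lintegral_blk hM]
    have h2 : ∫⁻ A : Sq α, ∫⁻ Y : α → β → ℝ, ∫⁻ C : β → α → ℝ, ∫⁻ D : Sq β,
        ((wt (blk₁₁ (blk A Y C D)) * dpow (Fintype.card β) (blk₁₁ (blk A Y C D)) *
          dpow (Fintype.card β) (blk A Y C D) : NNReal) : ENNReal) * F (blk A Y C D) =
        ∫⁻ A, wt A * (dpow (Fintype.card β) A * H A) := by
      refine lintegral_congr_ae ?_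
      filter_upwards [ae_mdet_ne_zero α] with A hA
      rw [← key A hA]
      simp only [blk₁₁_blk, ENNReal.coe_mul, mul_assoc]
      simp_rw [lintegral_const_mul' (wt A : ENNReal) _ ENNReal.coe_ne_top]
    rw [h2, h.unfold _ (by fun_prop)]
    have hΨ : Measurable fun z : (X × (β → α → ℝ)) × Sq α =>
        (dpow (Fintype.card β) z.2 : ENNReal) * ∫⁻ Y : α → β → ℝ, ∫⁻ D : Sq β,
          (dpow (Fintype.card β) D : ENNReal) *
            F (mmul (blk (nb z.1.1) 0 (mmul z.1.2 (nb z.1.1)) (mone β)) (blk z.2 Y 0 D)) := by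
      have h4 : Measurable fun z : (((X × (β → α → ℝ)) × Sq α) × (α → β → ℝ)) ×
          Sq β => (dpow (Fintype.card β) z.2 : ENNReal) *
            F (mmul (blk (nb z.1.1.1.1) 0 (mmul z.1.1.1.2 (nb z.1.1.1.1)) (mone β))
              (blk z.1.1.2 z.1.2 0 z.2)) := by fun_prop
      exact Measurable.mul (by fun_prop) h4.lintegral_prod_right'.lintegral_prod_right'
    have hpar : ∀ x : X × (β → α → ℝ), ∫⁻ q, F (mmul (blk (nb x.1) 0 (mmul x.2 (nb x.1))
        (mone β)) q) ∂(parHaar β μ) = _ := fun x => lintegral_parHaar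
      (F := fun q => F (mmul (blk (nb x.1) 0 (mmul x.2 (nb x.1)) (mone β)) q))
      (hF.comp (by fun_prop))
    simp_rw [hpar]
    rw [lintegral_prod _ hΨ.lintegral_prod_right'.aemeasurable]
    refine lintegral_congr fun x => ?_
    have hx : mdet (nb x) ≠ 0 := by rw [h.mdet_nb]; exact one_ne_zero
    have hx1 : ∀ b, dpow b (nb x) = 1 := fun b => by simp [dpow, h.mdet_nb]
    have h3 : ∀ p, (dpow (Fintype.card β) (mmul (nb x) p) : ENNReal) * H (mmul (nb x) p) =
        ∫⁻ Z : β → α → ℝ, (dpow (Fintype.card β) p : ENNReal) * ∫⁻ Y : α → β → ℝ,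
          ∫⁻ D : Sq β, (dpow (Fintype.card β) D : ENNReal) *
            F (mmul (blk (nb x) 0 (mmul Z (nb x)) (mone β)) (blk p Y 0 D)) := by
      intro p
      rw [dpow_mmul, hx1, one_mul, lintegral_const_mul' _ _ ENNReal.coe_ne_top]
      congr 1
      refine lintegral_congr fun Z => ?_
      have hG : Measurable fun Y : α → β → ℝ => ∫⁻ D : Sq β,
          (dpow (Fintype.card β) D : ENNReal) * F (blk (mmul (nb x) p) Y (mmul Z (mmul (nb x) p))
            (mmul Z Y + D)) :=
        Measurable.lintegral_prod_right' (f := fun z : (α → β → ℝ) × Sq β =>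
          (dpow (Fintype.card β) z.2 : ENNReal) * F (blk (mmul (nb x) p) z.1
            (mmul Z (mmul (nb x) p)) (mmul Z z.1 + z.2))) (by fun_prop)
      have h5 := lintegral_mmul_left hx hG
      rw [hx1, ENNReal.coe_one, one_mul] at h5
      rw [← h5]
      simp only [hmul]
    simp_rw [h3]
    refine lintegral_lintegral_swap (Measurable.aemeasurable ?_)
    exact hΨ.comp (f := fun w : Sq α × (β → α → ℝ) => ((x, w.2), w.1)) (by fun_prop)
  · intro S hS
    obtain ⟨p, hp, Y, D, hD, e⟩ := exists_mgram_blk h.exists_mgram h.mdet_ne_zero hS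
    exact ⟨blk p Y 0 D, ⟨hp, rfl, hD⟩, e⟩
  · rintro ⟨x, Z⟩ q ⟨h1, h2, h3⟩
    rw [← blk_eta q, h2, hmul]
    have hp : mdet (mmul (nb x) (blk₁₁ q)) ≠ 0 := by
      rw [mdet_mmul, h.mdet_nb, one_mul]
      exact h.mdet_ne_zero _ h1
    simp only [blk₁₁_blk, blk₂₁_blk, h.coord_mmul _ _ h1]
    rw [mmul_assoc Z, mmul_minv hp, mmul_mone]
  · filter_upwards [ae_blk₁₁ (β := β) h.ae_mem_left, ae_mdet_ne_zero (α ⊕ β)] with M h1 h2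
    obtain ⟨p, hp, e⟩ := h1
    have hdn : mdet (nb (θ (blk₁₁ M))) ≠ 0 := by rw [h.mdet_nb]; exact one_ne_zero
    have hd1 : mdet (blk₁₁ M) ≠ 0 := by
      rw [e, mdet_mmul]
      exact mul_ne_zero hdn (h.mdet_ne_zero _ hp)
    have e' : M = mmul (blk (nb (θ (blk₁₁ M))) 0 (mmul (mmul (blk₂₁ M) (minv (blk₁₁ M)))
        (nb (θ (blk₁₁ M)))) (mone β)) (blk p (mmul (minv (nb (θ (blk₁₁ M)))) (blk₁₂ M)) 0
          (blk₂₂ M - mmul (mmul (blk₂₁ M) (minv (blk₁₁ M))) (blk₁₂ M))) := by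
      rw [hmul, ← e, ← mmul_assoc _ _ (blk₁₂ M), mmul_minv hdn, mone_mmul,
        mmul_assoc _ _ (blk₁₁ M), minv_mmul hd1, mmul_mone, add_sub_cancel, blk_eta]
    refine ⟨_, ⟨?_, rfl, fun h0 => h2 ?_⟩, e'⟩
    · rwa [blk₁₁_blk]
    · rw [e', mdet_mmul, mdet_blk_zero]
      rw [blk₂₂_blk] at h0
      rw [h0, mul_zero, mul_zero]
  · have hQ : MeasurableSet {M : α ⊕ β → α ⊕ β → ℝ | blk₁₁ M ∈ P ∧ blk₂₁ M = 0 ∧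
        mdet (blk₂₂ M) ≠ 0} := hPm
    rw [parHaar]
    refine (ae_map_iff (by fun_prop) hQ).2 ?_
    have h1 := (Measure.quasiMeasurePreserving_fst
      (μ := μ.withDensity fun p => (dpow (Fintype.card β) p : ENNReal))
      (ν := (volume : Measure (α → β → ℝ)).prod ((volume : Measure (Sq β)).withDensity
          fun D => (dpow (Fintype.card β) D : ENNReal)))).ae
      (withDensity_absolutelyContinuous _ _ h.ae_mem)
    have h2 := ((Measure.quasiMeasurePreserving_snd
      (μ := (volume : Measure (α → β → ℝ)))
      (ν := ((volume : Measure (Sq β)).withDensity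
          fun D => (dpow (Fintype.card β) D : ENNReal)))).comp
      (Measure.quasiMeasurePreserving_snd
      (μ := μ.withDensity fun p => (dpow (Fintype.card β) p : ENNReal)))).ae
      (withDensity_absolutelyContinuous _ _ (ae_mdet_ne_zero β))
    filter_upwards [h1, h2] with z hz1 hz2
    exact ⟨hz1, rfl, hz2⟩
  · filter_upwards [ae_blk₁₁ (β := β) h.ae_weight_ne_zero, ae_mdet_ne_zero (α ⊕ β),
      ae_blk₁₁ (β := β) (ae_mdet_ne_zero α)] with M h1 h2 h3
    exact mul_ne_zero (mul_ne_zero h1 (dpow_ne_zero h3)) (dpow_ne_zero h2)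
  · intro k hk h0
    let k₀ : Set (α ⊕ β → α ⊕ β → ℝ) := k ∩ {M | blk₂₁ M = 0}
    have hk₀ : IsCompact k₀ := hk.inter_right (isClosed_singleton.preimage
      (show Continuous (blk₂₁ : (α ⊕ β → α ⊕ β → ℝ) → β → α → ℝ) by fun_prop))
    have hd : ∀ M ∈ k₀, mdet (blk₁₁ M) * mdet (blk₂₂ M) ≠ 0 := by
      rintro M ⟨hM, h1⟩
      rw [← mdet_blk_zero _ (blk₁₂ M), ← h1, blk_eta]
      exact h0 M hM
    have hA : IsCompact (blk₁₁ '' k₀) := hk₀.image (by fun_prop)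
    have hY : IsCompact (blk₁₂ '' k₀) := hk₀.image (by fun_prop)
    have hD : IsCompact (blk₂₂ '' k₀) := hk₀.image (by fun_prop)
    have hA0 : ∀ A ∈ blk₁₁ '' k₀, mdet A ≠ 0 := by
      rintro _ ⟨M, hM, rfl⟩
      exact left_ne_zero_of_mul (hd M hM)
    have hD0 : ∀ D ∈ blk₂₂ '' k₀, mdet D ≠ 0 := by
      rintro _ ⟨M, hM, rfl⟩
      exact right_ne_zero_of_mul (hd M hM)
    rw [parHaar, Measure.map_apply (by fun_prop) hk.measurableSet]
    refine (measure_mono (t := (blk₁₁ '' k₀) ×ˢ ((blk₁₂ '' k₀) ×ˢ (blk₂₂ '' k₀))) ?_).trans_lt ?_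
    · intro z hz
      exact ⟨⟨_, ⟨hz, rfl⟩, rfl⟩, ⟨_, ⟨hz, rfl⟩, rfl⟩, ⟨_, ⟨hz, rfl⟩, rfl⟩⟩
    · rw [Measure.prod_prod, Measure.prod_prod]
      exact ENNReal.mul_lt_top (withDensity_dpow_lt_top _ hA hA0 (h.measure_lt_top _ hA hA0))
        (ENNReal.mul_lt_top hY.measure_lt_top
          (withDensity_dpow_lt_top _ hD hD0 hD.measure_lt_top))

end Unfolding

section Average

variable {α X : Type} [Fintype α] [DecidableEq α] [MeasurableSpace X]

theorem IsUnfolding.reparam {X' : Type} [MeasurableSpace X'] {ν : Measure X} {nb : X → Sq α}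
    {P : Set (Sq α)} {μ : Measure (Sq α)} {wt : Sq α → NNReal}
    {θ : Sq α → X} (h : IsUnfolding ν nb P μ wt θ) {ν' : Measure X'} [SFinite ν']
    (e : X ≃ᵐ X') (he : MeasurePreserving e ν ν') :
    IsUnfolding ν' (fun x => nb (e.symm x)) P μ wt (fun M => e (θ M)) where
  sFinite_left := inferInstance
  sFinite_right := h.sFinite_right
  measurable_nb := h.measurable_nb.comp e.symm.measurable
  measurable_weight := h.measurable_weight
  measurable_coord := e.measurable.comp h.measurable_coord
  measurableSet := h.measurableSet
  mdet_nb x := h.mdet_nb _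
  mdet_ne_zero := h.mdet_ne_zero
  lintegral_mul_left := h.lintegral_mul_left
  unfold F hF := by
    have := h.sFinite_right
    have hnb := h.measurable_nb
    have h1 : Measurable fun x => ∫⁻ p, F (mmul (nb (e.symm x)) p) ∂μ :=
      Measurable.lintegral_prod_right' (f := fun z : X' × Sq α =>
        F (mmul (nb (e.symm z.1)) z.2)) (by
        have := e.symm.measurable
        fun_prop)
    rw [h.unfold F hF, ← he.lintegral_comp h1]
    simp
  exists_mgram := h.exists_mgram
  coord_mmul x p hp := by rw [h.coord_mmul _ p hp, e.apply_symm_apply]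
  ae_mem_left := by simpa using h.ae_mem_left
  ae_mem := h.ae_mem
  ae_weight_ne_zero := h.ae_weight_ne_zero
  measure_lt_top := h.measure_lt_top

theorem posDef_mgram {M : Sq α} (hM : mdet M ≠ 0) : (Matrix.of (mgram M)).PosDef := by
  have h1 := (Matrix.PosDef.one (n := α) (R := ℝ)).conjTranspose_mul_mul_same
    (B := Matrix.of M) ?_
  · rw [Matrix.mul_one, Matrix.conjTranspose_eq_transpose_of_trivial] at h1
    exact h1
  · refine Matrix.mulVec_injective_of_isUnit ?_
    rw [Matrix.isUnit_iff_isUnit_det, isUnit_iff_ne_zero]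
    exact hM

/-- The integral over `n̄(x) p` of a function of `x`, cut off by a function of the Gram matrix. -/
theorem IsUnfolding.lintegral_cutoff {ν : Measure X} {nb : X → Sq α}
    {P : Set (Sq α)} {μ : Measure (Sq α)} {wt : Sq α → NNReal}
    {θ : Sq α → X} (h : IsUnfolding ν nb P μ wt θ) {κ : Sq α → NNReal}
    (hκ : Measurable κ) {y : Sq α} (hy : mdet y ≠ 0) {G : X → ENNReal} (hG : Measurable G) :
    ∫⁻ M, ((wt M * κ (mgram (mmul y M)) : NNReal) : ENNReal) * G (θ M) =
      (∫⁻ p, κ (mgram p) ∂μ) * ∫⁻ x, G x ∂ν := by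
  have hθ := h.measurable_coord
  have hgm : Measurable (mgram (α := α)) := (show Continuous (mgram (α := α)) by fun_prop).measurable
  simp_rw [ENNReal.coe_mul, mul_assoc]
  rw [h.unfold (fun M => (κ (mgram (mmul y M)) : ENNReal) * G (θ M))
    (Measurable.mul ((hκ.comp (hgm.comp (by fun_prop))).coe_nnreal_ennreal) (hG.comp hθ)),
    ← lintegral_const_mul _ hG]
  refine lintegral_congr fun x => ?_
  have hx : mdet (mmul y (nb x)) ≠ 0 := by
    rw [mdet_mmul, h.mdet_nb, mul_one]
    exact hy
  obtain ⟨p₀, hp₀, e⟩ := h.exists_mgram _ (posDef_mgram hx)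
  have h1 : ∫⁻ p, (κ (mgram (mmul y (mmul (nb x) p))) : ENNReal) * G (θ (mmul (nb x) p)) ∂μ =
      ∫⁻ p, (κ (mgram (mmul p₀ p)) : ENNReal) * G x ∂μ := by
    refine lintegral_congr_ae ?_
    filter_upwards [h.ae_mem] with p hp
    rw [h.coord_mmul _ _ hp, ← mmul_assoc, mgram_mmul (mmul y (nb x)), mgram_mmul p₀, e]
  have h2 : Measurable fun p => (κ (mgram p) : ENNReal) := (hκ.comp hgm).coe_nnreal_ennreal
  rw [h1, lintegral_mul_const _ (by exact h2.comp (by fun_prop)),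
    h.lintegral_mul_left _ hp₀ _ h2]

/-- A smooth function of the Gram matrix, supported near the identity. -/
def cutoffRadius (α : Type) [Fintype α] [DecidableEq α] : ℝ :=
  Classical.choose (Metric.isOpen_iff.1
    (isOpen_ne_fun (show Continuous (mdet (α := α)) by fun_prop) continuous_const) (mone α)
    (show mdet (mone α) ≠ 0 by rw [mdet_mone]; exact one_ne_zero))

theorem cutoffRadius_pos (α : Type) [Fintype α] [DecidableEq α] : 0 < cutoffRadius α :=
  (Classical.choose_spec (Metric.isOpen_iff.1
    (isOpen_ne_fun (show Continuous (mdet (α := α)) by fun_prop) continuous_const) (mone α)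
    (show mdet (mone α) ≠ 0 by rw [mdet_mone]; exact one_ne_zero))).1

theorem mdet_ne_zero_of_dist_lt {S : Sq α} (hS : dist S (mone α) < cutoffRadius α) :
    mdet S ≠ 0 :=
  (Classical.choose_spec (Metric.isOpen_iff.1
    (isOpen_ne_fun (show Continuous (mdet (α := α)) by fun_prop) continuous_const) (mone α)
    (show mdet (mone α) ≠ 0 by rw [mdet_mone]; exact one_ne_zero))).2 hS

/-- A bump function near the identity. -/
def gramBump (α : Type) [Fintype α] [DecidableEq α] : ContDiffBump (mone α) :=
  ⟨cutoffRadius α / 4, cutoffRadius α / 2, by have := cutoffRadius_pos α; positivity, by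
    have := cutoffRadius_pos α
    linarith⟩

/-- A smooth function with compact support in the invertible matrices, which is invariant under
orthogonal matrices from the left. -/
def cutoff (M : Sq α) : ℝ := gramBump α (mgram M)

theorem ContDiff.mmul {Z β γ : Type} [Fintype β] [NormedAddCommGroup Z] [NormedSpace ℝ Z]
    [Fintype γ] {f : Z → α → β → ℝ} {g : Z → β → γ → ℝ} {n : WithTop ℕ∞}
    (hf : ContDiff ℝ n f) (hg : ContDiff ℝ n g) : ContDiff ℝ n fun z => mmul (f z) (g z) := by
  refine contDiff_pi.2 fun i => contDiff_pi.2 fun j => ContDiff.sum fun l _ => ContDiff.mul ?_ ?_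
  · exact contDiff_pi.1 (contDiff_pi.1 hf i) l
  · exact contDiff_pi.1 (contDiff_pi.1 hg l) j

theorem contDiff_mdet : ContDiff ℝ ∞ (mdet (α := α)) := by
  have h : (mdet (α := α)) = fun M : Sq α => ∑ σ : Equiv.Perm α,
      ((Equiv.Perm.sign σ : ℤ) : ℝ) * ∏ i, M (σ i) i := by
    funext M
    rw [mdet, Matrix.det_apply']
    rfl
  rw [h]
  refine ContDiff.sum fun σ _ => contDiff_const.mul (contDiff_prod fun i _ => ?_)
  exact contDiff_apply_apply ℝ ℝ (σ i) i

theorem contDiff_mgram : ContDiff ℝ ∞ (mgram (α := α)) := by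
  refine ContDiff.mmul (f := fun M : Sq α => mtrans M) ?_ contDiff_id
  refine contDiff_pi.2 fun i => contDiff_pi.2 fun j => ?_
  exact contDiff_apply_apply ℝ ℝ j i

theorem contDiff_cutoff : ContDiff ℝ ∞ (cutoff (α := α)) :=
  (gramBump α).contDiff.comp contDiff_mgram

theorem cutoff_nonneg (M : Sq α) : 0 ≤ cutoff M := (gramBump α).nonneg

theorem cutoff_mone : cutoff (mone α) = 1 := by
  have h : mgram (mone α) = mone α := by
    have h1 : mtrans (mone α) = mone α := Matrix.transpose_one
    rw [mgram, h1, mone_mmul]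
  rw [cutoff, h]
  exact (gramBump α).one_of_mem_closedBall (Metric.mem_closedBall_self (gramBump α).rIn_pos.le)

/-- A compact set that contains the support of the cutoff. -/
def cutoffSupport (α : Type) [Fintype α] [DecidableEq α] : Set (Sq α) :=
  {M | dist (mgram M) (mone α) ≤ cutoffRadius α / 2}

theorem cutoff_eq_zero {M : Sq α} (hM : M ∉ cutoffSupport α) : cutoff M = 0 :=
  (gramBump α).zero_of_le_dist (not_le.1 hM).le

theorem mdet_ne_zero_of_mem_cutoffSupport {M : Sq α} (hM : M ∈ cutoffSupport α) :
    mdet M ≠ 0 := by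
  have h1 := cutoffRadius_pos α
  have h2 : mdet (mgram M) ≠ 0 := mdet_ne_zero_of_dist_lt (lt_of_le_of_lt hM (by linarith))
  rw [mdet_mgram] at h2
  exact fun h => h2 (by rw [h]; ring)

theorem isCompact_cutoffSupport : IsCompact (cutoffSupport α) := by
  refine Metric.isCompact_of_isClosed_isBounded
    (isClosed_le (by fun_prop) continuous_const) ?_
  refine (Metric.isBounded_closedBall (x := (0 : Sq α))
    (r := 1 + (1 + cutoffRadius α / 2))).subset fun M hM => ?_
  have hr := cutoffRadius_pos α
  rw [mem_closedBall_zero_iff, pi_norm_le_iff_of_nonneg (by positivity)]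
  intro i
  rw [pi_norm_le_iff_of_nonneg (by positivity)]
  intro j
  have h1 : dist (mgram M j j) (mone α j j) ≤ cutoffRadius α / 2 :=
    ((dist_le_pi_dist _ _ j).trans (dist_le_pi_dist _ _ j)).trans hM
  rw [mone_apply, if_pos rfl, Real.dist_eq] at h1
  have h2 : M i j ^ 2 ≤ mgram M j j := by
    have h3 : mgram M j j = ∑ l, M l j ^ 2 := Finset.sum_congr rfl fun l _ => (sq (M l j)).symm
    rw [h3]
    exact Finset.single_le_sum (f := fun l => M l j ^ 2) (fun l _ => sq_nonneg _)
      (Finset.mem_univ i)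
  have h3 := (abs_le.1 h1).2
  rw [Real.norm_eq_abs]
  refine abs_le_of_sq_le_sq ?_ (by positivity)
  nlinarith

/-- The constant in the formula for integrals against the cutoff. -/
def cutoffConst (μ : Measure (Sq α)) : ENNReal := ∫⁻ p, (cutoff p).toNNReal ∂μ

theorem IsUnfolding.cutoffConst_ne_top {ν : Measure X} {nb : X → Sq α}
    {P : Set (Sq α)} {μ : Measure (Sq α)} {wt : Sq α → NNReal}
    {θ : Sq α → X} (h : IsUnfolding ν nb P μ wt θ) : cutoffConst μ ≠ ⊤ := by
  have h1 : cutoffConst μ ≤ ∫⁻ p, (cutoffSupport α).indicator 1 p ∂μ := by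
    refine lintegral_mono fun p => ?_
    by_cases hp : p ∈ cutoffSupport α
    · rw [indicator_of_mem hp]
      refine ENNReal.coe_le_one_iff.2 ?_
      exact Real.toNNReal_le_one.2 (gramBump α).le_one
    · rw [indicator_of_notMem hp, cutoff_eq_zero hp]
      simp
  rw [lintegral_indicator_one isCompact_cutoffSupport.measurableSet] at h1
  exact (h1.trans_lt (h.measure_lt_top _ isCompact_cutoffSupport fun M hM =>
    mdet_ne_zero_of_mem_cutoffSupport hM)).ne

theorem IsUnfolding.lintegral_cutoff' {ν : Measure X} {nb : X → Sq α}
    {P : Set (Sq α)} {μ : Measure (Sq α)} {wt : Sq α → NNReal}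
    {θ : Sq α → X} (h : IsUnfolding ν nb P μ wt θ) {y : Sq α} (hy : mdet y ≠ 0)
    {G : X → ENNReal} (hG : Measurable G) :
    ∫⁻ M, ((wt M * (cutoff (mmul y M)).toNNReal : NNReal) : ENNReal) * G (θ M) =
      cutoffConst μ * ∫⁻ x, G x ∂ν :=
  h.lintegral_cutoff (κ := fun S => (gramBump α S).toNNReal)
    ((gramBump α).continuous.measurable.real_toNNReal) hy hG

theorem IsUnfolding.cutoffConst_ne_zero {ν : Measure X} {nb : X → Sq α}
    {P : Set (Sq α)} {μ : Measure (Sq α)} {wt : Sq α → NNReal}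
    {θ : Sq α → X} (h : IsUnfolding ν nb P μ wt θ) : cutoffConst μ ≠ 0 := by
  intro h0
  have h1 := h.lintegral_cutoff' (y := mone α) (by rw [mdet_mone]; exact one_ne_zero)
    (G := fun _ => 1) measurable_const
  rw [h0, zero_mul] at h1
  simp only [mone_mmul, mul_one] at h1
  have hwt := h.measurable_weight
  have hc : Measurable (cutoff (α := α)) := contDiff_cutoff.continuous.measurable
  rw [lintegral_eq_zero_iff (by fun_prop)] at h1
  have h2 : ∀ᵐ M : Sq α, cutoff M = 0 := by
    filter_upwards [h1, h.ae_weight_ne_zero] with M h3 h4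
    have h5 : (wt M * (cutoff M).toNNReal : NNReal) = 0 :=
      ENNReal.coe_eq_zero.1 h3
    have h6 := (mul_eq_zero.1 h5).resolve_left h4
    exact le_antisymm (Real.toNNReal_eq_zero.1 h6) (cutoff_nonneg M)
  have h3 : (cutoff (α := α)) = fun _ => 0 :=
    (contDiff_cutoff.continuous.ae_eq_iff_eq volume continuous_const).1 h2
  have h4 := congrFun h3 (mone α)
  rw [cutoff_mone] at h4
  exact one_ne_zero h4

theorem IsUnfolding.integral_cutoff {ν : Measure X} {nb : X → Sq α}
    {P : Set (Sq α)} {μ : Measure (Sq α)} {wt : Sq α → NNReal}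
    {θ : Sq α → X} (h : IsUnfolding ν nb P μ wt θ) {y : Sq α} (hy : mdet y ≠ 0)
    {H : X → ℂ} (hH : AEStronglyMeasurable H ν) :
    (Integrable (fun M => ((wt M : ℝ) : ℂ) * ((cutoff (mmul y M) : ℝ) : ℂ) * H (θ M)) ↔
      Integrable H ν) ∧
    ∫ M, ((wt M : ℝ) : ℂ) * ((cutoff (mmul y M) : ℝ) : ℂ) * H (θ M) =
      (((cutoffConst μ).toReal : ℝ) : ℂ) * ∫ x, H x ∂ν := by
  have hwt := h.measurable_weight
  have hc : Measurable (cutoff (α := α)) := contDiff_cutoff.continuous.measurable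
  have h1 := integrable_integral_of_lintegral (μ := volume) (ν := ν) h.measurable_coord
    (w := fun M => wt M * (cutoff (mmul y M)).toNNReal) (by fun_prop) h.cutoffConst_ne_zero
    h.cutoffConst_ne_top (fun G hG => h.lintegral_cutoff' hy hG) hH
  simpa [Real.coe_toNNReal _ (cutoff_nonneg _)] using h1

end Average

section HolSmoothOn

variable {Q Q' E E' : Type} [NormedAddCommGroup Q] [NormedSpace ℂ Q]
  [NormedAddCommGroup Q'] [NormedSpace ℂ Q']
  [NormedAddCommGroup E] [NormedSpace ℝ E] [NormedAddCommGroup E'] [NormedSpace ℝ E']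

/-- Functions that are smooth, and holomorphic in the first variable, where the second variable
is in a given set. -/
def HolSmoothOn (Φ : Q × E → ℂ) (U : Set E) : Prop :=
  ContDiffOn ℝ ∞ Φ (univ ×ˢ U) ∧ ∀ x ∈ U, Differentiable ℂ fun q => Φ (q, x)

theorem HolSmooth.holSmoothOn {Φ : Q × E → ℂ} (h : HolSmooth Φ) (U : Set E) : HolSmoothOn Φ U :=
  ⟨h.1.contDiffOn, fun x _ => h.2 x⟩

theorem HolSmoothOn.mul {Φ Ψ : Q × E → ℂ} {U : Set E} (h : HolSmoothOn Φ U)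
    (h' : HolSmoothOn Ψ U) : HolSmoothOn (fun z => Φ z * Ψ z) U :=
  ⟨h.1.mul h'.1, fun x hx => (h.2 x hx).mul (h'.2 x hx)⟩

theorem HolSmoothOn.add {Φ Ψ : Q × E → ℂ} {U : Set E} (h : HolSmoothOn Φ U)
    (h' : HolSmoothOn Ψ U) : HolSmoothOn (fun z => Φ z + Ψ z) U :=
  ⟨h.1.add h'.1, fun x hx => (h.2 x hx).add (h'.2 x hx)⟩

theorem HolSmoothOn.cexp {Φ : Q × E → ℂ} {U : Set E} (h : HolSmoothOn Φ U) :
    HolSmoothOn (fun z => Complex.exp (Φ z)) U :=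
  ⟨h.1.cexp, fun x hx => (h.2 x hx).cexp⟩

theorem HolSmoothOn.congr {Φ Ψ : Q × E → ℂ} {U : Set E} (h : HolSmoothOn Φ U)
    (e : ∀ q, ∀ x ∈ U, Ψ (q, x) = Φ (q, x)) : HolSmoothOn Ψ U := by
  refine ⟨h.1.congr fun z hz => e z.1 z.2 hz.2, fun x hx => ?_⟩
  have h1 : (fun q => Ψ (q, x)) = fun q => Φ (q, x) := funext fun q => e q x hx
  rw [h1]
  exact h.2 x hx

theorem HolSmoothOn.of_right {f : E → ℂ} {U : Set E} (hf : ContDiffOn ℝ ∞ f U) :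
    HolSmoothOn (fun z : Q × E => f z.2) U :=
  ⟨hf.comp contDiff_snd.contDiffOn fun _ hz => hz.2, fun x _ => differentiable_const (f x)⟩

theorem HolSmoothOn.of_left {f : Q → ℂ} {U : Set E} (hf : ContDiff ℂ ∞ f) :
    HolSmoothOn (fun z : Q × E => f z.1) U :=
  (HolSmooth.of_left hf).holSmoothOn U

theorem HolSmoothOn.comp {Φ : Q × E → ℂ} {U : Set E} (h : HolSmoothOn Φ U) {a : Q' → Q}
    (ha : ContDiff ℂ ∞ a) {θ : E' → E} {U' : Set E'} (hθ : ContDiffOn ℝ ∞ θ U')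
    (hU : MapsTo θ U' U) : HolSmoothOn (fun z : Q' × E' => Φ (a z.1, θ z.2)) U' := by
  refine ⟨h.1.comp (((ha.restrict_scalars ℝ).comp contDiff_fst).contDiffOn.prodMk
    (hθ.comp contDiff_snd.contDiffOn fun _ hz => hz.2)) fun z hz => ⟨mem_univ _, hU hz.2⟩,
    fun x hx => (h.2 (θ x) (hU hx)).comp (ha.differentiable (by simp))⟩

theorem HolSmoothOn.holSmooth {Φ : Q × E → ℂ} {U : Set E} (h : HolSmoothOn Φ U) (hU : IsOpen U)
    {k : Set E} (hk : IsClosed k) (hkU : k ⊆ U) (h0 : ∀ q, ∀ x ∉ k, Φ (q, x) = 0) :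
    HolSmooth Φ := by
  constructor
  · rw [contDiff_iff_contDiffAt]
    rintro ⟨q, x⟩
    by_cases hx : x ∈ U
    · exact h.1.contDiffAt ((isOpen_univ.prod hU).mem_nhds ⟨mem_univ _, hx⟩)
    · have h1 : ∀ᶠ z : Q × E in 𝓝 (q, x), Φ z = 0 := by
        have h2 : (univ ×ˢ kᶜ : Set (Q × E)) ∈ 𝓝 (q, x) :=
          (isOpen_univ.prod hk.isOpen_compl).mem_nhds ⟨mem_univ _, fun h' => hx (hkU h')⟩
        filter_upwards [h2] with z hz
        exact h0 z.1 z.2 hz.2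
      exact contDiffAt_const.congr_of_eventuallyEq h1
  · intro x
    by_cases hx : x ∈ U
    · exact h.2 x hx
    · simp_rw [h0 _ x fun h' => hx (hkU h')]
      exact differentiable_const _

theorem holSmoothOn_sgnPow (ε : ZMod 2) :
    HolSmoothOn (fun z : ℂ × ℝ => sgnPow ε z.1 z.2) {x : ℝ | x ≠ 0} := by
  have habs : ContDiffOn ℝ ∞ (fun x : ℝ => |x|) {x : ℝ | x ≠ 0} := fun x hx =>
    (contDiffAt_abs hx).contDiffWithinAt
  have h1 : HolSmoothOn (fun z : ℂ × ℝ => (((z.2 * |z.2|⁻¹) ^ ε.val : ℝ) : ℂ)) {x : ℝ | x ≠ 0} := by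
    refine HolSmoothOn.of_right (f := fun x : ℝ => (((x * |x|⁻¹) ^ ε.val : ℝ) : ℂ)) ?_
    exact Complex.ofRealCLM.contDiff.comp_contDiffOn
      ((contDiffOn_id.mul (habs.inv fun x hx => abs_ne_zero.2 hx)).pow _)
  have h2 : HolSmoothOn (fun z : ℂ × ℝ => Complex.exp (((Real.log |z.2| : ℝ) : ℂ) * z.1))
      {x : ℝ | x ≠ 0} := by
    refine HolSmoothOn.cexp (HolSmoothOn.mul ?_ (HolSmoothOn.of_left contDiff_id))
    refine HolSmoothOn.of_right (f := fun x : ℝ => ((Real.log |x| : ℝ) : ℂ)) ?_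
    exact Complex.ofRealCLM.contDiff.comp_contDiffOn (habs.log fun x hx => abs_ne_zero.2 hx)
  refine (h1.mul h2).congr fun μ x hx => ?_
  have h3 : ((|x| : ℝ) : ℂ) ≠ 0 := by simpa using hx
  have h4 : Real.sign x = x * |x|⁻¹ := by
    rcases lt_or_gt_of_ne hx with h | h
    · rw [Real.sign_of_neg h, abs_of_neg h, inv_neg, mul_neg, mul_inv_cancel₀ hx]
    · rw [Real.sign_of_pos h, abs_of_pos h]
      field_simp
  simp only [sgnPow]
  rw [Complex.cpow_def_of_ne_zero h3, ← Complex.ofReal_log (abs_nonneg x), h4]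
  push_cast
  ring_nf

/-- Two entire functions that agree on a nonempty open set are equal. -/
theorem eq_of_differentiable_of_eqOn {f g : Q → ℂ} (hf : Differentiable ℂ f)
    (hg : Differentiable ℂ g) {U : Set Q} (hU : IsOpen U) (hne : U.Nonempty) (h : EqOn f g U) :
    f = g := by
  obtain ⟨q₀, hq₀⟩ := hne
  funext q
  let l : ℂ → Q := fun s => q₀ + s • (q - q₀)
  have hl : Differentiable ℂ l := (differentiable_const _).add (differentiable_id.smul_const _)
  have h1 : AnalyticOnNhd ℂ (f ∘ l) univ :=
    fun s _ => (hf.comp hl).analyticAt s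
  have h2 : AnalyticOnNhd ℂ (g ∘ l) univ :=
    fun s _ => (hg.comp hl).analyticAt s
  have h3 : f ∘ l =ᶠ[𝓝 0] g ∘ l := by
    have h4 : l ⁻¹' U ∈ 𝓝 (0 : ℂ) :=
      (hU.preimage hl.continuous).mem_nhds (by simpa [l] using hq₀)
    filter_upwards [h4] with s hs
    exact h hs
  have h5 := h1.eq_of_eventuallyEq h2 h3
  simpa [l] using congrFun h5 1

end HolSmoothOn

section Sections

variable {ι ι' : Type} [Fintype ι] [DecidableEq ι] [Fintype ι'] [DecidableEq ι']

/-- The entries of an invertible matrix. -/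
def gmat (g : GL ι ℝ) : Sq ι := (g : Matrix ι ι ℝ)

theorem gmat_mul (g h : GL ι ℝ) : gmat (g * h) = mmul (gmat g) (gmat h) := rfl

theorem mdet_gmat (g : GL ι ℝ) : mdet (gmat g) ≠ 0 := g.det_ne_zero

/-- An invertible matrix. -/
def toGL (X : Sq ι) (h : mdet X ≠ 0) : GL ι ℝ :=
  Matrix.GeneralLinearGroup.mkOfDetNeZero (Matrix.of X) h

theorem gmat_toGL (X : Sq ι) (h : mdet X ≠ 0) : gmat (toGL X h) = X := rfl

theorem gmat_injective : Function.Injective (gmat (ι := ι)) := fun _ _ h => Units.ext h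

theorem toGL_gmat (g : GL ι ℝ) : toGL (gmat g) (mdet_gmat g) = g := gmat_injective rfl

theorem extendGL_of_ne (f : GL ι ℝ → ℂ) {X : Sq ι} (h : mdet X ≠ 0) :
    extendGL f X = f (toGL X h) := dif_pos h

theorem extendGL_of_eq (f : GL ι ℝ → ℂ) {X : Sq ι} (h : mdet X = 0) :
    extendGL f X = 0 := dif_neg (not_not.2 h)

theorem extendGL_gmat (f : GL ι ℝ → ℂ) (g : GL ι ℝ) : extendGL f (gmat g) = f g := by
  rw [extendGL_of_ne f (mdet_gmat g), toGL_gmat]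

theorem isOpen_mdet_ne_zero : IsOpen {X : Sq ι | mdet X ≠ 0} :=
  isOpen_ne_fun (show Continuous (mdet (α := ι)) by fun_prop) continuous_const

variable {Q Q' : Type} [NormedAddCommGroup Q] [NormedSpace ℂ Q]
  [NormedAddCommGroup Q'] [NormedSpace ℂ Q']

/-- Families of smooth functions on `GL` that depend holomorphically on a parameter. -/
def HolSec (F : Q → GL ι ℝ → ℂ) : Prop :=
  HolSmoothOn (fun z : Q × Sq ι => extendGL (F z.1) z.2) {X | mdet X ≠ 0}

theorem HolSec.differentiable {F : Q → GL ι ℝ → ℂ} (h : HolSec F) (g : GL ι ℝ) :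
    Differentiable ℂ fun q => F q g := by
  have h1 := h.2 (gmat g) (mdet_gmat g)
  simpa only [extendGL_gmat] using h1

theorem HolSec.smoothGL {F : Q → GL ι ℝ → ℂ} (h : HolSec F) (q : Q) : SmoothGL (F q) :=
  h.1.comp (f := fun X : Sq ι => (q, X)) (by fun_prop) fun _ hX => ⟨mem_univ _, hX⟩

theorem HolSec.comp {F : Q → GL ι ℝ → ℂ} (h : HolSec F) {a : Q' → Q} (ha : ContDiff ℂ ∞ a) :
    HolSec fun q => F (a q) :=
  HolSmoothOn.comp h ha contDiffOn_id (mapsTo_id _)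

theorem SmoothGL.holSec_mul {f : GL ι ℝ → ℂ} (hf : SmoothGL f) {c : Q → Sq ι → ℂ}
    (hc : HolSmoothOn (fun z : Q × Sq ι => c z.1 z.2) {X | mdet X ≠ 0}) :
    HolSec fun q g => c q (gmat g) * f g := by
  refine (hc.mul (HolSmoothOn.of_right hf)).congr fun q X hX => ?_
  simp only [extendGL_of_ne _ (show mdet X ≠ 0 from hX), gmat_toGL]

end Sections

section Operators

variable {ι ι' : Type} [Fintype ι] [DecidableEq ι] [Fintype ι'] [DecidableEq ι']
  {Q A V : Type} [NormedAddCommGroup Q] [NormedSpace ℂ Q]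
  [NormedAddCommGroup A] [NormedSpace ℂ A]
  [NormedAddCommGroup V] [NormedSpace ℝ V] [MeasureSpace V] [BorelSpace V]
  [SecondCountableTopology V] [IsFiniteMeasureOnCompacts (volume : Measure V)]

/-- The operator from functions on `GL(ι)` to functions on `GL(ι')` that is given by the
functional `ζ a`, the weight `w`, and smooth maps into the matrices. -/
def zetaOp (ζ : A → (V → ℂ) → ℂ) (w : A × V → ℂ) (e : Sq ι' → Sq ι)
    (j : V → Sq ι) (a : A) (f : GL ι ℝ → ℂ) (g : GL ι' ℝ) : ℂ :=
  ζ a fun v => w (a, v) * extendGL f (mmul (e (gmat g)) (j v))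

theorem IsRegularization.holSec_zetaOp {K : A → V → ℂ} {N : A → ℂ} {D : Set A}
    {ζ : A → (V → ℂ) → ℂ} (hζ : IsRegularization K N D ζ) {w : A × V → ℂ} (hw : HolSmooth w)
    {e : Sq ι' → Sq ι} (he : ContDiff ℝ ∞ e)
    (he' : ∀ X, mdet X ≠ 0 → mdet (e X) ≠ 0) {j : V → Sq ι} (hj : ContDiff ℝ ∞ j) {k : Set V}
    (hk : IsCompact k) (hkj : ∀ v ∈ k, mdet (j v) ≠ 0) (hwk : ∀ a, ∀ v ∉ k, w (a, v) = 0)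
    {F : Q → GL ι ℝ → ℂ} (hF : HolSec F) {a : Q → A} (ha : ContDiff ℂ ∞ a) :
    HolSec fun q => zetaOp ζ w e j (a q) (F q) := by
  have key : ∀ c : Sq ι' → Sq ι', ContDiff ℝ ∞ c → (∀ X, mdet (c X) ≠ 0) →
      HolSmooth fun z : Q × Sq ι' =>
        ζ (a z.1) fun v => w (a z.1, v) * extendGL (F z.1) (mmul (e (c z.2)) (j v)) := by
    intro c hc hc0
    refine hζ.holSmooth a ha (fun z : Q × Sq ι' × V =>
      w (a z.1, z.2.2) * extendGL (F z.1) (mmul (e (c z.2.1)) (j z.2.2))) ?_ k hk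
      fun q X v hv => by simp only [hwk _ v hv, zero_mul]
    have hθ : ContDiff ℝ ∞ fun y : Sq ι' × V => mmul (e (c y.1)) (j y.2) :=
      ContDiff.mmul (he.comp (hc.comp contDiff_fst)) (hj.comp contDiff_snd)
    refine HolSmoothOn.holSmooth (U := {y : Sq ι' × V |
      mdet (mmul (e (c y.1)) (j y.2)) ≠ 0}) (k := univ ×ˢ k) ?_
      (isOpen_mdet_ne_zero.preimage hθ.continuous) (isClosed_univ.prod hk.isClosed) ?_ ?_
    · refine HolSmoothOn.mul ?_ ?_
      · exact (hw.comp ha (θ := fun y : Sq ι' × V => y.2) contDiff_snd).holSmoothOn _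
      · exact HolSmoothOn.comp hF (a := fun q => q) contDiff_id hθ.contDiffOn fun y hy => hy
    · rintro ⟨X, v⟩ ⟨-, hv⟩
      change mdet _ ≠ 0
      rw [mdet_mmul]
      exact mul_ne_zero (he' _ (hc0 X)) (hkj v hv)
    · intro q y hy
      simp only [hwk _ y.2 fun h => hy ⟨mem_univ _, h⟩, zero_mul]
  have hext : ∀ q, ∀ X : Sq ι', mdet X ≠ 0 → extendGL (zetaOp ζ w e j (a q) (F q)) X =
      ζ (a q) fun v => w (a q, v) * extendGL (F q) (mmul (e X) (j v)) := by
    intro q X hX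
    rw [extendGL_of_ne _ hX]
    rfl
  constructor
  · rintro ⟨q₀, X₀⟩ ⟨-, hX₀⟩
    obtain ⟨r, hr, hball⟩ := Metric.isOpen_iff.1 isOpen_mdet_ne_zero X₀ hX₀
    let b : ContDiffBump X₀ := ⟨r / 4, r / 2, by positivity, by linarith⟩
    let c : Sq ι' → Sq ι' := fun X => X₀ + b X • (X - X₀)
    have hc : ContDiff ℝ ∞ c :=
      contDiff_const.add (b.contDiff.smul (contDiff_id.sub contDiff_const))
    have hc0 : ∀ X, mdet (c X) ≠ 0 := by
      intro X
      refine hball ?_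
      rw [Metric.mem_ball, dist_eq_norm]
      simp only [c, add_sub_cancel_left, norm_smul, Real.norm_eq_abs, abs_of_nonneg b.nonneg]
      by_cases hX : dist X X₀ < r / 2
      · rw [dist_eq_norm] at hX
        have h1 : b X ≤ 1 := b.le_one
        nlinarith [norm_nonneg (X - X₀), b.nonneg (x := X)]
      · have h1 : b X = 0 := b.zero_of_le_dist (not_lt.1 hX)
        rw [h1, zero_mul]
        exact hr
    refine ((key c hc hc0).1.contDiffAt.congr_of_eventuallyEq ?_).contDiffWithinAt
    have h2 : (univ ×ˢ Metric.ball X₀ (r / 4) : Set (Q × Sq ι')) ∈ 𝓝 (q₀, X₀) :=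
      (isOpen_univ.prod Metric.isOpen_ball).mem_nhds
        ⟨mem_univ _, Metric.mem_ball_self (by positivity)⟩
    filter_upwards [h2] with z hz
    have hz2 : c z.2 = z.2 := by
      simp only [c, b.one_of_mem_closedBall (Metric.ball_subset_closedBall hz.2), one_smul,
        add_sub_cancel]
    have hz3 : mdet z.2 ≠ 0 := hz2 ▸ hc0 z.2
    simp only [hext z.1 z.2 hz3, hz2]
  · intro X hX
    have h1 := (key (fun _ => X) contDiff_const fun _ => hX).2 X
    exact fun q => (h1 q).congr_of_eventuallyEq (Eventually.of_forall fun q => hext q X hX)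

end Operators

section Blocks

variable {α β : Type} [Fintype α] [DecidableEq α] [Fintype β] [DecidableEq β]

theorem blk₁₁_mmul {α' β' γ δ : Type} (X : α' ⊕ β' → α ⊕ β → ℝ) (Y : α ⊕ β → γ ⊕ δ → ℝ) :
    blk₁₁ (mmul X Y) = mmul (blk₁₁ X) (blk₁₁ Y) + mmul (blk₁₂ X) (blk₂₁ Y) := by
  funext i j
  exact Fintype.sum_sum_type _

theorem blk₂₁_mmul {α' β' γ δ : Type} (X : α' ⊕ β' → α ⊕ β → ℝ) (Y : α ⊕ β → γ ⊕ δ → ℝ) :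
    blk₂₁ (mmul X Y) = mmul (blk₂₁ X) (blk₁₁ Y) + mmul (blk₂₂ X) (blk₂₁ Y) := by
  funext i j
  exact Fintype.sum_sum_type _

theorem mdet_eq_of_blk₂₁ {M : α ⊕ β → α ⊕ β → ℝ} (h : blk₂₁ M = 0) :
    mdet M = mdet (blk₁₁ M) * mdet (blk₂₂ M) := by
  rw [← mdet_blk_zero (blk₁₁ M) (blk₁₂ M) (blk₂₂ M), ← h, blk_eta]

theorem blk₁₁_conj (A : α ⊕ β → α ⊕ β → ℝ) {p : α ⊕ β → α ⊕ β → ℝ} (hp : blk₂₁ p = 0) :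
    blk₁₁ (mmul (mtrans p) (mmul A p)) =
      mmul (mtrans (blk₁₁ p)) (mmul (blk₁₁ A) (blk₁₁ p)) := by
  have h1 : blk₁₂ (mtrans p) = mtrans (blk₂₁ p) := rfl
  have h2 : blk₁₁ (mtrans p) = mtrans (blk₁₁ p) := rfl
  have h3 : mtrans (0 : β → α → ℝ) = 0 := rfl
  rw [blk₁₁_mmul, blk₁₁_mmul, hp, h1, h2, hp, h3, mmul_zero, zero_mmul, add_zero, add_zero]

theorem mdet_conj (A p : Sq α) :
    mdet (mmul (mtrans p) (mmul A p)) = mdet p ^ 2 * mdet A := by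
  have h1 : mdet (mtrans p) = mdet p := Matrix.det_transpose (Matrix.of p)
  rw [mdet_mmul, mdet_mmul, h1]
  ring

theorem contDiff_blk₁₁ : ContDiff ℝ ∞ (blk₁₁ : (α ⊕ β → α ⊕ β → ℝ) → Sq α) :=
  contDiff_pi.2 fun i => contDiff_pi.2 fun j => contDiff_apply_apply ℝ ℝ (Sum.inl i) (Sum.inl j)

theorem posDef_blk₁₁ {S : α ⊕ β → α ⊕ β → ℝ} (hS : (Matrix.of S).PosDef) :
    (Matrix.of (blk₁₁ S)).PosDef := hS.submatrix (e := Sum.inl) Sum.inl_injective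

theorem blk₁₁_mone : blk₁₁ (mone (α ⊕ β)) = mone α := by
  funext i j
  simp [blk₁₁, mone_apply]

end Blocks

theorem sgnPow_sq (μ : ℂ) {x : ℝ} (hx : x ≠ 0) : sgnPow 0 μ (x ^ 2) = sgnPow 0 (μ + μ) x := by
  rw [sq, sgnPow_mul, sgnPow_mul_sgnPow _ _ _ _ hx, add_zero]

theorem sgnPow_abs_one (μ : ℂ) {x : ℝ} (hx : x ^ 2 = 1) : sgnPow 0 μ x = 1 := by
  have h : |x| = 1 := by rwa [← sq_eq_sq₀ (abs_nonneg x) zero_le_one, sq_abs, one_pow]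
  rw [sgnPow_zero_left, h]
  simp

theorem ContDiff.differentiable_top {Q Q' : Type} [NormedAddCommGroup Q] [NormedSpace ℂ Q]
    [NormedAddCommGroup Q'] [NormedSpace ℂ Q'] {a : Q → Q'} (ha : ContDiff ℂ ∞ a) :
    Differentiable ℂ a := ha.differentiable (by simp)

theorem differentiable_sgnPow {Q : Type} [NormedAddCommGroup Q] [NormedSpace ℂ Q] (ε : ZMod 2)
    {a : Q → ℂ} (ha : Differentiable ℂ a) {x : ℝ} (hx : x ≠ 0) :
    Differentiable ℂ fun q => sgnPow ε (a q) x :=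
  ((holSmoothOn_sgnPow ε).2 x hx).comp ha

section Series

variable {ι ι' : Type} [Fintype ι] [DecidableEq ι] [Fintype ι'] [DecidableEq ι']
  {Q Q₀ : Type} [NormedAddCommGroup Q] [NormedSpace ℂ Q]
  [NormedAddCommGroup Q₀] [NormedSpace ℂ Q₀]

/-- `R` consists of the smooth functions on `GL(ι)` that transform under `P` by the characters
`χ`. -/
def IsInduced (P : Set (Sq ι)) (χ : Q → Sq ι → ℂ)
    (R : Q → Submodule ℂ (GL ι ℝ → ℂ)) : Prop :=
  (∀ q f, f ∈ R q ↔ SmoothGL f ∧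
    ∀ g p : GL ι ℝ, gmat p ∈ P → f (g * p) = χ q (gmat p) * f g) ∧
  ∀ p ∈ P, mdet p ≠ 0 → Differentiable ℂ fun q => χ q p

/-- A family of representations induced from a parabolic subgroup, with the ratio `c` of the
spherical vectors. -/
structure IsSeries (P : Set (Sq ι)) (χ : Q → Sq ι → ℂ)
    (R : Q → Submodule ℂ (GL ι ℝ → ℂ)) (c : Q → Sq ι → ℂ) : Prop where
  isInduced : IsInduced P χ R
  exists_mgram : ∀ S : Sq ι, (Matrix.of S).PosDef → ∃ p ∈ P, S = mgram p
  holSmoothOn : HolSmoothOn (fun z : Q × Sq ι => c z.1 z.2) {X | mdet X ≠ 0}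
  mmul_char : ∀ d q X p, mdet X ≠ 0 → p ∈ P → mdet p ≠ 0 →
    c d (mmul X p) * χ q p = χ (d + q) p * c d X
  eq_one : ∀ d X, mgram X = mone ι → c d X = 1
  zero_eq : ∀ X, mdet X ≠ 0 → c 0 X = 1

variable {P : Set (Sq ι)} {χ : Q → Sq ι → ℂ} {R : Q → Submodule ℂ (GL ι ℝ → ℂ)}
  {c : Q → Sq ι → ℂ}

theorem IsSeries.mul_mem (h : IsSeries P χ R c) {q₀ : Q} {f : GL ι ℝ → ℂ} (hf : f ∈ R q₀)
    (q : Q) : (fun g => c (q - q₀) (gmat g) * f g) ∈ R q := by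
  obtain ⟨h1, h2⟩ := (h.isInduced.1 q₀ f).1 hf
  refine (h.isInduced.1 q _).2 ⟨(h1.holSec_mul h.holSmoothOn).smoothGL (q - q₀), fun g p hp => ?_⟩
  rw [h2 g p hp, gmat_mul, ← mul_assoc, h.mmul_char _ _ _ _ (mdet_gmat g) hp (mdet_gmat p),
    sub_add_cancel, mul_assoc]

theorem IsSeries.exists_section (h : IsSeries P χ R c) {q₀ : Q} {f : GL ι ℝ → ℂ}
    (hf : f ∈ R q₀) : ∃ F : ∀ q, R q, HolSec (fun q => (F q : GL ι ℝ → ℂ)) ∧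
      (F q₀ : GL ι ℝ → ℂ) = f ∧
      ∀ k : GL ι ℝ, mgram (gmat k) = mone ι → ∀ q q',
        (F q : GL ι ℝ → ℂ) k = (F q' : GL ι ℝ → ℂ) k := by
  refine ⟨fun q => ⟨_, h.mul_mem hf q⟩, ?_, ?_, fun k hk q q' => ?_⟩
  · exact (((h.isInduced.1 q₀ f).1 hf).1.holSec_mul h.holSmoothOn).comp
      (contDiff_id.sub contDiff_const)
  · funext g
    simp only [sub_self, h.zero_eq _ (mdet_gmat g), one_mul]
  · simp only [h.eq_one _ _ hk]

theorem IsSeries.eq_of_orthogonal (h : IsSeries P χ R c) {q : Q} {f f' : GL ι ℝ → ℂ}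
    (hf : f ∈ R q) (hf' : f' ∈ R q)
    (e : ∀ k : GL ι ℝ, mgram (gmat k) = mone ι → f k = f' k) : f = f' := by
  funext g
  obtain ⟨p, hp, hg⟩ := h.exists_mgram _ (posDef_mgram (mdet_gmat g))
  have hp0 : mdet p ≠ 0 := by
    have h1 := congrArg mdet hg
    rw [mdet_mgram, mdet_mgram] at h1
    intro h0
    rw [h0, zero_pow two_ne_zero] at h1
    exact mdet_gmat g (pow_eq_zero_iff two_ne_zero |>.1 h1)
  set b := toGL p hp0 with hb
  have hbp : gmat b = p := rfl
  have hk : mgram (gmat (g * b⁻¹)) = mone ι := by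
    rw [gmat_mul, mgram_mmul, hg, ← hbp, ← mgram_mmul, ← gmat_mul, mul_inv_cancel]
    have h1 : mtrans (mone ι) = mone ι := Matrix.transpose_one
    change mgram (mone ι) = _
    rw [mgram, h1, mone_mmul]
  have h1 := ((h.isInduced.1 q f).1 hf).2 (g * b⁻¹) b hp
  have h2 := ((h.isInduced.1 q f').1 hf').2 (g * b⁻¹) b hp
  rw [inv_mul_cancel_right] at h1 h2
  rw [h1, h2, e _ hk]

theorem IsSeries.holSec_of_standard (h : IsSeries P χ R c) {F : ∀ q, R q}
    (hF : ∀ k : GL ι ℝ, mgram (gmat k) = mone ι → ∀ q q',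
      (F q : GL ι ℝ → ℂ) k = (F q' : GL ι ℝ → ℂ) k) :
    HolSec fun q => (F q : GL ι ℝ → ℂ) := by
  obtain ⟨F', h1, h2, h3⟩ := h.exists_section (F 0).2
  have h4 : F = F' := by
    funext q
    refine Subtype.ext (h.eq_of_orthogonal (F q).2 (F' q).2 fun k hk => ?_)
    rw [hF k hk q 0, h3 k hk q 0, h2]
  rw [h4]
  exact h1

/-- Two families of linear maps that depend holomorphically on the parameter are equal if they
agree on an open set. -/
theorem IsSeries.family_unique (h : IsSeries P χ R c) {a : Q₀ → Q}
    {R' : Q₀ → Submodule ℂ (GL ι' ℝ → ℂ)} {T T' : ∀ q, R (a q) →ₗ[ℂ] R' q}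
    (hT : ∀ F : ∀ q, R q, HolSec (fun q => (F q : GL ι ℝ → ℂ)) →
      (∀ k : GL ι ℝ, mgram (gmat k) = mone ι → ∀ q q',
        (F q : GL ι ℝ → ℂ) k = (F q' : GL ι ℝ → ℂ) k) →
      ∀ g, Differentiable ℂ fun q => (T q (F (a q)) : GL ι' ℝ → ℂ) g)
    (hT' : ∀ F : ∀ q, R q, HolSec (fun q => (F q : GL ι ℝ → ℂ)) →
      (∀ k : GL ι ℝ, mgram (gmat k) = mone ι → ∀ q q',
        (F q : GL ι ℝ → ℂ) k = (F q' : GL ι ℝ → ℂ) k) →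
      ∀ g, Differentiable ℂ fun q => (T' q (F (a q)) : GL ι' ℝ → ℂ) g)
    {D : Set Q₀} (hD : IsOpen D) (hne : D.Nonempty)
    (e : ∀ q ∈ D, ∀ f g, (T q f : GL ι' ℝ → ℂ) g = (T' q f : GL ι' ℝ → ℂ) g) : T = T' := by
  funext q
  refine LinearMap.ext fun f => Subtype.ext (funext fun g => ?_)
  obtain ⟨F, h1, h2, h3⟩ := h.exists_section f.2
  have h4 : F (a q) = f := Subtype.ext h2
  have h5 := congrFun (eq_of_differentiable_of_eqOn (hT F h1 h3 g) (hT' F h1 h3 g) hD hne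
    fun q hq => e q hq _ g) q
  simpa only [h4] using h5

/-- Operators that preserve holomorphic families of functions define intertwining maps between
induced representations, if they do so for parameters in an open set. -/
theorem IsSeries.exists_family (h : IsSeries P χ R c) {a : Q₀ → Q} (ha : ContDiff ℂ ∞ a)
    {R' : Q₀ → Submodule ℂ (GL ι' ℝ → ℂ)} {P' : Set (Sq ι')}
    {χ' : Q₀ → Sq ι' → ℂ} (hR' : IsInduced P' χ' R')
    {op : Q₀ → (GL ι ℝ → ℂ) → GL ι' ℝ → ℂ}
    (hop : ∀ F : Q₀ → GL ι ℝ → ℂ, HolSec F → HolSec fun q => op q (F q))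
    {D : Set Q₀} (hD : IsOpen D) (hne : D.Nonempty)
    (hadd : ∀ q ∈ D, ∀ f ∈ R (a q), ∀ f' ∈ R (a q), ∀ g, op q (f + f') g = op q f g + op q f' g)
    (hsmul : ∀ q ∈ D, ∀ f ∈ R (a q), ∀ (s : ℂ) g, op q (s • f) g = s * op q f g)
    (heq : ∀ q ∈ D, ∀ f ∈ R (a q), ∀ g p : GL ι' ℝ, gmat p ∈ P' →
      op q f (g * p) = χ' q (gmat p) * op q f g) :
    ∃ T : ∀ q, R (a q) →ₗ[ℂ] R' q, ∀ q f g, (T q f : GL ι' ℝ → ℂ) g = op q f g := by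
  have sec : ∀ q₀, ∀ f ∈ R (a q₀), ∃ F : Q₀ → GL ι ℝ → ℂ, HolSec F ∧ (∀ q, F q ∈ R (a q)) ∧
      F q₀ = f := by
    intro q₀ f hf
    obtain ⟨F, h1, h2, -⟩ := h.exists_section hf
    exact ⟨_, h1.comp ha, fun q => (F (a q)).2, h2⟩
  have hadd' : ∀ q, ∀ f ∈ R (a q), ∀ f' ∈ R (a q), op q (f + f') = op q f + op q f' := by
    intro q f hf f' hf'
    obtain ⟨F, h1, h2, h3⟩ := sec q f hf
    obtain ⟨F', h1', h2', h3'⟩ := sec q f' hf'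
    have h4 : HolSec (F + F') := by
      have h5 := HolSmoothOn.add h1 h1'
      unfold HolSec
      simpa only [Pi.add_apply, extendGL_add] using h5
    funext g
    have h6 := congrFun (eq_of_differentiable_of_eqOn ((hop _ h4).differentiable g)
      (((hop _ h1).differentiable g).add ((hop _ h1').differentiable g)) hD hne
      fun q hq => hadd q hq _ (h2 q) _ (h2' q) g) q
    simpa only [Pi.add_apply, h3, h3'] using h6
  have hsmul' : ∀ q, ∀ f ∈ R (a q), ∀ s : ℂ, op q (s • f) = s • op q f := by
    intro q f hf s
    obtain ⟨F, h1, h2, h3⟩ := sec q f hf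
    have h4 : HolSec (fun q => s • F q) := by
      have h5 := HolSmoothOn.mul (HolSmoothOn.of_left (contDiff_const (c := s))) h1
      unfold HolSec
      simpa only [extendGL_smul, Pi.smul_apply, smul_eq_mul] using h5
    funext g
    have h6 := congrFun (eq_of_differentiable_of_eqOn ((hop _ h4).differentiable g)
      (((hop _ h1).differentiable g).const_mul s) hD hne
      fun q hq => hsmul q hq _ (h2 q) s g) q
    simpa only [Pi.smul_apply, smul_eq_mul, h3] using h6
  have hmem : ∀ q, ∀ f ∈ R (a q), op q f ∈ R' q := by
    intro q f hf
    obtain ⟨F, h1, h2, h3⟩ := sec q f hf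
    rw [hR'.1]
    refine ⟨h3 ▸ (hop _ h1).smoothGL q, fun g p hp => ?_⟩
    have h6 := congrFun (eq_of_differentiable_of_eqOn ((hop _ h1).differentiable (g * p))
      ((hR'.2 _ hp (mdet_gmat p)).mul ((hop _ h1).differentiable g)) hD hne
      fun q hq => heq q hq _ (h2 q) g p hp) q
    simpa only [Pi.mul_apply, h3] using h6
  exact ⟨fun q =>
    { toFun := fun f => ⟨op q f, hmem q f f.2⟩
      map_add' := fun f f' => Subtype.ext (hadd' q f f.2 f' f'.2)
      map_smul' := fun s f => Subtype.ext (hsmul' q f f.2 s) }, fun _ _ _ => rfl⟩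

end Series

/-- The block upper triangular matrices with blocks of size `n`, `n`. -/
def parG (m : ℕ) : Set (Sq (IdxG m)) :=
  {p | mdet (blk₁₁ p) ≠ 0 ∧ blk₂₁ p = 0 ∧ mdet (blk₂₂ p) ≠ 0}

/-- The block upper triangular matrices with blocks of size `n - 1`, `1`, `n - 1`. -/
def parH (m : ℕ) : Set (Sq (IdxH m)) :=
  {p | (mdet (blk₁₁ (blk₁₁ p)) ≠ 0 ∧ blk₂₁ (blk₁₁ p) = 0 ∧ mdet (blk₂₂ (blk₁₁ p)) ≠ 0) ∧
    blk₂₁ p = 0 ∧ mdet (blk₂₂ p) ≠ 0}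

/-- The inducing character of `π_{ξ,λ}`. -/
def charG (m : ℕ) (ξ : ZMod 2 × ZMod 2) (lam : ℂ × ℂ) (p : Sq (IdxG m)) : ℂ :=
  sgnPow ξ.1 (-(lam.1 + ((m : ℂ) + 1) / 2)) (mdet (blk₁₁ p))
    * sgnPow ξ.2 (-(lam.2 - ((m : ℂ) + 1) / 2)) (mdet (blk₂₂ p))

/-- The inducing character of `τ_{η,ν}`. -/
def charH (m : ℕ) (η : ZMod 2 × ZMod 2 × ZMod 2) (ν : ℂ × ℂ × ℂ) (p : Sq (IdxH m)) : ℂ :=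
  sgnPow η.1 (-(ν.1 + ((m : ℂ) + 1) / 2)) (mdet (blk₁₁ (blk₁₁ p)))
    * sgnPow η.2.1 (-ν.2.1) (mdet (blk₂₂ (blk₁₁ p)))
    * sgnPow η.2.2 (-(ν.2.2 - ((m : ℂ) + 1) / 2)) (mdet (blk₂₂ p))

theorem isInduced_piRep (m : ℕ) (ξ : ZMod 2 × ZMod 2) :
    IsInduced (parG m) (charG m ξ) (piRep m ξ) := by
  refine ⟨fun lam f => and_congr_right fun _ => ⟨fun h g p hp => ?_, fun h g p p₁ p₂ Y hp => ?_⟩,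
    fun p hp _ => ?_⟩
  · refine h g p (Matrix.of (blk₁₁ (gmat p))) (Matrix.of (blk₂₂ (gmat p)))
      (Matrix.of (blk₁₂ (gmat p))) ?_
    have h1 := blk_eta (gmat p)
    rw [hp.2.1] at h1
    exact h1.symm
  · have h1 : gmat p = blk p₁ Y 0 p₂ := hp
    have h2 : mdet (blk (p₁ : Sq (Blk m)) Y 0 p₂) = _ := mdet_blk_zero _ _ _
    have h3 := mdet_gmat p
    rw [h1, h2] at h3
    have h4 := h g p (by
      rw [h1]
      exact ⟨left_ne_zero_of_mul h3, rfl, right_ne_zero_of_mul h3⟩)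
    rw [h1] at h4
    exact h4
  · exact (differentiable_sgnPow _ (by fun_prop) hp.1).mul
      (differentiable_sgnPow _ (by fun_prop) hp.2.2)

theorem isInduced_tauRep (m : ℕ) (η : ZMod 2 × ZMod 2 × ZMod 2) :
    IsInduced (parH m) (charH m η) (tauRep m η) := by
  refine ⟨fun lam f => and_congr_right fun _ => ⟨fun h g p hp => ?_,
    fun h g p p₁ p₃ p₂ y Z hp => ?_⟩, fun p hp _ => ?_⟩
  · refine h g p (Matrix.of (blk₁₁ (blk₁₁ (gmat p)))) (Matrix.of (blk₂₂ (gmat p)))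
      (Matrix.of (blk₂₂ (blk₁₁ (gmat p)))) (Matrix.of (blk₁₂ (blk₁₁ (gmat p))))
      (Matrix.of (blk₁₂ (gmat p))) ?_
    have h1 := blk_eta (gmat p)
    have h2 := blk_eta (blk₁₁ (gmat p))
    rw [hp.1.2.1] at h2
    rw [hp.2.1, ← h2] at h1
    exact h1.symm
  · have h1 : gmat p = blk (blk p₁ y 0 p₂) Z 0 p₃ := hp
    have h2 : mdet (blk (blk (p₁ : Sq (Fin m)) y 0 p₂) Z 0 p₃) = _ := mdet_blk_zero _ _ _
    have h2' : mdet (blk (p₁ : Sq (Fin m)) y 0 p₂) = _ := mdet_blk_zero _ _ _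
    have h3 := mdet_gmat p
    rw [h1, h2, h2'] at h3
    have h4 := h g p (by
      rw [h1]
      exact ⟨⟨left_ne_zero_of_mul (left_ne_zero_of_mul h3), rfl,
        right_ne_zero_of_mul (left_ne_zero_of_mul h3)⟩, rfl, right_ne_zero_of_mul h3⟩)
    rw [h1] at h4
    exact h4
  · exact ((differentiable_sgnPow _ (by fun_prop) hp.1.1).mul
      (differentiable_sgnPow _ (by fun_prop) hp.1.2.2)).mul
      (differentiable_sgnPow _ (by fun_prop) hp.2.2)

/-- The ratio of the spherical vectors of the series `π`. -/
def coeffG (m : ℕ) (d : ℂ × ℂ) (X : Sq (IdxG m)) : ℂ :=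
  sgnPow 0 (-(d.1 - d.2) / 2) (mdet (blk₁₁ (mgram X))) * sgnPow 0 (-d.2) (mdet X)

/-- The ratio of the spherical vectors of the series `τ`. -/
def coeffH (m : ℕ) (d : ℂ × ℂ × ℂ) (X : Sq (IdxH m)) : ℂ :=
  sgnPow 0 (-(d.1 - d.2.1) / 2) (mdet (blk₁₁ (blk₁₁ (mgram X))))
    * sgnPow 0 (-(d.2.1 - d.2.2) / 2) (mdet (blk₁₁ (mgram X))) * sgnPow 0 (-d.2.2) (mdet X)

theorem sgnPow_add_right (ε : ZMod 2) (μ μ' : ℂ) {x : ℝ} (hx : x ≠ 0) :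
    sgnPow ε (μ + μ') x = sgnPow 0 μ x * sgnPow ε μ' x := by
  rw [sgnPow_mul_sgnPow _ _ _ _ hx, zero_add]

theorem mdet_ne_zero_of_posDef {α : Type} [Fintype α] [DecidableEq α] {S : Sq α}
    (h : (Matrix.of S).PosDef) : mdet S ≠ 0 := h.det_pos.ne'

theorem HolSmoothOn.sgnPow {Q E : Type} [NormedAddCommGroup Q] [NormedSpace ℂ Q]
    [NormedAddCommGroup E] [NormedSpace ℝ E] (ε : ZMod 2) {a : Q → ℂ} (ha : ContDiff ℂ ∞ a)
    {θ : E → ℝ} (hθ : ContDiff ℝ ∞ θ) {U : Set E} (hU : ∀ x ∈ U, θ x ≠ 0) :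
    HolSmoothOn (fun z : Q × E => GLBranching.sgnPow ε (a z.1) (θ z.2)) U :=
  (holSmoothOn_sgnPow ε).comp ha hθ.contDiffOn hU

theorem exists_mgram_parG (m : ℕ) (S : Sq (IdxG m)) (hS : (Matrix.of S).PosDef) :
    ∃ p ∈ parG m, S = mgram p :=
  ((isUnfolding_gl (Blk m)).block (Blk m)).exists_mgram S hS

theorem exists_mgram_parH (m : ℕ) (S : Sq (IdxH m)) (hS : (Matrix.of S).PosDef) :
    ∃ p ∈ parH m, S = mgram p :=
  (((isUnfolding_gl (Fin m)).block Unit).block (Fin m)).exists_mgram S hS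

theorem holSmoothOn_sgnPow_mdet (ε : ZMod 2) {Q ι : Type} [NormedAddCommGroup Q] [NormedSpace ℂ Q]
    [Fintype ι] [DecidableEq ι] {a : Q → ℂ} (ha : ContDiff ℂ ∞ a) :
    HolSmoothOn (fun z : Q × Sq ι => GLBranching.sgnPow ε (a z.1) (mdet z.2))
      {X | mdet X ≠ 0} :=
  HolSmoothOn.sgnPow ε ha contDiff_mdet fun _ hX => hX

theorem holSmoothOn_sgnPow_blk₁₁ (ε : ZMod 2) {Q α β : Type} [NormedAddCommGroup Q]
    [NormedSpace ℂ Q] [Fintype α] [DecidableEq α] [Fintype β] [DecidableEq β] {a : Q → ℂ}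
    (ha : ContDiff ℂ ∞ a) :
    HolSmoothOn (fun z : Q × (α ⊕ β → α ⊕ β → ℝ) =>
      GLBranching.sgnPow ε (a z.1) (mdet (blk₁₁ (mgram z.2)))) {X | mdet X ≠ 0} :=
  HolSmoothOn.sgnPow ε ha (contDiff_mdet.comp (contDiff_blk₁₁.comp contDiff_mgram))
    fun _ hX => mdet_ne_zero_of_posDef (posDef_blk₁₁ (posDef_mgram hX))

theorem holSmoothOn_sgnPow_blk₁₁_blk₁₁ (ε : ZMod 2) {Q α β γ : Type} [NormedAddCommGroup Q]
    [NormedSpace ℂ Q] [Fintype α] [DecidableEq α] [Fintype β] [DecidableEq β] [Fintype γ]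
    [DecidableEq γ] {a : Q → ℂ} (ha : ContDiff ℂ ∞ a) :
    HolSmoothOn (fun z : Q × ((α ⊕ β) ⊕ γ → (α ⊕ β) ⊕ γ → ℝ) =>
      GLBranching.sgnPow ε (a z.1) (mdet (blk₁₁ (blk₁₁ (mgram z.2))))) {X | mdet X ≠ 0} :=
  HolSmoothOn.sgnPow ε ha
    (contDiff_mdet.comp (contDiff_blk₁₁.comp (contDiff_blk₁₁.comp contDiff_mgram)))
    fun _ hX => mdet_ne_zero_of_posDef (posDef_blk₁₁ (posDef_blk₁₁ (posDef_mgram hX)))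

theorem holSmoothOn_coeffG (m : ℕ) :
    HolSmoothOn (fun z : (ℂ × ℂ) × Sq (IdxG m) => coeffG m z.1 z.2)
      {X | mdet X ≠ 0} :=
  (holSmoothOn_sgnPow_blk₁₁ 0 (a := fun d : ℂ × ℂ => -(d.1 - d.2) / 2) (by fun_prop)).mul
    (holSmoothOn_sgnPow_mdet 0 (a := fun d : ℂ × ℂ => -d.2) (by fun_prop))

theorem coeffG_mmul (m : ℕ) (ξ : ZMod 2 × ZMod 2) (d q : ℂ × ℂ) (X : Sq (IdxG m))
    {p : Sq (IdxG m)} (hp : p ∈ parG m) :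
    coeffG m d (mmul X p) * charG m ξ q p = charG m ξ (d + q) p * coeffG m d X := by
  rw [coeffG, coeffG, mgram_mmul, blk₁₁_conj _ hp.2.1, mdet_conj, mdet_mmul,
    mdet_eq_of_blk₂₁ hp.2.1, sgnPow_mul, sgnPow_mul, sgnPow_mul, sgnPow_sq _ hp.1,
    sgnPow_add_right _ _ _ hp.1, charG, charG,
    Prod.fst_add, Prod.snd_add,
    show -(d.1 + q.1 + ((m : ℂ) + 1) / 2) = -(d.1 - d.2) / 2 + (-(d.1 - d.2) / 2 + (-d.2
      + -(q.1 + ((m : ℂ) + 1) / 2))) by ring,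
    show -(d.2 + q.2 - ((m : ℂ) + 1) / 2) = -d.2 + -(q.2 - ((m : ℂ) + 1) / 2) by ring]
  simp only [sgnPow_add_right _ _ _ hp.1, sgnPow_add_right _ _ _ hp.2.2]
  ring

theorem coeffG_eq_one (m : ℕ) (d : ℂ × ℂ) {X : Sq (IdxG m)}
    (hX : mgram X = mone (IdxG m)) : coeffG m d X = 1 := by
  have h1 := mdet_mgram X
  rw [hX, mdet_mone] at h1
  rw [coeffG, hX, blk₁₁_mone, mdet_mone, sgnPow_one_right, sgnPow_abs_one _ h1.symm, one_mul]

theorem isSeries_piRep (m : ℕ) (ξ : ZMod 2 × ZMod 2) :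
    IsSeries (parG m) (charG m ξ) (piRep m ξ) (coeffG m) where
  isInduced := isInduced_piRep m ξ
  exists_mgram := exists_mgram_parG m
  holSmoothOn := holSmoothOn_coeffG m
  mmul_char := fun d q X _ _ hp _ => coeffG_mmul m ξ d q X hp
  eq_one := fun d _ hX => coeffG_eq_one m d hX
  zero_eq := by
    intro X _
    simp [coeffG, sgnPow_zero_left]

theorem holSmoothOn_coeffH (m : ℕ) :
    HolSmoothOn (fun z : (ℂ × ℂ × ℂ) × Sq (IdxH m) => coeffH m z.1 z.2)
      {X | mdet X ≠ 0} :=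
  ((holSmoothOn_sgnPow_blk₁₁_blk₁₁ 0
      (a := fun d : ℂ × ℂ × ℂ => -(d.1 - d.2.1) / 2) (by fun_prop)).mul
    (holSmoothOn_sgnPow_blk₁₁ 0
      (a := fun d : ℂ × ℂ × ℂ => -(d.2.1 - d.2.2) / 2) (by fun_prop))).mul
    (holSmoothOn_sgnPow_mdet 0 (a := fun d : ℂ × ℂ × ℂ => -d.2.2) (by fun_prop))

theorem coeffH_mmul (m : ℕ) (η : ZMod 2 × ZMod 2 × ZMod 2) (d q : ℂ × ℂ × ℂ) (X : Sq (IdxH m))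
    {p : Sq (IdxH m)} (hp : p ∈ parH m) :
    coeffH m d (mmul X p) * charH m η q p = charH m η (d + q) p * coeffH m d X := by
  rw [coeffH, coeffH, mgram_mmul, blk₁₁_conj _ hp.2.1, blk₁₁_conj _ hp.1.2.1, mdet_conj,
    mdet_conj, mdet_mmul, mdet_eq_of_blk₂₁ hp.2.1, mdet_eq_of_blk₂₁ hp.1.2.1, mul_pow,
    sgnPow_mul, sgnPow_mul, sgnPow_mul, sgnPow_mul, sgnPow_mul, sgnPow_mul, sgnPow_sq _ hp.1.1,
    sgnPow_sq _ hp.1.1, sgnPow_sq _ hp.1.2.2, sgnPow_add_right _ _ _ hp.1.1,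
    sgnPow_add_right _ (-(d.2.1 - d.2.2) / 2) _ hp.1.1, sgnPow_add_right _ _ _ hp.1.2.2, charH, charH]
  simp only [Prod.fst_add, Prod.snd_add]
  rw [show -(d.1 + q.1 + ((m : ℂ) + 1) / 2) = -(d.1 - d.2.1) / 2 + (-(d.1 - d.2.1) / 2
      + (-(d.2.1 - d.2.2) / 2 + (-(d.2.1 - d.2.2) / 2 + (-d.2.2
      + -(q.1 + ((m : ℂ) + 1) / 2))))) by ring,
    show -(d.2.1 + q.2.1) = -(d.2.1 - d.2.2) / 2 + (-(d.2.1 - d.2.2) / 2 + (-d.2.2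
      + -q.2.1)) by ring,
    show -(d.2.2 + q.2.2 - ((m : ℂ) + 1) / 2) = -d.2.2 + -(q.2.2 - ((m : ℂ) + 1) / 2) by ring]
  simp only [sgnPow_add_right _ _ _ hp.1.1, sgnPow_add_right _ _ _ hp.1.2.2,
    sgnPow_add_right _ _ _ hp.2.2]
  ring

theorem coeffH_eq_one (m : ℕ) (d : ℂ × ℂ × ℂ) {X : Sq (IdxH m)}
    (hX : mgram X = mone (IdxH m)) : coeffH m d X = 1 := by
  have h1 := mdet_mgram X
  rw [hX, mdet_mone] at h1
  rw [coeffH, hX, blk₁₁_mone, blk₁₁_mone, mdet_mone, mdet_mone, sgnPow_one_right,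
    sgnPow_one_right, sgnPow_abs_one _ h1.symm, one_mul, one_mul]

theorem isSeries_tauRep (m : ℕ) (η : ZMod 2 × ZMod 2 × ZMod 2) :
    IsSeries (parH m) (charH m η) (tauRep m η) (coeffH m) where
  isInduced := isInduced_tauRep m η
  exists_mgram := exists_mgram_parH m
  holSmoothOn := holSmoothOn_coeffH m
  mmul_char := fun d q X _ _ hp _ => coeffH_mmul m η d q X hp
  eq_one := fun d _ hX => coeffH_eq_one m d hX
  zero_eq := by
    intro X _
    simp [coeffH, sgnPow_zero_left]

section Kernels

variable {ι ι' β X Q : Type} [Fintype ι] [DecidableEq ι] [Fintype ι'] [DecidableEq ι']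
  [Fintype β] [DecidableEq β] [MeasurableSpace X] [NormedAddCommGroup Q] [NormedSpace ℂ Q]

theorem SmoothGL.measurable_extendGL {f : GL ι ℝ → ℂ} (hf : SmoothGL f) :
    Measurable (extendGL f) := by
  classical
  have h1 : extendGL f = {X : Sq ι | mdet X ≠ 0}.piecewise (extendGL f) 0 := by
    funext X
    by_cases hX : mdet X ≠ 0
    · exact (piecewise_eq_of_mem _ _ _ hX).symm
    · rw [piecewise_eq_of_notMem _ _ _ hX, extendGL_of_eq f (not_not.1 hX), Pi.zero_apply]
  rw [h1]
  exact hf.continuousOn.measurable_piecewise continuousOn_const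
    isOpen_mdet_ne_zero.measurableSet

theorem integral_mmul_left {y : Sq β} (hy : mdet y ≠ 0) {G : Sq β → ℂ}
    (hG : Measurable G) :
    ∫ M, G (mmul y M) = ((dpow (Fintype.card β) y : ℝ) : ℂ) * ∫ M, G M := by
  have h1 := (integrable_integral_of_lintegral (μ := volume) (ν := volume)
    (θ := fun M : Sq β => mmul y M) (by fun_prop) (w := fun _ => 1) measurable_const
    (c := dpow (Fintype.card β) y) (by simpa using dpow_ne_zero hy) ENNReal.coe_ne_top
    (fun H hH => by simpa using lintegral_mmul_left hy hH) hG.aestronglyMeasurable).2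
  simpa using h1

/-- The smooth weight `|det M|_ε^c κ(M)` with the cutoff function `κ`. -/
def detWeight (ε : ZMod 2) (c : Q → ℂ) (z : Q × Sq β) : ℂ :=
  sgnPow ε (c z.1) (mdet z.2) * ((cutoff z.2 : ℝ) : ℂ)

theorem detWeight_eq_zero (ε : ZMod 2) (c : Q → ℂ) (q : Q) {M : Sq β}
    (hM : M ∉ cutoffSupport β) : detWeight ε c (q, M) = 0 := by
  simp only [detWeight, cutoff_eq_zero hM, Complex.ofReal_zero, mul_zero]

theorem holSmooth_detWeight (ε : ZMod 2) {c : Q → ℂ} (hc : ContDiff ℂ ∞ c) :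
    HolSmooth (detWeight (β := β) ε c) := by
  have h1 : HolSmoothOn (detWeight (β := β) ε c) {M | mdet M ≠ 0} :=
    (holSmoothOn_sgnPow_mdet ε hc).mul (HolSmoothOn.of_right
      (f := fun M : Sq β => ((cutoff M : ℝ) : ℂ))
      (Complex.ofRealCLM.contDiff.comp contDiff_cutoff).contDiffOn)
  exact h1.holSmooth isOpen_mdet_ne_zero isCompact_cutoffSupport.isClosed
    (fun M hM => mdet_ne_zero_of_mem_cutoffSupport hM)
    fun q M hM => detWeight_eq_zero ε c q hM

theorem SmoothGL.contDiff_detWeight_mul {f : GL ι ℝ → ℂ} (hf : SmoothGL f) (ε : ZMod 2)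
    {c : Q → ℂ} (hc : ContDiff ℂ ∞ c) (q : Q) {j : Sq β → Sq ι} (hj : ContDiff ℝ ∞ j)
    (hj' : ∀ M, mdet M ≠ 0 → mdet (j M) ≠ 0) {Y : Sq ι} (hY : mdet Y ≠ 0) :
    ContDiff ℝ ∞ (fun M => detWeight ε c (q, M) * extendGL f (mmul Y (j M))) ∧
      HasCompactSupport (fun M => detWeight ε c (q, M) * extendGL f (mmul Y (j M))) := by
  have h0 : ∀ M ∉ cutoffSupport β, detWeight ε c (q, M) * extendGL f (mmul Y (j M)) = 0 :=
    fun M hM => by rw [detWeight_eq_zero ε c q hM, zero_mul]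
  refine ⟨?_, HasCompactSupport.intro isCompact_cutoffSupport h0⟩
  have hθ : ContDiff ℝ ∞ fun M => mmul Y (j M) := ContDiff.mmul contDiff_const hj
  have h1 : HolSmoothOn (fun z : ℂ × Sq β => extendGL f (mmul Y (j z.2)))
      {M | mdet (mmul Y (j M)) ≠ 0} :=
    HolSmoothOn.of_right (f := fun M => extendGL f (mmul Y (j M)))
      (ContDiffOn.comp (t := {X | mdet X ≠ 0}) hf hθ.contDiffOn fun M hM => hM)
  have h2 : HolSmooth (fun z : ℂ × Sq β => detWeight ε c (q, z.2)) :=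
    (holSmooth_detWeight ε hc).comp (a := fun _ : ℂ => q) contDiff_const
      (θ := fun M : Sq β => M) contDiff_id
  have h3 : HolSmooth (fun z : ℂ × Sq β =>
      detWeight ε c (q, z.2) * extendGL f (mmul Y (j z.2))) := by
    refine ((h2.holSmoothOn _).mul h1).holSmooth (k := cutoffSupport β)
      (isOpen_mdet_ne_zero.preimage hθ.continuous) isCompact_cutoffSupport.isClosed
      (fun M hM => ?_) fun _ M hM => h0 M hM
    change mdet _ ≠ 0
    rw [mdet_mmul]
    exact mul_ne_zero hY (hj' M (mdet_ne_zero_of_mem_cutoffSupport hM))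
  exact h3.1.comp (f := fun M : Sq β => ((0 : ℂ), M)) (contDiff_const.prodMk contDiff_id)

variable {ν : Measure X} {nb : X → Sq β} {P : Set (Sq β)} {μ : Measure (Sq β)}
  {wt : Sq β → NNReal} {θ : Sq β → X}

theorem IsUnfolding.integral_kernel (h : IsUnfolding ν nb P μ wt θ) {K χ φ : Sq β → ℂ}
    {k : X → ℂ} (hk : Measurable k) (hφ : Measurable φ)
    (hK : ∀ x, ∀ p ∈ P, K (mmul (nb x) p) * χ p = ((wt (mmul (nb x) p) : ℝ) : ℂ) * k x)
    (hφp : ∀ M, ∀ p ∈ P, φ (mmul M p) = χ p * φ M) {y : Sq β} (hy : mdet y ≠ 0) :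
    (Integrable (fun M => ((cutoff (mmul y M) : ℝ) : ℂ) * (K M * φ M)) ↔
      Integrable (fun x => k x * φ (nb x)) ν) ∧
    ∫ M, ((cutoff (mmul y M) : ℝ) : ℂ) * (K M * φ M) =
      (((cutoffConst μ).toReal : ℝ) : ℂ) * ∫ x, k x * φ (nb x) ∂ν := by
  have h1 := h.integral_cutoff hy (H := fun x => k x * φ (nb x))
    (hk.mul (hφ.comp h.measurable_nb)).aestronglyMeasurable
  have h2 : (fun M => ((cutoff (mmul y M) : ℝ) : ℂ) * (K M * φ M)) =ᵐ[volume] fun M =>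
      ((wt M : ℝ) : ℂ) * ((cutoff (mmul y M) : ℝ) : ℂ) * (k (θ M) * φ (nb (θ M))) := by
    filter_upwards [h.ae_mem_left] with M hM
    obtain ⟨p, hp, e⟩ := hM
    have h3 := hK (θ M) p hp
    have h4 := hφp (nb (θ M)) p hp
    rw [← e] at h3 h4
    rw [h4, ← mul_assoc (K M), h3]
    ring
  rw [integrable_congr h2, integral_congr_ae h2]
  exact h1

/-- A regularized kernel on matrices defines operators from functions on `GL(ι)` to functions
on `GL(ι')` that are given by an integral in the coordinates of an unfolding. -/
theorem IsUnfolding.exists_operator (h : IsUnfolding ν nb P μ wt θ)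
    {K : Q → Sq β → ℂ} {N : Q → ℂ} {D : Set Q} (hreg : Regularizable K N D)
    (ε : ZMod 2) {c : Q → ℂ} (hc : ContDiff ℂ ∞ c) {χ : Q → Sq β → ℂ} {k : Q → X → ℂ}
    (hk : ∀ q, Measurable (k q))
    (hK : ∀ q x, ∀ p ∈ P, K q (mmul (nb x) p) * sgnPow ε (c q) (mdet (mmul (nb x) p)) * χ q p =
      ((wt (mmul (nb x) p) : ℝ) : ℂ) * k q x)
    {e : Sq ι' → Sq ι} (he : ContDiff ℝ ∞ e)
    (he' : ∀ Y, mdet Y ≠ 0 → mdet (e Y) ≠ 0) {j : Sq β → Sq ι} (hj : ContDiff ℝ ∞ j)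
    (hj' : ∀ M, mdet M ≠ 0 → mdet (j M) ≠ 0) :
    ∃ op : Q → (GL ι ℝ → ℂ) → GL ι' ℝ → ℂ,
      (∀ F : Q → GL ι ℝ → ℂ, HolSec F → HolSec fun q => op q (F q)) ∧
      (∀ q f f' g g', (∀ M, extendGL f' (mmul (e (gmat g)) (j M)) =
        extendGL f (mmul (e (gmat g')) (j M))) → op q f' g = op q f g') ∧
      ∀ q ∈ D, ∀ f, SmoothGL f → (∀ Y M, ∀ p ∈ P,
        extendGL f (mmul Y (j (mmul M p))) = χ q p * extendGL f (mmul Y (j M))) →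
        (∀ g, Integrable (fun x => k q x * extendGL f (mmul (e (gmat g)) (j (nb x)))) ν ∧
          op q f g = N q * ∫ x, k q x * extendGL f (mmul (e (gmat g)) (j (nb x))) ∂ν) ∧
        ∀ g g' y κ, mdet y ≠ 0 → κ ≠ 0 →
          (∀ M, K q (mmul y M) * sgnPow ε (c q) (mdet (mmul y M)) =
            κ * (K q M * sgnPow ε (c q) (mdet M))) →
          (∀ M, mmul (e (gmat g')) (j M) = mmul (e (gmat g)) (j (mmul y M))) →
          op q f g' = ((dpow (Fintype.card β) y : ℝ) : ℂ) * κ⁻¹ * op q f g := by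
  obtain ⟨ζ, hζ⟩ := hreg
  set C : ℂ := (((cutoffConst μ).toReal : ℝ) : ℂ) with hC
  have hC0 : C ≠ 0 := by
    rw [hC, Complex.ofReal_ne_zero]
    exact (ENNReal.toReal_pos h.cutoffConst_ne_zero h.cutoffConst_ne_top).ne'
  refine ⟨fun q f g => C⁻¹ * zetaOp ζ (detWeight ε c) e j q f g, fun F hF => ?_,
    fun q f f' g g' hff => ?_, fun q hq f hf hfp => ?_⟩
  · have h1 := HolSmoothOn.mul (HolSmoothOn.of_left (contDiff_const (c := C⁻¹)))
      (hζ.holSec_zetaOp (holSmooth_detWeight ε hc) he he' hj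
      isCompact_cutoffSupport (fun M hM => hj' M (mdet_ne_zero_of_mem_cutoffSupport hM))
      (fun q M hM => detWeight_eq_zero ε c q hM) hF (a := fun q => q) contDiff_id)
    refine h1.congr fun q X hX => ?_
    rw [extendGL_of_ne _ hX, extendGL_of_ne _ hX]
  · simp only [zetaOp, hff]
  · have hfm := hf.measurable_extendGL
    have hjm : Measurable j := hj.continuous.measurable
    have hint := fun (Y : Sq ι) (y : Sq β) (hy : mdet y ≠ 0) =>
      h.integral_kernel (K := fun M => K q M * sgnPow ε (c q) (mdet M)) (χ := χ q)
        (φ := fun M => extendGL f (mmul Y (j M))) (hk q)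
        (hfm.comp (by fun_prop)) (hK q) (fun M p hp => hfp Y M p hp) hy
    have hφ := fun (Y : Sq ι) (hY : mdet Y ≠ 0) =>
      hf.contDiff_detWeight_mul ε hc q hj hj' hY
    have hker : ∀ Y : Sq ι,
        (fun M => K q M * (detWeight ε c (q, M) * extendGL f (mmul Y (j M)))) =
        fun M => ((cutoff (mmul (mone β) M) : ℝ) : ℂ) *
          (K q M * sgnPow ε (c q) (mdet M) * extendGL f (mmul Y (j M))) := by
      intro Y
      funext M
      rw [detWeight, mone_mmul]
      ring
    have h1 : mdet (mone β) ≠ 0 := by rw [mdet_mone]; exact one_ne_zero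
    have hop : ∀ g, Integrable (fun x => k q x * extendGL f (mmul (e (gmat g)) (j (nb x)))) ν ∧
          C⁻¹ * zetaOp ζ (detWeight ε c) e j q f g =
            N q * ∫ x, k q x * extendGL f (mmul (e (gmat g)) (j (nb x))) ∂ν := by
      intro g
      obtain ⟨h2, h3⟩ := hφ (e (gmat g)) (he' _ (mdet_gmat g))
      refine ⟨(hint _ _ h1).1.1 ?_, ?_⟩
      · rw [← hker]
        exact hζ.integrable hq h2.continuous h3
      · rw [zetaOp, hζ.eq_integral q hq _ h2 h3, hker, (hint _ _ h1).2, ← hC]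
        field_simp
    refine ⟨hop, fun g g' y κ hy hκ hKy hj2 => ?_⟩
    have h2 := (hint (e (gmat g')) y hy).2
    have h3 : (fun M => ((cutoff (mmul y M) : ℝ) : ℂ) * (K q M * sgnPow ε (c q) (mdet M) *
        extendGL f (mmul (e (gmat g')) (j M)))) = fun M => (fun M =>
          κ⁻¹ * (((cutoff (mmul (mone β) M) : ℝ) : ℂ) * (K q M * sgnPow ε (c q) (mdet M) *
          extendGL f (mmul (e (gmat g)) (j M))))) (mmul y M) := by
      funext M
      simp only [hKy, hj2, mone_mmul]
      field_simp
    have hm : Measurable fun M => κ⁻¹ * (((cutoff (mmul (mone β) M) : ℝ) : ℂ) *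
        (K q M * sgnPow ε (c q) (mdet M) * extendGL f (mmul (e (gmat g)) (j M)))) := by
      have h4 : Measurable (cutoff (α := β)) := contDiff_cutoff.continuous.measurable
      have h5 := hζ.measurable q
      have h6 := measurable_sgnPow ε (c q)
      have h7 : Measurable fun M => extendGL f (mmul (e (gmat g)) (j M)) :=
        hfm.comp (by fun_prop)
      fun_prop
    rw [h3, integral_mmul_left hy hm, integral_const_mul, (hint _ _ h1).2] at h2
    beta_reduce
    rw [(hop g).2, (hop g').2]
    have h8 : ∫ x, k q x * extendGL f (mmul (e (gmat g')) (j (nb x))) ∂ν =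
        ((dpow (Fintype.card β) y : ℝ) : ℂ) * κ⁻¹ *
          ∫ x, k q x * extendGL f (mmul (e (gmat g)) (j (nb x))) ∂ν := by
      refine mul_left_cancel₀ hC0 (h2.symm.trans ?_)
      ring
    rw [h8]
    ring

end Kernels

section Entries

variable {α β γ δ : Type}

@[simp] theorem blk_inl_inl (A : α → γ → ℝ) (Y : α → δ → ℝ) (C : β → γ → ℝ) (D : β → δ → ℝ)
    (i : α) (j : γ) : blk A Y C D (Sum.inl i) (Sum.inl j) = A i j := rfl

@[simp] theorem blk_inl_inr (A : α → γ → ℝ) (Y : α → δ → ℝ) (C : β → γ → ℝ) (D : β → δ → ℝ)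
    (i : α) (j : δ) : blk A Y C D (Sum.inl i) (Sum.inr j) = Y i j := rfl

@[simp] theorem blk_inr_inl (A : α → γ → ℝ) (Y : α → δ → ℝ) (C : β → γ → ℝ) (D : β → δ → ℝ)
    (i : β) (j : γ) : blk A Y C D (Sum.inr i) (Sum.inl j) = C i j := rfl

@[simp] theorem blk_inr_inr (A : α → γ → ℝ) (Y : α → δ → ℝ) (C : β → γ → ℝ) (D : β → δ → ℝ)
    (i : β) (j : δ) : blk A Y C D (Sum.inr i) (Sum.inr j) = D i j := rfl

end Entries

section Reindex

variable {α β α' β' : Type} [Fintype α] [Fintype β] [Fintype α'] [Fintype β']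

/-- The submatrix with given row and column indices, as a linear map. -/
def submatrixCLM (r : α' → α) (s : β' → β) : (α → β → ℝ) →L[ℝ] (α' → β' → ℝ) :=
  ContinuousLinearMap.pi fun i => ContinuousLinearMap.pi fun j =>
    (ContinuousLinearMap.proj (R := ℝ) (φ := fun _ : β => ℝ) (s j)).comp
      (ContinuousLinearMap.proj (R := ℝ) (φ := fun _ : α => β → ℝ) (r i))

theorem submatrixCLM_apply (r : α' → α) (s : β' → β) (M : α → β → ℝ) (i : α') (j : β') :
    submatrixCLM r s M i j = M (r i) (s j) := rfl

theorem submatrixCLM_surjective {r : α' → α} {s : β' → β} (hr : Function.Injective r)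
    (hs : Function.Injective s) : Function.Surjective (submatrixCLM r s) := by
  intro N
  refine ⟨Function.extend r (fun i => Function.extend s (N i) 0) 0, ?_⟩
  funext i j
  rw [submatrixCLM_apply, hr.extend_apply, hs.extend_apply]

end Reindex

/-- The enumeration of the `n` indices. -/
def finBlk (m : ℕ) : Fin (m + 1) → Blk m := Fin.lastCases (Sum.inr ()) Sum.inl

theorem finBlk_castSucc (m : ℕ) (i : Fin m) : finBlk m i.castSucc = Sum.inl i :=
  Fin.lastCases_castSucc i

theorem finBlk_last (m : ℕ) : finBlk m (Fin.last m) = Sum.inr () := Fin.lastCases_last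

/-- The enumeration of the `n` indices as an equivalence. -/
def finBlkEquiv (m : ℕ) : Fin (m + 1) ≃ Blk m where
  toFun := finBlk m
  invFun := Sum.elim Fin.castSucc fun _ => Fin.last m
  left_inv i := by
    refine Fin.lastCases ?_ (fun i => ?_) i
    · rw [finBlk_last]; rfl
    · rw [finBlk_castSucc]; rfl
  right_inv i := by
    rcases i with i | i
    · exact finBlk_castSucc m i
    · exact finBlk_last m

theorem finBlk_injective (m : ℕ) : Function.Injective (finBlk m) := (finBlkEquiv m).injective

theorem det_finBlk (m : ℕ) (M : Sq (Blk m)) :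
    (Matrix.of fun i j => M (finBlk m i) (finBlk m j)).det = mdet M :=
  Matrix.det_submatrix_equiv_self (finBlkEquiv m) (Matrix.of M)

/-- The first `n - 1` rows of the lower left block, together with the last row of the upper left
one. -/
def crossBlk {m : ℕ} (M : Sq (IdxG m)) : Sq (Blk m) :=
  fun i j => M (Sum.elim (fun i => Sum.inr (Sum.inl i)) (fun _ => Sum.inl (Sum.inr ())) i)
    (Sum.inl j)

theorem crossBlk_mmul {m : ℕ} (M p : Sq (IdxG m)) (hp : blk₂₁ p = 0) :
    crossBlk (mmul M p) = mmul (crossBlk M) (blk₁₁ p) := by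
  funext i j
  have h : ∀ l, p (Sum.inr l) (Sum.inl j) = 0 := fun l => congrFun (congrFun hp l) j
  simp only [crossBlk, mmul, blk₁₁]
  rw [Fintype.sum_sum_type]
  simp only [h, mul_zero, Finset.sum_const_zero, add_zero]

theorem mdet_crossBlk_blk {m : ℕ} (X : Sq (Blk m)) :
    mdet (crossBlk (blk (mone (Blk m)) 0 X (mone (Blk m)))) = mdet (blk₁₁ X) := by
  have h : crossBlk (blk (mone (Blk m)) 0 X (mone (Blk m))) =
      blk (blk₁₁ X) (blk₁₂ X) 0 (mone Unit) := by
    funext i j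
    rcases i with i | i <;> rcases j with j | j <;>
      simp [crossBlk, blk₁₁, blk₁₂, mone_apply]
  rw [h, mdet_blk_zero, mdet_mone, mul_one]

/-- The kernel of the symmetry breaking operators on matrices. -/
def crossKernel (m : ℕ) (ε₁ ε₂ : ZMod 2) (a : ℂ × ℂ) (M : Sq (IdxG m)) : ℂ :=
  sgnPow ε₁ a.1 (mdet (blk₂₁ M)) * sgnPow ε₂ a.2 (mdet (crossBlk M))

/-- The row indices of `crossKernel`. -/
def crossRow (m : ℕ) : Fin (m + 2) → IdxG m :=
  Fin.lastCases (Sum.inl (Sum.inr ())) fun i => Sum.inr (finBlk m i)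

theorem crossRow_injective (m : ℕ) : Function.Injective (crossRow m) := by
  intro i j
  refine Fin.lastCases ?_ (fun i => ?_) i <;> refine Fin.lastCases ?_ (fun j => ?_) j <;>
    simp [crossRow, (finBlk_injective m).eq_iff]

theorem regularizable_crossKernel (m : ℕ) (ε₁ ε₂ : ZMod 2) :
    Regularizable (crossKernel m ε₁ ε₂) (pairNorm m ε₁ ε₂) {a | -1 < a.1.re ∧ -1 < a.2.re} := by
  have h := (regularizable_pairKernel m ε₁ ε₂).of_surjective
    (submatrixCLM (crossRow m) fun j => (Sum.inl (finBlk m j) : IdxG m))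
    (submatrixCLM_surjective (crossRow_injective m)
      (Sum.inl_injective.comp (finBlk_injective m)))
  have e : (fun a (M : Sq (IdxG m)) => pairKernel m ε₁ ε₂ a
      (submatrixCLM (crossRow m) (fun j => (Sum.inl (finBlk m j) : IdxG m)) M)) =
      crossKernel m ε₁ ε₂ := by
    funext a M
    rw [pairKernel, crossKernel, ← det_finBlk, ← det_finBlk]
    congr 3
    · refine congrArg (fun F => Matrix.det (Matrix.of F)) (funext fun i => funext fun j => ?_)
      rw [submatrixCLM_apply, crossRow, Fin.lastCases_castSucc]
      rfl
    · refine congrArg (fun F => Matrix.det (Matrix.of F)) (funext fun i => funext fun j => ?_)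
      rw [submatrixCLM_apply]
      refine Fin.lastCases ?_ (fun i => ?_) i
      · rw [Fin.succAbove_castSucc_self, Fin.succ_last, crossRow, Fin.lastCases_last, crossBlk,
          finBlk_last]
        rfl
      · rw [Fin.succAbove_of_castSucc_lt _ _ (by simp [Fin.lt_def]), crossRow,
          Fin.lastCases_castSucc, finBlk_castSucc, crossBlk]
        rfl
  rw [e] at h
  exact h

/-- The kernel in the determinant and the upper left minor of a matrix of size `n`. -/
def minorKernel (m : ℕ) (ε₁ ε₂ : ZMod 2) (a : ℂ × ℂ) (M : Sq (Blk m)) : ℂ :=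
  sgnPow ε₁ a.1 (mdet M) * sgnPow ε₂ a.2 (mdet (blk₁₁ M))

theorem regularizable_minorKernel (m : ℕ) (γ : Type) [Fintype γ] (ε₁ ε₂ : ZMod 2) :
    Regularizable (fun a (M : Blk m ⊕ γ → Blk m ⊕ γ → ℝ) => minorKernel m ε₁ ε₂ a (blk₁₁ M))
      (pairNorm m ε₁ ε₂) {a | -1 < a.1.re ∧ -1 < a.2.re} := by
  have h := (regularizable_flagKernel m ε₁ ε₂).of_surjective
    (submatrixCLM (fun j => (Sum.inl (finBlk m j) : Blk m ⊕ γ))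
      fun j => (Sum.inl (finBlk m j) : Blk m ⊕ γ))
    (submatrixCLM_surjective (Sum.inl_injective.comp (finBlk_injective m))
      (Sum.inl_injective.comp (finBlk_injective m)))
  have e : (fun a (M : Blk m ⊕ γ → Blk m ⊕ γ → ℝ) => flagKernel m ε₁ ε₂ a
      (submatrixCLM (fun j => (Sum.inl (finBlk m j) : Blk m ⊕ γ))
        (fun j => (Sum.inl (finBlk m j) : Blk m ⊕ γ)) M)) =
      fun a M => minorKernel m ε₁ ε₂ a (blk₁₁ M) := by
    funext a M
    rw [flagKernel, minorKernel, ← det_finBlk]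
    simp only [submatrixCLM_apply, finBlk_castSucc]
    rfl
  rw [e] at h
  exact h

section Unfoldings

/-- The weight of the unfolding of `G`. -/
def weightG (m : ℕ) (M : Sq (IdxG m)) : NNReal :=
  dpow (Fintype.card (Blk m)) (blk₁₁ M) * dpow (Fintype.card (Blk m)) (blk₁₁ M) *
    dpow (Fintype.card (Blk m)) M

/-- The weight of the unfolding of `H`. -/
def weightH (m : ℕ) (M : Sq (IdxH m)) : NNReal :=
  dpow (Fintype.card (Fin m)) (blk₁₁ (blk₁₁ M)) * dpow (Fintype.card Unit) (blk₁₁ (blk₁₁ M)) *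
    dpow (Fintype.card Unit) (blk₁₁ M) * dpow (Fintype.card (Fin m)) (blk₁₁ M) *
      dpow (Fintype.card (Fin m)) M

theorem exists_isUnfolding_G (m : ℕ) : ∃ μ θ,
    IsUnfolding (volume : Measure (Sq (Blk m)))
      (fun X => blk (mone (Blk m)) 0 X (mone (Blk m))) (parG m) μ (weightG m) θ := by
  let e : Unit × Sq (Blk m) ≃ᵐ (Sq (Blk m)) :=
    { toFun := Prod.snd
      invFun := fun X => ((), X)
      left_inv := fun _ => rfl
      right_inv := fun _ => rfl
      measurable_toFun := measurable_snd
      measurable_invFun := measurable_prodMk_left }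
  have he : MeasurePreserving e ((Measure.dirac ()).prod volume) volume :=
    measurePreserving_snd
  have h := ((isUnfolding_gl (Blk m)).block (Blk m)).reparam e he
  have h1 : (fun X : Sq (Blk m) => blk (mone (Blk m)) 0
      (mmul (e.symm X).2 (mone (Blk m))) (mone (Blk m))) =
      fun X => blk (mone (Blk m)) 0 X (mone (Blk m)) := by
    funext X
    rw [mmul_mone]
    rfl
  exact ⟨_, _, h1 ▸ h⟩

/-- The coordinates of the opposite unipotent radical of `H`. -/
abbrev CoordH (m : ℕ) : Type := Sq (Fin m) × (Fin m → ℝ) × (Fin m → ℝ)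

/-- The coordinates `(X, u, v)` of the opposite unipotent radical of `H` in terms of the iterated
block decomposition. -/
def coordEquiv (m : ℕ) : (Unit × (Unit → Fin m → ℝ)) × (Fin m → Blk m → ℝ) ≃ᵐ CoordH m where
  toFun z := (fun i j => z.2 i (Sum.inl j) + z.2 i (Sum.inr ()) * z.1.2 () j,
    fun i => z.2 i (Sum.inr ()), z.1.2 ())
  invFun x := (((), fun _ => x.2.2),
    fun i => Sum.elim (fun j => x.1 i j - x.2.1 i * x.2.2 j) fun _ => x.2.1 i)
  left_inv z := by
    refine Prod.ext rfl (funext fun i => funext fun j => ?_)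
    rcases j with j | j
    · simp
    · rfl
  right_inv x := by
    refine Prod.ext (funext fun i => funext fun j => ?_) rfl
    simp
  measurable_toFun := by
    simp only [Equiv.coe_fn_mk]
    fun_prop
  measurable_invFun := by
    simp only [Equiv.coe_fn_symm_mk]
    refine Measurable.prodMk (by fun_prop) (measurable_pi_lambda _ fun i =>
      measurable_pi_lambda _ fun j => ?_)
    rcases j with j | j <;> simp only [Sum.elim_inl, Sum.elim_inr] <;> fun_prop

theorem measurePreserving_coordEquiv (m : ℕ) : MeasurePreserving (coordEquiv m)
    (((Measure.dirac ()).prod volume).prod volume) volume := by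
  suffices h : MeasurePreserving (coordEquiv m).symm volume
      (((Measure.dirac ()).prod volume).prod volume) from h.symm
  have h1 : MeasurePreserving (fun z : Sq (Fin m) × ((Fin m → ℝ) × (Fin m → ℝ)) => z.swap)
      (volume.prod volume) (volume.prod volume) := Measure.measurePreserving_swap
  have h2 : MeasurePreserving (fun z : ((Fin m → ℝ) × (Fin m → ℝ)) × Sq (Fin m) =>
      (z.1, z.2 - fun (i j : Fin m) => z.1.1 i * z.1.2 j)) (volume.prod volume) (volume.prod volume) := by
    refine MeasurePreserving.skew_product (MeasurePreserving.id _)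
      (g := fun (a : (Fin m → ℝ) × (Fin m → ℝ)) (X : Sq (Fin m)) =>
        X - fun i j => a.1 i * a.2 j) ?_ (Eventually.of_forall fun a => ?_)
    · unfold Function.uncurry
      fun_prop
    · exact (measurePreserving_sub_right volume _).map_eq
  have h3 : MeasurePreserving (fun z : ((Fin m → ℝ) × (Fin m → ℝ)) × Sq (Fin m) => z.swap)
      (volume.prod volume) (volume.prod volume) := Measure.measurePreserving_swap
  have h4 : MeasurePreserving (MeasurableEquiv.prodAssoc (α := Fin m → Fin m → ℝ)
      (β := Fin m → ℝ) (γ := Fin m → ℝ)).symm (volume.prod (volume.prod volume))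
      ((volume.prod volume).prod volume) :=
    MeasurePreserving.symm _ volume_preserving_prodAssoc
  have h5 : MeasurePreserving (fun z : (Sq (Fin m) × (Fin m → ℝ)) × (Fin m → ℝ) => z.swap)
      ((volume.prod volume).prod volume) (volume.prod (volume.prod volume)) :=
    Measure.measurePreserving_swap
  have h6 : MeasurePreserving (fun v : Fin m → ℝ => ((), fun _ : Unit => v)) volume
      ((Measure.dirac ()).prod volume) := by
    have h7 : MeasurePreserving (fun v : Fin m → ℝ => fun _ : Unit => v) volume volume :=
      (volume_preserving_funUnique Unit (Fin m → ℝ)).symm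
    have h8 : MeasurePreserving (fun v : Unit → Fin m → ℝ => ((), v)) volume
        ((Measure.dirac ()).prod volume) := ⟨by fun_prop, (Measure.dirac_prod ()).symm⟩
    exact h8.comp h7
  have h9 : MeasurePreserving (fun u : Fin m → ℝ => fun i (_ : Unit) => u i) volume volume :=
    measurePreserving_pi (fun _ : Fin m => volume) (fun _ : Fin m => volume) fun _ =>
      (volume_preserving_funUnique Unit ℝ).symm
  have h10 := (measurePreserving_sumElim (Fin m) (Fin m) Unit).comp
    ((MeasurePreserving.id (volume : Measure (Sq (Fin m)))).prod h9)
  exact (h6.prod h10).comp (h5.comp (h4.comp (h3.comp (h2.comp h1))))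

/-- The matrix of `nbarH`. -/
def nbH (m : ℕ) (x : CoordH m) : Sq (IdxH m) :=
  blk (blk (mone (Fin m)) 0 (fun _ => x.2.2) (mone Unit)) 0
    (fun i => Sum.elim (x.1 i) fun _ => x.2.1 i) (mone (Fin m))

theorem exists_isUnfolding_H (m : ℕ) : ∃ μ θ,
    IsUnfolding (volume : Measure (CoordH m)) (nbH m) (parH m) μ (weightH m) θ := by
  have h := (((isUnfolding_gl (Fin m)).block Unit).block (Fin m)).reparam (coordEquiv m)
    (measurePreserving_coordEquiv m)
  have h1 : (fun x : CoordH m => blk (blk (mone (Fin m)) 0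
      (mmul ((coordEquiv m).symm x).1.2 (mone (Fin m))) (mone Unit)) 0
      (mmul ((coordEquiv m).symm x).2 (blk (mone (Fin m)) 0
      (mmul ((coordEquiv m).symm x).1.2 (mone (Fin m))) (mone Unit))) (mone (Fin m))) = nbH m := by
    funext x
    rw [mmul_mone, nbH]
    congr 1
    funext i j
    refine (Fintype.sum_sum_type _).trans ?_
    rcases j with j | j <;> simp [coordEquiv, mone_apply]
  exact ⟨_, _, h1 ▸ h⟩

end Unfoldings

theorem sgnPow_zero_zero (x : ℝ) : sgnPow 0 0 x = 1 := by
  simp [sgnPow_zero_left]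

theorem coe_dpow_eq_sgnPow {α : Type} [Fintype α] [DecidableEq α] (b : ℕ) (X : Sq α) : ((dpow b X : ℝ) : ℂ) = sgnPow 0 (-(b : ℂ)) (mdet X) := by
  rw [coe_dpow, sgnPow_zero_left, Complex.cpow_neg, Complex.cpow_natCast]
  push_cast
  rfl

section Induced

variable {ι ι' Q Q' : Type} [Fintype ι] [DecidableEq ι] [Fintype ι'] [DecidableEq ι']
  [NormedAddCommGroup Q] [NormedSpace ℂ Q] [NormedAddCommGroup Q'] [NormedSpace ℂ Q']

theorem IsInduced.comp {P : Set (Sq ι)} {χ : Q → Sq ι → ℂ}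
    {R : Q → Submodule ℂ (GL ι ℝ → ℂ)} (h : IsInduced P χ R) {a : Q' → Q}
    (ha : Differentiable ℂ a) : IsInduced P (fun q => χ (a q)) fun q => R (a q) :=
  ⟨fun q => h.1 (a q), fun p hp hp0 => (h.2 p hp hp0).comp ha⟩

theorem IsInduced.smoothGL {P : Set (Sq ι)} {χ : Q → Sq ι → ℂ}
    {R : Q → Submodule ℂ (GL ι ℝ → ℂ)} (h : IsInduced P χ R) {q : Q} {f : GL ι ℝ → ℂ}
    (hf : f ∈ R q) : SmoothGL f := ((h.1 q f).1 hf).1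

theorem IsInduced.extendGL_mmul {P : Set (Sq ι)} {χ : Q → Sq ι → ℂ}
    {R : Q → Submodule ℂ (GL ι ℝ → ℂ)} (h : IsInduced P χ R) {q : Q} {f : GL ι ℝ → ℂ}
    (hf : f ∈ R q) (Y : Sq ι) {p : Sq ι} (hp : p ∈ P) (hp0 : mdet p ≠ 0) :
    extendGL f (mmul Y p) = χ q p * extendGL f Y := by
  by_cases hY : mdet Y = 0
  · rw [extendGL_of_eq f hY, extendGL_of_eq f (by rw [mdet_mmul, hY, zero_mul]), mul_zero]
  · have h1 := ((h.1 q f).1 hf).2 (toGL Y hY) (toGL p hp0) hp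
    rw [← extendGL_gmat f, ← extendGL_gmat f, gmat_mul] at h1
    exact h1

theorem extendGL_of_translate {f f' : GL ι ℝ → ℂ} {x : GL ι ℝ} (h : ∀ g, f' g = f (x * g))
    (Y : Sq ι) : extendGL f' Y = extendGL f (mmul (gmat x) Y) := by
  by_cases hY : mdet Y = 0
  · rw [extendGL_of_eq f' hY, extendGL_of_eq f (by rw [mdet_mmul, hY, mul_zero])]
  · rw [extendGL_of_ne f' hY, h, ← extendGL_gmat f, gmat_mul]
    rfl

end Induced

section Characters

theorem zmod_two_add_self (a : ZMod 2) : a + a = 0 := by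
  revert a
  decide

theorem mdet_ne_zero_of_mem_parG {m : ℕ} {p : Sq (IdxG m)} (hp : p ∈ parG m) :
    mdet p ≠ 0 := by
  rw [mdet_eq_of_blk₂₁ hp.2.1]
  exact mul_ne_zero hp.1 hp.2.2

theorem mdet_ne_zero_of_mem_parH {m : ℕ} {p : Sq (IdxH m)} (hp : p ∈ parH m) :
    mdet p ≠ 0 := by
  rw [mdet_eq_of_blk₂₁ hp.2.1, mdet_eq_of_blk₂₁ hp.1.2.1]
  exact mul_ne_zero (mul_ne_zero hp.1.1 hp.1.2.2) hp.2.2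

theorem coe_weightG {m : ℕ} {M : Sq (IdxG m)} {a b : ℝ} (h1 : mdet (blk₁₁ M) = a)
    (h2 : mdet M = a * b) (ha : a ≠ 0) :
    ((weightG m M : ℝ) : ℂ) = sgnPow 0 (-(3 * ((m : ℂ) + 1))) a * sgnPow 0 (-((m : ℂ) + 1)) b := by
  have hc : ((Fintype.card (Blk m) : ℕ) : ℂ) = (m : ℂ) + 1 := by simp
  rw [weightG]
  push_cast
  rw [coe_dpow_eq_sgnPow _ (blk₁₁ M), coe_dpow_eq_sgnPow _ M, h1, h2, hc,
    sgnPow_mul, sgnPow_mul_sgnPow _ _ _ _ ha, ← mul_assoc, sgnPow_mul_sgnPow _ _ _ _ ha, add_zero,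
    add_zero]
  congr 2
  ring

theorem coe_weightH {m : ℕ} {M : Sq (IdxH m)} {a b d : ℝ}
    (h1 : mdet (blk₁₁ (blk₁₁ M)) = a) (h2 : mdet (blk₁₁ M) = a * b) (h3 : mdet M = a * b * d)
    (ha : a ≠ 0) (hb : b ≠ 0) :
    ((weightH m M : ℝ) : ℂ) = sgnPow 0 (-(3 * (m : ℂ) + 2)) a * sgnPow 0 (-(2 * (m : ℂ) + 1)) b *
      sgnPow 0 (-(m : ℂ)) d := by
  have hc : ((Fintype.card (Fin m) : ℕ) : ℂ) = (m : ℂ) := by simp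
  rw [weightH]
  push_cast
  rw [coe_dpow_eq_sgnPow _ (blk₁₁ (blk₁₁ M)), coe_dpow_eq_sgnPow _ (blk₁₁ (blk₁₁ M)),
    coe_dpow_eq_sgnPow _ (blk₁₁ M), coe_dpow_eq_sgnPow _ (blk₁₁ M),
    coe_dpow_eq_sgnPow _ M, h1, h2, h3, hc]
  have e1 : sgnPow 0 (-(3 * (m : ℂ) + 2)) a = sgnPow 0 (-(m : ℂ)) a *
      sgnPow 0 (-((Fintype.card Unit : ℕ) : ℂ)) a * sgnPow 0 (-((Fintype.card Unit : ℕ) : ℂ)) a *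
      sgnPow 0 (-(m : ℂ)) a * sgnPow 0 (-(m : ℂ)) a := by
    simp only [sgnPow_mul_sgnPow _ _ _ _ ha, add_zero, Fintype.card_unit, Nat.cast_one]
    congr 1
    ring
  have e2 : sgnPow 0 (-(2 * (m : ℂ) + 1)) b =
      sgnPow 0 (-((Fintype.card Unit : ℕ) : ℂ)) b *
      sgnPow 0 (-(m : ℂ)) b * sgnPow 0 (-(m : ℂ)) b := by
    simp only [sgnPow_mul_sgnPow _ _ _ _ hb, add_zero, Fintype.card_unit, Nat.cast_one]
    congr 1
    ring
  rw [e1, e2]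
  simp only [sgnPow_mul]
  ring

theorem blocks_nb_mmul {m : ℕ} (X : Sq (Blk m)) {p : Sq (IdxG m)}
    (hp : p ∈ parG m) :
    blk₁₁ (mmul (blk (mone (Blk m)) 0 X (mone (Blk m))) p) = blk₁₁ p ∧
    blk₂₁ (mmul (blk (mone (Blk m)) 0 X (mone (Blk m))) p) = mmul X (blk₁₁ p) ∧
    mdet (mmul (blk (mone (Blk m)) 0 X (mone (Blk m))) p) =
      mdet (blk₁₁ p) * mdet (blk₂₂ p) := by
  refine ⟨?_, ?_, ?_⟩
  · rw [blk₁₁_mmul, hp.2.1, mmul_zero, add_zero, blk₁₁_blk, mone_mmul]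
  · rw [blk₂₁_mmul, hp.2.1, mmul_zero, add_zero, blk₂₁_blk]
  · have h1 : mdet (blk (mone (Blk m)) 0 X (mone (Blk m))) = 1 :=
      (Matrix.det_fromBlocks_zero₁₂ _ _ _).trans (by simp [mone])
    rw [mdet_mmul, mdet_eq_of_blk₂₁ hp.2.1, h1, one_mul]

theorem crossKernel_mul_charG (m : ℕ) (ξ : ZMod 2 × ZMod 2) (lam : ℂ × ℂ) (η : ZMod 2) (ν : ℂ)
    (X : Sq (Blk m)) {p : Sq (IdxG m)} (hp : p ∈ parG m) :
    crossKernel m (ξ.1 + η) (η + ξ.2)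
        (lam.1 - ν - ((m : ℂ) + 1) / 2, ν - lam.2 - ((m : ℂ) + 1) / 2)
        (mmul (blk (mone (Blk m)) 0 X (mone (Blk m))) p) *
      sgnPow ξ.2 (lam.2 - 3 * ((m : ℂ) + 1) / 2)
        (mdet (mmul (blk (mone (Blk m)) 0 X (mone (Blk m))) p)) * charG m ξ lam p =
    ((weightG m (mmul (blk (mone (Blk m)) 0 X (mone (Blk m))) p) : ℝ) : ℂ) *
      (sgnPow (ξ.1 + η) (lam.1 - ν - ((m : ℂ) + 1) / 2) (mdet X) *
        sgnPow (η + ξ.2) (ν - lam.2 - ((m : ℂ) + 1) / 2) (mdet (blk₁₁ X))) := by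
  obtain ⟨h1, h2, h3⟩ := blocks_nb_mmul X hp
  rw [coe_weightG (congrArg mdet h1) h3 hp.1, h3, crossKernel, h2,
    crossBlk_mmul _ _ hp.2.1, mdet_mmul, mdet_mmul, mdet_crossBlk_blk, charG, sgnPow_mul,
    sgnPow_mul, sgnPow_mul]
  have e1 : sgnPow 0 (-(3 * ((m : ℂ) + 1))) (mdet (blk₁₁ p)) =
      sgnPow (ξ.1 + η) (lam.1 - ν - ((m : ℂ) + 1) / 2) (mdet (blk₁₁ p)) *
      sgnPow (η + ξ.2) (ν - lam.2 - ((m : ℂ) + 1) / 2) (mdet (blk₁₁ p)) *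
      sgnPow ξ.2 (lam.2 - 3 * ((m : ℂ) + 1) / 2) (mdet (blk₁₁ p)) *
      sgnPow ξ.1 (-(lam.1 + ((m : ℂ) + 1) / 2)) (mdet (blk₁₁ p)) := by
    simp only [sgnPow_mul_sgnPow _ _ _ _ hp.1]
    congr 1
    · linear_combination -zmod_two_add_self ξ.1 - zmod_two_add_self η - zmod_two_add_self ξ.2
    · ring
  have e2 : sgnPow 0 (-((m : ℂ) + 1)) (mdet (blk₂₂ p)) =
      sgnPow ξ.2 (lam.2 - 3 * ((m : ℂ) + 1) / 2) (mdet (blk₂₂ p)) *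
      sgnPow ξ.2 (-(lam.2 - ((m : ℂ) + 1) / 2)) (mdet (blk₂₂ p)) := by
    simp only [sgnPow_mul_sgnPow _ _ _ _ hp.2.2]
    congr 1
    · linear_combination - zmod_two_add_self ξ.2
    · ring
  rw [e1, e2]
  ring

theorem minorKernel_mul_charG (m : ℕ) (ξ : ZMod 2 × ZMod 2) (lam : ℂ × ℂ)
    (X : Sq (Blk m)) {p : Sq (IdxG m)} (hp : p ∈ parG m) :
    minorKernel m (ξ.1 + ξ.2) 0 (lam.1 - lam.2 - ((m : ℂ) + 1), 0)
        (blk₁₁ (mmul (blk (mone (Blk m)) 0 X (mone (Blk m))) p)) *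
      sgnPow ξ.2 (lam.2 - 3 * ((m : ℂ) + 1) / 2)
        (mdet (mmul (blk (mone (Blk m)) 0 X (mone (Blk m))) p)) * charG m ξ lam p =
    ((weightG m (mmul (blk (mone (Blk m)) 0 X (mone (Blk m))) p) : ℝ) : ℂ) * 1 := by
  obtain ⟨h1, h2, h3⟩ := blocks_nb_mmul X hp
  rw [coe_weightG (congrArg mdet h1) h3 hp.1, h3, h1, minorKernel, sgnPow_zero_zero, charG,
    sgnPow_mul]
  have e1 : sgnPow 0 (-(3 * ((m : ℂ) + 1))) (mdet (blk₁₁ p)) =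
      sgnPow (ξ.1 + ξ.2) (lam.1 - lam.2 - ((m : ℂ) + 1)) (mdet (blk₁₁ p)) *
      sgnPow ξ.2 (lam.2 - 3 * ((m : ℂ) + 1) / 2) (mdet (blk₁₁ p)) *
      sgnPow ξ.1 (-(lam.1 + ((m : ℂ) + 1) / 2)) (mdet (blk₁₁ p)) := by
    simp only [sgnPow_mul_sgnPow _ _ _ _ hp.1]
    congr 1
    · linear_combination -zmod_two_add_self ξ.1 - zmod_two_add_self ξ.2
    · ring
  have e2 : sgnPow 0 (-((m : ℂ) + 1)) (mdet (blk₂₂ p)) =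
      sgnPow ξ.2 (lam.2 - 3 * ((m : ℂ) + 1) / 2) (mdet (blk₂₂ p)) *
      sgnPow ξ.2 (-(lam.2 - ((m : ℂ) + 1) / 2)) (mdet (blk₂₂ p)) := by
    simp only [sgnPow_mul_sgnPow _ _ _ _ hp.2.2]
    congr 1
    · linear_combination - zmod_two_add_self ξ.2
    · ring
  rw [e1, e2]
  ring

theorem minorKernel_mul_charH (m : ℕ) (η : ZMod 2 × ZMod 2 × ZMod 2) (ν : ℂ × ℂ × ℂ)
    (x : CoordH m) {p : Sq (IdxH m)} (hp : p ∈ parH m) :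
    minorKernel m (η.2.1 + η.2.2) (η.1 + η.2.1)
        (ν.2.1 - ν.2.2 - ((m : ℂ) + 1) / 2, ν.1 - ν.2.1 - ((m : ℂ) + 1) / 2)
        (blk₁₁ (mmul (nbH m x) p)) *
      sgnPow η.2.2 (ν.2.2 - 3 * ((m : ℂ) + 1) / 2 + 1) (mdet (mmul (nbH m x) p)) * charH m η ν p =
    ((weightH m (mmul (nbH m x) p) : ℝ) : ℂ) * 1 := by
  have hd1 : mdet (blk (mone (Fin m)) 0 (fun _ => x.2.2) (mone Unit)) = 1 :=
    (Matrix.det_fromBlocks_zero₁₂ _ _ _).trans (by simp [mone])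
  have hd2 : mdet (nbH m x) = 1 :=
    (Matrix.det_fromBlocks_zero₁₂ _ _ _).trans (by
      change mdet (blk (mone (Fin m)) 0 (fun _ => x.2.2) (mone Unit)) * mdet (mone (Fin m)) = 1
      rw [hd1, mdet_mone, one_mul])
  have h0 : blk₁₁ (mmul (nbH m x) p) =
      mmul (blk (mone (Fin m)) 0 (fun _ => x.2.2) (mone Unit)) (blk₁₁ p) := by
    rw [blk₁₁_mmul, hp.2.1, mmul_zero, add_zero]
    rfl
  have h1 : blk₁₁ (blk₁₁ (mmul (nbH m x) p)) = blk₁₁ (blk₁₁ p) := by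
    rw [h0, blk₁₁_mmul, hp.1.2.1, mmul_zero, add_zero, blk₁₁_blk, mone_mmul]
  have h2 : mdet (blk₁₁ (mmul (nbH m x) p)) = mdet (blk₁₁ (blk₁₁ p)) * mdet (blk₂₂ (blk₁₁ p)) := by
    rw [h0, mdet_mmul, hd1, one_mul, mdet_eq_of_blk₂₁ hp.1.2.1]
  have h3 : mdet (mmul (nbH m x) p) =
      mdet (blk₁₁ (blk₁₁ p)) * mdet (blk₂₂ (blk₁₁ p)) * mdet (blk₂₂ p) := by
    rw [mdet_mmul, hd2, one_mul, mdet_eq_of_blk₂₁ hp.2.1, mdet_eq_of_blk₂₁ hp.1.2.1]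
  rw [coe_weightH (congrArg mdet h1) h2 h3 hp.1.1 hp.1.2.2, h3, minorKernel, h1, h2, charH]
  simp only [sgnPow_mul]
  have e1 : sgnPow 0 (-(3 * (m : ℂ) + 2)) (mdet (blk₁₁ (blk₁₁ p))) =
      sgnPow (η.2.1 + η.2.2) (ν.2.1 - ν.2.2 - ((m : ℂ) + 1) / 2) (mdet (blk₁₁ (blk₁₁ p))) *
      sgnPow (η.1 + η.2.1) (ν.1 - ν.2.1 - ((m : ℂ) + 1) / 2) (mdet (blk₁₁ (blk₁₁ p))) *
      sgnPow η.2.2 (ν.2.2 - 3 * ((m : ℂ) + 1) / 2 + 1) (mdet (blk₁₁ (blk₁₁ p))) *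
      sgnPow η.1 (-(ν.1 + ((m : ℂ) + 1) / 2)) (mdet (blk₁₁ (blk₁₁ p))) := by
    simp only [sgnPow_mul_sgnPow _ _ _ _ hp.1.1]
    congr 1
    · linear_combination -zmod_two_add_self η.1 - zmod_two_add_self η.2.1 -
        zmod_two_add_self η.2.2
    · ring
  have e2 : sgnPow 0 (-(2 * (m : ℂ) + 1)) (mdet (blk₂₂ (blk₁₁ p))) =
      sgnPow (η.2.1 + η.2.2) (ν.2.1 - ν.2.2 - ((m : ℂ) + 1) / 2) (mdet (blk₂₂ (blk₁₁ p))) *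
      sgnPow η.2.2 (ν.2.2 - 3 * ((m : ℂ) + 1) / 2 + 1) (mdet (blk₂₂ (blk₁₁ p))) *
      sgnPow η.2.1 (-ν.2.1) (mdet (blk₂₂ (blk₁₁ p))) := by
    simp only [sgnPow_mul_sgnPow _ _ _ _ hp.1.2.2]
    congr 1
    · linear_combination -zmod_two_add_self η.2.1 - zmod_two_add_self η.2.2
    · ring
  have e3 : sgnPow 0 (-(m : ℂ)) (mdet (blk₂₂ p)) =
      sgnPow η.2.2 (ν.2.2 - 3 * ((m : ℂ) + 1) / 2 + 1) (mdet (blk₂₂ p)) *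
      sgnPow η.2.2 (-(ν.2.2 - ((m : ℂ) + 1) / 2)) (mdet (blk₂₂ p)) := by
    simp only [sgnPow_mul_sgnPow _ _ _ _ hp.2.2]
    congr 1
    · linear_combination -zmod_two_add_self η.2.2
    · ring
  rw [e1, e2, e3]
  ring

end Characters

section Norms

theorem pairNorm_eq_inv_nA (m : ℕ) (ξ : ZMod 2 × ZMod 2) (lam : ℂ × ℂ) (η : ZMod 2) (ν : ℂ) :
    pairNorm m (ξ.1 + η) (η + ξ.2)
      (lam.1 - ν - ((m : ℂ) + 1) / 2, ν - lam.2 - ((m : ℂ) + 1) / 2) = (nA m ξ lam η ν)⁻¹ := by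
  have h : ξ.1 + η + (η + ξ.2) = ξ.1 + ξ.2 := by linear_combination zmod_two_add_self η
  rw [pairNorm, nA, mul_inv, mul_inv, Finset.prod_inv_distrib, h, add_comm η]
  refine congrArg₂ (· * ·) (congrArg₂ (· * ·) ?_ ?_) ?_
  · exact congrArg (fun z => (Gamma z)⁻¹) (by ring_nf)
  · exact congrArg (fun z => (Gamma z)⁻¹) (by ring_nf)
  · exact congrArg (fun z => z⁻¹) (Finset.prod_congr rfl fun i _ =>
      congrArg Gamma (by ring))

theorem pairNorm_eq_inv_nS (m : ℕ) (η : ZMod 2 × ZMod 2 × ZMod 2) (ν : ℂ × ℂ × ℂ) :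
    pairNorm m (η.2.1 + η.2.2) (η.1 + η.2.1)
      (ν.2.1 - ν.2.2 - ((m : ℂ) + 1) / 2, ν.1 - ν.2.1 - ((m : ℂ) + 1) / 2) = (nS m η ν)⁻¹ := by
  have h : η.2.1 + η.2.2 + (η.1 + η.2.1) = η.1 + η.2.2 := by
    linear_combination zmod_two_add_self η.2.1
  rw [pairNorm, nS, mul_inv, mul_inv, Finset.prod_inv_distrib, h,
    mul_comm (Gamma _)⁻¹ (Gamma _)⁻¹]
  refine congrArg₂ (· * ·) (congrArg₂ (· * ·) ?_ ?_) ?_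
  · exact congrArg (fun z => (Gamma z)⁻¹) (by ring_nf)
  · exact congrArg (fun z => (Gamma z)⁻¹) (by ring_nf)
  · exact congrArg (fun z => z⁻¹) (Finset.prod_congr rfl fun i _ =>
      congrArg Gamma (by ring))

theorem pairNorm_eq_inv_nT (m : ℕ) (ξ : ZMod 2 × ZMod 2) (lam : ℂ × ℂ) :
    Gamma (1 / 2) * pairNorm m (ξ.1 + ξ.2) 0 (lam.1 - lam.2 - ((m : ℂ) + 1), 0) =
      (nT m ξ lam)⁻¹ := by
  have h1 : Finset.Icc 1 (m + 1) = insert 1 (Finset.Icc 2 (m + 1)) := by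
    ext i
    simp only [Finset.mem_Icc, Finset.mem_insert]
    omega
  have h2 : Gamma (1 / 2) ≠ 0 := Complex.Gamma_ne_zero_of_re_pos (by norm_num)
  have h3 : ((0 : ℂ) + 1 + rep 0) / 2 = 1 / 2 := by simp [rep]
  rw [pairNorm, nT, h1, Finset.prod_insert (by simp), mul_inv, Finset.prod_inv_distrib, add_zero,
    h3, mul_comm (Gamma _)⁻¹ (Gamma (1 / 2))⁻¹, mul_assoc,
    mul_inv_cancel_left₀ h2]
  refine congrArg₂ (· * ·) ?_ ?_
  · exact congrArg (fun z => (Gamma z)⁻¹) (by push_cast; ring_nf)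
  · exact congrArg (fun z => z⁻¹) (Finset.prod_congr rfl fun i _ =>
      congrArg Gamma (by ring))

end Norms

section Family

variable {ι ι' X Q Q₀ : Type} [Fintype ι] [DecidableEq ι] [Fintype ι'] [DecidableEq ι']
  [MeasurableSpace X] [NormedAddCommGroup Q] [NormedSpace ℂ Q]
  [NormedAddCommGroup Q₀] [NormedSpace ℂ Q₀]

/-- A version of `IsSeries.exists_family` for operators that are given by an integral for
parameters in an open set. -/
theorem IsSeries.exists_family_of_integral {P : Set (Sq ι)} {χ : Q → Sq ι → ℂ}
    {R : Q → Submodule ℂ (GL ι ℝ → ℂ)} {c : Q → Sq ι → ℂ} (h : IsSeries P χ R c)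
    {a : Q₀ → Q} (ha : ContDiff ℂ ∞ a)
    {R' : Q₀ → Submodule ℂ (GL ι' ℝ → ℂ)} {P' : Set (Sq ι')}
    {χ' : Q₀ → Sq ι' → ℂ} (hR' : IsInduced P' χ' R')
    {op : Q₀ → (GL ι ℝ → ℂ) → GL ι' ℝ → ℂ}
    (hop : ∀ F : Q₀ → GL ι ℝ → ℂ, HolSec F → HolSec fun q => op q (F q))
    {D : Set Q₀} (hD : IsOpen D) (hne : D.Nonempty) {ν : Measure X} {k : Q₀ → X → ℂ} {N : Q₀ → ℂ}
    {Y : GL ι' ℝ → X → Sq ι}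
    (hint : ∀ q ∈ D, ∀ f ∈ R (a q), ∀ g, Integrable (fun x => k q x * extendGL f (Y g x)) ν ∧
      op q f g = N q * ∫ x, k q x * extendGL f (Y g x) ∂ν)
    (heq : ∀ q ∈ D, ∀ f ∈ R (a q), ∀ g p : GL ι' ℝ, gmat p ∈ P' →
      op q f (g * p) = χ' q (gmat p) * op q f g) :
    ∃ T : ∀ q, R (a q) →ₗ[ℂ] R' q, ∀ q f g, (T q f : GL ι' ℝ → ℂ) g = op q f g := by
  refine h.exists_family ha hR' hop hD hne (fun q hq f hf f' hf' g => ?_)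
    (fun q hq f hf s g => ?_) heq
  · obtain ⟨h1, h2⟩ := hint q hq f hf g
    obtain ⟨h1', h2'⟩ := hint q hq f' hf' g
    rw [(hint q hq _ (add_mem hf hf') g).2, h2, h2', ← mul_add, ← integral_add h1 h1']
    simp only [extendGL_add, Pi.add_apply, mul_add]
  · rw [(hint q hq _ (Submodule.smul_mem _ s hf) g).2, (hint q hq f hf g).2, extendGL_smul]
    simp only [Pi.smul_apply, smul_eq_mul, mul_left_comm _ s, integral_const_mul]

end Family

theorem contDiff_mmul_right {α : Type} [Fintype α] [DecidableEq α] (w : Sq α) :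
    ContDiff ℝ ∞ fun Y : Sq α => mmul Y w := ContDiff.mmul contDiff_id contDiff_const

section OperatorT

variable (m : ℕ)

theorem gmat_nbarG (X : Sq (Blk m)) :
    gmat (nbarG m X) = blk (mone (Blk m)) 0 X (mone (Blk m)) := rfl

theorem integrandT_eq (f : GG m → ℂ) (g : GG m) (X : Sq (Blk m)) :
    integrandT m f g X = extendGL f
      (mmul (mmul (gmat g) (gmat (wtildeG m))) (blk (mone (Blk m)) 0 X (mone (Blk m)))) := by
  rw [integrandT, ← extendGL_gmat f, gmat_mul, gmat_mul, gmat_nbarG]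

/-- The conjugate of a block upper triangular matrix by `wtildeG`. -/
def conjG (p : Sq (IdxG m)) : Sq (IdxG m) :=
  blk (blk₂₂ p) 0 (-blk₁₂ p) (blk₁₁ p)

theorem mmul_wtildeG {p : Sq (IdxG m)} (hp : blk₂₁ p = 0) :
    mmul p (gmat (wtildeG m)) = mmul (gmat (wtildeG m)) (conjG m p) := by
  have h1 : gmat (wtildeG m) = blk 0 (-mone (Blk m)) (mone (Blk m)) 0 := rfl
  have h2 : ∀ A : Sq (Blk m), mmul A (-mone (Blk m)) = -A := fun A =>
    (Matrix.mul_neg (Matrix.of A) 1).trans (congrArg _ (Matrix.mul_one _))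
  have h3 : ∀ A : Sq (Blk m), mmul (-mone (Blk m)) A = -A := fun A =>
    (Matrix.neg_mul 1 (Matrix.of A)).trans (congrArg _ (Matrix.one_mul _))
  conv_lhs => rw [← blk_eta p, hp]
  rw [h1, conjG, mmul_blk, mmul_blk]
  simp only [mmul_zero, zero_mmul, mmul_mone, mone_mmul, h2, h3, zero_add, add_zero, neg_neg,
    neg_zero]

theorem mdet_conjG (p : Sq (IdxG m)) :
    mdet (conjG m p) = mdet (blk₂₂ p) * mdet (blk₁₁ p) := Matrix.det_fromBlocks_zero₁₂ _ _ _

theorem blk₁₁_conjG_mmul (p M : Sq (IdxG m)) :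
    blk₁₁ (mmul (conjG m p) M) = mmul (blk₂₂ p) (blk₁₁ M) := by
  rw [blk₁₁_mmul, conjG, blk₁₁_blk, blk₁₂_blk, zero_mmul, add_zero]

theorem exists_operator_T (ξ : ZMod 2 × ZMod 2) :
    ∃ T : ∀ lam : ℂ × ℂ, piRep m ξ lam →ₗ[ℂ] piRep m ξ.swap lam.swap,
      (∀ (lam : ℂ × ℂ) (x : GG m) (f f' : piRep m ξ lam),
        (∀ g, (f' : GG m → ℂ) g = (f : GG m → ℂ) (x⁻¹ * g)) →
        ∀ g, (T lam f' : GG m → ℂ) g = (T lam f : GG m → ℂ) (x⁻¹ * g)) ∧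
      (∀ lam : ℂ × ℂ, (m : ℝ) < (lam.1 - lam.2).re → ∀ (f : piRep m ξ lam) (g : GG m),
        Integrable (integrandT m f g) ∧
        (T lam f : GG m → ℂ) g = (nT m ξ lam)⁻¹ * ∫ X, integrandT m f g X) ∧
      ∀ F : ∀ lam, piRep m ξ lam, HolSec (fun lam => (F lam : GG m → ℂ)) →
        HolSec fun lam => (T lam (F lam) : GG m → ℂ) := by
  obtain ⟨μ, θ, hU⟩ := exists_isUnfolding_G m
  let D : Set (ℂ × ℂ) := {lam | (m : ℝ) < (lam.1 - lam.2).re}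
  have hreg : Regularizable (fun (lam : ℂ × ℂ) (M : Sq (IdxG m)) =>
      minorKernel m (ξ.1 + ξ.2) 0 (lam.1 - lam.2 - ((m : ℂ) + 1), 0) (blk₁₁ M))
      (fun lam => (nT m ξ lam)⁻¹) D := by
    have h1 := (((regularizable_minorKernel m (Blk m) (ξ.1 + ξ.2) 0).comp
      (f := fun lam : ℂ × ℂ => (lam.1 - lam.2 - ((m : ℂ) + 1), (0 : ℂ))) (by fun_prop)).mul_norm
      (N' := fun _ => Gamma (1 / 2)) contDiff_const).mono (D' := D) ?_
    · simp only [pairNorm_eq_inv_nT] at h1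
      exact h1
    · intro lam hlam
      have h2 : (m : ℝ) < (lam.1 - lam.2).re := hlam
      simp only [Complex.sub_re] at h2
      simp only [mem_preimage, mem_ofPred_eq, Complex.sub_re, Complex.add_re, Complex.natCast_re,
        Complex.one_re, Complex.zero_re]
      constructor <;> linarith
  obtain ⟨op, hhol, htr, hD⟩ := hU.exists_operator hreg ξ.2
    (c := fun lam : ℂ × ℂ => lam.2 - 3 * ((m : ℂ) + 1) / 2) (by fun_prop)
    (χ := charG m ξ) (k := fun _ _ => 1) (fun _ => measurable_const)
    (fun lam X p hp => minorKernel_mul_charG m ξ lam X hp)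
    (contDiff_mmul_right (gmat (wtildeG m)))
    (fun Y hY => by rw [mdet_mmul]; exact mul_ne_zero hY (mdet_gmat _))
    (j := fun M => M) contDiff_id (fun _ h => h)
  have hser := isSeries_piRep m ξ
  have hchar : ∀ lam, ∀ f ∈ piRep m ξ lam, ∀ (Y M : Sq (IdxG m)), ∀ p ∈ parG m,
      extendGL f (mmul Y (mmul M p)) = charG m ξ lam p * extendGL f (mmul Y M) := by
    intro lam f hf Y M p hp
    rw [← mmul_assoc]
    exact hser.isInduced.extendGL_mmul hf _ hp (mdet_ne_zero_of_mem_parG hp)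
  have hint := fun lam (hlam : lam ∈ D) f (hf : f ∈ piRep m ξ lam) =>
    hD lam hlam f (hser.isInduced.smoothGL hf) (hchar lam f hf)
  obtain ⟨T, hT⟩ := hser.exists_family_of_integral (a := fun lam => lam) contDiff_id
    ((isInduced_piRep m ξ.swap).comp (a := Prod.swap) (by unfold Prod.swap; fun_prop)) hhol
    (D := D)
    (isOpen_lt continuous_const (by fun_prop)) ⟨((m : ℂ) + 1, 0), by simp [D]⟩
    (fun lam hlam f hf => (hint lam hlam f hf).1) (fun lam hlam f hf g p hp => by
      have hc : ((Fintype.card (IdxG m) : ℕ) : ℂ) = 2 * ((m : ℂ) + 1) := by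
        simp; ring
      rw [(hint lam hlam f hf).2 g (g * p) (conjG m (gmat p))
        (sgnPow (ξ.1 + ξ.2) (lam.1 - lam.2 - ((m : ℂ) + 1)) (mdet (blk₂₂ (gmat p))) *
          sgnPow ξ.2 (lam.2 - 3 * ((m : ℂ) + 1) / 2)
            (mdet (blk₂₂ (gmat p)) * mdet (blk₁₁ (gmat p))))
        (by rw [mdet_conjG]; exact mul_ne_zero hp.2.2 hp.1)
        (mul_ne_zero (sgnPow_ne_zero _ _ hp.2.2) (sgnPow_ne_zero _ _ (mul_ne_zero hp.2.2 hp.1)))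
        (fun M => by
          rw [minorKernel, minorKernel, sgnPow_zero_zero, sgnPow_zero_zero, blk₁₁_conjG_mmul,
            mdet_mmul, mdet_mmul, mdet_conjG, sgnPow_mul, sgnPow_mul]
          ring)
        (fun M => by
          rw [gmat_mul, mmul_assoc (gmat g), mmul_wtildeG m hp.2.1, ← mmul_assoc, mmul_assoc])]
      congr 1
      rw [coe_dpow_eq_sgnPow, hc, mdet_conjG, charG, sgnPow_mul, sgnPow_mul, mul_inv, mul_inv,
        ← sgnPow_neg _ _ hp.1, ← sgnPow_neg _ _ hp.2.2, ← sgnPow_neg _ _ hp.2.2]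
      have e1 : sgnPow ξ.2 (-(lam.2 + ((m : ℂ) + 1) / 2)) (mdet (blk₁₁ (gmat p))) =
          sgnPow 0 (-(2 * ((m : ℂ) + 1))) (mdet (blk₁₁ (gmat p))) *
          sgnPow ξ.2 (-(lam.2 - 3 * ((m : ℂ) + 1) / 2)) (mdet (blk₁₁ (gmat p))) := by
        rw [sgnPow_mul_sgnPow _ _ _ _ hp.1, zero_add]
        congr 1
        ring
      have e2 : sgnPow ξ.1 (-(lam.1 - ((m : ℂ) + 1) / 2)) (mdet (blk₂₂ (gmat p))) =
          sgnPow 0 (-(2 * ((m : ℂ) + 1))) (mdet (blk₂₂ (gmat p))) *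
          sgnPow (ξ.1 + ξ.2) (-(lam.1 - lam.2 - ((m : ℂ) + 1))) (mdet (blk₂₂ (gmat p))) *
          sgnPow ξ.2 (-(lam.2 - 3 * ((m : ℂ) + 1) / 2)) (mdet (blk₂₂ (gmat p))) := by
        rw [sgnPow_mul_sgnPow _ _ _ _ hp.2.2, sgnPow_mul_sgnPow _ _ _ _ hp.2.2]
        congr 1
        · linear_combination -zmod_two_add_self ξ.2
        · ring
      simp only [Prod.fst_swap, Prod.snd_swap]
      rw [e1, e2]
      ring)
  refine ⟨T, fun lam x f f' hff g => ?_, fun lam hlam f g => ?_, fun F hF => ?_⟩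
  · rw [hT, hT]
    refine htr lam f f' g (x⁻¹ * g) fun M => ?_
    rw [extendGL_of_translate hff, gmat_mul]
    simp only [mmul_assoc]
  · have h1 := (hint lam hlam f f.2).1 g
    simp only [one_mul, ← integrandT_eq] at h1
    rw [hT]
    exact h1
  · have h1 : (fun lam => (T lam (F lam) : GG m → ℂ)) = fun lam => op lam (F lam) :=
      funext fun lam => funext fun g => hT lam (F lam) g
    rw [h1]
    exact hhol _ hF

theorem exists_isNormalizedT : ∃ T : FamilyT m, IsNormalizedT m T ∧
    ∀ ξ (F : ∀ lam, piRep m ξ lam), HolSec (fun lam => (F lam : GG m → ℂ)) →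
      HolSec fun lam => (T ξ lam (F lam) : GG m → ℂ) := by
  choose T h1 h2 h3 using exists_operator_T m
  refine ⟨T, ⟨h1, h2, fun ξ F hF g => (h3 ξ F ?_).differentiable g⟩, h3⟩
  refine (isSeries_piRep m ξ).holSec_of_standard fun k hk => hF k ?_
  rw [Matrix.mem_orthogonalGroup_iff']
  exact hk

end OperatorT

section OperatorS

variable (m : ℕ)

theorem gmat_nbarH (x : CoordH m) : gmat (nbarH m x) = nbH m x := by
  funext i j
  rcases i with (i | i) | i <;> rcases j with (j | j) | j <;> rfl

theorem integrandS_eq (f : HH m → ℂ) (h : HH m) (x : CoordH m) :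
    integrandS m f h x = extendGL f
      (mmul (mmul (gmat h) (gmat (wtildeH m))) (nbH m x)) := by
  rw [integrandS, ← extendGL_gmat f, gmat_mul, gmat_mul, gmat_nbarH]

/-- The conjugate of a block upper triangular matrix by `wtildeH`. -/
def conjH (p : Sq (IdxH m)) : Sq (IdxH m) :=
  blk (blk (blk₂₂ p) 0 (fun _ j => p (Sum.inl (Sum.inr ())) (Sum.inr j)) (blk₂₂ (blk₁₁ p))) 0
    (fun i => Sum.elim (fun j => -p (Sum.inl (Sum.inl i)) (Sum.inr j))
      (fun j => -p (Sum.inl (Sum.inl i)) (Sum.inl (Sum.inr j)))) (blk₁₁ (blk₁₁ p))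

theorem mmul_wtildeH {p : Sq (IdxH m)} (hp : blk₂₁ p = 0) (hp' : blk₂₁ (blk₁₁ p) = 0) :
    mmul p (gmat (wtildeH m)) = mmul (gmat (wtildeH m)) (conjH m p) := by
  have h1 : gmat (wtildeH m) = blk (blk 0 0 0 (mone Unit))
      (Sum.elim (-mone (Fin m)) 0) (fun i => Sum.elim (mone (Fin m) i) 0) 0 := by
    funext i j
    rcases i with (i | i) | i <;> rcases j with (j | j) | j <;> rfl
  have h2 : ∀ i j, p (Sum.inr i) (Sum.inl j) = 0 := fun i j => congrFun (congrFun hp i) j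
  have h3 : ∀ i j, p (Sum.inl (Sum.inr i)) (Sum.inl (Sum.inl j)) = 0 := fun i j =>
    congrFun (congrFun hp' i) j
  rw [h1]
  funext i j
  rcases i with (i | i) | i <;> rcases j with (j | j) | j <;>
    simp [mmul, conjH, Fintype.sum_sum_type, mone_apply, h2, h3, blk₁₁, blk₂₂]

theorem mdet_conjH (p : Sq (IdxH m)) :
    mdet (conjH m p) = mdet (blk₂₂ p) * mdet (blk₂₂ (blk₁₁ p)) * mdet (blk₁₁ (blk₁₁ p)) := by
  refine (Matrix.det_fromBlocks_zero₁₂ _ _ _).trans (congrArg (· * mdet (blk₁₁ (blk₁₁ p))) ?_)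
  exact Matrix.det_fromBlocks_zero₁₂ _ _ _

theorem blk₁₁_conjH_mmul (p M : Sq (IdxH m)) :
    blk₁₁ (mmul (conjH m p) M) = mmul (blk (blk₂₂ p) 0
      (fun _ j => p (Sum.inl (Sum.inr ())) (Sum.inr j)) (blk₂₂ (blk₁₁ p))) (blk₁₁ M) := by
  rw [blk₁₁_mmul, conjH, blk₁₁_blk, blk₁₂_blk, zero_mmul, add_zero]

theorem minorKernel_conjH (ε₁ ε₂ : ZMod 2) (a : ℂ × ℂ) (p M : Sq (IdxH m)) :
    minorKernel m ε₁ ε₂ a (blk₁₁ (mmul (conjH m p) M)) =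
      sgnPow ε₁ a.1 (mdet (blk₂₂ p) * mdet (blk₂₂ (blk₁₁ p))) * sgnPow ε₂ a.2 (mdet (blk₂₂ p)) *
        minorKernel m ε₁ ε₂ a (blk₁₁ M) := by
  have h1 : mdet (blk (blk₂₂ p) 0 (fun _ j => p (Sum.inl (Sum.inr ())) (Sum.inr j))
      (blk₂₂ (blk₁₁ p))) = mdet (blk₂₂ p) * mdet (blk₂₂ (blk₁₁ p)) :=
    Matrix.det_fromBlocks_zero₁₂ _ _ _
  rw [minorKernel, minorKernel, blk₁₁_conjH_mmul, blk₁₁_mmul, blk₁₁_blk, blk₁₂_blk, zero_mmul,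
    add_zero, mdet_mmul, mdet_mmul, h1, sgnPow_mul, sgnPow_mul ε₂]
  ring

theorem exists_operator_S (η : ZMod 2 × ZMod 2 × ZMod 2) :
    ∃ S : ∀ ν : ℂ × ℂ × ℂ, tauRep m η ν →ₗ[ℂ] tauRep m (wH η) (wH ν),
      (∀ (ν : ℂ × ℂ × ℂ) (x : HH m) (f f' : tauRep m η ν),
        (∀ h, (f' : HH m → ℂ) h = (f : HH m → ℂ) (x⁻¹ * h)) →
        ∀ h, (S ν f' : HH m → ℂ) h = (S ν f : HH m → ℂ) (x⁻¹ * h)) ∧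
      (∀ ν : ℂ × ℂ × ℂ, ((m : ℝ) + 1) / 2 - 1 < (ν.1 - ν.2.1).re →
        ((m : ℝ) + 1) / 2 - 1 < (ν.2.1 - ν.2.2).re → ∀ (f : tauRep m η ν) (h : HH m),
        Integrable (integrandS m f h) ∧
        (S ν f : HH m → ℂ) h = (nS m η ν)⁻¹ * ∫ x, integrandS m f h x) ∧
      ∀ F : ∀ ν, tauRep m η ν, HolSec (fun ν => (F ν : HH m → ℂ)) →
        HolSec fun ν => (S ν (F ν) : HH m → ℂ) := by
  obtain ⟨μ, θ, hU⟩ := exists_isUnfolding_H m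
  let D : Set (ℂ × ℂ × ℂ) := {ν | ((m : ℝ) + 1) / 2 - 1 < (ν.1 - ν.2.1).re ∧
    ((m : ℝ) + 1) / 2 - 1 < (ν.2.1 - ν.2.2).re}
  have hreg : Regularizable (fun (ν : ℂ × ℂ × ℂ) (M : Sq (IdxH m)) =>
      minorKernel m (η.2.1 + η.2.2) (η.1 + η.2.1)
        (ν.2.1 - ν.2.2 - ((m : ℂ) + 1) / 2, ν.1 - ν.2.1 - ((m : ℂ) + 1) / 2) (blk₁₁ M))
      (fun ν => (nS m η ν)⁻¹) D := by
    have h1 := ((regularizable_minorKernel m (Fin m) (η.2.1 + η.2.2) (η.1 + η.2.1)).comp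
      (f := fun ν : ℂ × ℂ × ℂ => (ν.2.1 - ν.2.2 - ((m : ℂ) + 1) / 2,
        ν.1 - ν.2.1 - ((m : ℂ) + 1) / 2)) (by fun_prop)).mono (D' := D) ?_
    · simp only [pairNorm_eq_inv_nS] at h1
      exact h1
    · intro ν hν
      have e : (((m : ℂ) + 1) / 2).re = ((m : ℝ) + 1) / 2 := by
        rw [show ((m : ℂ) + 1) / 2 = ((((m : ℝ) + 1) / 2 : ℝ) : ℂ) by push_cast; ring,
          Complex.ofReal_re]
      have h2 : _ ∧ _ := hν
      simp only [Complex.sub_re] at h2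
      simp only [mem_preimage, mem_ofPred_eq, Complex.sub_re, e]
      constructor <;> linarith
  obtain ⟨op, hhol, htr, hD⟩ := hU.exists_operator hreg η.2.2
    (c := fun ν : ℂ × ℂ × ℂ => ν.2.2 - 3 * ((m : ℂ) + 1) / 2 + 1) (by fun_prop)
    (χ := charH m η) (k := fun _ _ => 1) (fun _ => measurable_const)
    (fun ν x p hp => minorKernel_mul_charH m η ν x hp)
    (contDiff_mmul_right (gmat (wtildeH m)))
    (fun Y hY => by rw [mdet_mmul]; exact mul_ne_zero hY (mdet_gmat _))
    (j := fun M => M) contDiff_id (fun _ h => h)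
  have hser := isSeries_tauRep m η
  have hDo : IsOpen D :=
    IsOpen.and (p₁ := fun ν : ℂ × ℂ × ℂ => ((m : ℝ) + 1) / 2 - 1 < (ν.1 - ν.2.1).re)
      (p₂ := fun ν : ℂ × ℂ × ℂ => ((m : ℝ) + 1) / 2 - 1 < (ν.2.1 - ν.2.2).re)
      (isOpen_lt continuous_const (by fun_prop)) (isOpen_lt continuous_const (by fun_prop))
  have hchar : ∀ ν, ∀ f ∈ tauRep m η ν, ∀ (Y M : Sq (IdxH m)), ∀ p ∈ parH m,
      extendGL f (mmul Y (mmul M p)) = charH m η ν p * extendGL f (mmul Y M) := by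
    intro ν f hf Y M p hp
    rw [← mmul_assoc]
    exact hser.isInduced.extendGL_mmul hf _ hp (mdet_ne_zero_of_mem_parH hp)
  have hint := fun ν (hν : ν ∈ D) f (hf : f ∈ tauRep m η ν) =>
    hD ν hν f (hser.isInduced.smoothGL hf) (hchar ν f hf)
  obtain ⟨S, hS⟩ := hser.exists_family_of_integral (a := fun ν => ν) contDiff_id
    ((isInduced_tauRep m (wH η)).comp (a := wH) (by unfold wH; fun_prop)) hhol
    (D := D)
    hDo
    ⟨((m : ℂ) + 1, 0, -((m : ℂ) + 1)), by
      simp only [D, mem_ofPred_eq]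
      constructor <;> simp <;> linarith [(Nat.cast_nonneg m : (0 : ℝ) ≤ m)]⟩
    (fun ν hν f hf => (hint ν hν f hf).1) (fun ν hν f hf g p hp => by
      have hc : ((Fintype.card (IdxH m) : ℕ) : ℂ) = 2 * (m : ℂ) + 1 := by
        simp; ring
      have h23 := mul_ne_zero hp.2.2 hp.1.2.2
      have h123 := mul_ne_zero h23 hp.1.1
      rw [(hint ν hν f hf).2 g (g * p) (conjH m (gmat p))
        (sgnPow (η.2.1 + η.2.2) (ν.2.1 - ν.2.2 - ((m : ℂ) + 1) / 2)
            (mdet (blk₂₂ (gmat p)) * mdet (blk₂₂ (blk₁₁ (gmat p)))) *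
          sgnPow (η.1 + η.2.1) (ν.1 - ν.2.1 - ((m : ℂ) + 1) / 2) (mdet (blk₂₂ (gmat p))) *
          sgnPow η.2.2 (ν.2.2 - 3 * ((m : ℂ) + 1) / 2 + 1) (mdet (blk₂₂ (gmat p)) *
            mdet (blk₂₂ (blk₁₁ (gmat p))) * mdet (blk₁₁ (blk₁₁ (gmat p)))))
        (by rw [mdet_conjH]; exact h123)
        (mul_ne_zero (mul_ne_zero (sgnPow_ne_zero _ _ h23) (sgnPow_ne_zero _ _ hp.2.2))
          (sgnPow_ne_zero _ _ h123))
        (fun M => by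
          rw [minorKernel_conjH, mdet_mmul, mdet_conjH, sgnPow_mul η.2.2 _ _ (mdet M)]
          ring)
        (fun M => by
          rw [gmat_mul, mmul_assoc (gmat g), mmul_wtildeH m hp.2.1 hp.1.2.1, ← mmul_assoc,
            mmul_assoc])]
      congr 1
      rw [coe_dpow_eq_sgnPow, hc, mdet_conjH, charH]
      simp only [sgnPow_mul, mul_inv, ← sgnPow_neg _ _ hp.1.1, ← sgnPow_neg _ _ hp.1.2.2,
        ← sgnPow_neg _ _ hp.2.2]
      have e1 : sgnPow η.2.2 (-(ν.2.2 + ((m : ℂ) + 1) / 2)) (mdet (blk₁₁ (blk₁₁ (gmat p)))) =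
          sgnPow 0 (-(2 * (m : ℂ) + 1)) (mdet (blk₁₁ (blk₁₁ (gmat p)))) *
          sgnPow η.2.2 (-(ν.2.2 - 3 * ((m : ℂ) + 1) / 2 + 1))
            (mdet (blk₁₁ (blk₁₁ (gmat p)))) := by
        rw [sgnPow_mul_sgnPow _ _ _ _ hp.1.1, zero_add]
        congr 1
        ring
      have e2 : sgnPow η.2.1 (-ν.2.1) (mdet (blk₂₂ (blk₁₁ (gmat p)))) =
          sgnPow 0 (-(2 * (m : ℂ) + 1)) (mdet (blk₂₂ (blk₁₁ (gmat p)))) *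
          sgnPow (η.2.1 + η.2.2) (-(ν.2.1 - ν.2.2 - ((m : ℂ) + 1) / 2))
            (mdet (blk₂₂ (blk₁₁ (gmat p)))) *
          sgnPow η.2.2 (-(ν.2.2 - 3 * ((m : ℂ) + 1) / 2 + 1))
            (mdet (blk₂₂ (blk₁₁ (gmat p)))) := by
        rw [sgnPow_mul_sgnPow _ _ _ _ hp.1.2.2, sgnPow_mul_sgnPow _ _ _ _ hp.1.2.2]
        congr 1
        · linear_combination -zmod_two_add_self η.2.2
        · ring
      have e3 : sgnPow η.1 (-(ν.1 - ((m : ℂ) + 1) / 2)) (mdet (blk₂₂ (gmat p))) =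
          sgnPow 0 (-(2 * (m : ℂ) + 1)) (mdet (blk₂₂ (gmat p))) *
          sgnPow (η.2.1 + η.2.2) (-(ν.2.1 - ν.2.2 - ((m : ℂ) + 1) / 2)) (mdet (blk₂₂ (gmat p))) *
          sgnPow (η.1 + η.2.1) (-(ν.1 - ν.2.1 - ((m : ℂ) + 1) / 2)) (mdet (blk₂₂ (gmat p))) *
          sgnPow η.2.2 (-(ν.2.2 - 3 * ((m : ℂ) + 1) / 2 + 1)) (mdet (blk₂₂ (gmat p))) := by
        rw [sgnPow_mul_sgnPow _ _ _ _ hp.2.2, sgnPow_mul_sgnPow _ _ _ _ hp.2.2,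
          sgnPow_mul_sgnPow _ _ _ _ hp.2.2]
        congr 1
        · linear_combination -zmod_two_add_self η.2.2 - zmod_two_add_self η.2.1
        · ring
      rw [e1, e2, e3]
      ring)
  refine ⟨S, fun ν x f f' hff g => ?_, fun ν hν hν' f g => ?_, fun F hF => ?_⟩
  · rw [hS, hS]
    refine htr ν f f' g (x⁻¹ * g) fun M => ?_
    rw [extendGL_of_translate hff, gmat_mul]
    simp only [mmul_assoc]
  · have h1 := (hint ν ⟨hν, hν'⟩ f f.2).1 g
    simp only [one_mul, ← integrandS_eq] at h1
    rw [hS]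
    exact h1
  · have h1 : (fun ν => (S ν (F ν) : HH m → ℂ)) = fun ν => op ν (F ν) :=
      funext fun ν => funext fun g => hS ν (F ν) g
    rw [h1]
    exact hhol _ hF

theorem exists_isNormalizedS : ∃ S : FamilyS m, IsNormalizedS m S ∧
    ∀ η (F : ∀ ν, tauRep m η ν), HolSec (fun ν => (F ν : HH m → ℂ)) →
      HolSec fun ν => (S η ν (F ν) : HH m → ℂ) := by
  choose S h1 h2 h3 using exists_operator_S m
  refine ⟨S, ⟨h1, h2, fun η F hF h => (h3 η F ?_).differentiable h⟩, h3⟩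
  refine (isSeries_tauRep m η).holSec_of_standard fun k hk => hF k ?_
  rw [Matrix.mem_orthogonalGroup_iff']
  exact hk

end OperatorS

section Embedding

variable (m : ℕ)

/-- The embedding of matrices `X ↦ diag(X, 1)`. -/
def extH (X : Sq (IdxH m)) : Sq (IdxG m) :=
  blk (blk₁₁ X) (fun i => Sum.elim (fun j => X (Sum.inl i) (Sum.inr j)) 0)
    (Sum.elim (fun i j => X (Sum.inr i) (Sum.inl j)) 0) (blk (blk₂₂ X) 0 0 (mone Unit))

theorem gmat_embH (h : HH m) : gmat (embH m h) = extH m (gmat h) := by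
  funext i j
  rcases i with (i | i) | (i | i) <;> rcases j with (j | j) | (j | j) <;> rfl

theorem extH_mmul (X Y : Sq (IdxH m)) :
    extH m (mmul X Y) = mmul (extH m X) (extH m Y) := by
  funext i j
  rcases i with (i | i) | (i | i) <;> rcases j with (j | j) | (j | j) <;>
    simp [mmul, extH, Fintype.sum_sum_type, blk₁₁, blk₂₂, mone_apply]

theorem embH_mul (h h' : HH m) : embH m (h * h') = embH m h * embH m h' := by
  refine gmat_injective ?_
  rw [gmat_embH, gmat_mul, gmat_mul, gmat_embH, gmat_embH, extH_mmul]

theorem embH_inv (h : HH m) : embH m h⁻¹ = (embH m h)⁻¹ := by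
  refine eq_inv_of_mul_eq_one_left ?_
  rw [← embH_mul, inv_mul_cancel]
  refine gmat_injective ?_
  rw [gmat_embH]
  funext i j
  rcases i with (i | i) | (i | i) <;> rcases j with (j | j) | (j | j) <;>
    simp [extH, gmat, blk₁₁, blk₂₂, mone_apply, Matrix.one_apply]

theorem mdet_extH_ne_zero {X : Sq (IdxH m)} (hX : mdet X ≠ 0) :
    mdet (extH m X) ≠ 0 := by
  have h := mdet_gmat (embH m (toGL X hX))
  rwa [gmat_embH, gmat_toGL] at h

theorem contDiff_extH : ContDiff ℝ ∞ (extH m) := by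
  refine contDiff_pi.2 fun i => contDiff_pi.2 fun j => ?_
  have h := fun i j => contDiff_apply_apply ℝ ℝ (n := ∞) (i : IdxH m) (j : IdxH m)
  rcases i with (i | i) | (i | i) <;> rcases j with (j | j) | (j | j) <;>
    first
    | exact h _ _
    | exact contDiff_const

theorem mdet_extH {p : Sq (IdxH m)} (hp : blk₂₁ p = 0) :
    mdet (extH m p) = mdet (blk₁₁ p) * mdet (blk₂₂ p) := by
  have h1 : blk₂₁ (extH m p) = 0 := by
    funext i j
    rcases i with i | i
    · exact congrFun (congrFun hp i) j
    · rfl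
  have h2 : mdet (blk (blk₂₂ p) 0 0 (mone Unit)) = mdet (blk₂₂ p) := by
    rw [mdet_blk_zero, mdet_mone, mul_one]
  rw [mdet_eq_of_blk₂₁ h1, extH, blk₁₁_blk, blk₂₂_blk, h2]

theorem mdet_blk₂₁_extH_mmul {p : Sq (IdxH m)} (hp : blk₂₁ p = 0)
    (M : Sq (IdxG m)) :
    mdet (blk₂₁ (mmul (extH m p) M)) = mdet (blk₂₂ p) * mdet (blk₂₁ M) := by
  have h1 : blk₂₁ (extH m p) = 0 := by
    funext i j
    rcases i with i | i
    · exact congrFun (congrFun hp i) j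
    · rfl
  have h2 : mdet (blk (blk₂₂ p) 0 0 (mone Unit)) = mdet (blk₂₂ p) := by
    rw [mdet_blk_zero, mdet_mone, mul_one]
  rw [blk₂₁_mmul, h1, zero_mmul, zero_add, mdet_mmul, extH, blk₂₂_blk, h2]

theorem mdet_crossBlk_extH_mmul {p : Sq (IdxH m)} (hp : blk₂₁ p = 0)
    (hp' : blk₂₁ (blk₁₁ p) = 0) (M : Sq (IdxG m)) :
    mdet (crossBlk (mmul (extH m p) M)) =
      mdet (blk₂₂ p) * mdet (blk₂₂ (blk₁₁ p)) * mdet (crossBlk M) := by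
  have h0 : crossBlk (mmul (extH m p) M) = mmul (blk (blk₂₂ p) 0
      (fun _ j => p (Sum.inl (Sum.inr ())) (Sum.inr j)) (blk₂₂ (blk₁₁ p))) (crossBlk M) := by
    have h2 : ∀ i j, p (Sum.inr i) (Sum.inl j) = 0 := fun i j => congrFun (congrFun hp i) j
    have h3 : ∀ i j, p (Sum.inl (Sum.inr i)) (Sum.inl (Sum.inl j)) = 0 := fun i j =>
      congrFun (congrFun hp' i) j
    funext i j
    rcases i with i | i <;> rcases j with j | j <;>
      simp [crossBlk, mmul, extH, Fintype.sum_sum_type, h2, h3, blk₁₁, blk₂₂, add_comm]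
  have h1 : mdet (blk (blk₂₂ p) 0 (fun _ j => p (Sum.inl (Sum.inr ())) (Sum.inr j))
      (blk₂₂ (blk₁₁ p))) = mdet (blk₂₂ p) * mdet (blk₂₂ (blk₁₁ p)) :=
    Matrix.det_fromBlocks_zero₁₂ _ _ _
  rw [h0, mdet_mmul, h1]

end Embedding

section OperatorA

variable (m : ℕ)

theorem integrandA_eq (ξ : ZMod 2 × ZMod 2) (lam : ℂ × ℂ) (η : ZMod 2) (ν : ℂ) (f : GG m → ℂ)
    (h : HH m) (X : Sq (Blk m)) :
    integrandA m ξ lam η ν f h X =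
      sgnPow (ξ.1 + η) (lam.1 - ν - ((m : ℂ) + 1) / 2) (mdet X) *
        sgnPow (η + ξ.2) (ν - lam.2 - ((m : ℂ) + 1) / 2) (mdet (blk₁₁ X)) *
        extendGL f (mmul (extH m (gmat h)) (blk (mone (Blk m)) 0 X (mone (Blk m)))) := by
  rw [integrandA, ← gmat_embH, ← gmat_nbarG, ← gmat_mul, extendGL_gmat]
  rfl

theorem measurable_kernelA (ε₁ ε₂ : ZMod 2) (a b : ℂ) :
    Measurable fun X : Sq (Blk m) =>
      sgnPow ε₁ a (mdet X) * sgnPow ε₂ b (mdet (blk₁₁ X)) := by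
  have h1 := measurable_sgnPow ε₁ a
  have h2 := measurable_sgnPow ε₂ b
  fun_prop

theorem re_half_succ : (((m : ℂ) + 1) / 2).re = ((m : ℝ) + 1) / 2 := by
  rw [show ((m : ℂ) + 1) / 2 = ((((m : ℝ) + 1) / 2 : ℝ) : ℂ) by push_cast; ring,
    Complex.ofReal_re]

theorem exists_operator_A (ξ : ZMod 2 × ZMod 2) (η : ZMod 2) :
    ∃ A : ∀ z : (ℂ × ℂ) × ℂ, piRep m ξ z.1 →ₗ[ℂ] tauRep m (ξ.2, η, ξ.1) (z.1.2, z.2, z.1.1),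
      (∀ (z : (ℂ × ℂ) × ℂ) (x : HH m) (f f' : piRep m ξ z.1),
        (∀ g, (f' : GG m → ℂ) g = (f : GG m → ℂ) ((embH m x)⁻¹ * g)) →
        ∀ h, (A z f' : HH m → ℂ) h = (A z f : HH m → ℂ) (x⁻¹ * h)) ∧
      (∀ z : (ℂ × ℂ) × ℂ, ((m : ℝ) + 1) / 2 - 1 < (z.1.1 - z.2).re →
        ((m : ℝ) + 1) / 2 - 1 < (z.2 - z.1.2).re → ∀ (f : piRep m ξ z.1) (h : HH m),
        Integrable (integrandA m ξ z.1 η z.2 f h) ∧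
        (A z f : HH m → ℂ) h = (nA m ξ z.1 η z.2)⁻¹ * ∫ X, integrandA m ξ z.1 η z.2 f h X) ∧
      ∀ F : ∀ z : (ℂ × ℂ) × ℂ, piRep m ξ z.1, HolSec (fun z => (F z : GG m → ℂ)) →
        HolSec fun z => (A z (F z) : HH m → ℂ) := by
  obtain ⟨μ, θ, hU⟩ := exists_isUnfolding_G m
  let D : Set ((ℂ × ℂ) × ℂ) := {z | ((m : ℝ) + 1) / 2 - 1 < (z.1.1 - z.2).re ∧
    ((m : ℝ) + 1) / 2 - 1 < (z.2 - z.1.2).re}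
  have hreg : Regularizable (fun (z : (ℂ × ℂ) × ℂ) (M : Sq (IdxG m)) =>
      crossKernel m (ξ.1 + η) (η + ξ.2)
        (z.1.1 - z.2 - ((m : ℂ) + 1) / 2, z.2 - z.1.2 - ((m : ℂ) + 1) / 2) M)
      (fun z => (nA m ξ z.1 η z.2)⁻¹) D := by
    have h1 := ((regularizable_crossKernel m (ξ.1 + η) (η + ξ.2)).comp
      (f := fun z : (ℂ × ℂ) × ℂ => (z.1.1 - z.2 - ((m : ℂ) + 1) / 2,
        z.2 - z.1.2 - ((m : ℂ) + 1) / 2)) (by fun_prop)).mono (D' := D) ?_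
    · simp only [pairNorm_eq_inv_nA] at h1
      exact h1
    · intro z hz
      have h2 : _ ∧ _ := hz
      simp only [Complex.sub_re] at h2
      simp only [mem_preimage, mem_ofPred_eq, Complex.sub_re, re_half_succ]
      constructor <;> linarith
  obtain ⟨op, hhol, htr, hD⟩ := hU.exists_operator hreg ξ.2
    (c := fun z : (ℂ × ℂ) × ℂ => z.1.2 - 3 * ((m : ℂ) + 1) / 2) (by fun_prop)
    (χ := fun z => charG m ξ z.1) (fun _ => measurable_kernelA m _ _ _ _)
    (fun z X p hp => crossKernel_mul_charG m ξ z.1 η z.2 X hp)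
    (contDiff_extH m) (fun Y hY => mdet_extH_ne_zero m hY)
    (j := fun M => M) contDiff_id (fun _ h => h)
  have hser := isSeries_piRep m ξ
  have hDo : IsOpen D :=
    IsOpen.and (p₁ := fun z : (ℂ × ℂ) × ℂ => ((m : ℝ) + 1) / 2 - 1 < (z.1.1 - z.2).re)
      (p₂ := fun z : (ℂ × ℂ) × ℂ => ((m : ℝ) + 1) / 2 - 1 < (z.2 - z.1.2).re)
      (isOpen_lt continuous_const (by fun_prop)) (isOpen_lt continuous_const (by fun_prop))
  have hchar : ∀ lam, ∀ f ∈ piRep m ξ lam, ∀ (Y M : Sq (IdxG m)), ∀ p ∈ parG m,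
      extendGL f (mmul Y (mmul M p)) = charG m ξ lam p * extendGL f (mmul Y M) := by
    intro lam f hf Y M p hp
    rw [← mmul_assoc]
    exact hser.isInduced.extendGL_mmul hf _ hp (mdet_ne_zero_of_mem_parG hp)
  have hint := fun z (hz : z ∈ D) f (hf : f ∈ piRep m ξ z.1) =>
    hD z hz f (hser.isInduced.smoothGL hf) (hchar z.1 f hf)
  obtain ⟨A, hA⟩ := hser.exists_family_of_integral (a := fun z : (ℂ × ℂ) × ℂ => z.1) contDiff_fst
    ((isInduced_tauRep m (ξ.2, η, ξ.1)).comp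
      (a := fun z : (ℂ × ℂ) × ℂ => (z.1.2, z.2, z.1.1)) (by fun_prop)) hhol
    (D := D) hDo
    ⟨(((m : ℂ) + 1, -((m : ℂ) + 1)), 0), by
      simp only [D, mem_ofPred_eq]
      constructor <;> simp <;> linarith [(Nat.cast_nonneg m : (0 : ℝ) ≤ m)]⟩
    (fun z hz f hf => (hint z hz f hf).1) (fun z hz f hf g p hp => by
      have hc : ((Fintype.card (IdxG m) : ℕ) : ℂ) = 2 * ((m : ℂ) + 1) := by
        simp; ring
      have h23 := mul_ne_zero hp.2.2 hp.1.2.2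
      have h123 := mul_ne_zero (mul_ne_zero hp.1.1 hp.1.2.2) hp.2.2
      have hdet : mdet (extH m (gmat p)) = mdet (blk₁₁ (blk₁₁ (gmat p))) *
          mdet (blk₂₂ (blk₁₁ (gmat p))) * mdet (blk₂₂ (gmat p)) := by
        rw [mdet_extH m hp.2.1, mdet_eq_of_blk₂₁ hp.1.2.1]
      rw [(hint z hz f hf).2 g (g * p) (extH m (gmat p))
        (sgnPow (ξ.1 + η) (z.1.1 - z.2 - ((m : ℂ) + 1) / 2) (mdet (blk₂₂ (gmat p))) *
          sgnPow (η + ξ.2) (z.2 - z.1.2 - ((m : ℂ) + 1) / 2)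
            (mdet (blk₂₂ (gmat p)) * mdet (blk₂₂ (blk₁₁ (gmat p)))) *
          sgnPow ξ.2 (z.1.2 - 3 * ((m : ℂ) + 1) / 2) (mdet (blk₁₁ (blk₁₁ (gmat p))) *
          mdet (blk₂₂ (blk₁₁ (gmat p))) * mdet (blk₂₂ (gmat p))))
        (by rw [hdet]; exact h123)
        (mul_ne_zero (mul_ne_zero (sgnPow_ne_zero _ _ hp.2.2) (sgnPow_ne_zero _ _ h23))
          (sgnPow_ne_zero _ _ h123))
        (fun M => by
          rw [crossKernel, crossKernel, mdet_blk₂₁_extH_mmul m hp.2.1,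
            mdet_crossBlk_extH_mmul m hp.2.1 hp.1.2.1, mdet_mmul, hdet,
            sgnPow_mul ξ.2 _ _ (mdet M), sgnPow_mul (η + ξ.2) _ _ (mdet (crossBlk M)),
            sgnPow_mul (ξ.1 + η)]
          ring)
        (fun M => by rw [gmat_mul, extH_mmul, mmul_assoc])]
      congr 1
      rw [coe_dpow_eq_sgnPow, hc, hdet, charH]
      simp only [sgnPow_mul, mul_inv, ← sgnPow_neg _ _ hp.1.1, ← sgnPow_neg _ _ hp.1.2.2,
        ← sgnPow_neg _ _ hp.2.2]
      have e1 : sgnPow ξ.2 (-(z.1.2 + ((m : ℂ) + 1) / 2)) (mdet (blk₁₁ (blk₁₁ (gmat p)))) =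
          sgnPow 0 (-(2 * ((m : ℂ) + 1))) (mdet (blk₁₁ (blk₁₁ (gmat p)))) *
          sgnPow ξ.2 (-(z.1.2 - 3 * ((m : ℂ) + 1) / 2)) (mdet (blk₁₁ (blk₁₁ (gmat p)))) := by
        rw [sgnPow_mul_sgnPow _ _ _ _ hp.1.1, zero_add]
        congr 1
        ring
      have e2 : sgnPow η (-z.2) (mdet (blk₂₂ (blk₁₁ (gmat p)))) =
          sgnPow 0 (-(2 * ((m : ℂ) + 1))) (mdet (blk₂₂ (blk₁₁ (gmat p)))) *
          sgnPow (η + ξ.2) (-(z.2 - z.1.2 - ((m : ℂ) + 1) / 2))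
            (mdet (blk₂₂ (blk₁₁ (gmat p)))) *
          sgnPow ξ.2 (-(z.1.2 - 3 * ((m : ℂ) + 1) / 2)) (mdet (blk₂₂ (blk₁₁ (gmat p)))) := by
        rw [sgnPow_mul_sgnPow _ _ _ _ hp.1.2.2, sgnPow_mul_sgnPow _ _ _ _ hp.1.2.2]
        congr 1
        · linear_combination -zmod_two_add_self ξ.2
        · ring
      have e3 : sgnPow ξ.1 (-(z.1.1 - ((m : ℂ) + 1) / 2)) (mdet (blk₂₂ (gmat p))) =
          sgnPow 0 (-(2 * ((m : ℂ) + 1))) (mdet (blk₂₂ (gmat p))) *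
          sgnPow (ξ.1 + η) (-(z.1.1 - z.2 - ((m : ℂ) + 1) / 2)) (mdet (blk₂₂ (gmat p))) *
          sgnPow (η + ξ.2) (-(z.2 - z.1.2 - ((m : ℂ) + 1) / 2)) (mdet (blk₂₂ (gmat p))) *
          sgnPow ξ.2 (-(z.1.2 - 3 * ((m : ℂ) + 1) / 2)) (mdet (blk₂₂ (gmat p))) := by
        rw [sgnPow_mul_sgnPow _ _ _ _ hp.2.2, sgnPow_mul_sgnPow _ _ _ _ hp.2.2,
          sgnPow_mul_sgnPow _ _ _ _ hp.2.2]
        congr 1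
        · linear_combination -zmod_two_add_self η - zmod_two_add_self ξ.2
        · ring
      rw [e1, e2, e3]
      ring)
  refine ⟨A, fun z x f f' hff g => ?_, fun z hz hz' f g => ?_, fun F hF => ?_⟩
  · rw [hA, hA]
    refine htr z f f' g (x⁻¹ * g) fun M => ?_
    rw [extendGL_of_translate hff, gmat_mul, extH_mmul, ← embH_inv, gmat_embH, mmul_assoc]
  · have h1 := (hint z ⟨hz, hz'⟩ f f.2).1 g
    simp only [← integrandA_eq] at h1
    rw [hA]
    exact h1
  · have h1 : (fun z => (A z (F z) : HH m → ℂ)) = fun z => op z (F z) :=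
      funext fun z => funext fun g => hA z (F z) g
    rw [h1]
    exact hhol _ hF

theorem exists_isNormalizedA : ∃ A : FamilyA m, IsNormalizedA m A ∧
    ∀ ξ η (F : ∀ z : (ℂ × ℂ) × ℂ, piRep m ξ z.1), HolSec (fun z => (F z : GG m → ℂ)) →
      HolSec fun z : (ℂ × ℂ) × ℂ => (A ξ z.1 η z.2 (F z) : HH m → ℂ) := by
  choose A h1 h2 h3 using exists_operator_A m
  let A' : FamilyA m := fun ξ lam η ν => A ξ η (lam, ν)
  have e1 : ∀ (ξ : ZMod 2 × ZMod 2) (lam : ℂ × ℂ) (η : ZMod 2) (ν : ℂ) (f : piRep m ξ lam),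
      A' ξ lam η ν f = A ξ η (lam, ν) f := fun _ _ _ _ _ => rfl
  refine ⟨A', ⟨fun ξ lam η ν x f f' hff h => ?_, fun ξ lam η ν hl hl' f h => ?_,
    fun ξ η F hF h => ?_⟩, h3⟩
  · rw [e1, e1]
    exact h1 ξ η (lam, ν) x f f' hff h
  · rw [e1]
    exact h2 ξ η (lam, ν) hl hl' f h
  have h4 : HolSec fun lam => (F lam : GG m → ℂ) :=
    (isSeries_piRep m ξ).holSec_of_standard fun k hk => hF k (by
      rw [Matrix.mem_orthogonalGroup_iff']
      exact hk)
  have h5 : HolSec fun z : (ℂ × ℂ) × ℂ => (F z.1 : GG m → ℂ) := h4.comp contDiff_fst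
  exact (h3 ξ η (fun z => F z.1) h5).differentiable h

end OperatorA

section EmbeddingB

variable (m : ℕ)

/-- The embedding of `2 × 2` matrices in the indices `n` and `2n`. -/
def embB (M : IdxG 0 → IdxG 0 → ℝ) : Sq (IdxG m) :=
  blk (blk (mone (Fin m)) 0 0 (blk₂₂ (blk₁₁ M))) (blk 0 0 0 (blk₂₂ (blk₁₂ M)))
    (blk 0 0 0 (blk₂₂ (blk₂₁ M))) (blk (mone (Fin m)) 0 0 (blk₂₂ (blk₂₂ M)))

theorem embB_mmul (M N : IdxG 0 → IdxG 0 → ℝ) :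
    embB m (mmul M N) = mmul (embB m M) (embB m N) := by
  funext i j
  rcases i with (i | i) | (i | i) <;> rcases j with (j | j) | (j | j) <;>
    simp [mmul, embB, Fintype.sum_sum_type, blk₁₁, blk₁₂, blk₂₁, blk₂₂, mone_apply]

theorem embB_mone : embB m (mone (IdxG 0)) = mone (IdxG m) := by
  funext i j
  rcases i with (i | i) | (i | i) <;> rcases j with (j | j) | (j | j) <;>
    simp [embB, blk₁₁, blk₁₂, blk₂₁, blk₂₂, mone_apply]

theorem mdet_embB_ne_zero {M : IdxG 0 → IdxG 0 → ℝ} (hM : mdet M ≠ 0) : mdet (embB m M) ≠ 0 := by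
  have h := congrArg (fun N => mdet (embB m N)) (mmul_minv hM)
  simp only [embB_mmul, embB_mone, mdet_mmul, mdet_mone] at h
  exact left_ne_zero_of_mul_eq_one h

theorem contDiff_embB : ContDiff ℝ ∞ (embB m) := by
  refine contDiff_pi.2 fun i => contDiff_pi.2 fun j => ?_
  have h := fun i j => contDiff_apply_apply ℝ ℝ (n := ∞) (i : IdxG 0) (j : IdxG 0)
  rcases i with (i | i) | (i | i) <;> rcases j with (j | j) | (j | j) <;>
    first
    | exact h _ _
    | exact contDiff_const

theorem mdet_blk₂₂_of_zero (M : Blk 0 → Blk 0 → ℝ) : mdet (blk₂₂ M) = mdet M := by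
  have h : blk₂₁ M = 0 := by
    funext i j
    exact j.elim0
  have h1 : mdet (blk₁₁ M) = 1 := Matrix.det_isEmpty
  rw [mdet_eq_of_blk₂₁ h, h1, one_mul]

theorem blocks_embB {p : IdxG 0 → IdxG 0 → ℝ} (hp : p ∈ parG 0) :
    mdet (blk₁₁ (embB m p)) = mdet (blk₁₁ p) ∧ mdet (blk₂₂ (embB m p)) = mdet (blk₂₂ p) ∧
      blk₂₁ (embB m p) = 0 := by
  refine ⟨?_, ?_, ?_⟩
  · rw [embB, blk₁₁_blk, mdet_blk_zero, mdet_mone, one_mul, mdet_blk₂₂_of_zero]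
  · rw [embB, blk₂₂_blk, mdet_blk_zero, mdet_mone, one_mul, mdet_blk₂₂_of_zero]
  · rw [embB, blk₂₁_blk, hp.2.1]
    funext i j
    rcases i with i | i <;> rcases j with j | j <;> rfl

theorem embB_mem_parG {p : IdxG 0 → IdxG 0 → ℝ} (hp : p ∈ parG 0) : embB m p ∈ parG m := by
  obtain ⟨h1, h2, h3⟩ := blocks_embB m hp
  exact ⟨h1 ▸ hp.1, h3, h2 ▸ hp.2.2⟩

theorem charG_embB (ξ : ZMod 2 × ZMod 2) (lam : ℂ × ℂ) {p : IdxG 0 → IdxG 0 → ℝ}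
    (hp : p ∈ parG 0) : charG m ξ lam (embB m p) =
      charG 0 ξ (lam.1 + (m : ℂ) / 2, lam.2 - (m : ℂ) / 2) p := by
  obtain ⟨h1, h2, -⟩ := blocks_embB m hp
  rw [charG, charG, h1, h2]
  congr 2
  · push_cast; ring
  · push_cast; ring

theorem nA_zero (ξ : ZMod 2 × ZMod 2) (lam : ℂ × ℂ) (η : ZMod 2) (ν : ℂ) :
    nA 0 ξ (lam.1 + (m : ℂ) / 2, lam.2 - (m : ℂ) / 2) η ν = nB m ξ lam η ν := by
  rw [nA, nB, Finset.Icc_eq_empty (by norm_num), Finset.prod_empty, mul_one]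
  congr 3
  · push_cast; ring_nf
  · push_cast; ring_nf

/-- The matrix of `nbarLast`. -/
def nbLast (t : ℝ) : Sq (IdxG m) :=
  blk (mone (Blk m)) 0 (blk 0 0 0 fun _ _ => t) (mone (Blk m))

theorem gmat_nbarLast (t : ℝ) : gmat (nbarLast m t) = nbLast m t := by
  have h : gmat (nbarLast m t) = Matrix.transvection (lastIdx m) (nthIdx m) t := rfl
  rw [h]
  funext i j
  rcases i with (i | i) | (i | i) <;> rcases j with (j | j) | (j | j) <;>
    simp [nbLast, Matrix.transvection, mone_apply, Matrix.one_apply]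

theorem embB_nb (t : ℝ) :
    embB m (blk (mone (Blk 0)) 0 (fun _ _ => t) (mone (Blk 0))) = nbLast m t := by
  funext i j
  rcases i with (i | i) | (i | i) <;> rcases j with (j | j) | (j | j) <;>
    simp [nbLast, embB, mone_apply, blk₂₂]

/-- The conjugate of a block upper triangular matrix in `H` by `nbarLast`. -/
def conjB (s : ℝ) (p : Sq (IdxH m)) : Sq (IdxG m) :=
  blk (blk₁₁ p) (fun i => Sum.elim (fun j => p (Sum.inl i) (Sum.inr j)) 0) 0
    (blk (blk₂₂ p) 0 (fun _ j => -s * p (Sum.inl (Sum.inr ())) (Sum.inr j)) (mone Unit))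

theorem extH_mmul_nbLast (t : ℝ) {p : Sq (IdxH m)} (hp : p ∈ parH m) :
    mmul (extH m p) (nbLast m t) = mmul (nbLast m ((mdet (blk₂₂ (blk₁₁ p)))⁻¹ * t))
      (conjB m ((mdet (blk₂₂ (blk₁₁ p)))⁻¹ * t) p) := by
  have h2 : ∀ i j, p (Sum.inr i) (Sum.inl j) = 0 := fun i j => congrFun (congrFun hp.2.1 i) j
  have h3 : ∀ i j, p (Sum.inl (Sum.inr i)) (Sum.inl (Sum.inl j)) = 0 := fun i j =>
    congrFun (congrFun hp.1.2.1 i) j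
  have h4 : mdet (blk₂₂ (blk₁₁ p)) = p (Sum.inl (Sum.inr ())) (Sum.inl (Sum.inr ())) :=
    Matrix.det_unique _
  have h5 := hp.1.2.2
  rw [h4] at h5 ⊢
  funext i j
  rcases i with (i | i) | (i | i) <;> rcases j with (j | j) | (j | j) <;>
    simp [mmul, extH, nbLast, conjB, Fintype.sum_sum_type, h2, h3, blk₁₁, blk₂₂, mone_apply]
  field_simp

theorem conjB_mem_parG (s : ℝ) {p : Sq (IdxH m)} (hp : p ∈ parH m) :
    conjB m s p ∈ parG m ∧ mdet (blk₁₁ (conjB m s p)) =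
      mdet (blk₁₁ (blk₁₁ p)) * mdet (blk₂₂ (blk₁₁ p)) ∧
      mdet (blk₂₂ (conjB m s p)) = mdet (blk₂₂ p) := by
  have h1 : mdet (blk₁₁ (conjB m s p)) =
      mdet (blk₁₁ (blk₁₁ p)) * mdet (blk₂₂ (blk₁₁ p)) := mdet_eq_of_blk₂₁ hp.1.2.1
  have h2 : mdet (blk₂₂ (conjB m s p)) = mdet (blk₂₂ p) :=
    (Matrix.det_fromBlocks_zero₁₂ _ _ _).trans (by
      change mdet (blk₂₂ p) * mdet (mone Unit) = _
      rw [mdet_mone, mul_one])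
  exact ⟨⟨h1 ▸ mul_ne_zero hp.1.1 hp.1.2.2, rfl, h2 ▸ hp.2.2⟩, h1, h2⟩

end EmbeddingB

section OperatorB

variable (m : ℕ)

/-- Matrices of size `1`. -/
def unitMat : (Blk 0 → Blk 0 → ℝ) ≃ᵐ ℝ :=
  letI : Unique (Blk 0) := ⟨⟨Sum.inr ()⟩, fun i => by rcases i with i | i; exacts [i.elim0, rfl]⟩
  (MeasurableEquiv.funUnique (Blk 0) (Blk 0 → ℝ)).trans (MeasurableEquiv.funUnique (Blk 0) ℝ)

theorem measurePreserving_unitMat : MeasurePreserving unitMat := by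
  let : Unique (Blk 0) := ⟨⟨Sum.inr ()⟩, fun i => by rcases i with i | i; exacts [i.elim0, rfl]⟩
  exact (volume_preserving_funUnique (Blk 0) ℝ).comp
    (volume_preserving_funUnique (Blk 0) (Blk 0 → ℝ))

theorem mdet_const (t : ℝ) : mdet (fun _ _ : Blk 0 => t) = t := by
  rw [← mdet_blk₂₂_of_zero]
  exact Matrix.det_unique _

theorem integrandB_eq (ξ : ZMod 2 × ZMod 2) (lam : ℂ × ℂ) (η : ZMod 2) (ν : ℂ) (f : GG m → ℂ)
    (h : HH m) (t : ℝ) :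
    integrandB m ξ lam η ν f h t = sgnPow (ξ.1 + η) (lam.1 - ν + ((m : ℂ) + 1) / 2) t *
        extendGL f (mmul (extH m (gmat h)) (nbLast m t)) / ((|t| : ℝ) : ℂ) := by
  rw [integrandB, ← gmat_embH, ← gmat_nbarLast, ← gmat_mul, extendGL_gmat]

theorem kernelB_eq (ξ : ZMod 2 × ZMod 2) (lam : ℂ × ℂ) (η : ZMod 2) (ν : ℂ) (f : GG m → ℂ)
    (h : HH m) {t : ℝ} (ht : t ≠ 0) :
    sgnPow (ξ.1 + η) (lam.1 + (m : ℂ) / 2 - ν - (((0 : ℕ) : ℂ) + 1) / 2)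
        (mdet (fun _ _ : Blk 0 => t)) *
      sgnPow (η + ξ.2) (ν - (lam.2 - (m : ℂ) / 2) - (((0 : ℕ) : ℂ) + 1) / 2)
        (mdet (blk₁₁ (fun _ _ : Blk 0 => t))) *
      extendGL f (mmul (extH m (gmat h))
        (embB m (blk (mone (Blk 0)) 0 (fun _ _ => t) (mone (Blk 0))))) =
    integrandB m ξ lam η ν f h t := by
  have h1 : mdet (blk₁₁ (fun _ _ : Blk 0 => t)) = 1 := Matrix.det_isEmpty
  have h2 : sgnPow (ξ.1 + η) (lam.1 - ν + ((m : ℂ) + 1) / 2) t =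
      sgnPow (ξ.1 + η) (lam.1 + (m : ℂ) / 2 - ν - (((0 : ℕ) : ℂ) + 1) / 2) t *
        sgnPow 0 1 t := by
    rw [sgnPow_mul_sgnPow _ _ _ _ ht, add_zero]
    congr 1
    push_cast
    ring
  have h3 : ((|t| : ℝ) : ℂ) ≠ 0 := by simpa using ht
  rw [integrandB_eq, h1, mdet_const, embB_nb, h2, sgnPow_one_right, sgnPow_zero_left,
    Complex.cpow_one]
  field_simp

theorem integral_unitMat {G : (Blk 0 → Blk 0 → ℝ) → ℂ} {G' : ℝ → ℂ}
    (h : ∀ t ≠ 0, G (fun _ _ => t) = G' t) :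
    (Integrable G → Integrable G') ∧ ∫ X, G X = ∫ t, G' t := by
  have h1 := measurePreserving_unitMat.symm
  have h2 : (G ∘ unitMat.symm) =ᵐ[volume] G' := by
    filter_upwards [Measure.ae_ne volume (0 : ℝ)] with t ht
    exact h t ht
  refine ⟨fun hG => ((h1.integrable_comp_emb unitMat.symm.measurableEmbedding).2 hG).congr h2, ?_⟩
  rw [← integral_congr_ae h2, ← h1.integral_comp unitMat.symm.measurableEmbedding]
  rfl

theorem integral_integrandB_mul {ξ : ZMod 2 × ZMod 2} {lam : ℂ × ℂ} (η : ZMod 2) (ν : ℂ)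
    {f : GG m → ℂ} (hf : f ∈ piRep m ξ lam) (h p : HH m) (hp : gmat p ∈ parH m) :
    ∫ t, integrandB m ξ lam η ν f (h * p) t =
      charH m (ξ.1, η, ξ.2) (lam.1, ν, lam.2) (gmat p) * ∫ t, integrandB m ξ lam η ν f h t := by
  set a := mdet (blk₁₁ (blk₁₁ (gmat p))) with ha
  set b := mdet (blk₂₂ (blk₁₁ (gmat p))) with hb
  set d := mdet (blk₂₂ (gmat p)) with hd
  have hb0 : b ≠ 0 := hp.1.2.2
  have hbc : ((|b| : ℝ) : ℂ) ≠ 0 := by simpa using hb0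
  set s := sgnPow ξ.1 (-(lam.1 + ((m : ℂ) + 1) / 2)) (a * b) *
    sgnPow ξ.2 (-(lam.2 - ((m : ℂ) + 1) / 2)) d with hs
  have h1 : ∀ t, integrandB m ξ lam η ν f (h * p) t =
      s * sgnPow (ξ.1 + η) (lam.1 - ν + ((m : ℂ) + 1) / 2) b * (((|b| : ℝ) : ℂ))⁻¹ *
        integrandB m ξ lam η ν f h (b⁻¹ * t) := by
    intro t
    obtain ⟨h2, h3, h4⟩ := conjB_mem_parG m (b⁻¹ * t) hp
    have h5 : extendGL f (mmul (extH m (gmat (h * p))) (nbLast m t)) =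
        s * extendGL f (mmul (extH m (gmat h)) (nbLast m (b⁻¹ * t))) := by
      rw [gmat_mul, extH_mmul, mmul_assoc, extH_mmul_nbLast m t hp, ← mmul_assoc,
        (isSeries_piRep m ξ).isInduced.extendGL_mmul hf _ h2 (mdet_ne_zero_of_mem_parG h2), charG,
        h3, h4]
    have h6 : sgnPow (ξ.1 + η) (lam.1 - ν + ((m : ℂ) + 1) / 2) t =
        sgnPow (ξ.1 + η) (lam.1 - ν + ((m : ℂ) + 1) / 2) b *
          sgnPow (ξ.1 + η) (lam.1 - ν + ((m : ℂ) + 1) / 2) (b⁻¹ * t) := by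
      rw [← sgnPow_mul, mul_inv_cancel_left₀ hb0]
    have h7 : ((|t| : ℝ) : ℂ) = ((|b| : ℝ) : ℂ) * ((|b⁻¹ * t| : ℝ) : ℂ) := by
      rw [← Complex.ofReal_mul, ← abs_mul, mul_inv_cancel_left₀ hb0]
    rw [integrandB_eq, integrandB_eq, h5, h6, h7]
    simp only [div_eq_mul_inv, mul_inv]
    ring
  have h2 : sgnPow η (-ν) b = sgnPow ξ.1 (-(lam.1 + ((m : ℂ) + 1) / 2)) b *
      sgnPow (ξ.1 + η) (lam.1 - ν + ((m : ℂ) + 1) / 2) b := by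
    rw [sgnPow_mul_sgnPow _ _ _ _ hb0]
    congr 1
    · linear_combination -zmod_two_add_self ξ.1
    · ring
  simp_rw [h1]
  rw [integral_const_mul, Measure.integral_comp_mul_left (fun t => integrandB m ξ lam η ν f h t),
    inv_inv, charH, ← ha, ← hb, ← hd, h2, hs, sgnPow_mul]
  rw [Complex.real_smul]
  field_simp

theorem exists_operator_B (ξ : ZMod 2 × ZMod 2) (η : ZMod 2) :
    ∃ B : ∀ z : (ℂ × ℂ) × ℂ, piRep m ξ z.1 →ₗ[ℂ] tauRep m (ξ.1, η, ξ.2) (z.1.1, z.2, z.1.2),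
      (∀ (z : (ℂ × ℂ) × ℂ) (x : HH m) (f f' : piRep m ξ z.1),
        (∀ g, (f' : GG m → ℂ) g = (f : GG m → ℂ) ((embH m x)⁻¹ * g)) →
        ∀ h, (B z f' : HH m → ℂ) h = (B z f : HH m → ℂ) (x⁻¹ * h)) ∧
      (∀ z : (ℂ × ℂ) × ℂ, -(((m : ℝ) + 1) / 2) < (z.1.1 - z.2).re →
        -(((m : ℝ) + 1) / 2) < (z.2 - z.1.2).re → ∀ (f : piRep m ξ z.1) (h : HH m),
        Integrable (integrandB m ξ z.1 η z.2 f h) ∧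
        (B z f : HH m → ℂ) h = (nB m ξ z.1 η z.2)⁻¹ * ∫ t, integrandB m ξ z.1 η z.2 f h t) ∧
      ∀ F : ∀ z : (ℂ × ℂ) × ℂ, piRep m ξ z.1, HolSec (fun z => (F z : GG m → ℂ)) →
        HolSec fun z => (B z (F z) : HH m → ℂ) := by
  obtain ⟨μ, θ, hU⟩ := exists_isUnfolding_G 0
  let D : Set ((ℂ × ℂ) × ℂ) := {z | -(((m : ℝ) + 1) / 2) < (z.1.1 - z.2).re ∧
    -(((m : ℝ) + 1) / 2) < (z.2 - z.1.2).re}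
  let l : (ℂ × ℂ) × ℂ → ℂ × ℂ := fun z => (z.1.1 + (m : ℂ) / 2, z.1.2 - (m : ℂ) / 2)
  have hreg : Regularizable (fun (z : (ℂ × ℂ) × ℂ) (M : IdxG 0 → IdxG 0 → ℝ) =>
      crossKernel 0 (ξ.1 + η) (η + ξ.2)
        ((l z).1 - z.2 - (((0 : ℕ) : ℂ) + 1) / 2, z.2 - (l z).2 - (((0 : ℕ) : ℂ) + 1) / 2) M)
      (fun z => (nB m ξ z.1 η z.2)⁻¹) D := by
    have h1 := ((regularizable_crossKernel 0 (ξ.1 + η) (η + ξ.2)).comp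
      (f := fun z : (ℂ × ℂ) × ℂ => ((l z).1 - z.2 - (((0 : ℕ) : ℂ) + 1) / 2,
        z.2 - (l z).2 - (((0 : ℕ) : ℂ) + 1) / 2)) (by fun_prop)).mono (D' := D) ?_
    · simp only [pairNorm_eq_inv_nA] at h1
      simp only [l, nA_zero] at h1
      exact h1
    · intro z hz
      have h2 : _ ∧ _ := hz
      have h3 : ((m : ℂ) / 2).re = (m : ℝ) / 2 := by
        rw [show (m : ℂ) / 2 = (((m : ℝ) / 2 : ℝ) : ℂ) by push_cast; ring, Complex.ofReal_re]
      have h4 := re_half_succ 0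
      simp only [Complex.sub_re] at h2
      simp only [l, mem_preimage, mem_ofPred_eq, Complex.sub_re, Complex.add_re, h3, h4]
      push_cast
      constructor <;> linarith
  obtain ⟨op, hhol, htr, hD⟩ := hU.exists_operator hreg ξ.2
    (c := fun z : (ℂ × ℂ) × ℂ => (l z).2 - 3 * (((0 : ℕ) : ℂ) + 1) / 2) (by fun_prop)
    (χ := fun z => charG 0 ξ (l z)) (fun _ => measurable_kernelA 0 _ _ _ _)
    (fun z X p hp => crossKernel_mul_charG 0 ξ (l z) η z.2 X hp)
    (contDiff_extH m) (fun Y hY => mdet_extH_ne_zero m hY)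
    (contDiff_embB m) (fun _ h => mdet_embB_ne_zero m h)
  have hser := isSeries_piRep m ξ
  have hDo : IsOpen D :=
    IsOpen.and (p₁ := fun z : (ℂ × ℂ) × ℂ => -(((m : ℝ) + 1) / 2) < (z.1.1 - z.2).re)
      (p₂ := fun z : (ℂ × ℂ) × ℂ => -(((m : ℝ) + 1) / 2) < (z.2 - z.1.2).re)
      (isOpen_lt continuous_const (by fun_prop)) (isOpen_lt continuous_const (by fun_prop))
  have hchar : ∀ z : (ℂ × ℂ) × ℂ, ∀ f ∈ piRep m ξ z.1, ∀ (Y : Sq (IdxG m))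
      (M : IdxG 0 → IdxG 0 → ℝ), ∀ p ∈ parG 0, extendGL f (mmul Y (embB m (mmul M p))) =
        charG 0 ξ (l z) p * extendGL f (mmul Y (embB m M)) := by
    intro z f hf Y M p hp
    rw [embB_mmul, ← mmul_assoc, hser.isInduced.extendGL_mmul hf _ (embB_mem_parG m hp)
      (mdet_embB_ne_zero m (mdet_ne_zero_of_mem_parG hp)), charG_embB m ξ z.1 hp]
  have hint := fun z (hz : z ∈ D) f (hf : f ∈ piRep m ξ z.1) =>
    (hD z hz f (hser.isInduced.smoothGL hf) (hchar z f hf)).1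
  have hint' : ∀ z ∈ D, ∀ f ∈ piRep m ξ z.1, ∀ h, Integrable (integrandB m ξ z.1 η z.2 f h) ∧
      op z f h = (nB m ξ z.1 η z.2)⁻¹ * ∫ t, integrandB m ξ z.1 η z.2 f h t := by
    intro z hz f hf h
    obtain ⟨h1, h2⟩ := hint z hz f hf h
    have h3 := integral_unitMat (G := fun X : Blk 0 → Blk 0 → ℝ =>
        sgnPow (ξ.1 + η) ((l z).1 - z.2 - (((0 : ℕ) : ℂ) + 1) / 2) (mdet X) *
          sgnPow (η + ξ.2) (z.2 - (l z).2 - (((0 : ℕ) : ℂ) + 1) / 2) (mdet (blk₁₁ X)) *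
          extendGL f (mmul (extH m (gmat h)) (embB m (blk (mone (Blk 0)) 0 X (mone (Blk 0))))))
      (G' := integrandB m ξ z.1 η z.2 f h)
      fun t (ht : t ≠ 0) => kernelB_eq m ξ z.1 η z.2 f h ht
    refine ⟨h3.1 h1, h2.trans ?_⟩
    rw [← h3.2]
  obtain ⟨B, hB⟩ := hser.exists_family_of_integral (a := fun z : (ℂ × ℂ) × ℂ => z.1) contDiff_fst
    ((isInduced_tauRep m (ξ.1, η, ξ.2)).comp
      (a := fun z : (ℂ × ℂ) × ℂ => (z.1.1, z.2, z.1.2)) (by fun_prop)) hhol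
    (D := D) hDo
    ⟨((0, 0), 0), by
      simp only [D, mem_ofPred_eq]
      constructor <;> simp <;> linarith [(Nat.cast_nonneg m : (0 : ℝ) ≤ m)]⟩
    hint (fun z hz f hf g p hp => by
      rw [(hint' z hz f hf _).2, (hint' z hz f hf _).2, integral_integrandB_mul m η z.2 hf g p hp]
      ring)
  refine ⟨B, fun z x f f' hff g => ?_, fun z hz hz' f g => ?_, fun F hF => ?_⟩
  · rw [hB, hB]
    refine htr z f f' g (x⁻¹ * g) fun M => ?_
    rw [extendGL_of_translate hff, gmat_mul, extH_mmul, ← embH_inv, gmat_embH, mmul_assoc]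
  · rw [hB]
    exact hint' z ⟨hz, hz'⟩ f f.2 g
  · have h1 : (fun z => (B z (F z) : HH m → ℂ)) = fun z => op z (F z) :=
      funext fun z => funext fun g => hB z (F z) g
    rw [h1]
    exact hhol _ hF

theorem exists_isNormalizedB : ∃ B : FamilyB m, IsNormalizedB m B ∧
    ∀ ξ η (F : ∀ z : (ℂ × ℂ) × ℂ, piRep m ξ z.1), HolSec (fun z => (F z : GG m → ℂ)) →
      HolSec fun z : (ℂ × ℂ) × ℂ => (B ξ z.1 η z.2 (F z) : HH m → ℂ) := by
  choose B h1 h2 h3 using exists_operator_B m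
  let B' : FamilyB m := fun ξ lam η ν => B ξ η (lam, ν)
  have e1 : ∀ (ξ : ZMod 2 × ZMod 2) (lam : ℂ × ℂ) (η : ZMod 2) (ν : ℂ) (f : piRep m ξ lam),
      B' ξ lam η ν f = B ξ η (lam, ν) f := fun _ _ _ _ _ => rfl
  refine ⟨B', ⟨fun ξ lam η ν x f f' hff h => ?_, fun ξ lam η ν hl hl' f h => ?_,
    fun ξ η F hF h => ?_⟩, h3⟩
  · rw [e1, e1]
    exact h1 ξ η (lam, ν) x f f' hff h
  · rw [e1]
    exact h2 ξ η (lam, ν) hl hl' f h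
  have h4 : HolSec fun lam => (F lam : GG m → ℂ) :=
    (isSeries_piRep m ξ).holSec_of_standard fun k hk => hF k (by
      rw [Matrix.mem_orthogonalGroup_iff']
      exact hk)
  have h5 : HolSec fun z : (ℂ × ℂ) × ℂ => (F z.1 : GG m → ℂ) := h4.comp contDiff_fst
  exact (h3 ξ η (fun z => F z.1) h5).differentiable h

end OperatorB

section Uniqueness

variable {m : ℕ}

theorem isOpen_re_lt {Q : Type} [TopologicalSpace Q] {a : ℝ} {f : Q → ℂ} (hf : Continuous f) :
    IsOpen {q | a < (f q).re} :=
  isOpen_lt continuous_const (Complex.continuous_re.comp hf)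

theorem standardSectionG {ξ : ZMod 2 × ZMod 2} {F : ∀ lam, piRep m ξ lam}
    (hF : ∀ k : GG m, mgram (gmat k) = mone (IdxG m) → ∀ q q',
      (F q : GG m → ℂ) k = (F q' : GG m → ℂ) k) : IsStandardSectionG m ξ F :=
  fun k hk => hF k ((Matrix.mem_orthogonalGroup_iff' _ _).1 hk)

theorem standardSectionH {η : ZMod 2 × ZMod 2 × ZMod 2} {F : ∀ ν, tauRep m η ν}
    (hF : ∀ k : HH m, mgram (gmat k) = mone (IdxH m) → ∀ q q',
      (F q : HH m → ℂ) k = (F q' : HH m → ℂ) k) : IsStandardSectionH m η F :=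
  fun k hk => hF k ((Matrix.mem_orthogonalGroup_iff' _ _).1 hk)

theorem IsNormalizedT.unique {T T' : FamilyT m} (h : IsNormalizedT m T)
    (h' : IsNormalizedT m T') : T = T' := by
  funext ξ
  refine (isSeries_piRep m ξ).family_unique (a := id)
    (fun F _ hs g => h.holomorphic ξ F (standardSectionG hs) g)
    (fun F _ hs g => h'.holomorphic ξ F (standardSectionG hs) g)
    (D := {lam : ℂ × ℂ | (m : ℝ) < (lam.1 - lam.2).re}) (isOpen_re_lt (by fun_prop))
    ⟨((m : ℂ) + 1, 0), by simp⟩ fun lam hl f g => ?_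
  exact ((h.integral ξ lam hl f g).2).trans ((h'.integral ξ lam hl f g).2).symm

theorem IsNormalizedS.unique {S S' : FamilyS m} (h : IsNormalizedS m S)
    (h' : IsNormalizedS m S') : S = S' := by
  funext η
  refine (isSeries_tauRep m η).family_unique (a := id)
    (fun F _ hs g => h.holomorphic η F (standardSectionH hs) g)
    (fun F _ hs g => h'.holomorphic η F (standardSectionH hs) g)
    (D := {ν : ℂ × ℂ × ℂ | ((m : ℝ) + 1) / 2 - 1 < (ν.1 - ν.2.1).re} ∩
      {ν : ℂ × ℂ × ℂ | ((m : ℝ) + 1) / 2 - 1 < (ν.2.1 - ν.2.2).re})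
    ((isOpen_re_lt (by fun_prop)).inter (isOpen_re_lt (by fun_prop)))
    ⟨((m : ℂ) + 1, 0, -((m : ℂ) + 1)), ?_⟩ fun ν hν f g => ?_
  · constructor <;> simp <;> linarith [(Nat.cast_nonneg m : (0 : ℝ) ≤ m)]
  · exact ((h.integral η ν hν.1 hν.2 f g).2).trans ((h'.integral η ν hν.1 hν.2 f g).2).symm

theorem IsNormalizedA.unique {A A' : FamilyA m} (h : IsNormalizedA m A)
    (h' : IsNormalizedA m A') : A = A' := by
  funext ξ lam η ν
  have h1 : (fun z : (ℂ × ℂ) × ℂ => A ξ z.1 η z.2) = fun z : (ℂ × ℂ) × ℂ => A' ξ z.1 η z.2 := by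
    refine (isSeries_piRep m ξ).family_unique (a := fun z : (ℂ × ℂ) × ℂ => z.1)
      (fun F _ hs g => h.holomorphic ξ η F (standardSectionG hs) g)
      (fun F _ hs g => h'.holomorphic ξ η F (standardSectionG hs) g)
      (D := {z : (ℂ × ℂ) × ℂ | ((m : ℝ) + 1) / 2 - 1 < (z.1.1 - z.2).re} ∩
        {z : (ℂ × ℂ) × ℂ | ((m : ℝ) + 1) / 2 - 1 < (z.2 - z.1.2).re})
      ((isOpen_re_lt (by fun_prop)).inter (isOpen_re_lt (by fun_prop)))
      ⟨(((m : ℂ) + 1, -((m : ℂ) + 1)), 0), ?_⟩ fun z hz f g => ?_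
    · constructor <;> simp <;> linarith [(Nat.cast_nonneg m : (0 : ℝ) ≤ m)]
    · exact ((h.integral ξ z.1 η z.2 hz.1 hz.2 f g).2).trans
        ((h'.integral ξ z.1 η z.2 hz.1 hz.2 f g).2).symm
  exact congrFun h1 (lam, ν)

theorem IsNormalizedB.unique {B B' : FamilyB m} (h : IsNormalizedB m B)
    (h' : IsNormalizedB m B') : B = B' := by
  funext ξ lam η ν
  have h1 : (fun z : (ℂ × ℂ) × ℂ => B ξ z.1 η z.2) = fun z : (ℂ × ℂ) × ℂ => B' ξ z.1 η z.2 := by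
    refine (isSeries_piRep m ξ).family_unique (a := fun z : (ℂ × ℂ) × ℂ => z.1)
      (fun F _ hs g => h.holomorphic ξ η F (standardSectionG hs) g)
      (fun F _ hs g => h'.holomorphic ξ η F (standardSectionG hs) g)
      (D := {z : (ℂ × ℂ) × ℂ | -(((m : ℝ) + 1) / 2) < (z.1.1 - z.2).re} ∩
        {z : (ℂ × ℂ) × ℂ | -(((m : ℝ) + 1) / 2) < (z.2 - z.1.2).re})
      ((isOpen_re_lt (by fun_prop)).inter (isOpen_re_lt (by fun_prop)))
      ⟨((0, 0), 0), ?_⟩ fun z hz f g => ?_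
    · constructor <;> simp <;> linarith [(Nat.cast_nonneg m : (0 : ℝ) ≤ m)]
    · exact ((h.integral ξ z.1 η z.2 hz.1 hz.2 f g).2).trans
        ((h'.integral ξ z.1 η z.2 hz.1 hz.2 f g).2).symm
  exact congrFun h1 (lam, ν)

end Uniqueness

section Inversion

variable {α : Type} [Fintype α] [DecidableEq α]

theorem minv_minv {X : Sq α} (h : mdet X ≠ 0) : minv (minv X) = X :=
  Matrix.nonsing_inv_nonsing_inv (Matrix.of X) (Ne.isUnit h)

/-- The derivative of the inversion of matrices. -/
theorem hasFDerivAt_minv {X : Sq α} (h : mdet X ≠ 0) :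
    HasFDerivAt minv (-(mulLeftMap α (Matrix.of (minv X)) ∘ₗ
      mulRightMap α (Matrix.of (minv X)))).toContinuousLinearMap
      X := by
  have h1 : DifferentiableAt ℝ (minv (α := α)) X := by
    have h2 : ∀ Y : Sq α, minv Y = (mdet Y)⁻¹ • (Matrix.of Y).adjugate := fun Y => by
      rw [minv, Matrix.inv_def, Ring.inverse_eq_inv']
      rfl
    rw [funext h2]
    refine ((contDiff_mdet.differentiable (by simp)).differentiableAt.inv h).smul ?_
    refine differentiableAt_pi.2 fun i => differentiableAt_pi.2 fun j => ?_
    have h3 : (fun Y : Sq α => (Matrix.of Y).adjugate i j) =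
        fun Y => mdet (Function.update Y j (Pi.single i 1)) :=
      funext fun Y => Matrix.adjugate_apply _ _ _
    rw [h3]
    refine (contDiff_mdet.differentiable (by simp)).differentiableAt.comp X
      (differentiableAt_pi.2 fun k => ?_)
    by_cases hk : k = j
    · subst hk
      simp
    · simp only [Function.update_of_ne hk]
      fun_prop
  have h4 := h1.hasFDerivAt
  suffices h5 : fderiv ℝ minv X =
      (-(mulLeftMap α (Matrix.of (minv X)) ∘ₗ
      mulRightMap α (Matrix.of (minv X)))).toContinuousLinearMap from h5 ▸ h4
  refine ContinuousLinearMap.ext fun H => ?_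
  have h5 : HasDerivAt (fun t : ℝ => X + t • H) H 0 := by
    simpa using ((hasDerivAt_id (0 : ℝ)).smul_const H).const_add X
  have h6 : HasDerivAt (fun t : ℝ => minv (X + t • H)) (fderiv ℝ minv X H) 0 :=
    HasFDerivAt.comp_hasDerivAt (0 : ℝ) (by rwa [zero_smul, add_zero]) h5
  have h7 : ∀ᶠ t : ℝ in 𝓝 0, mdet (X + t • H) ≠ 0 :=
    h5.continuousAt.eventually (isOpen_mdet_ne_zero.mem_nhds (by simpa using h))
  have h8 : mmul H (minv X) + mmul X (fderiv ℝ minv X H) = 0 := by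
    funext i k
    have h9 : HasDerivAt (fun t : ℝ => ∑ j, (X + t • H) i j * minv (X + t • H) j k)
        (∑ j, (H i j * minv (X + (0 : ℝ) • H) j k +
          (X + (0 : ℝ) • H) i j * fderiv ℝ minv X H j k)) 0 :=
      HasDerivAt.fun_sum fun j _ =>
        (hasDerivAt_pi.1 (hasDerivAt_pi.1 h5 i) j).mul (hasDerivAt_pi.1 (hasDerivAt_pi.1 h6 j) k)
    have h10 := h9.unique ((hasDerivAt_const (0 : ℝ) (mone α i k)).congr_of_eventuallyEq
      (h7.mono fun t ht => congrFun (congrFun (mmul_minv ht) i) k))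
    rw [Finset.sum_add_distrib, zero_smul, add_zero] at h10
    exact h10
  have h9 := congrArg (mmul (minv X)) (eq_neg_of_add_eq_zero_right h8)
  rw [← mmul_assoc, minv_mmul h, mone_mmul] at h9
  refine h9.trans (Eq.trans ?_ (neg_one_smul ℝ _))
  exact (Matrix.mul_neg (Matrix.of (minv X)) (Matrix.of (mmul H (minv X)))).trans
    (neg_one_smul ℝ _).symm

theorem lintegral_minv {G : Sq α → ENNReal} :
    ∫⁻ X, dpow (2 * Fintype.card α) X * G (minv X) = ∫⁻ X, G X := by
  let s : Set (Sq α) := {X | mdet X ≠ 0}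
  have hs : MeasurableSet s := isOpen_mdet_ne_zero.measurableSet
  have h0 : ∀ X ∈ s, mdet (minv X) ≠ 0 := fun X hX => by
    rw [mdet_minv]
    exact inv_ne_zero hX
  have h1 : minv '' s = s := by
    refine Subset.antisymm ?_ fun X hX => ⟨minv X, h0 X hX, minv_minv hX⟩
    rintro _ ⟨X, hX, rfl⟩
    exact h0 X hX
  have h2 := lintegral_image_eq_lintegral_abs_det_fderiv_mul volume hs
    (fun X hX => (hasFDerivAt_minv hX).hasFDerivWithinAt)
    (fun X hX Y hY e => by rw [← minv_minv hX, e, minv_minv hY]) G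
  have h3 : volume.restrict s = (volume : Measure (Sq α)) :=
    Measure.restrict_eq_self_of_ae_mem (ae_mdet_ne_zero α)
  rw [h1, h3] at h2
  rw [h2]
  refine lintegral_congr_ae ?_
  filter_upwards [ae_mdet_ne_zero α] with X hX
  congr 1
  rw [LinearMap.det_toContinuousLinearMap, ← neg_one_smul ℝ, LinearMap.det_smul, LinearMap.det_comp,
    det_mulLeftMap, det_mulRightMap]
  have h4 : (Matrix.of (minv X)).det = (mdet X)⁻¹ := mdet_minv X
  rw [h4, abs_mul, abs_pow, abs_neg, abs_one, one_pow, one_mul, ← pow_add, ← two_mul, abs_pow,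
    abs_inv, ENNReal.ofReal]
  congr 1
  ext
  rw [coe_dpow, Real.coe_toNNReal _ (by positivity), inv_pow]

theorem lintegral_inv (H : ℝ → ENNReal) :
    ∫⁻ t : ℝ, ((‖t‖₊ ^ 2)⁻¹ : NNReal) * H t⁻¹ = ∫⁻ t, H t := by
  have hs : MeasurableSet {t : ℝ | t ≠ 0} := (measurableSet_singleton 0).compl
  have h1 : Inv.inv '' {t : ℝ | t ≠ 0} = {t : ℝ | t ≠ 0} := by
    ext t
    simp
  have h2 := lintegral_image_eq_lintegral_abs_deriv_mul hs
    (fun t ht => (hasDerivAt_inv ht).hasDerivWithinAt) inv_injective.injOn H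
  have h3 : volume.restrict {t : ℝ | t ≠ 0} = (volume : Measure ℝ) :=
    Measure.restrict_eq_self_of_ae_mem (Measure.ae_ne volume 0)
  rw [h1, h3] at h2
  rw [h2]
  refine lintegral_congr fun t => ?_
  congr 1
  rw [ENNReal.ofReal]
  congr 1
  ext
  rw [Real.coe_toNNReal _ (abs_nonneg _)]
  simp

end Inversion

section Coordinates

variable (m : ℕ)

/-- A square matrix of size `m + 1` in block coordinates. -/
def coordMat (z : CoordH m × ℝ) : Sq (Blk m) :=
  blk z.1.1 (fun i _ => z.1.2.1 i) (fun _ => z.1.2.2) fun _ _ => z.2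

theorem measurePreserving_coordMat : MeasurePreserving (coordMat m) := by
  have h1 := measurePreserving_blk (α := Fin m) (β := Unit) (γ := Fin m) (δ := Unit)
  have h2 : MeasurePreserving (fun u : Fin m → ℝ => fun i (_ : Unit) => u i) volume volume :=
    measurePreserving_pi (fun _ : Fin m => volume) (fun _ : Fin m => volume) fun _ =>
      (volume_preserving_funUnique Unit ℝ).symm
  have h3 : MeasurePreserving (fun v : Fin m → ℝ => fun _ : Unit => v) volume volume :=
    (volume_preserving_funUnique Unit (Fin m → ℝ)).symm
  have h4 : MeasurePreserving (fun t : ℝ => fun _ _ : Unit => t) volume volume :=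
    (volume_preserving_funUnique Unit (Unit → ℝ)).symm.comp
      (volume_preserving_funUnique Unit ℝ).symm
  have h5 : MeasurePreserving (MeasurableEquiv.prodAssoc (α := Fin m → Fin m → ℝ)
      (β := Fin m → ℝ) (γ := Fin m → ℝ)).symm :=
    MeasurePreserving.symm _ volume_preserving_prodAssoc
  have h6 : MeasurePreserving (MeasurableEquiv.prodAssoc
      (α := Sq (Fin m) × (Fin m → ℝ)) (β := Fin m → ℝ) (γ := ℝ)) :=
    volume_preserving_prodAssoc
  exact h1.comp ((((MeasurePreserving.id _).prod h2).prod (h3.prod h4)).comp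
    (h6.comp (h5.prod (MeasurePreserving.id _))))

/-- The scaling of the coordinates that relates the opposite unipotent radical of `H` to block
matrices. -/
def coordScale (t : ℝ) : CoordH m →ₗ[ℝ] CoordH m :=
  LinearMap.prodMap (-LinearMap.id) (LinearMap.prodMap (-t • LinearMap.id) LinearMap.id)

theorem det_coordScale (t : ℝ) : |LinearMap.det (coordScale m t)| = |t| ^ m := by
  rw [coordScale, LinearMap.det_prodMap, LinearMap.det_prodMap, ← neg_one_smul ℝ,
    LinearMap.det_smul, LinearMap.det_smul]
  simp [abs_mul, abs_pow]

/-- The matrix `(-X, -u/t; v, 1/t)`. -/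
def coordY (z : CoordH m × ℝ) : Sq (Blk m) :=
  coordMat m (coordScale m z.2⁻¹ z.1, z.2⁻¹)

@[fun_prop] theorem measurable_coordY : Measurable (coordY m) := by
  have h : coordY m = fun z => coordMat m ((-z.1.1, -z.2⁻¹ • z.1.2.1, z.1.2.2), z.2⁻¹) := rfl
  rw [h]
  exact (measurePreserving_coordMat m).measurable.comp (by fun_prop)

theorem lintegral_coordY {F : Sq (Blk m) → ENNReal} (hF : Measurable F) :
    ∫⁻ z, ((‖z.2‖₊ ^ (m + 2))⁻¹ : NNReal) * F (coordY m z) = ∫⁻ Y, F Y := by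
  have hFc : Measurable fun z : CoordH m × ℝ => F (coordMat m z) :=
    hF.comp (measurePreserving_coordMat m).measurable
  rw [← (measurePreserving_coordMat m).lintegral_comp hF, Measure.volume_eq_prod,
    lintegral_prod_symm _ hFc.aemeasurable, ← lintegral_inv, lintegral_prod_symm _ (by fun_prop)]
  have := isAddHaarMeasure_volume_prod (Fin m → ℝ) (Fin m → ℝ)
  have := isAddHaarMeasure_volume_prod (Sq (Fin m)) ((Fin m → ℝ) × (Fin m → ℝ))
  refine lintegral_congr_ae ?_
  filter_upwards [Measure.ae_ne volume (0 : ℝ)] with t ht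
  have h2 := lintegral_comp_linearMap (volume : Measure (CoordH m)) (f := coordScale m t⁻¹)
    (abs_ne_zero.1 (by rw [det_coordScale]; positivity))
    (hFc.comp (measurable_id.prodMk (measurable_const (a := t⁻¹))))
  rw [det_coordScale] at h2
  rw [lintegral_const_mul' _ _ ENNReal.coe_ne_top]
  simp only [Function.comp_def, id] at h2
  rw [← h2, ← mul_assoc]
  congr 1
  rw [ENNReal.ofReal, ← ENNReal.coe_mul]
  congr 1
  ext
  push_cast
  rw [Real.coe_toNNReal _ (by positivity), Real.norm_eq_abs, pow_add, mul_inv, mul_comm, abs_inv,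
    inv_pow]

theorem ae_mdet_coordY_ne_zero : ∀ᵐ z : CoordH m × ℝ, z.2 ≠ 0 ∧ mdet (coordY m z) ≠ 0 := by
  have h1 : MeasurableSet {Y : Sq (Blk m) | mdet Y = 0} :=
    (isOpen_mdet_ne_zero.isClosed_compl.measurableSet).congr (by ext; simp)
  have h2 := lintegral_coordY m (F := {Y | mdet Y = 0}.indicator 1) (measurable_one.indicator h1)
  have h0 : volume {Y : Sq (Blk m) | mdet Y = 0} = 0 :=
    measure_eq_zero_iff_ae_notMem.2 (ae_mdet_ne_zero _)
  rw [lintegral_indicator_one h1, h0, lintegral_eq_zero_iff (by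
      have := (measurable_one (α := ENNReal)).indicator h1
      fun_prop)] at h2
  have h3 : ∀ᵐ z : CoordH m × ℝ, z.2 ≠ 0 :=
    Measure.quasiMeasurePreserving_snd.ae (Measure.ae_ne volume (0 : ℝ))
  filter_upwards [h2, h3] with z hz hz'
  refine ⟨hz', fun h4 => ?_⟩
  rw [indicator_of_mem (show coordY m z ∈ {Y | mdet Y = 0} from h4)] at hz
  simp [hz'] at hz

/-- The Jacobian of `z ↦ (coordY m z)⁻¹`. -/
def coordWeight (z : CoordH m × ℝ) : NNReal :=
  (‖z.2‖₊ ^ (m + 2))⁻¹ * dpow (2 * (m + 1)) (coordY m z)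

theorem lintegral_minv_coordY {G : Sq (Blk m) → ENNReal} (hG : Measurable G) :
    ∫⁻ z, coordWeight m z * G (minv (coordY m z)) = ∫⁻ X, G X := by
  have h1 := lintegral_coordY m (F := fun Y => dpow (2 * (m + 1)) Y * G (minv Y)) (by fun_prop)
  have h2 := lintegral_minv (G := G)
  simp only [Fintype.card_sum, Fintype.card_fin, Fintype.card_unit] at h2
  rw [h2] at h1
  rw [← h1]
  simp only [coordWeight, ENNReal.coe_mul, mul_assoc]

end Coordinates

section Beta

theorem inv_Gamma_one_sub {z : ℂ} (hz : Gamma z ≠ 0) :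
    (Gamma (1 - z))⁻¹ = Gamma z * Complex.sin (Real.pi * z) / Real.pi := by
  have h1 := Complex.Gamma_mul_Gamma_one_sub z
  have hpi : (Real.pi : ℂ) ≠ 0 := Complex.ofReal_ne_zero.2 Real.pi_ne_zero
  rcases eq_or_ne (Gamma (1 - z)) 0 with h2 | h2
  · rw [h2, mul_zero, eq_comm, div_eq_zero_iff, or_iff_right hpi] at h1
    rw [h2, h1]
    simp
  · have h3 : Complex.sin (Real.pi * z) ≠ 0 := fun h3 => by
      rw [h3, div_zero] at h1
      exact mul_ne_zero hz h2 h1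
    rw [eq_div_iff h3] at h1
    rw [eq_div_iff hpi, inv_mul_eq_iff_eq_mul₀ h2]
    linear_combination -h1

/-- The local factor `Γ((a + [ε])/2) / Γ((1 - a + [ε])/2)`. -/
def gammaRatio (ε : ZMod 2) (a : ℂ) : ℂ :=
  Gamma ((a + rep ε) / 2) * (Gamma ((1 - a + rep ε) / 2))⁻¹

theorem gammaRatio_zero {a : ℂ} (ha : 0 < a.re) : gammaRatio 0 a =
    Gamma a * 2 ^ (1 - a) * (√Real.pi : ℝ) * Complex.cos (Real.pi * a / 2) / Real.pi := by
  have h1 := Complex.Gamma_mul_Gamma_add_half (a / 2)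
  have h2 := inv_Gamma_one_sub (z := a / 2 + 1 / 2) (Complex.Gamma_ne_zero_of_re_pos (by
    simp only [Complex.add_re, Complex.div_ofNat_re, Complex.one_re]; linarith))
  have h3 : rep 0 = 0 := by simp [rep]
  rw [gammaRatio, h3, add_zero, add_zero, show (1 - a) / 2 = 1 - (a / 2 + 1 / 2) by ring, h2,
    show (Real.pi : ℂ) * (a / 2 + 1 / 2) = Real.pi * a / 2 + Real.pi / 2 by ring,
    Complex.sin_add_pi_div_two, mul_div_assoc, ← mul_assoc, h1, mul_div_cancel₀ _ two_ne_zero]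
  ring

theorem gammaRatio_one {a : ℂ} (ha : 0 < a.re) : gammaRatio 1 a =
    Gamma a * 2 ^ (1 - a) * (√Real.pi : ℝ) * Complex.sin (Real.pi * a / 2) / Real.pi := by
  have h1 := Complex.Gamma_mul_Gamma_add_half (a / 2)
  have h2 := inv_Gamma_one_sub (z := a / 2) (Complex.Gamma_ne_zero_of_re_pos (by
    simp only [Complex.div_ofNat_re]; linarith))
  have h3 : rep 1 = 1 := by simp [rep, ZMod.val_one]
  rw [gammaRatio, h3, show (1 - a + 1) / 2 = 1 - a / 2 by ring, h2,
    show (Real.pi : ℂ) * (a / 2) = Real.pi * a / 2 by ring,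
    show (a + 1) / 2 = a / 2 + 1 / 2 by ring, mul_div_assoc, ← mul_assoc,
    mul_comm (Gamma (a / 2 + 1 / 2)), h1, mul_div_cancel₀ _ two_ne_zero]
  ring

theorem betaIntegral_eq {a b c : ℂ} (ha : 0 < a.re) (hb : 0 < b.re) (hc : 0 < c.re)
    (h : a + b + c = 1) : Complex.betaIntegral a b =
      Gamma a * Gamma b * Gamma c * Complex.sin (Real.pi * c) / Real.pi := by
  have h1 := Complex.Gamma_mul_Gamma_eq_betaIntegral ha hb
  have h2 := inv_Gamma_one_sub (Complex.Gamma_ne_zero_of_re_pos hc)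
  have h3 : Gamma (a + b) ≠ 0 := Complex.Gamma_ne_zero_of_re_pos (by
    rw [Complex.add_re]; linarith)
  rw [← show a + b = 1 - c by linear_combination h] at h2
  rw [h1]
  calc _ = Gamma (a + b) * Complex.betaIntegral a b * (Gamma (a + b))⁻¹ := by
        field_simp
    _ = _ := by rw [h2]; ring

/-- The integrand of the Beta integral over the real line. -/
def betaKernel (ε₁ ε₂ : ZMod 2) (a b : ℂ) (s : ℝ) : ℂ :=
  sgnPow ε₁ (a - 1) s * sgnPow ε₂ (b - 1) (1 - s)

theorem sgnPow_of_pos (ε : ZMod 2) (μ : ℂ) {x : ℝ} (hx : 0 < x) : sgnPow ε μ x = (x : ℂ) ^ μ := by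
  rw [sgnPow, Real.sign_of_pos hx, abs_of_pos hx]
  simp

theorem sgnPow_neg_arg (ε : ZMod 2) (μ : ℂ) (x : ℝ) :
    sgnPow ε μ (-x) = (-1) ^ ε.val * sgnPow ε μ x := by
  rw [sgnPow, sgnPow, Real.sign_neg, abs_neg]
  push_cast
  rw [neg_pow]
  ring

theorem integral_betaKernel_Ioo (ε₁ ε₂ : ZMod 2) {a b : ℂ} (ha : 0 < a.re) (hb : 0 < b.re) :
    IntegrableOn (betaKernel ε₁ ε₂ a b) (Ioo 0 1) ∧
      ∫ s in Ioo 0 1, betaKernel ε₁ ε₂ a b s = Complex.betaIntegral a b := by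
  have h1 : EqOn (betaKernel ε₁ ε₂ a b) (fun s : ℝ => (s : ℂ) ^ (a - 1) * (1 - (s : ℂ)) ^ (b - 1))
      (Ioo 0 1) := fun s hs => by
    simp only [betaKernel]
    rw [sgnPow_of_pos _ _ hs.1, sgnPow_of_pos _ _ (sub_pos.2 hs.2)]
    push_cast
    rfl
  have h2 := (intervalIntegrable_iff_integrableOn_Ioo_of_le zero_le_one).1
    (Complex.betaIntegral_convergent ha hb)
  refine ⟨h2.congr_fun h1.symm measurableSet_Ioo, ?_⟩
  rw [setIntegral_congr_fun measurableSet_Ioo h1, Complex.betaIntegral,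
    intervalIntegral.integral_of_le zero_le_one, integral_Ioc_eq_integral_Ioo]

theorem integral_betaKernel_Ioi (ε₁ ε₂ : ZMod 2) {a b c : ℂ} (hb : 0 < b.re) (hc : 0 < c.re)
    (h : a + b + c = 1) :
    IntegrableOn (betaKernel ε₁ ε₂ a b) (Ioi 1) ∧
      ∫ s in Ioi 1, betaKernel ε₁ ε₂ a b s = (-1) ^ ε₂.val * Complex.betaIntegral c b := by
  have h1 : Inv.inv '' Ioo (0 : ℝ) 1 = Ioi 1 := by
    ext s
    simp only [Set.image_inv_eq_inv, Set.mem_inv, mem_Ioo, mem_Ioi, inv_pos]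
    exact ⟨fun hs => by simpa using one_lt_inv_iff₀.2 ⟨inv_pos.2 hs.1, hs.2⟩,
      fun hs => ⟨by linarith, inv_lt_one_of_one_lt₀ hs⟩⟩
  have h2 : ∀ s ∈ Ioo (0 : ℝ) 1, HasDerivWithinAt Inv.inv (-(s ^ 2)⁻¹) (Ioo 0 1) s := fun s hs =>
    (hasDerivAt_inv hs.1.ne').hasDerivWithinAt
  have h3 : EqOn (fun s : ℝ => |-(s ^ 2)⁻¹| • betaKernel ε₁ ε₂ a b s⁻¹)
      (fun s => (-1) ^ ε₂.val * betaKernel 0 0 c b s) (Ioo 0 1) := fun s hs => by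
    have h4 : 1 - s⁻¹ = -((1 - s) * s⁻¹) := by
      field_simp [hs.1.ne']
      ring
    have h5 := sub_pos.2 hs.2
    have h6 : ((|-(s ^ 2)⁻¹| : ℝ) : ℂ) = (s : ℂ) ^ (-2 : ℂ) := by
      rw [abs_neg, abs_of_pos (by have := hs.1; positivity), Complex.cpow_neg]
      push_cast
      norm_num
    have h7 : (s : ℂ) ≠ 0 := Complex.ofReal_ne_zero.2 hs.1.ne'
    simp only [betaKernel]
    rw [Complex.real_smul, h4, sgnPow_neg_arg, sgnPow_mul,
      sgnPow_inv _ _ hs.1.ne', sgnPow_inv _ _ hs.1.ne']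
    simp only [sgnPow_of_pos _ _ hs.1, sgnPow_of_pos _ _ h5, h6]
    rw [show c - 1 = -2 + -(a - 1) + -(b - 1) by linear_combination h, Complex.cpow_add _ _ h7,
      Complex.cpow_add _ _ h7, Complex.cpow_neg _ (a - 1), Complex.cpow_neg _ (b - 1)]
    ring
  obtain ⟨h4, h5⟩ := integral_betaKernel_Ioo 0 0 hc hb
  rw [← h1, integrableOn_image_iff_integrableOn_abs_deriv_smul measurableSet_Ioo h2
    inv_injective.injOn, integral_image_eq_integral_abs_deriv_smul measurableSet_Ioo h2
    inv_injective.injOn, setIntegral_congr_fun measurableSet_Ioo h3, integral_const_mul, h5]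
  exact ⟨IntegrableOn.congr_fun (h4.const_mul _) h3.symm measurableSet_Ioo, rfl⟩

theorem integral_betaKernel_Iio (ε₁ ε₂ : ZMod 2) {a b c : ℂ} (ha : 0 < a.re) (hc : 0 < c.re)
    (h : a + b + c = 1) :
    IntegrableOn (betaKernel ε₁ ε₂ a b) (Iio 0) ∧
      ∫ s in Iio 0, betaKernel ε₁ ε₂ a b s = (-1) ^ ε₁.val * Complex.betaIntegral c a := by
  obtain ⟨h1, h2⟩ := integral_betaKernel_Ioi ε₂ ε₁ (a := b) ha hc (by rw [← h]; ring)
  have h3 := Measure.measurePreserving_sub_left (volume : Measure ℝ) 1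
  have h4 : betaKernel ε₁ ε₂ a b = betaKernel ε₂ ε₁ b a ∘ fun s => 1 - s := by
    funext s
    simp only [betaKernel, Function.comp_apply, sub_sub_cancel]
    ring
  have h5 : Iio (0 : ℝ) = (fun s => 1 - s) ⁻¹' Ioi 1 := by
    ext s
    simp
  have h6 := (MeasurableEquiv.subLeft (1 : ℝ)).measurableEmbedding
  rw [h4, h5, ← h2]
  exact ⟨(h3.integrableOn_comp_preimage h6).2 h1, h3.setIntegral_preimage_emb h6 _ _⟩

theorem integral_betaKernel (ε₁ ε₂ : ZMod 2) {a b c : ℂ} (ha : 0 < a.re) (hb : 0 < b.re)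
    (hc : 0 < c.re) (h : a + b + c = 1) :
    Integrable (betaKernel ε₁ ε₂ a b) ∧ ∫ s, betaKernel ε₁ ε₂ a b s =
      (√Real.pi : ℝ) * (-1) ^ (ε₁ * ε₂).val *
        (gammaRatio ε₁ a * gammaRatio ε₂ b * gammaRatio (ε₁ + ε₂) c) := by
  obtain ⟨h1, h1'⟩ := integral_betaKernel_Iio ε₁ ε₂ ha hc h
  obtain ⟨h2, h2'⟩ := integral_betaKernel_Ioo ε₁ ε₂ ha hb
  obtain ⟨h3, h3'⟩ := integral_betaKernel_Ioi ε₁ ε₂ hb hc h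
  have h4 : volume.restrict (Iio 0 ∪ Ioo 0 1 ∪ Ioi 1) = (volume : Measure ℝ) := by
    refine Measure.restrict_eq_self_of_ae_mem ?_
    filter_upwards [Measure.ae_ne volume (0 : ℝ), Measure.ae_ne volume (1 : ℝ)] with s hs hs'
    rcases lt_or_gt_of_ne hs with h4 | h4
    · exact Or.inl (Or.inl h4)
    · exact (lt_or_gt_of_ne hs').imp (fun h5 => Or.inr ⟨h4, h5⟩) id
  have h5 : IntegrableOn (betaKernel ε₁ ε₂ a b) (Iio 0 ∪ Ioo 0 1 ∪ Ioi 1) :=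
    (h1.union h2).union h3
  have h6 : ∫ s in Iio 0 ∪ Ioo 0 1 ∪ Ioi 1, betaKernel ε₁ ε₂ a b s =
      (-1) ^ ε₁.val * Complex.betaIntegral c a + Complex.betaIntegral a b +
        (-1) ^ ε₂.val * Complex.betaIntegral c b := by
    rw [setIntegral_union _ measurableSet_Ioi (h1.union h2) h3, setIntegral_union _
      measurableSet_Ioo h1 h2, h1', h2', h3']
    · exact Set.disjoint_left.2 fun s hs hs' => lt_asymm hs hs'.1
    · refine Set.disjoint_left.2 fun s hs hs' => ?_
      have h7 : (1 : ℝ) < s := hs'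
      rcases hs with hs | hs
      · exact absurd (show s < 0 from hs) (by linarith)
      · exact lt_asymm hs.2 h7
  rw [IntegrableOn, h4] at h5
  rw [h4] at h6
  refine ⟨h5, h6.trans ?_⟩
  rw [betaIntegral_eq ha hb hc h, betaIntegral_eq hc ha hb (by rw [← h]; ring),
    betaIntegral_eq hc hb ha (by rw [← h]; ring)]
  have hpi : (Real.pi : ℂ) ≠ 0 := Complex.ofReal_ne_zero.2 Real.pi_ne_zero
  have hsq : ((√Real.pi : ℝ) : ℂ) ^ 2 = Real.pi := by
    rw [← Complex.ofReal_pow, Real.sq_sqrt Real.pi_pos.le]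
  have h2p : (2 : ℂ) ^ (1 - a) * 2 ^ (1 - b) * 2 ^ (1 - c) = 4 := by
    rw [← Complex.cpow_add _ _ two_ne_zero, ← Complex.cpow_add _ _ two_ne_zero,
      show 1 - a + (1 - b) + (1 - c) = (2 : ℕ) by push_cast; linear_combination -h,
      Complex.cpow_natCast]
    norm_num
  obtain ⟨x, hx⟩ : ∃ x, x = Real.pi * a / 2 := ⟨_, rfl⟩
  obtain ⟨y, hy⟩ : ∃ y, y = Real.pi * b / 2 := ⟨_, rfl⟩
  have hz : Real.pi * c / 2 = Real.pi / 2 - (x + y) := by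
    rw [hx, hy]
    linear_combination (Real.pi / 2 : ℂ) * h
  have ex : Real.pi * a = 2 * x := by rw [hx]; ring
  have ey : Real.pi * b = 2 * y := by rw [hy]; ring
  have ez : Real.pi * c = Real.pi - 2 * (x + y) := by linear_combination 2 * hz
  have key : ∀ t₁ t₂ t₃ e : ℂ, (√Real.pi : ℝ) * e *
      (Gamma a * 2 ^ (1 - a) * (√Real.pi : ℝ) * t₁ / Real.pi *
        (Gamma b * 2 ^ (1 - b) * (√Real.pi : ℝ) * t₂ / Real.pi) *
        (Gamma c * 2 ^ (1 - c) * (√Real.pi : ℝ) * t₃ / Real.pi)) =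
      Gamma a * Gamma b * Gamma c / Real.pi * (4 * e * (t₁ * t₂ * t₃)) := by
    intro t₁ t₂ t₃ e
    rw [← h2p]
    field_simp
    rw [show ((√Real.pi : ℝ) : ℂ) ^ 4 = (((√Real.pi : ℝ) : ℂ) ^ 2) ^ 2 by ring, hsq]
    ring
  have hxx := Complex.sin_sq_add_cos_sq x
  have hyy := Complex.sin_sq_add_cos_sq y
  rw [ex, ey, ez, Complex.sin_pi_sub, Complex.sin_two_mul, Complex.sin_two_mul, Complex.sin_two_mul,
    Complex.sin_add, Complex.cos_add]
  have v1 : (1 : ZMod 2).val = 1 := rfl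
  have v0 : (0 : ZMod 2).val = 0 := rfl
  rcases zmod_two_cases ε₁ with rfl | rfl <;> rcases zmod_two_cases ε₂ with rfl | rfl
  · rw [add_zero, mul_zero, gammaRatio_zero ha, gammaRatio_zero hb, gammaRatio_zero hc, key, ← hx,
      ← hy, hz, Complex.cos_pi_div_two_sub, Complex.sin_add, v0]
    linear_combination (-2 * Gamma a * Gamma b * Gamma c / Real.pi) *
      (Complex.sin y * Complex.cos y * hxx + Complex.sin x * Complex.cos x * hyy)
  · rw [zero_add, zero_mul, gammaRatio_zero ha, gammaRatio_one hb, gammaRatio_one hc, key, ← hx,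
      ← hy, hz, Complex.sin_pi_div_two_sub, Complex.cos_add, v0, v1]
    linear_combination (-2 * Gamma a * Gamma b * Gamma c / Real.pi) *
      (Complex.sin y * Complex.cos y * hxx - Complex.sin x * Complex.cos x * hyy)
  · rw [add_zero, mul_zero, gammaRatio_one ha, gammaRatio_zero hb, gammaRatio_one hc, key, ← hx,
      ← hy, hz, Complex.sin_pi_div_two_sub, Complex.cos_add, v0, v1]
    linear_combination (-2 * Gamma a * Gamma b * Gamma c / Real.pi) *
      (-Complex.sin y * Complex.cos y * hxx + Complex.sin x * Complex.cos x * hyy)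
  · rw [show (1 : ZMod 2) + 1 = 0 from rfl, one_mul, gammaRatio_one ha, gammaRatio_one hb,
      gammaRatio_zero hc, key, ← hx, ← hy, hz, Complex.cos_pi_div_two_sub, Complex.sin_add, v1]
    linear_combination (-2 * Gamma a * Gamma b * Gamma c / Real.pi) *
      (-Complex.sin y * Complex.cos y * hxx - Complex.sin x * Complex.cos x * hyy)

end Beta

section CompositionSB

variable (m : ℕ)

/-- The upper triangular factor of `wtildeH * nbarH * nbarLast`. -/
def factorSB (z : CoordH m × ℝ) : Sq (IdxG m) :=
  blk (mmul (coordY m z) (blk (mone (Fin m)) 0 0 fun _ _ : Unit => z.2)) (blk (-mone (Fin m)) 0 0 (0 : Unit → Unit → ℝ)) 0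
    (mmul (minv (coordY m z)) (blk (mone (Fin m)) (blk₁₂ (coordY m z)) 0 (blk₂₂ (coordY m z))))

variable {m} {z : CoordH m × ℝ}

local notation "Yz" => coordY m z

theorem mmul_wtildeH_nbH (ht : z.2 ≠ 0) (hY : mdet Yz ≠ 0) :
    mmul (extH m (mmul (gmat (wtildeH m)) (nbH m z.1))) (nbLast m z.2) =
      mmul (blk (mone (Blk m)) 0 (minv Yz) (mone (Blk m))) (factorSB m z) := by
  have h1 : mmul (minv Yz) (mmul Yz (blk (mone (Fin m)) 0 0 fun _ _ : Unit => z.2)) =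
      blk (mone (Fin m)) 0 0 fun _ _ : Unit => z.2 := by
    rw [← mmul_assoc, minv_mmul hY, mone_mmul]
  have h2 : mmul (minv Yz) (blk (-mone (Fin m)) 0 0 (0 : Unit → Unit → ℝ)) +
      mmul (minv Yz) (blk (mone (Fin m)) (blk₁₂ Yz) 0 (blk₂₂ Yz)) =
      blk 0 0 0 (mone Unit) := by
    have h3 : mmul (minv Yz) (blk (-mone (Fin m)) 0 0 (0 : Unit → Unit → ℝ)) +
        mmul (minv Yz) (blk (mone (Fin m)) (blk₁₂ Yz) 0 (blk₂₂ Yz)) =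
        mmul (minv Yz) (mmul Yz (blk 0 0 0 (mone Unit))) := by
      refine (Matrix.mul_add (Matrix.of (minv Yz))
        (Matrix.of (blk (-mone (Fin m)) (0 : Fin m → Unit → ℝ) (0 : Unit → Fin m → ℝ) 0))
        (Matrix.of (blk (mone (Fin m)) (blk₁₂ Yz) 0 (blk₂₂ Yz)))).symm.trans ?_
      congr 1
      funext i j
      refine Eq.trans ?_ (Fintype.sum_sum_type _).symm
      rcases i with i | i <;> rcases j with j | j <;> simp [blk₁₂, blk₂₂, mone_apply]
    rw [h3, ← mmul_assoc, minv_mmul hY, mone_mmul]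
  rw [factorSB, mmul_blk, h1]
  simp only [mone_mmul, zero_mmul, add_zero, mmul_zero, h2]
  have h4 : gmat (wtildeH m) = blk (blk 0 0 0 (mone Unit)) (Sum.elim (-mone (Fin m)) 0)
      (fun i => Sum.elim (mone (Fin m) i) 0) 0 := by
    funext i j
    rcases i with (i | i) | i <;> rcases j with (j | j) | j <;> rfl
  rw [h4]
  funext i j
  rcases i with (i | i) | (i | i) <;> rcases j with (j | j) | (j | j) <;>
    simp [mmul, extH, nbH, nbLast, coordY, coordMat, coordScale, Fintype.sum_sum_type, blk₁₁, blk₂₂,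
      mone_apply, ht]
  field_simp

theorem mdet_minv_coordY (ht : z.2 ≠ 0) (hY : mdet Yz ≠ 0) :
    mdet (blk₁₁ (minv Yz)) ≠ 0 ∧
    mdet (minv Yz) = mdet (blk₁₁ (minv Yz)) * z.2 ∧
    mdet (blk₁₁ (factorSB m z)) = (mdet (blk₁₁ (minv Yz)))⁻¹ ∧
    mdet (blk₂₂ (factorSB m z)) = mdet (blk₁₁ (minv Yz)) := by
  have h1 : mdet (blk (mone (Fin m)) (blk₁₂ Yz) 0 (blk₂₂ Yz)) = z.2⁻¹ := by
    rw [mdet_blk_zero, mdet_mone, one_mul]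
    exact Matrix.det_unique _
  have h2 : mmul (minv Yz)
      (blk (mone (Fin m)) (blk₁₂ Yz) 0 (blk₂₂ Yz)) =
      blk (blk₁₁ (minv Yz)) 0 (blk₂₁ (minv Yz)) (mone Unit) := by
    have h3 := minv_mmul hY
    funext i j
    rcases j with j | j
    · refine (Fintype.sum_sum_type _).trans ?_
      rcases i with i | i <;> simp [mone_apply, blk₁₁, blk₂₁]
    · refine Eq.trans ?_ ((congrFun (congrFun h3 i) (Sum.inr j)).trans ?_)
      · refine Finset.sum_congr rfl fun k _ => ?_
        rcases k with k | k <;> rfl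
      · rcases i with i | i <;> simp [mone_apply]
  have h3 : mdet (mmul (minv Yz)
      (blk (mone (Fin m)) (blk₁₂ Yz) 0 (blk₂₂ Yz))) =
      mdet (blk₁₁ (minv Yz)) := by
    rw [h2]
    refine (Matrix.det_fromBlocks_zero₁₂ _ _ _).trans ?_
    change mdet (blk₁₁ (minv Yz)) * mdet (mone Unit) = _
    rw [mdet_mone, mul_one]
  have h4 : mdet (minv Yz) = mdet (blk₁₁ (minv Yz)) * z.2 := by
    rw [← h3, mdet_mmul, h1]
    field_simp
  have h5 : mdet (minv Yz) ≠ 0 := by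
    rw [mdet_minv]
    exact inv_ne_zero hY
  have h6 : mdet (blk (mone (Fin m)) 0 0 fun _ _ : Unit => z.2) = z.2 := by
    rw [mdet_blk_zero, mdet_mone, one_mul]
    exact Matrix.det_unique _
  refine ⟨left_ne_zero_of_mul (h4 ▸ h5), h4, ?_, h3⟩
  change mdet (mmul Yz (blk (mone (Fin m)) 0 0 fun _ _ : Unit => z.2)) = _
  rw [mdet_minv] at h4
  rw [mdet_mmul, h6, ← inv_inv (mdet Yz), h4, mul_inv, mul_assoc, inv_mul_cancel₀ ht,
    mul_one]

theorem integrandB_wtildeH_nbarH {ξ : ZMod 2 × ZMod 2} {lam : ℂ × ℂ} (η : ZMod 2) (ν : ℂ)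
    {f : GG m → ℂ} (hf : f ∈ piRep m ξ lam) (h : HH m) (ht : z.2 ≠ 0)
    (hY : mdet Yz ≠ 0) :
    integrandB m ξ lam η ν f (h * wtildeH m * nbarH m z.1) z.2 =
      ((coordWeight m z : ℝ) : ℂ) * integrandA m ξ lam η ν f h (minv Yz) := by
  obtain ⟨h1, h2, h3, h4⟩ := mdet_minv_coordY ht hY
  have h5 : factorSB m z ∈ parG m :=
    ⟨by rw [h3]; exact inv_ne_zero h1, rfl, by rw [h4]; exact h1⟩
  have h6 : mmul (extH m (gmat (h * wtildeH m * nbarH m z.1))) (nbLast m z.2) =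
      mmul (mmul (extH m (gmat h)) (blk (mone (Blk m)) 0 (minv Yz) (mone (Blk m))))
        (factorSB m z) := by
    rw [mul_assoc, gmat_mul, extH_mmul, mmul_assoc, gmat_mul, gmat_nbarH, mmul_wtildeH_nbH ht hY,
      mmul_assoc]
  have h7 : ((coordWeight m z : ℝ) : ℂ) = sgnPow 0 (-((m : ℂ) + 2)) z.2 *
      sgnPow 0 (2 * ((m : ℂ) + 1)) (mdet (blk₁₁ (minv Yz)) * z.2) := by
    rw [← h2, mdet_minv, sgnPow_inv _ _ hY, ← sgnPow_neg _ _ hY, coordWeight]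
    push_cast
    rw [coe_dpow_eq_sgnPow]
    congr 1
    · rw [sgnPow_zero_left, Complex.cpow_neg]
      congr 1
      rw [show (m : ℂ) + 2 = ((m + 2 : ℕ) : ℂ) by push_cast; ring, Complex.cpow_natCast]
      simp
    · push_cast
      rfl
  have h8 : (((|z.2| : ℝ) : ℂ))⁻¹ = sgnPow 0 (-1) z.2 := by
    rw [sgnPow_zero_left, Complex.cpow_neg_one]
  rw [integrandB_eq, integrandA_eq, h6, (isSeries_piRep m ξ).isInduced.extendGL_mmul hf _ h5
    (mdet_ne_zero_of_mem_parG h5), charG, h3, h4, h7, h2, div_eq_mul_inv, h8]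
  generalize mdet (blk₁₁ (minv Yz)) = δ at *
  simp only [sgnPow_mul, sgnPow_inv _ _ h1]
  rw [← sgnPow_neg _ _ h1]
  have e1 : sgnPow (ξ.1 + η) (lam.1 - ν + ((m : ℂ) + 1) / 2) z.2 * sgnPow 0 (-1) z.2 =
      sgnPow 0 (-((m : ℂ) + 2)) z.2 * sgnPow 0 (2 * ((m : ℂ) + 1)) z.2 *
        sgnPow (ξ.1 + η) (lam.1 - ν - ((m : ℂ) + 1) / 2) z.2 := by
    simp only [sgnPow_mul_sgnPow _ _ _ _ ht]
    congr 1
    · ring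
    · ring
  have e2 : sgnPow ξ.1 (-(-(lam.1 + ((m : ℂ) + 1) / 2))) δ *
      sgnPow ξ.2 (-(lam.2 - ((m : ℂ) + 1) / 2)) δ = sgnPow 0 (2 * ((m : ℂ) + 1)) δ *
        sgnPow (ξ.1 + η) (lam.1 - ν - ((m : ℂ) + 1) / 2) δ *
        sgnPow (η + ξ.2) (ν - lam.2 - ((m : ℂ) + 1) / 2) δ := by
    simp only [sgnPow_mul_sgnPow _ _ _ _ h1]
    congr 1
    · linear_combination -zmod_two_add_self η
    · ring
  rw [mul_right_comm, e1, e2]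
  ring

theorem integral_integrandS_B {ξ : ZMod 2 × ZMod 2} {lam : ℂ × ℂ} {η : ZMod 2} {ν : ℂ}
    {f : GG m → ℂ} (hf : f ∈ piRep m ξ lam) (h : HH m)
    (hA : Integrable (integrandA m ξ lam η ν f h)) :
    ∫ x, ∫ t, integrandB m ξ lam η ν f (h * wtildeH m * nbarH m x) t =
      ∫ X, integrandA m ξ lam η ν f h X := by
  have h1 : Measurable (coordWeight m) := by
    unfold coordWeight
    fun_prop
  obtain ⟨h2, h3⟩ := integrable_integral_of_lintegral (μ := volume) (ν := volume)
    (θ := fun z => minv (coordY m z)) (by fun_prop) h1 one_ne_zero ENNReal.one_ne_top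
    (fun G hG => by rw [one_mul, lintegral_minv_coordY m hG]) hA.1
  rw [ENNReal.toReal_one, Complex.ofReal_one, one_mul] at h3
  have h4 : (fun z : CoordH m × ℝ =>
      integrandB m ξ lam η ν f (h * wtildeH m * nbarH m z.1) z.2) =ᵐ[volume] fun z =>
      ((coordWeight m z : ℝ) : ℂ) * integrandA m ξ lam η ν f h (minv (coordY m z)) := by
    filter_upwards [ae_mdet_coordY_ne_zero m] with z hz
    exact integrandB_wtildeH_nbarH η ν hf h hz.1 hz.2
  have h5 := (h2.2 hA).congr h4.symm
  rw [← h3, ← integral_congr_ae h4]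
  exact (integral_prod _ h5).symm

end CompositionSB

section Scaling

/-- The kernel `|t|^{a-1} |x - t y|^{b-1}`, with signs. -/
def shiftKernel (ε₁ ε₂ : ZMod 2) (a b : ℂ) (x y t : ℝ) : ℂ :=
  sgnPow ε₁ (a - 1) t * sgnPow ε₂ (b - 1) (x - t * y)

theorem shiftKernel_mul (ε₁ ε₂ : ZMod 2) (a b : ℂ) {x y : ℝ} (hx : x ≠ 0) (hy : y ≠ 0) (s : ℝ) :
    ((|x / y| : ℝ) : ℂ) * shiftKernel ε₁ ε₂ a b x y (x / y * s) =
      sgnPow (ε₁ + ε₂) (a + b - 1) x * sgnPow ε₁ (-a) y * betaKernel ε₁ ε₂ a b s := by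
  have h1 : x - x / y * s * y = x * (1 - s) := by
    field_simp
  have h2 : ((|x / y| : ℝ) : ℂ) = sgnPow 0 1 (x / y) := by
    rw [sgnPow_zero_left, Complex.cpow_one]
  have h3 : sgnPow (ε₁ + ε₂) (a + b - 1) x = sgnPow 0 1 x * sgnPow ε₁ (a - 1) x *
      sgnPow ε₂ (b - 1) x := by
    simp only [sgnPow_mul_sgnPow _ _ _ _ hx]
    congr 1
    · rw [zero_add]
    · ring
  have h4 : sgnPow ε₁ (-a) y = sgnPow 0 1 y⁻¹ * sgnPow ε₁ (a - 1) y⁻¹ := by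
    rw [sgnPow_inv _ _ hy, sgnPow_inv _ _ hy, ← mul_inv, sgnPow_mul_sgnPow _ _ _ _ hy,
      sgnPow_neg _ _ hy, zero_add, add_sub_cancel]
  rw [shiftKernel, betaKernel, h1, h2, h3, h4, div_eq_mul_inv]
  simp only [sgnPow_mul]
  ring

theorem integral_comp_mul {E : Type} [NormedAddCommGroup E] [NormedSpace ℝ E] {r : ℝ} (hr : r ≠ 0)
    (g : ℝ → E) : ∫ t, g t = ∫ s, |r| • g (r * s) := by
  rw [integral_smul, Measure.integral_comp_mul_left, smul_smul, abs_inv,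
    mul_inv_cancel₀ (abs_ne_zero.2 hr), one_smul]

theorem integral_shiftKernel {ε₁ ε₂ : ZMod 2} {a b : ℂ} (h : Integrable (betaKernel ε₁ ε₂ a b))
    {x y : ℝ} (hx : x ≠ 0) (hy : y ≠ 0) :
    Integrable (shiftKernel ε₁ ε₂ a b x y) ∧
    ∫ t, shiftKernel ε₁ ε₂ a b x y t = sgnPow (ε₁ + ε₂) (a + b - 1) x * sgnPow ε₁ (-a) y *
      ∫ s, betaKernel ε₁ ε₂ a b s ∧
    ∫ t, ‖shiftKernel ε₁ ε₂ a b x y t‖ = ‖sgnPow (ε₁ + ε₂) (a + b - 1) x * sgnPow ε₁ (-a) y‖ *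
      ∫ s, ‖betaKernel ε₁ ε₂ a b s‖ := by
  have hr : x / y ≠ 0 := div_ne_zero hx hy
  have h1 := shiftKernel_mul ε₁ ε₂ a b hx hy
  refine ⟨?_, ?_, ?_⟩
  · rw [← integrable_comp_mul_left_iff _ hr]
    refine ((h.const_mul (sgnPow (ε₁ + ε₂) (a + b - 1) x * sgnPow ε₁ (-a) y)).const_mul
      ((|x / y| : ℝ) : ℂ)⁻¹).congr (Eventually.of_forall fun s => ?_)
    simp only
    rw [← h1, inv_mul_cancel_left₀]
    exact Complex.ofReal_ne_zero.2 (abs_ne_zero.2 hr)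
  · rw [integral_comp_mul hr, ← integral_const_mul]
    refine integral_congr_ae (Eventually.of_forall fun s => ?_)
    exact (Complex.real_smul).trans (h1 s)
  · rw [integral_comp_mul hr, ← integral_const_mul]
    refine integral_congr_ae (Eventually.of_forall fun s => ?_)
    simp only
    rw [← norm_mul, ← h1, norm_mul, Complex.norm_real, smul_eq_mul, Real.norm_eq_abs, abs_abs]

end Scaling

section CompositionBT

variable {m : ℕ}

theorem mmul_wtildeG_nb {Y : Sq (Blk m)} (hY : mdet Y ≠ 0) :
    mmul (gmat (wtildeG m)) (blk (mone (Blk m)) 0 (-minv Y) (mone (Blk m))) =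
      mmul (blk (mone (Blk m)) 0 Y (mone (Blk m))) (blk (minv Y) (-mone (Blk m)) 0 Y) := by
  have h1 : gmat (wtildeG m) = blk 0 (-mone (Blk m)) (mone (Blk m)) 0 := rfl
  have h2 : ∀ Z : Sq (Blk m), mmul (-mone (Blk m)) Z = -Z := fun Z =>
    (Matrix.neg_mul (Matrix.of (mone (Blk m))) (Matrix.of Z)).trans
      (congrArg (fun Z => -Z) (mone_mmul Z))
  have h3 : ∀ Z : Sq (Blk m), mmul Z (-mone (Blk m)) = -Z := fun Z =>
    (Matrix.mul_neg (Matrix.of Z) (Matrix.of (mone (Blk m)))).trans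
      (congrArg (fun Z => -Z) (mmul_mone Z))
  rw [h1, mmul_blk, mmul_blk]
  simp only [mmul_zero, zero_mmul, mone_mmul, h2, h3, mmul_minv hY, neg_neg, zero_add, add_zero,
    neg_add_cancel]

theorem integral_integrandT {ξ : ZMod 2 × ZMod 2} {lam : ℂ × ℂ} {f : GG m → ℂ}
    (hf : f ∈ piRep m ξ lam) (g : GG m) (hT : Integrable (integrandT m f g)) :
    ∫ X, integrandT m f g X = ∫ Y, sgnPow (ξ.1 + ξ.2) (lam.1 - lam.2 - ((m : ℂ) + 1)) (mdet Y) *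
      extendGL f (mmul (gmat g) (blk (mone (Blk m)) 0 Y (mone (Blk m)))) := by
  have h1 := (integrable_integral_of_lintegral (μ := volume) (ν := volume)
    (θ := fun Y : Sq (Blk m) => -minv Y) (w := dpow (2 * Fintype.card (Blk m)))
    (by fun_prop) (by fun_prop) one_ne_zero ENNReal.one_ne_top (fun G hG => by
      rw [lintegral_minv (G := fun X => G (-X)), one_mul, lintegral_neg_eq_self]) hT.1).2
  rw [ENNReal.toReal_one, Complex.ofReal_one, one_mul] at h1
  rw [← h1]
  refine integral_congr_ae ?_
  filter_upwards [ae_mdet_ne_zero (Blk m)] with Y hY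
  have h2 : blk (minv Y) (-mone (Blk m)) 0 Y ∈ parG m :=
    ⟨show mdet (minv Y) ≠ 0 by rw [mdet_minv]; exact inv_ne_zero hY, rfl, hY⟩
  have h3 : charG m ξ lam (blk (minv Y) (-mone (Blk m)) 0 Y) =
      sgnPow (ξ.1 + ξ.2) (lam.1 - lam.2 + ((m : ℂ) + 1)) (mdet Y) := by
    change sgnPow ξ.1 _ (mdet (minv Y)) * sgnPow ξ.2 _ (mdet Y) = _
    rw [mdet_minv, sgnPow_inv _ _ hY, ← sgnPow_neg _ _ hY, sgnPow_mul_sgnPow _ _ _ _ hY]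
    congr 1
    ring
  rw [integrandT_eq, mmul_assoc, mmul_wtildeG_nb hY, ← mmul_assoc,
    (isSeries_piRep m ξ).isInduced.extendGL_mmul hf _ h2 (mdet_ne_zero_of_mem_parG h2), h3,
    coe_dpow_eq_sgnPow, ← mul_assoc, sgnPow_mul_sgnPow _ _ _ _ hY, zero_add]
  congr 2
  simp only [Fintype.card_sum, Fintype.card_fin, Fintype.card_unit]
  push_cast
  ring

variable (m) in
/-- The matrix with last entry `t`. -/
def corner (t : ℝ) : Sq (Blk m) := blk 0 0 0 fun _ _ => t

theorem nbLast_mmul (t : ℝ) (Y : Sq (Blk m)) :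
    mmul (nbLast m t) (blk (mone (Blk m)) 0 Y (mone (Blk m))) =
      blk (mone (Blk m)) 0 (Y + corner m t) (mone (Blk m)) := by
  rw [nbLast, mmul_blk]
  simp only [mmul_zero, zero_mmul, mone_mmul, mmul_mone, zero_add, add_zero]
  rw [add_comm Y]
  rfl

theorem mdet_sub_corner (Z : Sq (Blk m)) (t : ℝ) :
    mdet (Z - corner m t) = mdet Z - t * mdet (blk₁₁ Z) := by
  have h1 : Matrix.of (Z - corner m t) = (Matrix.of Z).updateRow (Sum.inr ())
      (Z (Sum.inr ()) + (-t) • Pi.single (Sum.inr ()) 1) := by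
    ext i j
    rcases i with i | i
    · rw [Matrix.updateRow_ne (by simp)]
      rcases j with j | j <;> simp [corner]
    · rw [show i = () from rfl, Matrix.updateRow_self]
      rcases j with j | j <;> simp [corner, sub_eq_add_neg]
  have h2 : (Matrix.of Z).updateRow (Sum.inr ()) (Pi.single (Sum.inr ()) 1) =
      Matrix.of (blk (blk₁₁ Z) (blk₁₂ Z) 0 (mone Unit)) := by
    ext i j
    rcases i with i | i
    · rw [Matrix.updateRow_ne (by simp)]
      rcases j with j | j <;> rfl
    · rw [show i = () from rfl, Matrix.updateRow_self]
      rcases j with j | j <;> simp [mone_apply]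
  have h3 : mdet (blk (blk₁₁ Z) (blk₁₂ Z) 0 (mone Unit)) = mdet (blk₁₁ Z) := by
    rw [mdet_blk_zero, mdet_mone, mul_one]
  rw [mdet, h1, Matrix.det_updateRow_add, Matrix.det_updateRow_smul, h2]
  change Matrix.det (Matrix.updateRow (Matrix.of Z) (Sum.inr ()) (Matrix.of Z (Sum.inr ()))) +
    -t * mdet _ = _
  rw [Matrix.updateRow_eq_self, h3]
  simp only [mdet]
  ring

theorem integral_integrandB_T {ξ : ZMod 2 × ZMod 2} {lam : ℂ × ℂ} {η : ZMod 2} {ν : ℂ}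
    {f f' : GG m → ℂ} (hf : f ∈ piRep m ξ lam) (h : HH m)
    (hT : ∀ g, Integrable (integrandT m f g)) {κ : ℂ}
    (hf' : ∀ g, f' g = κ * ∫ X, integrandT m f g X)
    (hA : Integrable (integrandA m ξ lam η ν f h))
    (hβ : Integrable (betaKernel (ξ.2 + η) (ξ.1 + ξ.2) (lam.2 - ν + ((m : ℂ) + 1) / 2)
      (lam.1 - lam.2 - ((m : ℂ) + 1) + 1))) :
    ∫ t, integrandB m ξ.swap lam.swap η ν f' h t =
      κ * (∫ s, betaKernel (ξ.2 + η) (ξ.1 + ξ.2) (lam.2 - ν + ((m : ℂ) + 1) / 2)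
        (lam.1 - lam.2 - ((m : ℂ) + 1) + 1) s) * ∫ X, integrandA m ξ lam η ν f h X := by
  set a := lam.2 - ν + ((m : ℂ) + 1) / 2 with ha
  set b := lam.1 - lam.2 - ((m : ℂ) + 1) + 1 with hb
  let φ : Sq (Blk m) → ℂ := fun Z =>
    extendGL f (mmul (extH m (gmat h)) (blk (mone (Blk m)) 0 Z (mone (Blk m))))
  let F : Sq (Blk m) → ℝ → ℂ := fun Z t =>
    shiftKernel (ξ.2 + η) (ξ.1 + ξ.2) a b (mdet Z) (mdet (blk₁₁ Z)) t * φ Z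
  have hφ : Measurable φ :=
    ((isSeries_piRep m ξ).isInduced.smoothGL hf).measurable_extendGL.comp (by fun_prop)
  have hF : Measurable (Function.uncurry F) := by
    have h1 : ∀ ε μ, Measurable (sgnPow ε μ) := measurable_sgnPow
    exact (((h1 _ _).comp measurable_snd).mul ((h1 _ _).comp (by fun_prop))).mul
      (hφ.comp measurable_fst)
  have hAF : ∀ Z, sgnPow (ξ.2 + η + (ξ.1 + ξ.2)) (a + b - 1) (mdet Z) *
      sgnPow (ξ.2 + η) (-a) (mdet (blk₁₁ Z)) * φ Z = integrandA m ξ lam η ν f h Z := by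
    intro Z
    rw [integrandA_eq]
    congr 3
    · linear_combination zmod_two_add_self ξ.2
    · rw [ha, hb]; ring
    · exact add_comm _ _
    · rw [ha]; ring
  have hae : ∀ᵐ Z : Sq (Blk m), mdet Z ≠ 0 ∧ mdet (blk₁₁ Z) ≠ 0 := by
    filter_upwards [ae_mdet_ne_zero (Blk m), ae_blk₁₁ (ae_mdet_ne_zero (Fin m))] with Z hZ hZ'
    exact ⟨hZ, hZ'⟩
  have hFi : Integrable (Function.uncurry F) := by
    refine (integrable_prod_iff hF.aestronglyMeasurable).2 ⟨?_, ?_⟩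
    · filter_upwards [hae] with Z hZ
      exact (integral_shiftKernel hβ hZ.1 hZ.2).1.mul_const (φ Z)
    · refine (hA.norm.mul_const (∫ s, ‖betaKernel (ξ.2 + η) (ξ.1 + ξ.2) a b s‖)).congr ?_
      filter_upwards [hae] with Z hZ
      simp only [Function.uncurry_apply_pair, F, norm_mul (shiftKernel _ _ _ _ _ _ _)]
      rw [integral_mul_const, (integral_shiftKernel hβ hZ.1 hZ.2).2.2, ← hAF, norm_mul _ (φ Z)]
      ring
  have h1 : ∀ t ≠ 0, integrandB m ξ.swap lam.swap η ν f' h t = κ * ∫ Z, F Z t := by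
    intro t ht
    have h2 : (((|t| : ℝ) : ℂ))⁻¹ = sgnPow 0 (-1) t := by
      rw [sgnPow_zero_left, Complex.cpow_neg_one]
    have h3 : sgnPow (ξ.2 + η) a t * sgnPow 0 (-1) t = sgnPow (ξ.2 + η) (a - 1) t := by
      rw [sgnPow_mul_sgnPow _ _ _ _ ht, add_zero, sub_eq_add_neg]
    have h4 := integral_integrandT hf (embH m h * nbarLast m t) (hT _)
    simp only [gmat_mul, gmat_embH, gmat_nbarLast, mmul_assoc, nbLast_mmul] at h4
    replace h4 := h4.trans (integral_sub_right_eq_self (fun Y =>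
      sgnPow (ξ.1 + ξ.2) (lam.1 - lam.2 - ((m : ℂ) + 1)) (mdet Y) * φ (Y + corner m t))
      (corner m t)).symm
    simp only [sub_add_cancel, mdet_sub_corner] at h4
    rw [integrandB, hf', h4, div_eq_mul_inv, h2]
    change sgnPow (ξ.2 + η) a t * _ * _ = _
    rw [mul_right_comm, h3, mul_left_comm, ← integral_const_mul]
    congr 2
    funext Z
    simp only [F, φ, shiftKernel, hb]
    rw [add_sub_cancel_right]
    ring
  have h2 : ∫ t, integrandB m ξ.swap lam.swap η ν f' h t = κ * ∫ t, ∫ Z, F Z t := by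
    rw [← integral_const_mul]
    refine integral_congr_ae ?_
    filter_upwards [Measure.ae_ne volume (0 : ℝ)] with t ht
    exact h1 t ht
  rw [h2, ← integral_integral_swap hFi, mul_assoc]
  congr 1
  rw [← integral_const_mul]
  refine integral_congr_ae ?_
  filter_upwards [hae] with Z hZ
  simp only [F]
  rw [integral_mul_const, (integral_shiftKernel hβ hZ.1 hZ.2).2.1, ← hAF]
  ring

end CompositionBT

section Identities

variable {m : ℕ}

theorem nS_eq_nA (ξ : ZMod 2 × ZMod 2) (lam : ℂ × ℂ) (η : ZMod 2) (ν : ℂ) :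
    nS m (ξ.1, η, ξ.2) (lam.1, ν, lam.2) = nA m ξ lam η ν := by
  rw [nS, nA, add_comm ξ.2 η]

theorem differentiable_inv_Gamma {Q : Type} [NormedAddCommGroup Q] [NormedSpace ℂ Q] {f : Q → ℂ}
    (hf : ContDiff ℂ ∞ f) : Differentiable ℂ fun q => (Gamma (f q))⁻¹ :=
  ContDiff.differentiable_top (contDiff_inv_Gamma hf)

theorem comp_S_B {S : FamilyS m} {A : FamilyA m} {B : FamilyB m} (hS : IsNormalizedS m S)
    (hA : IsNormalizedA m A) (hB : IsNormalizedB m B)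
    (hS' : ∀ η (F : ∀ ν, tauRep m η ν), HolSec (fun ν => (F ν : HH m → ℂ)) →
      HolSec fun ν => (S η ν (F ν) : HH m → ℂ))
    (hA' : ∀ ξ η (F : ∀ z : (ℂ × ℂ) × ℂ, piRep m ξ z.1), HolSec (fun z => (F z : GG m → ℂ)) →
      HolSec fun z : (ℂ × ℂ) × ℂ => (A ξ z.1 η z.2 (F z) : HH m → ℂ))
    (hB' : ∀ ξ η (F : ∀ z : (ℂ × ℂ) × ℂ, piRep m ξ z.1), HolSec (fun z => (F z : GG m → ℂ)) →
      HolSec fun z : (ℂ × ℂ) × ℂ => (B ξ z.1 η z.2 (F z) : HH m → ℂ))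
    (ξ : ZMod 2 × ZMod 2) (lam : ℂ × ℂ) (η : ZMod 2) (ν : ℂ) :
    S (ξ.1, η, ξ.2) (lam.1, ν, lam.2) ∘ₗ B ξ lam η ν = (nB m ξ lam η ν)⁻¹ • A ξ lam η ν := by
  have key := (isSeries_piRep m ξ).family_unique (a := fun z : (ℂ × ℂ) × ℂ => z.1)
    (R' := fun z : (ℂ × ℂ) × ℂ => tauRep m (ξ.2, η, ξ.1) (z.1.2, z.2, z.1.1))
    (T := fun z : (ℂ × ℂ) × ℂ => S (ξ.1, η, ξ.2) (z.1.1, z.2, z.1.2) ∘ₗ B ξ z.1 η z.2)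
    (T' := fun z : (ℂ × ℂ) × ℂ => (nB m ξ z.1 η z.2)⁻¹ • A ξ z.1 η z.2) ?_ ?_
    (D := {z : (ℂ × ℂ) × ℂ | ((m : ℝ) + 1) / 2 - 1 < (z.1.1 - z.2).re} ∩
      {z : (ℂ × ℂ) × ℂ | ((m : ℝ) + 1) / 2 - 1 < (z.2 - z.1.2).re})
    ((isOpen_re_lt (by fun_prop)).inter (isOpen_re_lt (by fun_prop)))
    ⟨(((m : ℂ) + 1, -((m : ℂ) + 1)), 0), ?_⟩ ?_
  · exact congrFun key (lam, ν)
  · intro F hF _ g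
    have h1 := (hB' ξ η (fun z => F z.1) (hF.comp contDiff_fst)).comp
      (a := fun ν : ℂ × ℂ × ℂ => ((ν.1, ν.2.2), ν.2.1)) (by fun_prop)
    have h2 := (hS' (ξ.1, η, ξ.2) (fun ν => B ξ (ν.1, ν.2.2) η ν.2.1 (F (ν.1, ν.2.2))) h1).comp
      (a := fun z : (ℂ × ℂ) × ℂ => (z.1.1, z.2, z.1.2)) (by fun_prop)
    exact h2.differentiable g
  · intro F hF _ g
    have h1 := (hA' ξ η (fun z => F z.1) (hF.comp contDiff_fst)).differentiable g
    refine Differentiable.mul ?_ h1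
    simp only [nB, mul_inv]
    exact (differentiable_inv_Gamma (by fun_prop)).mul (differentiable_inv_Gamma (by fun_prop))
  · constructor <;> simp <;> linarith [(Nat.cast_nonneg m : (0 : ℝ) ≤ m)]
  · intro z hz f h
    have hm : (0 : ℝ) ≤ m := Nat.cast_nonneg m
    have hz1 : ((m : ℝ) + 1) / 2 - 1 < (z.1.1 - z.2).re := hz.1
    have hz2 : ((m : ℝ) + 1) / 2 - 1 < (z.2 - z.1.2).re := hz.2
    obtain ⟨h1, h2⟩ := hA.integral ξ z.1 η z.2 hz1 hz2 f h
    have h3 := fun g => (hB.integral ξ z.1 η z.2 (by linarith) (by linarith) f g).2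
    have h4 := (hS.integral (ξ.1, η, ξ.2) (z.1.1, z.2, z.1.2) hz1 hz2 (B ξ z.1 η z.2 f) h).2
    refine h4.trans ?_
    simp only [integrandS, h3]
    rw [integral_const_mul, integral_integrandS_B f.2 h h1, nS_eq_nA, mul_left_comm, ← h2]
    rfl

theorem prod_Gamma_eq (ξ : ZMod 2 × ZMod 2) (lam : ℂ × ℂ) : nT m ξ lam =
    Gamma ((lam.1 - lam.2 - ((m : ℂ) + 1) + 1 + rep (ξ.1 + ξ.2)) / 2) *
      ∏ i ∈ Finset.Icc 2 (m + 1),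
        Gamma ((lam.1 - lam.2 + (i : ℂ) - ((m : ℂ) + 1) + rep (ξ.1 + ξ.2)) / 2) := by
  rw [nT, ← Finset.insert_Icc_succ_left_eq_Icc (by omega), Finset.prod_insert (by simp)]
  congr 1
  · push_cast; rfl
  · refine Finset.prod_congr rfl fun i _ => ?_
    congr 2
    ring

theorem gammaRatio_numerator_ne_zero (ε : ZMod 2) {a : ℂ} (ha : 0 < a.re) :
    Gamma ((a + rep ε) / 2) ≠ 0 := by
  refine Complex.Gamma_ne_zero_of_re_pos ?_
  rw [Complex.div_ofNat_re, Complex.add_re, rep, Complex.natCast_re]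
  have : (0 : ℝ) ≤ ε.val := Nat.cast_nonneg _
  linarith

theorem gammaRatio_mul_eq (ξ : ZMod 2 × ZMod 2) (lam : ℂ × ℂ) (η : ZMod 2) (ν : ℂ)
    (ha : 0 < (lam.2 - ν + ((m : ℂ) + 1) / 2).re)
    (hb : 0 < (lam.1 - lam.2 - ((m : ℂ) + 1) + 1).re)
    (hc : 0 < (ν - lam.1 + ((m : ℂ) + 1) / 2).re) :
    (nB m ξ.swap lam.swap η ν)⁻¹ * (nT m ξ lam)⁻¹ *
      (gammaRatio (ξ.2 + η) (lam.2 - ν + ((m : ℂ) + 1) / 2) *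
        gammaRatio (ξ.1 + ξ.2) (lam.1 - lam.2 - ((m : ℂ) + 1) + 1) *
        gammaRatio (ξ.2 + η + (ξ.1 + ξ.2)) (ν - lam.1 + ((m : ℂ) + 1) / 2)) =
      (Gamma ((lam.2 - lam.1 + ((m : ℂ) + 1) + rep (ξ.1 + ξ.2)) / 2))⁻¹ *
        (nA m ξ lam η ν)⁻¹ := by
  have h1 := gammaRatio_numerator_ne_zero (ξ.2 + η) ha
  have h2 := gammaRatio_numerator_ne_zero (ξ.1 + ξ.2) hb
  have h3 := gammaRatio_numerator_ne_zero (ξ.1 + η) hc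
  have e : ξ.2 + η + (ξ.1 + ξ.2) = ξ.1 + η := by linear_combination zmod_two_add_self ξ.2
  rw [prod_Gamma_eq, nB, nA, e, gammaRatio, gammaRatio, gammaRatio]
  simp only [Prod.fst_swap, Prod.snd_swap, mul_inv]
  rw [show 1 - (lam.2 - ν + ((m : ℂ) + 1) / 2) + rep (ξ.2 + η) =
      ν - lam.2 + 1 - ((m : ℂ) + 1) / 2 + rep (ξ.2 + η) by ring,
    show 1 - (lam.1 - lam.2 - ((m : ℂ) + 1) + 1) + rep (ξ.1 + ξ.2) =
      lam.2 - lam.1 + ((m : ℂ) + 1) + rep (ξ.1 + ξ.2) by ring,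
    show 1 - (ν - lam.1 + ((m : ℂ) + 1) / 2) + rep (ξ.1 + η) =
      lam.1 - ν + 1 - ((m : ℂ) + 1) / 2 + rep (ξ.1 + η) by ring]
  generalize Gamma ((lam.2 - ν + ((m : ℂ) + 1) / 2 + rep (ξ.2 + η)) / 2) = g1 at *
  generalize Gamma ((lam.1 - lam.2 - ((m : ℂ) + 1) + 1 + rep (ξ.1 + ξ.2)) / 2) = g2 at *
  generalize Gamma ((ν - lam.1 + ((m : ℂ) + 1) / 2 + rep (ξ.1 + η)) / 2) = g3 at *
  have key : ∀ P X Y Z : ℂ, g1⁻¹ * g3⁻¹ * (g2⁻¹ * P) * (g1 * X * (g2 * Y) * (g3 * Z)) =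
      Y * (Z * X * P) := fun P X Y Z => by
    field_simp
  exact key _ _ _ _

theorem comp_B_T {T : FamilyT m} {A : FamilyA m} {B : FamilyB m} (hT : IsNormalizedT m T)
    (hA : IsNormalizedA m A) (hB : IsNormalizedB m B)
    (hT' : ∀ ξ (F : ∀ lam, piRep m ξ lam), HolSec (fun lam => (F lam : GG m → ℂ)) →
      HolSec fun lam => (T ξ lam (F lam) : GG m → ℂ))
    (hA' : ∀ ξ η (F : ∀ z : (ℂ × ℂ) × ℂ, piRep m ξ z.1), HolSec (fun z => (F z : GG m → ℂ)) →
      HolSec fun z : (ℂ × ℂ) × ℂ => (A ξ z.1 η z.2 (F z) : HH m → ℂ))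
    (hB' : ∀ ξ η (F : ∀ z : (ℂ × ℂ) × ℂ, piRep m ξ z.1), HolSec (fun z => (F z : GG m → ℂ)) →
      HolSec fun z : (ℂ × ℂ) × ℂ => (B ξ z.1 η z.2 (F z) : HH m → ℂ))
    (ξ : ZMod 2 × ZMod 2) (lam : ℂ × ℂ) (η : ZMod 2) (ν : ℂ) :
    B ξ.swap lam.swap η ν ∘ₗ T ξ lam =
      (((Real.sqrt Real.pi : ℝ) : ℂ) * (-1) ^ ((η + ξ.2) * (ξ.1 + ξ.2)).val
        * (Gamma ((lam.2 - lam.1 + ((m : ℂ) + 1) + rep (ξ.1 + ξ.2)) / 2))⁻¹) •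
        A ξ lam η ν := by
  have key := (isSeries_piRep m ξ).family_unique (a := fun z : (ℂ × ℂ) × ℂ => z.1)
    (R' := fun z : (ℂ × ℂ) × ℂ => tauRep m (ξ.2, η, ξ.1) (z.1.2, z.2, z.1.1))
    (T := fun z : (ℂ × ℂ) × ℂ => B ξ.swap z.1.swap η z.2 ∘ₗ T ξ z.1)
    (T' := fun z : (ℂ × ℂ) × ℂ => (((Real.sqrt Real.pi : ℝ) : ℂ) *
      (-1) ^ ((η + ξ.2) * (ξ.1 + ξ.2)).val *
      (Gamma ((z.1.2 - z.1.1 + ((m : ℂ) + 1) + rep (ξ.1 + ξ.2)) / 2))⁻¹) •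
        A ξ z.1 η z.2) ?_ ?_
    (D := {z : (ℂ × ℂ) × ℂ | (m : ℝ) < (z.1.1 - z.1.2).re} ∩
      ({z : (ℂ × ℂ) × ℂ | -(((m : ℝ) + 1) / 2) < (z.1.2 - z.2).re} ∩
        {z : (ℂ × ℂ) × ℂ | -(((m : ℝ) + 1) / 2) < (z.2 - z.1.1).re}))
    ((isOpen_re_lt (by fun_prop)).inter
      ((isOpen_re_lt (by fun_prop)).inter (isOpen_re_lt (by fun_prop))))
    ⟨((((2 * m + 1 : ℝ) / 4 : ℝ), (-(2 * m + 1 : ℝ) / 4 : ℝ)), 0), ?_⟩ ?_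
  · exact congrFun key (lam, ν)
  · intro F hF _ g
    have h1 := (hT' ξ F hF).comp (a := fun z : (ℂ × ℂ) × ℂ => (z.1.2, z.1.1)) (by fun_prop)
    have h2 := (hB' ξ.swap η (fun z => T ξ (z.1.2, z.1.1) (F (z.1.2, z.1.1))) h1).comp
      (a := fun z : (ℂ × ℂ) × ℂ => ((z.1.2, z.1.1), z.2)) (by fun_prop)
    exact h2.differentiable g
  · intro F hF _ g
    have h1 := (hA' ξ η (fun z => F z.1) (hF.comp contDiff_fst)).differentiable g
    refine Differentiable.mul ?_ h1
    exact (differentiable_inv_Gamma (by fun_prop)).const_mul _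
  · refine ⟨?_, ?_, ?_⟩ <;> simp only [mem_ofPred_eq, Complex.sub_re, Complex.ofReal_re,
      Complex.zero_re] <;> linarith
  · intro z hz f h
    have hz1 : (m : ℝ) < (z.1.1 - z.1.2).re := hz.1
    have hz2 : -(((m : ℝ) + 1) / 2) < (z.1.2 - z.2).re := hz.2.1
    have hz3 : -(((m : ℝ) + 1) / 2) < (z.2 - z.1.1).re := hz.2.2
    have hr := re_half_succ m
    simp only [Complex.sub_re] at hz1 hz2 hz3
    obtain ⟨h1, h2⟩ := hA.integral ξ z.1 η z.2 (by rw [Complex.sub_re]; linarith)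
      (by rw [Complex.sub_re]; linarith) f h
    have h3 := hT.integral ξ z.1 hz.1 f
    have h4 := (hB.integral ξ.swap z.1.swap η z.2 hz.2.1 hz.2.2 (T ξ z.1 f) h).2
    have ha : 0 < (z.1.2 - z.2 + ((m : ℂ) + 1) / 2).re := by
      rw [Complex.add_re, Complex.sub_re, hr]
      linarith
    have hb : 0 < (z.1.1 - z.1.2 - ((m : ℂ) + 1) + 1).re := by
      simp only [Complex.add_re, Complex.sub_re, Complex.natCast_re, Complex.one_re]
      linarith
    have hc : 0 < (z.2 - z.1.1 + ((m : ℂ) + 1) / 2).re := by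
      rw [Complex.add_re, Complex.sub_re, hr]
      linarith
    obtain ⟨h5, h6⟩ := integral_betaKernel (ξ.2 + η) (ξ.1 + ξ.2) ha hb hc (by ring)
    have h7 := integral_integrandB_T f.2 h (fun g => (h3 g).1) (fun g => (h3 g).2) h1 h5
    have h8 := gammaRatio_mul_eq ξ z.1 η z.2 ha hb hc
    refine (h4.trans ?_).trans (congrArg (fun w => ((Real.sqrt Real.pi : ℝ) : ℂ) *
      (-1) ^ ((η + ξ.2) * (ξ.1 + ξ.2)).val *
      (Gamma ((z.1.2 - z.1.1 + ((m : ℂ) + 1) + rep (ξ.1 + ξ.2)) / 2))⁻¹ * w) h2).symm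
    rw [h7, h6, add_comm η]
    linear_combination ((√Real.pi : ℝ) : ℂ) * (-1) ^ ((ξ.2 + η) * (ξ.1 + ξ.2)).val *
      (∫ X, integrandA m ξ z.1 η z.2 f h X) * h8

end Identities

end GLBranching

end

theorem theoremB (m : ℕ) :
    (∃! T : GLBranching.FamilyT m, GLBranching.IsNormalizedT m T) ∧
    (∃! S : GLBranching.FamilyS m, GLBranching.IsNormalizedS m S) ∧
    (∃! A : GLBranching.FamilyA m, GLBranching.IsNormalizedA m A) ∧
    (∃! B : GLBranching.FamilyB m, GLBranching.IsNormalizedB m B) ∧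
    ∀ (T : GLBranching.FamilyT m) (S : GLBranching.FamilyS m)
      (A : GLBranching.FamilyA m) (B : GLBranching.FamilyB m),
      GLBranching.IsNormalizedT m T → GLBranching.IsNormalizedS m S →
      GLBranching.IsNormalizedA m A → GLBranching.IsNormalizedB m B →
      ∀ (ξ : ZMod 2 × ZMod 2) (lam : ℂ × ℂ) (η : ZMod 2) (ν : ℂ),
        S (ξ.1, η, ξ.2) (lam.1, ν, lam.2) ∘ₗ B ξ lam η ν
            = (GLBranching.nB m ξ lam η ν)⁻¹ • A ξ lam η ν ∧
        B ξ.swap lam.swap η ν ∘ₗ T ξ lam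
            = (((Real.sqrt Real.pi : ℝ) : ℂ) * (-1) ^ ((η + ξ.2) * (ξ.1 + ξ.2)).val
                * (Complex.Gamma ((lam.2 - lam.1 + ((m : ℂ) + 1)
                    + GLBranching.rep (ξ.1 + ξ.2)) / 2))⁻¹) • A ξ lam η ν := by
  obtain ⟨T₀, hT, hT'⟩ := GLBranching.exists_isNormalizedT m
  obtain ⟨S₀, hS, hS'⟩ := GLBranching.exists_isNormalizedS m
  obtain ⟨A₀, hA, hA'⟩ := GLBranching.exists_isNormalizedA m
  obtain ⟨B₀, hB, hB'⟩ := GLBranching.exists_isNormalizedB m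
  refine ⟨⟨T₀, hT, fun T h => h.unique hT⟩, ⟨S₀, hS, fun S h => h.unique hS⟩,
    ⟨A₀, hA, fun A h => h.unique hA⟩, ⟨B₀, hB, fun B h => h.unique hB⟩,
    fun T S A B h1 h2 h3 h4 ξ lam η ν => ?_⟩
  rw [h1.unique hT, h2.unique hS, h3.unique hA, h4.unique hB]
  exact ⟨GLBranching.comp_S_B hS hA hB hS' hA' hB' ξ lam η ν,
    GLBranching.comp_B_T hT hA hB hT' hA' hB' ξ lam η ν⟩
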